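/- **Setting.** Let $m_*\ge 36(N+10)$ and let $g$ be a $C^{m_*}$ Riemannian metric on a neighborhood $U$ of the origin in $\mathbb R^2$. Assume that its Gaussian curvature $K$ vanishes at $0$ to finite order exactly $N$, and that near $0$ the set $K^{-1}(0)$ consists of two $C^{m_*}$ curves intersecting transversely at $0$. In given coordinates $y$ with a given function $z_0$, for $\varepsilon>0$ and $x=\varepsilon^{-2}y$ put, for a function $w=w(x)$, $z=z_0+\varepsilon^5w$, $$\Phi(w)=\det\nabla_{ij}z-K|g|(1-|\nabla_gz|^2),\qquad \mathcal L(w)u=\tfrac{d}{dt}\Phi(w+tu)\big|_{t=0},\qquad a^{22}=\nabla_{11}z,$$ regarded as functions of $x$; here $\nabla_{ij}$ are the covariant derivatives in the coordinates $y$ and $|g|=\det g_{ij}$. Norms of $w$ are taken over the unit disc $B_1=\{|x|<1\}$ (its closure for $|w|_{C^3}$, the largest supremum of a partial derivative of order at most $3$). **Lemma 2.1.** There is a neighborhood $V\subset U$ of $0$ such that the following holds. Call the connected components of $V\setminus K^{-1}(0)$ regions. For every region $\Omega_0$ there are $C^{m_*}$ coordinates $y$ on $V$, centered at $0$, in which $K^{-1}(0)\cap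 V$ is the part in $V$ of two lines through the origin and $\Omega_0$ contains the positive $y^2$-axis near $0$, with the following property. Let $z_0=\frac12(y^1)^2+\sum_{n=3}^{m_*}p_n(y)$ with $p_n$ homogeneous polynomials of degree $n$ such that, for $w=0$, all derivatives of $\Phi$ of order at most $m_*-2$ vanish at the origin. Let $\Omega$ be any region of one of the following types: * (E) $K>0$ on $\Omega$, and near $0$ the region $\Omega$ contains neither the positive nor the negative $y^2$-axis; * (H1) $K<0$ on $\Omega$, and near $0$ the region $\Omega$ contains the positive or the negative $y^2$-axis; * (H2) $K<0$ on $\Omega$, and near $0$ the region $\Omega$ contains neither. Then there is a linear change of the coordinates $y$, under which the old first coordinate is a nonzero multiple of the new first coordinate (from here on $y$, $x=\varepsilon^{-2}y$, $g_{ij}$, $\Phi$, $\mathcal L$, $a^{22}$ refer to the new coordinates, $z_0$ being the same function on $V$), there are $\varepsilon_1>0$ such that $x\in B_2$ gives a point of $V$ whenever $|\varepsilon|<\varepsilon_1$, and functions $$\bar k(\varepsilon,x,w,\nabla w,\nabla^2w,\nabla\xi),\quad \bar c(\varepsilon,x,w,\nabla w,\nabla^2w,\nabla^3w,\nabla\xi,\nabla^2\xi),\quad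 \bar d(\varepsilon,x,w,\nabla w,\nabla^2w)$$ of class $C^{m_*-4}$ in all their arguments for $|\varepsilon|<\varepsilon_1$, $|x|<2$, all components of the $w$-arguments of absolute value less than $2$, and arbitrary $\xi$-arguments, and there are constants $C_m$ ($m\le m_*-2$), $C'$, $\sigma_0>0$ and $0<\delta_0<\pi/2$, such that for every $0<\sigma<\sigma_0$ there is $0<\varepsilon_0\le\varepsilon_1$ for which the following holds for all $0<\delta<\delta_0$, all $0<\varepsilon<\varepsilon_0$ and all $w\in C^\infty$ with $|w|_{C^3}<1$. There is a $C^{m_*-2}$ change of coordinates $x\mapsto\xi(x)$ (a diffeomorphism, $C^{m_*-2}$ together with its inverse) from an open set $D\subset B_1$ that contains $\{|x|<\sigma\}$ onto an open set that contains $\{|\xi|<\sigma\}$, with $\xi(0)=0$, such that: 1. In the coordinates $\xi$ the part of $\Omega$ in $\{|\xi|<\sigma\}$ is, respectively for the types (E), (H1), (H2), $$\{0<\xi^2<(\tan\delta)\xi^1,\ |\xi|<\sigma\},\qquad \{h(\xi^1)<\xi^2,\ |\xi|<\sigma\},\qquad \{h(\xi^2)<\xi^1,\ |\xi|<\sigma\},$$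 where in the last two cases $h$ is a Lipschitz function on $(-\sigma,\sigma)$ with $h(0)=0$, of class $C^1$ away from $0$, and $\big|h(t)-|t|\big|\le C'\sigma$ for $|t|<\sigma$, $\big|\frac{d}{dt}(h(t)-|t|)\big|\le C'\sigma$ for $0<|t|<\sigma$. 2. On $D$ one has $a^{22}>0$ and, for every $u\in C^2(D)$, $$\varepsilon^{-1}\mathcal L(w)u=a^{22}L(w)u+(a^{22})^{-1}\Phi(w)\big[\partial_{x^1}^2u-\partial_{x^1}\log(a^{22}\sqrt{|g|})\,\partial_{x^1}u\big],$$ $$L(w)u=\partial_{\xi^1}(k\,\partial_{\xi^1}u)+\partial_{\xi^2}^2u+c\,\partial_{\xi^1}u+d\,\partial_{\xi^2}u,$$ $$k=K\bar k,\qquad c=K\bar c+(a^{22})^{-2}\,\partial_{x^1}\Phi(w)\,\partial_{x^1}\xi^1,\qquad d=\varepsilon^2\bar d,$$ where $\bar k,\bar c,\bar d$ are evaluated at $\varepsilon$, $x$ and the derivatives at $x$ of $w$ and $\xi$, and $\bar k>\frac12$ on $D$. 3. For all $0\le m\le m_*-2$, $$\|\xi\|_{H^m(D)}\le\delta^{-1}C_m\big(1+\|w\|_{H^{m+4}(B_1)}\big).$$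 -/

import Mathlib

open Set Filter Topology MeasureTheory
open scoped ContDiff ENNReal

noncomputable section

namespace DarbouxForm

/-- The Euclidean plane. Coordinates are indexed by `0, 1`, so the superscripts `1, 2` of the
mathematical notation correspond to the Lean indices `0, 1`. -/
abbrev Plane := EuclideanSpace ℝ (Fin 2)

/-- Coordinate vectors. -/
def e (i : Fin 2) : Plane := EuclideanSpace.single i 1

/-! ### Partial derivatives, jets and norms -/

section Calculus

variable {F : Type*} [NormedAddCommGroup F] [NormedSpace ℝ F]

/-- Partial derivative in the `i`-th coordinate. -/
def pd (i : Fin 2) (f : Plane → F) (x : Plane) : F := fderiv ℝ f x (e i)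

/-- First, second and third partial derivatives. The finite function spaces in which they take
values carry the sup norm, so that the norm is the largest norm of a partial derivative. -/
def grad (f : Plane → F) (x : Plane) : Fin 2 → F := fun i => pd i f x

def hess (f : Plane → F) (x : Plane) : Fin 2 → Fin 2 → F := fun i j => pd i (pd j f) x

def third (f : Plane → F) (x : Plane) : Fin 2 → Fin 2 → Fin 2 → F :=
  fun i j l => pd i (pd j (pd l f)) x

/-- The Sobolev norm `(∑_{|α| ≤ m} ∫_D |∂^α f|²)^{1/2}`, with `∂^α` the classical partial
derivatives; it is only applied to functions of class `C^m` on the open set `D`. -/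
def sobolevNorm (m : ℕ) (D : Set Plane) (f : Plane → F) : ℝ≥0∞ :=
  (∑ s ∈ Finset.range (m + 1), ∑ q ∈ Finset.HasAntidiagonal.antidiagonal s,
    ∫⁻ x in D, ‖((pd 0)^[q.1] ((pd 1)^[q.2] f)) x‖ₑ ^ 2) ^ (1 / 2 : ℝ)

end Calculus

/-- `|w|_{C³} < 1` on the closed unit disc. -/
def SmallC3 (w : Plane → ℝ) : Prop :=
  ∀ x ∈ Metric.closedBall (0 : Plane) 1,
    |w x| < 1 ∧ ‖grad w x‖ < 1 ∧ ‖hess w x‖ < 1 ∧ ‖third w x‖ < 1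

/-! ### Riemannian metrics on plane domains -/

/-- A Riemannian metric of class `C^m` on `U`, given by its matrix `g_{ij}`. -/
def IsMetricOn (m : ℕ) (g : Plane → Matrix (Fin 2) (Fin 2) ℝ) (U : Set Plane) : Prop :=
  (∀ p ∈ U, (g p).PosDef) ∧ ∀ i j, ContDiffOn ℝ m (fun p => g p i j) U

/-- Christoffel symbols `Γ^l_{ij}`. -/
def christoffel (G : Plane → Matrix (Fin 2) (Fin 2) ℝ) (l i j : Fin 2) (y : Plane) : ℝ :=
  (1 / 2) * ∑ s, (G y)⁻¹ l s *
    (pd i (fun q => G q s j) y + pd j (fun q => G q s i) y - pd s (fun q => G q i j) y)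

/-- Gaussian curvature `K = R_{1212} / |g|`, where `R_{1212} = g_{1l} R^l_{212}` and
`R^l_{212} = ∂₁Γ^l_{22} - ∂₂Γ^l_{12} + Γ^s_{22}Γ^l_{1s} - Γ^s_{12}Γ^l_{2s}`. -/
def gaussCurv (G : Plane → Matrix (Fin 2) (Fin 2) ℝ) (y : Plane) : ℝ :=
  (∑ l, G y 0 l *
    (pd 0 (christoffel G l 1 1) y - pd 1 (christoffel G l 0 1) y +
      ∑ s, (christoffel G s 1 1 y * christoffel G l 0 s y -
        christoffel G s 0 1 y * christoffel G l 1 s y))) / (G y).det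

/-- The expression of the metric `g` in the coordinates `y`, where `χ` maps `y` to the point. -/
def pullback (χ : Plane → Plane) (g : Plane → Matrix (Fin 2) (Fin 2) ℝ) :
    Plane → Matrix (Fin 2) (Fin 2) ℝ :=
  fun y => Matrix.of fun i j => ∑ a, ∑ b, g (χ y) a b * pd i χ y a * pd j χ y b

/-- Second covariant derivatives `∇_{ij} z`. -/
def covHess (G : Plane → Matrix (Fin 2) (Fin 2) ℝ) (z : Plane → ℝ) (i j : Fin 2) (y : Plane) : ℝ :=
  pd i (pd j z) y - ∑ l, christoffel G l i j y * pd l z y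

/-- `|∇_g z|²`. -/
def gradSq (G : Plane → Matrix (Fin 2) (Fin 2) ℝ) (z : Plane → ℝ) (y : Plane) : ℝ :=
  ∑ i, ∑ j, (G y)⁻¹ i j * pd i z y * pd j z y

/-- The Darboux operator `det ∇_{ij} z - K |g| (1 - |∇_g z|²)`. -/
def darboux (G : Plane → Matrix (Fin 2) (Fin 2) ℝ) (z : Plane → ℝ) (y : Plane) : ℝ :=
  (Matrix.of fun i j => covHess G z i j y).det -
    gaussCurv G y * (G y).det * (1 - gradSq G z y)

/-! ### The rescaled equation -/

/-- `z = z₀ + ε⁵ w`, where `w` is a function of the rescaled variable `x = ε⁻² y`. -/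
def height (ζ : Plane → ℝ) (ε : ℝ) (w : Plane → ℝ) (y : Plane) : ℝ :=
  ζ y + ε ^ 5 * w ((ε ^ 2)⁻¹ • y)

/-- `Φ(w)` as a function of `x`. -/
def Phi (G : Plane → Matrix (Fin 2) (Fin 2) ℝ) (ζ : Plane → ℝ) (ε : ℝ) (w : Plane → ℝ)
    (x : Plane) : ℝ :=
  darboux G (height ζ ε w) (ε ^ 2 • x)

/-- The cofactor `a²² = ∇₁₁ z` as a function of `x`. -/
def a22 (G : Plane → Matrix (Fin 2) (Fin 2) ℝ) (ζ : Plane → ℝ) (ε : ℝ) (w : Plane → ℝ)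
    (x : Plane) : ℝ :=
  covHess G (height ζ ε w) 0 0 (ε ^ 2 • x)

/-- `z₀ = (y¹)²/2 + p₃ + ⋯ + p_M` with `p_n` homogeneous of degree `n`, solving the Darboux equation
at the origin up to and including order `M - 2`. -/
def IsApproxSolution (M : ℕ) (G : Plane → Matrix (Fin 2) (Fin 2) ℝ) (z₀ : Plane → ℝ) : Prop :=
  (∃ p : ℕ → MvPolynomial (Fin 2) ℝ, (∀ n, (p n).IsHomogeneous n) ∧
    ∀ y : Plane, z₀ y = (1 / 2) * y 0 ^ 2 +
      ∑ n ∈ Finset.Icc 3 M, MvPolynomial.eval (fun i => y i) (p n)) ∧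
  ∀ n : ℕ, n + 2 ≤ M → iteratedFDeriv ℝ n (darboux G z₀) 0 = 0

/-! ### The zero set of the curvature and the regions it bounds -/

/-- `f` vanishes at the origin to finite order exactly `N`. -/
def VanishesToOrder (N : ℕ) (f : Plane → ℝ) : Prop :=
  (∀ n < N, iteratedFDeriv ℝ n f 0 = 0) ∧ iteratedFDeriv ℝ N f 0 ≠ 0

/-- A simple `C^m` arc through the origin. -/
def IsArc (m : ℕ) (γ : ℝ → Plane) : Prop :=
  γ 0 = 0 ∧ ContDiffOn ℝ m γ (Icc (-1) 1) ∧ InjOn γ (Icc (-1) 1)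

/-- Near the origin the zero set of `f` consists of two `C^m` curves which intersect transversely
at the origin. -/
def ZeroSetTwoCurves (m : ℕ) (f : Plane → ℝ) : Prop :=
  ∃ γ₁ γ₂ : ℝ → Plane, IsArc m γ₁ ∧ IsArc m γ₂ ∧
    LinearIndependent ℝ ![deriv γ₁ 0, deriv γ₂ 0] ∧
    ∀ᶠ p in 𝓝 (0 : Plane), f p = 0 ↔ p ∈ γ₁ '' Icc (-1) 1 ∪ γ₂ '' Icc (-1) 1

/-- `Ω` is one of the domains into which the zero set of the curvature divides `V`. -/
def IsRegion (g : Plane → Matrix (Fin 2) (Fin 2) ℝ) (V Ω : Set Plane) : Prop :=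
  ∃ p ∈ V, gaussCurv g p ≠ 0 ∧ Ω = connectedComponentIn {q ∈ V | gaussCurv g q ≠ 0} p

/-- Initial `C^M` coordinates `y` on `V` (the point with coordinates `y` is `ψ y`) in which the two
curves are straight lines, so that the regions are sectors, and in which the region `Ω₀` contains
the positive `y²`-axis near the origin. -/
structure IsInitialChart (M : ℕ) (g : Plane → Matrix (Fin 2) (Fin 2) ℝ) (V Ω₀ : Set Plane)
    (ψ : OpenPartialHomeomorph Plane Plane) : Prop where
  target_eq : ψ.target = V
  zero_mem : (0 : Plane) ∈ ψ.source
  map_zero : ψ 0 = 0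
  contDiffOn : ContDiffOn ℝ M ψ ψ.source
  contDiffOn_symm : ContDiffOn ℝ M ψ.symm ψ.target
  lines : ∃ s₁ s₂ : ℝ, s₁ ≠ s₂ ∧ ∀ y ∈ ψ.source,
    gaussCurv g (ψ y) = 0 ↔ y 1 = s₁ * y 0 ∨ y 1 = s₂ * y 0
  axis : ∀ᶠ t : ℝ in 𝓝[>] 0, ψ (t • e 1) ∈ Ω₀

/-- The region contains, near the origin, the positive or the negative `y²`-axis. -/
def ContainsHalfAxis (ψ : Plane → Plane) (Ω : Set Plane) : Prop :=
  (∀ᶠ t : ℝ in 𝓝[>] 0, ψ (t • e 1) ∈ Ω) ∨ (∀ᶠ t : ℝ in 𝓝[<] 0, ψ (t • e 1) ∈ Ω)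

/-- Elliptic regions, hyperbolic regions which contain half of the `y²`-axis (`ϱ = 1, 2`), and the
other hyperbolic regions (`ϱ = 3, 4`). -/
inductive Kind
  | elliptic
  | vertical
  | lateral

def HasKind (g : Plane → Matrix (Fin 2) (Fin 2) ℝ) (ψ : Plane → Plane) (Ω : Set Plane) :
    Kind → Prop
  | .elliptic => (∀ p ∈ Ω, 0 < gaussCurv g p) ∧ ¬ ContainsHalfAxis ψ Ω
  | .vertical => (∀ p ∈ Ω, gaussCurv g p < 0) ∧ ContainsHalfAxis ψ Ω
  | .lateral => (∀ p ∈ Ω, gaussCurv g p < 0) ∧ ¬ ContainsHalfAxis ψ Ω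

/-- `h` is Lipschitz on `(-σ, σ)`, `h(0) = 0`, `h` is `C¹` away from `0`, and
`|h(t) - |t||_{C¹} ≤ C σ` (the derivative being taken away from the corner `t = 0`). -/
def IsNearAbs (σ C : ℝ) (h : ℝ → ℝ) : Prop :=
  (∃ Λ, LipschitzOnWith Λ h (Ioo (-σ) σ)) ∧ h 0 = 0 ∧
  ContDiffOn ℝ 1 h (Ioo (-σ) 0) ∧ ContDiffOn ℝ 1 h (Ioo 0 σ) ∧
  ∀ t ∈ Ioo (-σ) σ, abs (h t - abs t) ≤ C * σ ∧ (t ≠ 0 → abs (deriv (fun s => h s - abs s) t) ≤ C * σ)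

/-- The standard form of a region `D` within the disc of radius `σ` in the coordinates `ξ`. -/
def IsStandardRegion (σ δ C : ℝ) (D : Set Plane) : Kind → Prop
  | .elliptic => D = {η | 0 < η 1 ∧ η 1 < Real.tan δ * η 0 ∧ ‖η‖ < σ}
  | .vertical => ∃ h, IsNearAbs σ C h ∧ D = {η | h (η 0) < η 1 ∧ ‖η‖ < σ}
  | .lateral => ∃ h, IsNearAbs σ C h ∧ D = {η | h (η 1) < η 0 ∧ ‖η‖ < σ}

/-! ### The canonical form -/

/-- The arguments `(ε, x, w, ∇w, ∇²w)`. -/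
abbrev ArgD := ℝ × Plane × ℝ × (Fin 2 → ℝ) × (Fin 2 → Fin 2 → ℝ)

/-- The arguments `(ε, x, w, ∇w, ∇²w)` and `∇ξ`. -/
abbrev ArgK := ArgD × (Fin 2 → Plane)

/-- The arguments `(ε, x, w, ∇w, ∇²w)`, `∇³w`, `∇ξ` and `∇²ξ`. -/
abbrev ArgC := ArgD × (Fin 2 → Fin 2 → Fin 2 → ℝ) × (Fin 2 → Plane) × (Fin 2 → Fin 2 → Plane)

/-- Open sets of arguments: `|ε| < ε₁`, while `x`, `w` and its derivatives have norm less than `2`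
and the derivatives of `ξ` are arbitrary. -/
def domD (ε₁ : ℝ) : Set ArgD :=
  Ioo (-ε₁) ε₁ ×ˢ Metric.ball 0 2 ×ˢ Metric.ball 0 2 ×ˢ Metric.ball 0 2 ×ˢ Metric.ball 0 2

def domK (ε₁ : ℝ) : Set ArgK := domD ε₁ ×ˢ univ

def domC (ε₁ : ℝ) : Set ArgC := domD ε₁ ×ˢ Metric.ball 0 2 ×ˢ univ

def argD (ε : ℝ) (w : Plane → ℝ) (x : Plane) : ArgD := (ε, x, w x, grad w x, hess w x)

def argK (ε : ℝ) (w : Plane → ℝ) (ξ : Plane → Plane) (x : Plane) : ArgK :=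
  (argD ε w x, grad ξ x)

def argC (ε : ℝ) (w : Plane → ℝ) (ξ : Plane → Plane) (x : Plane) : ArgC :=
  (argD ε w x, third w x, grad ξ x, hess ξ x)

/-- `∂f/∂ξ^i` for a function `f` of `x`, again as a function of `x`. -/
def pdChart (ξ : OpenPartialHomeomorph Plane Plane) (i : Fin 2) (f : Plane → ℝ) (x : Plane) : ℝ :=
  pd i (fun η => f (ξ.symm η)) (ξ x)

/-- `L u = ∂_{ξ¹}(k ∂_{ξ¹} u) + ∂²_{ξ²} u + c ∂_{ξ¹} u + d ∂_{ξ²} u`, as a function of `x`. -/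
def opL (ξ : OpenPartialHomeomorph Plane Plane) (k c d u : Plane → ℝ) (x : Plane) : ℝ :=
  pdChart ξ 0 (fun p => k p * pdChart ξ 0 u p) x + pdChart ξ 1 (pdChart ξ 1 u) x +
    c x * pdChart ξ 0 u x + d x * pdChart ξ 1 u x

/-- `k = K k̄`. -/
def coeffK (G : Plane → Matrix (Fin 2) (Fin 2) ℝ) (ε : ℝ) (w : Plane → ℝ)
    (kbar : ArgK → ℝ) (ξ : Plane → Plane) (x : Plane) : ℝ :=
  gaussCurv G (ε ^ 2 • x) * kbar (argK ε w ξ x)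

/-- `c = K c̄ + (a²²)⁻² ∂_{x¹}Φ(w) ∂_{x¹}ξ¹`. -/
def coeffC (G : Plane → Matrix (Fin 2) (Fin 2) ℝ) (ζ : Plane → ℝ) (ε : ℝ) (w : Plane → ℝ)
    (cbar : ArgC → ℝ) (ξ : Plane → Plane) (x : Plane) : ℝ :=
  gaussCurv G (ε ^ 2 • x) * cbar (argC ε w ξ x) +
    (a22 G ζ ε w x)⁻¹ ^ 2 * pd 0 (Phi G ζ ε w) x * pd 0 ξ x 0

/-- `d = ε² d̄`. -/
def coeffD (ε : ℝ) (w : Plane → ℝ) (dbar : ArgD → ℝ) (x : Plane) : ℝ :=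
  ε ^ 2 * dbar (argD ε w x)

/-- `ξ` is a local `C^{M-2}` change of coordinates, defined on a part of the unit disc that contains
the disc of radius `σ` in the `x`-plane, and whose range contains the disc of radius `σ` in the
`ξ`-plane. -/
structure IsCoordChange (M : ℕ) (σ : ℝ) (ξ : OpenPartialHomeomorph Plane Plane) : Prop where
  source_subset : ξ.source ⊆ Metric.ball 0 1
  ball_subset_source : Metric.ball 0 σ ⊆ ξ.source
  ball_subset_target : Metric.ball 0 σ ⊆ ξ.target
  map_zero : ξ 0 = 0
  contDiffOn : ContDiffOn ℝ (M - 2 : ℕ) ξ ξ.source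
  contDiffOn_symm : ContDiffOn ℝ (M - 2 : ℕ) ξ.symm ξ.target

/-- In the coordinates `ξ` the linearization of `Φ` at `w` has the canonical form
`ε⁻¹ 𝓛(w)u = a²² L(w)u + (a²²)⁻¹ Φ(w) [∂²_{x¹}u - ∂_{x¹} log(a²² √|g|) ∂_{x¹}u]`,
where `a²² > 0` and `k̄ > 1/2`. -/
structure HasCanonicalForm (G : Plane → Matrix (Fin 2) (Fin 2) ℝ) (ζ : Plane → ℝ) (ε : ℝ)
    (w : Plane → ℝ) (kbar : ArgK → ℝ) (cbar : ArgC → ℝ) (dbar : ArgD → ℝ)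
    (ξ : OpenPartialHomeomorph Plane Plane) : Prop where
  a22_pos : ∀ x ∈ ξ.source, 0 < a22 G ζ ε w x
  kbar_gt : ∀ x ∈ ξ.source, 1 / 2 < kbar (argK ε w ξ x)
  linearization : ∀ u : Plane → ℝ, ContDiffOn ℝ 2 u ξ.source → ∀ x ∈ ξ.source,
    HasDerivAt (fun t : ℝ => Phi G ζ ε (fun p => w p + t * u p) x)
      (ε * (a22 G ζ ε w x *
          opL ξ (coeffK G ε w kbar ξ) (coeffC G ζ ε w cbar ξ) (coeffD ε w dbar) u x +
        (a22 G ζ ε w x)⁻¹ * Phi G ζ ε w x *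
          (pd 0 (pd 0 u) x -
            pd 0 (fun p => Real.log (a22 G ζ ε w p * √(G (ε ^ 2 • p)).det)) x * pd 0 u x))) 0

end DarbouxForm

end

/-!
The two curves on which `K` vanishes are straightened by the map `(s, t) ↦ γ₁(s) + γ₂(t)`, after which
the regions are the quadrants (`exists_straightening`, `exists_quadrant_of_isRegion`). A linear change
then turns any quadrant into one of the model sectors `0 < y² < y¹`, `|y¹| < y²` and `|y²| < y¹`
(`exists_adapted_coordinates`); if the lines of the first coordinates are chosen steep enough, the
determinant of the metric at the origin becomes at least `1`. It remains to treat a metric for which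
the region is a model sector, a cone which the scaling `x = ε⁻² y` preserves
(`exists_canonical_coordinates`).

Write `p = ∇₁₁z` and `q = ∇₁₂z`, so that `p = 1 + O(ε)` and `q = O(ε)`. The principal part of
`ε⁻¹ 𝓛(w)` is `p ∂₂² - 2 q ∂₁∂₂ + (∇₂₂z) ∂₁²`, and by the definition of `Φ(w)` its determinant is
`p ∇₂₂z - q² = Φ(w) + K |g| (1 - |∇z|²)`. Up to the term with `Φ(w)`, it is therefore `p` times
`(∂₂ - (q/p) ∂₁)² + K |g| (1 - |∇z|²) p⁻² ∂₁²`, and it becomes diagonal in the coordinates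
`ξ = (λ F, x²)`, where `F` is constant on the integral curves of `∂₂ - (q/p) ∂₁` and `λ ≥ 1` is a
constant. Now `k = K |g| (1 - |∇z|²) (λ ∂₁F)² / p²`; in the first order terms the derivatives of `K`
and of `∇²z` combine, by the equations of Codazzi, to `∂₁Φ(w)` and to a multiple of `K`
(`opL_eq`, `IsSmoothMetric.codazzi_zero`, `IsSmoothMetric.codazzi_one`, `canonical_identity`,
`hasCanonicalForm`).

The function `F` is a first integral of a field with a slope of order `ε`. The field is extended to
the plane by a cutoff function, its flow is a fixed point of a contraction, and `F` is the first
component of the inverse of the flow (`IsSmallSlope.exists_flow`, `IsSmallSlope.firstIntegral`). For a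
sector `0 < y² < y¹` it is normalized by `F = x¹` on the line `x² = x¹`, and `λ = 1 / tan δ`, so that
both sides of the sector become straight; otherwise it is normalized on `x² = 0`, and `λ = 1`. As the
slope is small, `F` is `C¹`-close to `x¹`, so that the sides `x² = ± x¹` of the other sectors become
graphs close to the function `|t|` (`IsSmallSlope.isStandardRegion_of_sector`).

The bound of `ξ` in Sobolev spaces must be linear in the norm of `w`. Let `W_j` be the norm of `w` in
`C^{j+2}` on a square. Interpolation and the bound of `w` in `C³`, hence of `W_1`, give
`W_i W_j ≤ C W_{i+j-1}` for `i, j ≥ 1` (`isWeight_cNorm`). The functions whose derivatives of order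
`j` are bounded by `C W_j` are thus closed under products and quotients, and the linear equations for
the derivatives of `F` along the flow show that `F` is one of them
(`IsSmallSlope.exists_tame_firstIntegral`). Finally `W_m` is bounded by the norm of `w` in `H^{m+4}`,
because `W^{2,1}` embeds in `C⁰` in two dimensions (`exists_cNorm_le_sobolevNorm`).
-/

noncomputable section

namespace DarbouxForm

/-! ### Calculus on the plane -/

/-- The point with coordinates `a, b`. -/
def pt (a b : ℝ) : Plane := !₂[a, b]

@[simp] lemma pt_zero (a b : ℝ) : pt a b 0 = a := rfl
@[simp] lemma pt_one (a b : ℝ) : pt a b 1 = b := rfl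

lemma pt_eta (x : Plane) : pt (x 0) (x 1) = x := by
  ext i; fin_cases i <;> rfl

lemma plane_ext {x y : Plane} (h0 : x 0 = y 0) (h1 : x 1 = y 1) : x = y := by
  ext i; fin_cases i <;> assumption

@[simp] lemma e_zero_zero : e 0 0 = 1 := by simp [e]
@[simp] lemma e_zero_one : e 0 1 = 0 := by simp [e]
@[simp] lemma e_one_zero : e 1 0 = 0 := by simp [e]
@[simp] lemma e_one_one : e 1 1 = 1 := by simp [e]
@[simp] lemma norm_e (i : Fin 2) : ‖e i‖ = 1 := by simp [e]

lemma pt_eq (a b : ℝ) : pt a b = a • e 0 + b • e 1 := by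
  apply plane_ext <;> simp

lemma norm_plane_sq (x : Plane) : ‖x‖ ^ 2 = x 0 ^ 2 + x 1 ^ 2 := by
  simp [EuclideanSpace.norm_sq_eq, Fin.sum_univ_two]

lemma abs_coord_le (x : Plane) (i : Fin 2) : |x i| ≤ ‖x‖ := by
  simpa using PiLp.norm_apply_le x i

lemma norm_plane_le (x : Plane) : ‖x‖ ≤ |x 0| + |x 1| := by
  apply abs_le_of_sq_le_sq' _ (by positivity) |>.2
  rw [norm_plane_sq, add_sq, sq_abs, sq_abs]
  have : 0 ≤ |x 0| * |x 1| := by positivity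
  linarith

/-- The `i`-th coordinate as a continuous linear form. -/
def coord (i : Fin 2) : Plane →L[ℝ] ℝ := EuclideanSpace.proj i

@[simp] lemma coord_apply (i : Fin 2) (x : Plane) : coord i x = x i := rfl

lemma contDiff_coord {n : WithTop ℕ∞} (i : Fin 2) : ContDiff ℝ n (fun x : Plane => x i) :=
  (coord i).contDiff

lemma norm_coord_le (i : Fin 2) : ‖coord i‖ ≤ 1 :=
  ContinuousLinearMap.opNorm_le_bound _ zero_le_one fun x => by
    simpa using abs_coord_le x i

lemma contDiff_pt {E : Type*} [NormedAddCommGroup E] [NormedSpace ℝ E] {n : WithTop ℕ∞}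
    {f g : E → ℝ} (hf : ContDiff ℝ n f) (hg : ContDiff ℝ n g) :
    ContDiff ℝ n fun x => pt (f x) (g x) := by
  simp only [pt_eq]
  exact (hf.smul contDiff_const).add (hg.smul contDiff_const)

lemma continuous_pt {E : Type*} [TopologicalSpace E]
    {f g : E → ℝ} (hf : Continuous f) (hg : Continuous g) :
    Continuous fun x => pt (f x) (g x) := by
  simp only [pt_eq]
  exact (hf.smul continuous_const).add (hg.smul continuous_const)

section

variable {F : Type*} [NormedAddCommGroup F] [NormedSpace ℝ F]

lemma clm_plane_apply (L : Plane →L[ℝ] F) (v : Plane) : L v = v 0 • L (e 0) + v 1 • L (e 1) := by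
  conv_lhs => rw [← pt_eta v, pt_eq]
  simp

lemma norm_clm_le (L : Plane →L[ℝ] F) : ‖L‖ ≤ ‖L (e 0)‖ + ‖L (e 1)‖ := by
  refine ContinuousLinearMap.opNorm_le_bound _ (by positivity) fun v => ?_
  rw [clm_plane_apply]
  calc _ ≤ ‖v 0 • L (e 0)‖ + ‖v 1 • L (e 1)‖ := norm_add_le _ _
    _ ≤ ‖v‖ * ‖L (e 0)‖ + ‖v‖ * ‖L (e 1)‖ := by
        rw [norm_smul, norm_smul]
        gcongr
        · exact abs_coord_le v 0
        · exact abs_coord_le v 1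
    _ = _ := by ring

lemma fderiv_plane_apply (f : Plane → F) (x v : Plane) :
    fderiv ℝ f x v = v 0 • pd 0 f x + v 1 • pd 1 f x := clm_plane_apply _ v

lemma norm_pd_le (i : Fin 2) (f : Plane → F) (x : Plane) : ‖pd i f x‖ ≤ ‖fderiv ℝ f x‖ := by
  simpa [pd] using (fderiv ℝ f x).le_opNorm (e i)

lemma pd_congr {f g : Plane → F} {x : Plane} (h : f =ᶠ[𝓝 x] g) (i : Fin 2) :
    pd i f x = pd i g x := by rw [pd, pd, h.fderiv_eq]

lemma pd_eventuallyEq {f g : Plane → F} {x : Plane} (h : f =ᶠ[𝓝 x] g) (i : Fin 2) :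
    pd i f =ᶠ[𝓝 x] pd i g :=
  h.eventuallyEq_nhds.mono fun _ hy => pd_congr hy i

lemma _root_.ContDiffAt.pd {f : Plane → F} {x : Plane} {m n : WithTop ℕ∞}
    (hf : ContDiffAt ℝ n f x) (hmn : m + 1 ≤ n) (i : Fin 2) : ContDiffAt ℝ m (pd i f) x :=
  (hf.fderiv_right hmn).clm_apply contDiffAt_const

lemma _root_.ContDiff.pd {f : Plane → F} {m n : WithTop ℕ∞}
    (hf : ContDiff ℝ n f) (hmn : m + 1 ≤ n) (i : Fin 2) : ContDiff ℝ m (pd i f) :=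
  contDiff_iff_contDiffAt.2 fun _ => hf.contDiffAt.pd hmn i

lemma pd_comm {f : Plane → F} {x : Plane} (hf : ContDiffAt ℝ 2 f x) (i j : Fin 2) :
    pd i (pd j f) x = pd j (pd i f) x := by
  have hd : DifferentiableAt ℝ (fderiv ℝ f) x :=
    (hf.fderiv_right (m := 1) (by norm_num)).differentiableAt (by norm_num)
  have hs : IsSymmSndFDerivAt ℝ f x := hf.isSymmSndFDerivAt (by simp)
  have key : ∀ k l : Fin 2, pd k (pd l f) x = fderiv ℝ (fderiv ℝ f) x (e k) (e l) := by
    intro k l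
    change fderiv ℝ (fun y => fderiv ℝ f y (e l)) x (e k) = _
    rw [fderiv_clm_apply hd (differentiableAt_const _)]
    simp
  rw [key, key, hs.eq]

lemma hasDerivAt_fst {f : Plane → F} {s t : ℝ} (hf : DifferentiableAt ℝ f (pt s t)) :
    HasDerivAt (fun s' => f (pt s' t)) (pd 0 f (pt s t)) s := by
  have h : HasDerivAt (fun s' => pt s' t) (e 0) s := by
    simp only [pt_eq]
    simpa using ((hasDerivAt_id s).smul_const (e 0)).add_const (t • e 1)
  exact (hf.hasFDerivAt).comp_hasDerivAt s h

lemma hasDerivAt_snd {f : Plane → F} {s t : ℝ} (hf : DifferentiableAt ℝ f (pt s t)) :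
    HasDerivAt (fun t' => f (pt s t')) (pd 1 f (pt s t)) t := by
  have h : HasDerivAt (fun t' => pt s t') (e 1) t := by
    simp only [pt_eq]
    simpa using ((hasDerivAt_id t).smul_const (e 1)).const_add (s • e 0)
  exact (hf.hasFDerivAt).comp_hasDerivAt t h

lemma pd_comp_curve {f : Plane → F} {a b : ℝ → ℝ} {a' b' t : ℝ}
    (hf : DifferentiableAt ℝ f (pt (a t) (b t))) (ha : HasDerivAt a a' t) (hb : HasDerivAt b b' t) :
    HasDerivAt (fun τ => f (pt (a τ) (b τ)))
      (a' • pd 0 f (pt (a t) (b t)) + b' • pd 1 f (pt (a t) (b t))) t := by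
  have h : HasDerivAt (fun τ => pt (a τ) (b τ)) (pt a' b') t := by
    simp only [pt_eq]
    exact (ha.smul_const (e 0)).add (hb.smul_const (e 1))
  have h2 := (hf.hasFDerivAt).comp_hasDerivAt t h
  rw [fderiv_plane_apply] at h2
  exact h2

lemma pd_add {f g : Plane → F} {x : Plane} (hf : DifferentiableAt ℝ f x)
    (hg : DifferentiableAt ℝ g x) (i : Fin 2) :
    pd i (fun y => f y + g y) x = pd i f x + pd i g x := by
  simp only [pd]; rw [fderiv_fun_add hf hg]; rfl

lemma pd_sub {f g : Plane → F} {x : Plane} (hf : DifferentiableAt ℝ f x)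
    (hg : DifferentiableAt ℝ g x) (i : Fin 2) :
    pd i (fun y => f y - g y) x = pd i f x - pd i g x := by
  simp only [pd]; rw [fderiv_fun_sub hf hg]; rfl

lemma pd_neg {f : Plane → F} {x : Plane} (i : Fin 2) :
    pd i (fun y => - f y) x = - pd i f x := by
  simp only [pd]; rw [fderiv_fun_neg]; rfl

lemma pd_const (c : F) (i : Fin 2) (x : Plane) : pd i (fun _ => c) x = 0 := by
  simp [pd]

lemma pd_mul {f g : Plane → ℝ} {x : Plane} (hf : DifferentiableAt ℝ f x)
    (hg : DifferentiableAt ℝ g x) (i : Fin 2) :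
    pd i (fun y => f y * g y) x = pd i f x * g x + f x * pd i g x := by
  simp only [pd]; rw [fderiv_fun_mul hf hg]; simp; ring

lemma pd_const_mul {f : Plane → ℝ} {x : Plane} (c : ℝ) (hf : DifferentiableAt ℝ f x)
    (i : Fin 2) : pd i (fun y => c * f y) x = c * pd i f x := by
  simp only [pd]; rw [fderiv_const_mul hf]; rfl

lemma pd_sum {ι : Type*} {s : Finset ι} {f : ι → Plane → F} {x : Plane}
    (hf : ∀ k ∈ s, DifferentiableAt ℝ (f k) x) (i : Fin 2) :
    pd i (fun y => ∑ k ∈ s, f k y) x = ∑ k ∈ s, pd i (f k) x := by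
  simp only [pd]; rw [fderiv_fun_sum hf]; simp

lemma pd_comp_real {f : Plane → ℝ} {g : ℝ → ℝ} {g' : ℝ} {x : Plane} (hf : DifferentiableAt ℝ f x)
    (hg : HasDerivAt g g' (f x)) (i : Fin 2) : pd i (fun y => g (f y)) x = g' * pd i f x := by
  have := (hg.comp_hasFDerivAt x hf.hasFDerivAt).fderiv
  simp only [pd]
  change fderiv ℝ (g ∘ f) x (e i) = _
  rw [this]; simp

lemma pd_coord (i j : Fin 2) (x : Plane) : pd i (fun y : Plane => y j) x = if i = j then 1 else 0 := by
  have : fderiv ℝ (fun y : Plane => y j) x = coord j := (coord j).fderiv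
  rw [pd, this, coord_apply]
  fin_cases i <;> fin_cases j <;> simp

/-- The chain rule for a rescaling of the argument. -/
lemma pd_comp_smul (f : Plane → F) (c : ℝ) (i : Fin 2) (x : Plane) :
    pd i (fun y => f (c • y)) x = c • pd i f (c • x) := by
  simp only [pd]
  rw [fderiv_comp_smul]; simp

lemma pd_apply {f : Plane → Plane} {x : Plane} (hf : DifferentiableAt ℝ f x) (i j : Fin 2) :
    pd i (fun y => f y j) x = pd i f x j := by
  have := ((coord j).hasFDerivAt.comp x hf.hasFDerivAt).fderiv
  simp only [pd]
  change fderiv ℝ (coord j ∘ f) x (e i) = _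
  rw [this]; rfl

/-- The chain rule for a map of the plane. -/
lemma pd_comp_plane {f : Plane → F} {h : Plane → Plane} {x : Plane} (i : Fin 2)
    (hf : DifferentiableAt ℝ f (h x)) (hh : DifferentiableAt ℝ h x) :
    pd i (fun y => f (h y)) x = pd i h x 0 • pd 0 f (h x) + pd i h x 1 • pd 1 f (h x) := by
  have := (hf.hasFDerivAt.comp x hh.hasFDerivAt).fderiv
  change fderiv ℝ (f ∘ h) x (e i) = _
  rw [this, ContinuousLinearMap.comp_apply, fderiv_plane_apply]
  rfl

/-- The identification of the plane with `ℝ × ℝ`. -/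
def planeProd : Plane ≃L[ℝ] ℝ × ℝ :=
  LinearEquiv.toContinuousLinearEquiv
    { toFun := fun x => (x 0, x 1)
      invFun := fun p => pt p.1 p.2
      map_add' := fun _ _ => rfl
      map_smul' := fun _ _ => rfl
      left_inv := fun x => pt_eta x
      right_inv := fun _ => rfl }

lemma planeProd_apply (x : Plane) : planeProd x = (x 0, x 1) := rfl

/-- A function with continuous partial derivatives is differentiable. -/
lemma hasFDerivAt_of_partials {f f0 f1 : Plane → F}
    (h0 : ∀ s t, HasDerivAt (fun s' => f (pt s' t)) (f0 (pt s t)) s)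
    (h1 : ∀ s t, HasDerivAt (fun t' => f (pt s t')) (f1 (pt s t)) t)
    (c0 : Continuous f0) (c1 : Continuous f1) (x : Plane) :
    HasFDerivAt f ((coord 0).smulRight (f0 x) + (coord 1).smulRight (f1 x)) x := by
  have hL : Continuous fun v : F => ContinuousLinearMap.smulRight (1 : ℝ →L[ℝ] ℝ) v :=
    (ContinuousLinearMap.smulRightL ℝ ℝ F (1 : ℝ →L[ℝ] ℝ)).continuous
  have key := hasStrictFDerivAt_uncurry_coprod (𝕜 := ℝ) (u := planeProd x)
    (f := fun s t => f (pt s t))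
    (f₁ := fun s t => ContinuousLinearMap.smulRight (1 : ℝ →L[ℝ] ℝ) (f0 (pt s t)))
    (f₂ := fun s t => ContinuousLinearMap.smulRight (1 : ℝ →L[ℝ] ℝ) (f1 (pt s t)))
    (Eventually.of_forall fun v => (h0 v.1 v.2).hasFDerivAt)
    (Eventually.of_forall fun v => (h1 v.1 v.2).hasFDerivAt)
    (hL.comp (c0.comp (continuous_pt continuous_fst continuous_snd))).continuousAt
    (hL.comp (c1.comp (continuous_pt continuous_fst continuous_snd))).continuousAt
  have h2 := key.hasFDerivAt.comp x planeProd.hasFDerivAt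
  have e1 : (Function.HasUncurry.uncurry (fun s t => f (pt s t)) ∘ planeProd : Plane → F) = f := by
    ext y
    change f (pt (y 0) (y 1)) = f y
    rw [pt_eta]
  rw [e1] at h2
  refine h2.congr_fderiv ?_
  ext v
  simp [planeProd_apply, Function.HasUncurry.uncurry, pt_eta]

/-- A function whose partial derivatives are of class `C^n` is of class `C^{n+1}`. -/
lemma contDiff_succ_of_partials {f f0 f1 : Plane → F} {n : ℕ}
    (h0 : ∀ s t, HasDerivAt (fun s' => f (pt s' t)) (f0 (pt s t)) s)
    (h1 : ∀ s t, HasDerivAt (fun t' => f (pt s t')) (f1 (pt s t)) t)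
    (c0 : ContDiff ℝ n f0) (c1 : ContDiff ℝ n f1) : ContDiff ℝ (n + 1 : ℕ) f := by
  rw [Nat.cast_add, Nat.cast_one, contDiff_succ_iff_hasFDerivAt]
  refine ⟨fun x => (coord 0).smulRight (f0 x) + (coord 1).smulRight (f1 x), ?_,
    hasFDerivAt_of_partials h0 h1 c0.continuous c1.continuous⟩
  exact ((ContinuousLinearMap.smulRightL ℝ Plane F (coord 0)).contDiff.comp c0).add
    ((ContinuousLinearMap.smulRightL ℝ Plane F (coord 1)).contDiff.comp c1)

/-! ### Norms of iterated derivatives -/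

lemma norm_iteratedFDeriv_pd_le {f : Plane → F} {x : Plane} {n : ℕ}
    (hf : ContDiffAt ℝ (n + 1 : ℕ) f x) (i : Fin 2) :
    ‖iteratedFDeriv ℝ n (pd i f) x‖ ≤ ‖iteratedFDeriv ℝ (n + 1) f x‖ := by
  have := norm_iteratedFDeriv_clm_apply_const (𝕜 := ℝ) (c := e i) (n := n) (N := n)
    (hf.fderiv_right (m := n) (by simp)) le_rfl
  rw [norm_e, one_mul, norm_iteratedFDeriv_fderiv] at this
  exact this

lemma norm_iteratedFDeriv_succ_le {f : Plane → F} {x : Plane} {n : ℕ}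
    (hf : ContDiffAt ℝ (n + 1 : ℕ) f x) :
    ‖iteratedFDeriv ℝ (n + 1) f x‖ ≤
      ‖iteratedFDeriv ℝ n (pd 0 f) x‖ + ‖iteratedFDeriv ℝ n (pd 1 f) x‖ := by
  let L : Fin 2 → F →L[ℝ] (Plane →L[ℝ] F) := fun i => ContinuousLinearMap.smulRightL ℝ Plane F (coord i)
  have hL : ∀ i, ‖L i‖ ≤ 1 := fun i => ContinuousLinearMap.opNorm_le_bound _ zero_le_one fun v => by
    change ‖(coord i).smulRight v‖ ≤ 1 * ‖v‖
    rw [ContinuousLinearMap.norm_smulRight_apply]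
    gcongr
    exact norm_coord_le i
  have hfd : fderiv ℝ f = (L 0 ∘ pd 0 f) + (L 1 ∘ pd 1 f) := by
    ext y v
    simp [L, fderiv_plane_apply f y v]
  have hp : ∀ i, ContDiffAt ℝ n (pd i f) x := fun i => hf.pd (by simp) i
  rw [← norm_iteratedFDeriv_fderiv, hfd, iteratedFDeriv_add_apply
    ((L 0).contDiff.contDiffAt.comp x (hp 0)) ((L 1).contDiff.contDiffAt.comp x (hp 1))]
  refine (norm_add_le _ _).trans (add_le_add ?_ ?_)
  · exact ((L 0).norm_iteratedFDeriv_comp_left (hp 0) le_rfl).trans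
      (mul_le_of_le_one_left (norm_nonneg _) (hL 0))
  · exact ((L 1).norm_iteratedFDeriv_comp_left (hp 1) le_rfl).trans
      (mul_le_of_le_one_left (norm_nonneg _) (hL 1))

lemma norm_iteratedFDeriv_mul_le_at {f g : Plane → ℝ} {x : Plane} {n : ℕ}
    (hf : ContDiffAt ℝ n f x) (hg : ContDiffAt ℝ n g x) :
    ‖iteratedFDeriv ℝ n (fun y => f y * g y) x‖ ≤ ∑ i ∈ Finset.range (n + 1),
      (n.choose i : ℝ) * ‖iteratedFDeriv ℝ i f x‖ * ‖iteratedFDeriv ℝ (n - i) g x‖ := by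
  obtain ⟨u, hu, hfu⟩ := hf.contDiffOn le_rfl (by simp)
  obtain ⟨v, hv, hgv⟩ := hg.contDiffOn le_rfl (by simp)
  obtain ⟨s, hs, hso, hxs⟩ := mem_nhds_iff.1 (inter_mem hu hv)
  have := norm_iteratedFDerivWithin_mul_le (A := ℝ) (hfu.mono fun y hy => (hs hy).1)
    (hgv.mono fun y hy => (hs hy).2) hso.uniqueDiffOn hxs (le_refl (n : WithTop ℕ∞))
  simp only [iteratedFDerivWithin_of_isOpen _ hso hxs] at this
  exact this

end

/-! ### Integrals depending on a parameter -/

lemma abs_integral_le_of_support {g : ℝ → ℝ} {η : ℝ} (hη : 0 ≤ η) (hg : Continuous g)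
    (hb : ∀ τ, |g τ| ≤ η) (h0 : ∀ τ, 2 ≤ |τ| → g τ = 0) (t : ℝ) :
    |∫ τ in (0 : ℝ)..t, g τ| ≤ 2 * η := by
  have base : ∀ t, |t| ≤ 2 → |∫ τ in (0 : ℝ)..t, g τ| ≤ 2 * η := by
    intro t ht
    have := intervalIntegral.norm_integral_le_of_norm_le_const (a := 0) (b := t) (f := g) (C := η)
      fun x _ => hb x
    rw [sub_zero, Real.norm_eq_abs] at this
    nlinarith
  rcases le_or_gt |t| 2 with ht | ht
  · exact base t ht
  rcases lt_abs.1 ht with h | h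
  · have h2 : ∫ τ in (2 : ℝ)..t, g τ = 0 := by
      rw [intervalIntegral.integral_congr (g := fun _ => (0 : ℝ))]
      · simp
      · intro x hx
        rw [uIcc_of_le h.le] at hx
        exact h0 x (hx.1.trans (le_abs_self x))
    rw [← intervalIntegral.integral_add_adjacent_intervals (hg.intervalIntegrable 0 2)
      (hg.intervalIntegrable 2 t), h2, add_zero]
    exact base 2 (by norm_num)
  · have h2 : ∫ τ in (-2 : ℝ)..t, g τ = 0 := by
      rw [intervalIntegral.integral_congr (g := fun _ => (0 : ℝ))]
      · simp
      · intro x hx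
        rw [uIcc_of_ge (by linarith)] at hx
        exact h0 x (le_trans (by linarith [hx.2]) (neg_le_abs x))
    rw [← intervalIntegral.integral_add_adjacent_intervals (hg.intervalIntegrable 0 (-2))
      (hg.intervalIntegrable (-2) t), h2, add_zero]
    exact base (-2) (by norm_num)

lemma hasDerivAt_param_integral {g : Plane → ℝ} (hg : ContDiff ℝ 1 g) (s t : ℝ) :
    HasDerivAt (fun s' => ∫ τ in (0 : ℝ)..t, g (pt s' τ)) (∫ τ in (0 : ℝ)..t, pd 0 g (pt s τ)) s := by
  have hc : Continuous (pd 0 g) := (hg.pd (m := 0) (by norm_num) 0).continuous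
  have hcomp : IsCompact ((fun p : ℝ × ℝ => pt p.1 p.2) '' (Icc (s - 1) (s + 1) ×ˢ uIcc 0 t)) :=
    (isCompact_Icc.prod isCompact_uIcc).image (continuous_pt continuous_fst continuous_snd)
  obtain ⟨C, hC⟩ := hcomp.exists_bound_of_continuousOn hc.continuousOn
  have hline : ∀ s', Continuous fun τ => pt s' τ := fun s' =>
    continuous_pt continuous_const continuous_id
  refine (intervalIntegral.hasDerivAt_integral_of_dominated_loc_of_deriv_le
    (F := fun s' τ => g (pt s' τ)) (F' := fun s' τ => pd 0 g (pt s' τ)) (bound := fun _ => C)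
    (s := Icc (s - 1) (s + 1)) (Icc_mem_nhds (by linarith) (by linarith)) ?_ ?_ ?_ ?_ ?_ ?_).2
  · exact Eventually.of_forall fun s' => (hg.continuous.comp (hline s')).aestronglyMeasurable
  · exact (hg.continuous.comp (hline s)).intervalIntegrable _ _
  · exact (hc.comp (hline s)).aestronglyMeasurable
  · exact Eventually.of_forall fun τ hτ s' hs' =>
      hC _ ⟨(s', τ), ⟨hs', uIoc_subset_uIcc hτ⟩, rfl⟩
  · exact intervalIntegrable_const
  · exact Eventually.of_forall fun τ _ s' _ =>
      hasDerivAt_fst (hg.differentiable (by norm_num) _)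

lemma continuous_param_integral {g : Plane → ℝ} (hg : Continuous g) :
    Continuous fun x : Plane => ∫ τ in (0 : ℝ)..x 1, g (pt (x 0) τ) := by
  have := intervalIntegral.continuous_parametric_primitive_of_continuous (a₀ := 0) (μ := volume)
    (f := fun s τ => g (pt s τ)) (hg.comp (continuous_pt continuous_fst continuous_snd))
  exact this.comp planeProd.continuous

lemma contDiff_param_integral {n : ℕ} : ∀ {g : Plane → ℝ}, ContDiff ℝ n g →
    ContDiff ℝ n fun x : Plane => ∫ τ in (0 : ℝ)..x 1, g (pt (x 0) τ) := by
  induction n with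
  | zero =>
    intro g hg
    exact contDiff_zero.2 (continuous_param_integral hg.continuous)
  | succ n ih =>
    intro g hg
    refine contDiff_succ_of_partials
      (f0 := fun x => ∫ τ in (0 : ℝ)..x 1, pd 0 g (pt (x 0) τ)) (f1 := g) ?_ ?_ ?_ ?_
    · intro s t
      exact hasDerivAt_param_integral (hg.of_le (by simp)) s t
    · intro s t
      have hc : Continuous fun τ => g (pt s τ) :=
        hg.continuous.comp (continuous_pt continuous_const continuous_id)
      exact hc.integral_hasStrictDerivAt 0 t |>.hasDerivAt
    · exact ih (hg.pd (by simp) 0)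
    · exact hg.of_le (by simp)

/-! ### The flow of a small vector field `∂₂ + b ∂₁` -/

/-- The slope `b` of the field `∂₂ + b ∂₁` is of class `C^k`, small in the relevant norms, and
vanishes outside a strip. -/
structure IsSmallSlope (k : ℕ) (η : ℝ) (b : Plane → ℝ) : Prop where
  one_le : 1 ≤ k
  contDiff : ContDiff ℝ k b
  nonneg : 0 ≤ η
  small : η ≤ 1 / 8
  abs_le : ∀ x, |b x| ≤ η
  abs_pd_le : ∀ x, |pd 0 b x| ≤ η
  support : ∀ x : Plane, 2 ≤ |x 1| → b x = 0

namespace IsSmallSlope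

variable {k : ℕ} {η : ℝ} {b : Plane → ℝ}

lemma differentiable (hb : IsSmallSlope k η b) : Differentiable ℝ b :=
  hb.contDiff.differentiable (by have := hb.one_le; simp; omega)

lemma contDiff_one (hb : IsSmallSlope k η b) : ContDiff ℝ 1 b :=
  hb.contDiff.of_le (by exact_mod_cast hb.one_le)

lemma continuous_pd (hb : IsSmallSlope k η b) : Continuous (pd 0 b) :=
  (hb.contDiff_one.pd (m := 0) (by norm_num) 0).continuous

lemma pd_support (hb : IsSmallSlope k η b) (x : Plane) (hx : 2 ≤ |x 1|) : pd 0 b x = 0 := by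
  have h := hasDerivAt_fst (hb.differentiable (pt (x 0) (x 1)))
  have h0 : (fun s' => b (pt s' (x 1))) = fun _ => 0 := by
    ext s'
    exact hb.support _ (by simpa using hx)
  rw [h0, pt_eta] at h
  exact h.unique (hasDerivAt_const _ _)

lemma abs_sub_le (hb : IsSmallSlope k η b) (u v τ : ℝ) :
    |b (pt u τ) - b (pt v τ)| ≤ η * |u - v| := by
  have := Convex.norm_image_sub_le_of_norm_hasDerivWithin_le (f := fun s => b (pt s τ))
    (f' := fun s => pd 0 b (pt s τ)) (s := univ) (C := η) (x := v) (y := u)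
    (fun s _ => (hasDerivAt_fst (hb.differentiable _)).hasDerivWithinAt)
    (fun s _ => hb.abs_pd_le _) convex_univ (mem_univ _) (mem_univ _)
  simpa using this

/-- The flow exists as the fixed point of a contraction on the bounded continuous functions. -/
lemma exists_flow (hb : IsSmallSlope k η b) : ∃ φ : Plane → ℝ, Continuous φ ∧
    ∀ s t, φ (pt s t) = s + ∫ τ in (0 : ℝ)..t, b (pt (φ (pt s τ)) τ) := by
  have hη := hb.nonneg
  have hη8 := hb.small
  let g : BoundedContinuousFunction Plane ℝ → Plane → ℝ := fun ψ x => b (pt (x 0 + ψ x) (x 1))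
  have hgc : ∀ ψ, Continuous (g ψ) := fun ψ => hb.contDiff.continuous.comp
    (continuous_pt ((coord 0).continuous.add ψ.continuous) (coord 1).continuous)
  have hline : ∀ s, Continuous fun τ => pt s τ := fun s =>
    continuous_pt continuous_const continuous_id
  let T : BoundedContinuousFunction Plane ℝ → BoundedContinuousFunction Plane ℝ := fun ψ =>
    BoundedContinuousFunction.ofNormedAddCommGroup
      (fun x => ∫ τ in (0 : ℝ)..x 1, g ψ (pt (x 0) τ)) (continuous_param_integral (hgc ψ)) (2 * η)
      (fun x => abs_integral_le_of_support hη ((hgc ψ).comp (hline _)) (fun τ => hb.abs_le _)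
        (fun τ hτ => hb.support _ hτ) _)
  have hT : ∀ ψ x, T ψ x = ∫ τ in (0 : ℝ)..x 1, g ψ (pt (x 0) τ) := fun _ _ => rfl
  have hcontr : ContractingWith (1 / 4) T := by
    refine ⟨by rw [← NNReal.coe_lt_coe]; norm_num, LipschitzWith.of_dist_le_mul fun ψ ψ' => ?_⟩
    rw [BoundedContinuousFunction.dist_le (by positivity)]
    intro x
    have hcl : ∀ ψ, Continuous fun τ => g ψ (pt (x 0) τ) := fun ψ => (hgc ψ).comp (hline _)
    rw [hT, hT, Real.dist_eq, ← intervalIntegral.integral_sub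
      ((hcl ψ).intervalIntegrable _ _) ((hcl ψ').intervalIntegrable _ _)]
    have := abs_integral_le_of_support (g := fun τ => g ψ (pt (x 0) τ) - g ψ' (pt (x 0) τ))
      (η := η * dist ψ ψ') (by positivity) ((hcl ψ).sub (hcl ψ'))
      (fun τ => ?_) (fun τ hτ => ?_) (x 1)
    · refine this.trans ?_
      have hd : 0 ≤ dist ψ ψ' := dist_nonneg
      push_cast
      nlinarith
    · refine (hb.abs_sub_le _ _ _).trans ?_
      gcongr
      have := BoundedContinuousFunction.dist_coe_le_dist (f := ψ) (g := ψ') (pt (x 0) τ)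
      rw [Real.dist_eq] at this
      simpa using this
    · simp only [g]
      rw [hb.support _ (by simpa using hτ), hb.support _ (by simpa using hτ), sub_zero]
  let ψ := hcontr.fixedPoint
  have hfix : T ψ = ψ := hcontr.fixedPoint_isFixedPt
  refine ⟨fun x => x 0 + ψ x, (coord 0).continuous.add ψ.continuous, fun s t => ?_⟩
  have : ψ (pt s t) = T ψ (pt s t) := by rw [hfix]
  simp only [this, hT, g, pt_zero, pt_one]

/-- The flow `φ` of `∂₂ + b ∂₁`: `t ↦ (φ(s, t), t)` is the integral curve through `(s, 0)`. -/
def flow (hb : IsSmallSlope k η b) : Plane → ℝ := hb.exists_flow.choose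

lemma continuous_flow (hb : IsSmallSlope k η b) : Continuous hb.flow :=
  hb.exists_flow.choose_spec.1

lemma flow_eq (hb : IsSmallSlope k η b) (s t : ℝ) :
    hb.flow (pt s t) = s + ∫ τ in (0 : ℝ)..t, b (pt (hb.flow (pt s τ)) τ) :=
  hb.exists_flow.choose_spec.2 s t

/-- The map `(s, t) ↦ (φ(s, t), t)`. -/
def flowMap (hb : IsSmallSlope k η b) (x : Plane) : Plane := pt (hb.flow x) (x 1)

@[simp] lemma flowMap_one (hb : IsSmallSlope k η b) (x : Plane) : hb.flowMap x 1 = x 1 := rfl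

lemma continuous_flowMap (hb : IsSmallSlope k η b) : Continuous hb.flowMap :=
  continuous_pt hb.continuous_flow (coord 1).continuous

lemma continuous_flowMap_line (hb : IsSmallSlope k η b) (s : ℝ) :
    Continuous fun τ => hb.flowMap (pt s τ) :=
  hb.continuous_flowMap.comp (continuous_pt continuous_const continuous_id)

lemma flow_eq' (hb : IsSmallSlope k η b) (s t : ℝ) :
    hb.flow (pt s t) = s + ∫ τ in (0 : ℝ)..t, b (hb.flowMap (pt s τ)) := hb.flow_eq s t

lemma flow_zero (hb : IsSmallSlope k η b) (s : ℝ) : hb.flow (pt s 0) = s := by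
  rw [flow_eq]; simp

lemma abs_flow_sub_le (hb : IsSmallSlope k η b) (x : Plane) : |hb.flow x - x 0| ≤ 2 * η := by
  rw [← pt_eta x, flow_eq']
  simp only [pt_zero, add_sub_cancel_left]
  exact abs_integral_le_of_support hb.nonneg
    (hb.contDiff.continuous.comp (hb.continuous_flowMap_line _)) (fun _ => hb.abs_le _)
    (fun τ hτ => hb.support _ (by simpa using hτ)) _

lemma hasDerivAt_flow_snd (hb : IsSmallSlope k η b) (s t : ℝ) :
    HasDerivAt (fun t' => hb.flow (pt s t')) (b (hb.flowMap (pt s t))) t := by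
  have hc : Continuous fun τ => b (hb.flowMap (pt s τ)) :=
    hb.contDiff.continuous.comp (hb.continuous_flowMap_line s)
  simp only [flow_eq']
  exact ((hc.integral_hasStrictDerivAt 0 t).hasDerivAt).const_add s

lemma abs_flow_sub_flow (hb : IsSmallSlope k η b) (s s' t : ℝ) :
    |hb.flow (pt s' t) - hb.flow (pt s t) - (s' - s)| ≤ |s' - s| / 3 := by
  have hη := hb.nonneg
  have hη8 := hb.small
  set Δ : ℝ → ℝ := fun t => hb.flow (pt s' t) - hb.flow (pt s t) with hΔ
  have hbd : BddAbove (range fun t => |Δ t|) := by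
    refine ⟨|s' - s| + 4 * η, ?_⟩
    rintro _ ⟨t, rfl⟩
    have h1 := _root_.abs_le.1 (hb.abs_flow_sub_le (pt s' t))
    have h2 := _root_.abs_le.1 (hb.abs_flow_sub_le (pt s t))
    simp only [pt_zero] at h1 h2
    have h3 := le_abs_self (s' - s)
    have h4 := neg_le_abs (s' - s)
    exact _root_.abs_le.2 ⟨by simp only [hΔ]; linarith, by simp only [hΔ]; linarith⟩
  set B := ⨆ t, |Δ t| with hB
  have hle : ∀ t, |Δ t| ≤ B := fun t => le_ciSup hbd t
  have hB0 : 0 ≤ B := (abs_nonneg _).trans (hle 0)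
  have hkey : ∀ t, |Δ t - (s' - s)| ≤ B / 4 := by
    intro t
    have hc : ∀ s, Continuous fun τ => b (hb.flowMap (pt s τ)) := fun s =>
      hb.contDiff.continuous.comp (hb.continuous_flowMap_line s)
    have : Δ t - (s' - s) = ∫ τ in (0 : ℝ)..t,
        (b (hb.flowMap (pt s' τ)) - b (hb.flowMap (pt s τ))) := by
      rw [intervalIntegral.integral_sub ((hc s').intervalIntegrable _ _)
        ((hc s).intervalIntegrable _ _)]
      simp only [hΔ, flow_eq']
      ring
    rw [this]
    refine (abs_integral_le_of_support (η := η * B) (by positivity) ((hc s').sub (hc s))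
      (fun τ => ?_) (fun τ hτ => ?_) t).trans (by nlinarith)
    · exact (hb.abs_sub_le _ _ _).trans (by gcongr; exact hle τ)
    · simp only [Pi.sub_apply]
      rw [hb.support (hb.flowMap _) (by simpa using hτ),
        hb.support (hb.flowMap _) (by simpa using hτ), sub_zero]
  have hB2 : B ≤ |s' - s| + B / 4 := by
    refine ciSup_le fun t => ?_
    have := abs_sub_abs_le_abs_sub (Δ t) (s' - s)
    linarith [hkey t]
  linarith [hkey t]

/-- The derivative of the flow with respect to the initial value. -/
def flowDeriv (hb : IsSmallSlope k η b) (x : Plane) : ℝ :=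
  Real.exp (∫ τ in (0 : ℝ)..x 1, pd 0 b (hb.flowMap (pt (x 0) τ)))

lemma hasDerivAt_flow_fst (hb : IsSmallSlope k η b) (s t : ℝ) :
    HasDerivAt (fun s' => hb.flow (pt s' t)) (hb.flowDeriv (pt s t)) s := by
  have hline : ∀ s, Continuous fun τ => hb.flow (pt s τ) := fun s =>
    hb.continuous_flow.comp (continuous_pt continuous_const continuous_id)
  have hbc : ∀ s, Continuous fun τ => b (hb.flowMap (pt s τ)) := fun s =>
    hb.contDiff.continuous.comp (hb.continuous_flowMap_line s)
  -- the divided difference of `b` along two integral curves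
  let B : ℝ → ℝ → ℝ := fun s' τ => (b (hb.flowMap (pt s' τ)) - b (hb.flowMap (pt s τ))) /
    (hb.flow (pt s' τ) - hb.flow (pt s τ))
  have hne : ∀ s', s' ≠ s → ∀ τ, hb.flow (pt s' τ) - hb.flow (pt s τ) ≠ 0 := by
    intro s' hs' τ h0
    have h := hb.abs_flow_sub_flow s s' τ
    rw [h0, zero_sub, abs_neg] at h
    have : 0 < |s' - s| := abs_pos.2 (sub_ne_zero.2 hs')
    linarith
  have hBc : ∀ s', s' ≠ s → Continuous (B s') := fun s' hs' =>
    ((hbc s').sub (hbc s)).div ((hline s').sub (hline s)) (hne s' hs')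
  have hBb : ∀ s', s' ≠ s → ∀ τ, |B s' τ| ≤ η := by
    intro s' hs' τ
    rw [abs_div, div_le_iff₀ (abs_pos.2 (hne s' hs' τ))]
    exact hb.abs_sub_le _ _ _
  have hsol : ∀ s', s' ≠ s → hb.flow (pt s' t) - hb.flow (pt s t) =
      (s' - s) * Real.exp (∫ τ in (0 : ℝ)..t, B s' τ) := by
    intro s' hs'
    let U : ℝ → ℝ := fun t => (hb.flow (pt s' t) - hb.flow (pt s t)) *
      Real.exp (-∫ τ in (0 : ℝ)..t, B s' τ)
    have hU : ∀ t, HasDerivAt U 0 t := by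
      intro t
      have h1 := (hb.hasDerivAt_flow_snd s' t).sub (hb.hasDerivAt_flow_snd s t)
      have h2 := (((hBc s' hs').integral_hasStrictDerivAt 0 t).hasDerivAt).neg.exp
      refine (h1.mul h2).congr_deriv ?_
      have : (b (hb.flowMap (pt s' t)) - b (hb.flowMap (pt s t))) =
        B s' t * (hb.flow (pt s' t) - hb.flow (pt s t)) := by
        simp only [B]; field_simp [hne s' hs' t]
      rw [this]
      simp only [Pi.sub_apply, Pi.neg_apply]
      ring
    have hconst := is_const_of_deriv_eq_zero (fun t => (hU t).differentiableAt)
      (fun t => (hU t).deriv) t 0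
    simp only [U, flow_zero, intervalIntegral.integral_same, neg_zero, Real.exp_zero,
      mul_one] at hconst
    rw [← hconst, mul_assoc, ← Real.exp_add, neg_add_cancel, Real.exp_zero, mul_one]
  rw [hasDerivAt_iff_tendsto_slope]
  have hlim : Tendsto (fun s' => Real.exp (∫ τ in (0 : ℝ)..t, B s' τ)) (𝓝[≠] s)
      (𝓝 (hb.flowDeriv (pt s t))) := by
    refine (Real.continuous_exp.tendsto _).comp ?_
    refine intervalIntegral.tendsto_integral_filter_of_dominated_convergence (fun _ => η) ?_ ?_ ?_ ?_
    · filter_upwards [self_mem_nhdsWithin] with s' hs'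
      exact (hBc s' hs').aestronglyMeasurable
    · filter_upwards [self_mem_nhdsWithin] with s' hs'
      exact Eventually.of_forall fun τ _ => hBb s' hs' τ
    · exact intervalIntegrable_const
    · refine Eventually.of_forall fun τ _ => ?_
      have hd := hasDerivAt_fst (hb.differentiable (pt (hb.flow (pt s τ)) τ))
      rw [hasDerivAt_iff_tendsto_slope] at hd
      have hφ : Tendsto (fun s' => hb.flow (pt s' τ)) (𝓝[≠] s) (𝓝[≠] (hb.flow (pt s τ))) := by
        refine tendsto_nhdsWithin_iff.2 ⟨?_, ?_⟩
        · exact ((hb.continuous_flow.comp (continuous_pt continuous_id continuous_const)).tendsto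
            s).mono_left nhdsWithin_le_nhds
        · filter_upwards [self_mem_nhdsWithin] with s' hs'
          exact sub_ne_zero.1 (hne s' hs' τ)
      refine (hd.comp hφ).congr fun s' => ?_
      simp only [Function.comp, slope_def_field, B]
      rfl
  refine hlim.congr' ?_
  filter_upwards [self_mem_nhdsWithin] with s' hs'
  rw [slope_def_field, hsol s' hs', mul_div_cancel_left₀ _ (sub_ne_zero.2 hs')]

lemma contDiff_flow (hb : IsSmallSlope k η b) : ContDiff ℝ k hb.flow := by
  have h : ∀ n : ℕ, n ≤ k → ContDiff ℝ n hb.flow := by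
    intro n
    induction n with
    | zero => exact fun _ => contDiff_zero.2 hb.continuous_flow
    | succ n ih =>
      intro hn
      have hφ := ih (by omega)
      have hΦ : ContDiff ℝ n hb.flowMap := contDiff_pt hφ (contDiff_coord 1)
      refine contDiff_succ_of_partials (f1 := fun x => b (hb.flowMap x)) hb.hasDerivAt_flow_fst
        hb.hasDerivAt_flow_snd ?_ ?_
      · have h0 : ContDiff ℝ n (pd 0 b) := hb.contDiff.pd (by exact_mod_cast hn) 0
        exact (contDiff_param_integral (h0.comp hΦ)).exp
      · exact (hb.contDiff.of_le (by exact_mod_cast (by omega : n ≤ k))).comp hΦ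
  exact h k le_rfl

lemma contDiff_flowMap (hb : IsSmallSlope k η b) : ContDiff ℝ k hb.flowMap :=
  contDiff_pt hb.contDiff_flow (contDiff_coord 1)

lemma pd_zero_flow (hb : IsSmallSlope k η b) (x : Plane) : pd 0 hb.flow x = hb.flowDeriv x := by
  have h := hasDerivAt_fst (hb.contDiff_flow.differentiable
    (by have := hb.one_le; simp; omega) (pt (x 0) (x 1)))
  have := h.unique (hb.hasDerivAt_flow_fst (x 0) (x 1))
  rwa [pt_eta] at this

lemma flowDeriv_pos (hb : IsSmallSlope k η b) (x : Plane) : 0 < hb.flowDeriv x := Real.exp_pos _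

lemma abs_inv_flowDeriv_sub_one (hb : IsSmallSlope k η b) (x : Plane) :
    |(hb.flowDeriv x)⁻¹ - 1| ≤ 4 * η := by
  have hη8 := hb.small
  have h := abs_integral_le_of_support hb.nonneg
    (hb.continuous_pd.comp (hb.continuous_flowMap_line (x 0))) (fun _ => hb.abs_pd_le _)
    (fun τ hτ => hb.pd_support _ (by simpa using hτ)) (x 1)
  rw [flowDeriv, ← Real.exp_neg]
  refine (Real.abs_exp_sub_one_le (x := -_) ?_).trans ?_
  · rw [abs_neg]; exact h.trans (by linarith)
  · rw [abs_neg]; simp only [Function.comp_def] at h; linarith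

end IsSmallSlope

/-! ### Diffeomorphisms of the plane which preserve the second coordinate -/

/-- The linear map with matrix `(a b; 0 1)`, where `a ≠ 0`. -/
def shearEquiv (a b : ℝ) (ha : a ≠ 0) : Plane ≃L[ℝ] Plane :=
  LinearEquiv.toContinuousLinearEquiv
    { toFun := fun v => pt (a * v 0 + b * v 1) (v 1)
      invFun := fun v => pt ((v 0 - b * v 1) / a) (v 1)
      map_add' := fun u v => by apply plane_ext <;> simp; ring
      map_smul' := fun c v => by apply plane_ext <;> simp; ring
      left_inv := fun v => by apply plane_ext <;> simp; field_simp
      right_inv := fun v => by apply plane_ext <;> simp; field_simp; ring }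

lemma shearEquiv_apply (a b : ℝ) (ha : a ≠ 0) (v : Plane) :
    shearEquiv a b ha v = pt (a * v 0 + b * v 1) (v 1) := rfl

/-- If `∂₁f > 0` and `f` is at a bounded distance from a multiple of the first coordinate, then
`x ↦ (f(x), x²)` is a diffeomorphism of the plane. -/
lemma exists_graph_diffeo {k : ℕ} (hk : 1 ≤ k) {f : Plane → ℝ} (hf : ContDiff ℝ k f)
    (hpos : ∀ x, 0 < pd 0 f x) {c B : ℝ} (hc : 0 < c) (hB : ∀ x, |f x - c * x 0| ≤ B) :
    ∃ Ψ : Plane ≃ₜ Plane, (∀ x, Ψ x = pt (f x) (x 1)) ∧ ContDiff ℝ k Ψ ∧ ContDiff ℝ k Ψ.symm := by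
  have hk0 : (k : WithTop ℕ∞) ≠ 0 := by simp; omega
  have hd : Differentiable ℝ f := hf.differentiable hk0
  have hmono : ∀ t, StrictMono fun s => f (pt s t) := fun t =>
    strictMono_of_hasDerivAt_pos (fun s => hasDerivAt_fst (hd _)) fun s => hpos _
  have hsurj : ∀ t, Function.Surjective fun s => f (pt s t) := by
    intro t
    have hcont : Continuous fun s => f (pt s t) :=
      hf.continuous.comp (continuous_pt continuous_id continuous_const)
    refine hcont.surjective ?_ ?_
    · refine tendsto_atTop_mono (f := fun s => c * s - B) (fun s => ?_)
        (tendsto_atTop_add_const_right _ _ (tendsto_id.const_mul_atTop hc))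
      have := (abs_le.1 (hB (pt s t))).1
      simp only [pt_zero] at this
      linarith
    · refine tendsto_atBot_mono (g := fun s => f (pt s t)) (f := fun s => c * s + B) (fun s => ?_)
        (tendsto_atBot_add_const_right _ _ (tendsto_id.const_mul_atBot hc))
      have := (abs_le.1 (hB (pt s t))).2
      simp only [pt_zero] at this
      linarith
  let Ψ : Plane → Plane := fun x => pt (f x) (x 1)
  have hΨ : ContDiff ℝ k Ψ := contDiff_pt hf (contDiff_coord 1)
  have hbij : Function.Bijective Ψ := by
    constructor
    · intro x y hxy
      have h1' : Ψ x 1 = Ψ y 1 := by rw [hxy]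
      have h0' : Ψ x 0 = Ψ y 0 := by rw [hxy]
      have h1 : x 1 = y 1 := h1'
      have h0 : f x = f y := h0'
      refine plane_ext ((hmono (x 1)).injective ?_) h1
      simp only
      rw [pt_eta, h0]
      conv_lhs => rw [← pt_eta y]
      rw [h1]
    · intro y
      obtain ⟨s, hs⟩ := hsurj (y 1) (y 0)
      exact ⟨pt s (y 1), plane_ext hs rfl⟩
  have hderiv : ∀ x, HasFDerivAt Ψ
      ((shearEquiv (pd 0 f x) (pd 1 f x) (hpos x).ne' : Plane ≃L[ℝ] Plane) : Plane →L[ℝ] Plane) x := by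
    intro x
    have h1 : HasFDerivAt (fun y => f y • e 0 + y 1 • e 1)
        ((fderiv ℝ f x).smulRight (e 0) + (coord 1).smulRight (e 1)) x :=
      ((hd x).hasFDerivAt.smul_const _).add (((coord 1).hasFDerivAt).smul_const _)
    have h2 : (fun y => f y • e 0 + y 1 • e 1) = Ψ := by
      ext1 y; exact (pt_eq _ _).symm
    rw [h2] at h1
    refine h1.congr_fderiv ?_
    ext1 v
    change fderiv ℝ f x v • e 0 + v 1 • e 1 = shearEquiv (pd 0 f x) (pd 1 f x) (hpos x).ne' v
    rw [shearEquiv_apply, pt_eq, fderiv_plane_apply]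
    simp only [smul_eq_mul]
    ring_nf
  have hopen : IsOpenMap Ψ := by
    refine isOpenMap_of_hasStrictFDerivAt_equiv (f' := fun x =>
      shearEquiv (pd 0 f x) (pd 1 f x) (hpos x).ne') fun x => ?_
    exact hΨ.contDiffAt.hasStrictFDerivAt' (hderiv x) hk0
  let H : Plane ≃ₜ Plane :=
    (Equiv.ofBijective Ψ hbij).toHomeomorphOfContinuousOpen hΨ.continuous hopen
  have hH : (H : Plane → Plane) = Ψ := rfl
  refine ⟨H, fun x => rfl, by rw [hH]; exact hΨ, contDiff_iff_contDiffAt.2 fun y => ?_⟩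
  exact H.toOpenPartialHomeomorph.contDiffAt_symm (mem_univ y) (hderiv (H.symm y)) hΨ.contDiffAt

namespace IsSmallSlope

variable {k : ℕ} {η : ℝ} {b : Plane → ℝ}

lemma exists_flowHomeo (hb : IsSmallSlope k η b) : ∃ Ψ : Plane ≃ₜ Plane,
    (∀ x, Ψ x = hb.flowMap x) ∧ ContDiff ℝ k Ψ ∧ ContDiff ℝ k Ψ.symm :=
  exists_graph_diffeo hb.one_le hb.contDiff_flow
    (fun x => by rw [pd_zero_flow]; exact hb.flowDeriv_pos x) one_pos
    (fun x => by rw [one_mul]; exact hb.abs_flow_sub_le x)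

/-- `(s, t) ↦ (φ(s, t), t)` as a homeomorphism of the plane. -/
def flowHomeo (hb : IsSmallSlope k η b) : Plane ≃ₜ Plane := hb.exists_flowHomeo.choose

lemma flowHomeo_apply (hb : IsSmallSlope k η b) (x : Plane) : hb.flowHomeo x = hb.flowMap x :=
  hb.exists_flowHomeo.choose_spec.1 x

/-- The first integral of `∂₂ + b ∂₁` which equals `x¹` on the line `x² = 0`. -/
def firstIntegral (hb : IsSmallSlope k η b) (x : Plane) : ℝ := hb.flowHomeo.symm x 0

lemma contDiff_firstIntegral (hb : IsSmallSlope k η b) : ContDiff ℝ k hb.firstIntegral :=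
  (contDiff_coord 0).comp hb.exists_flowHomeo.choose_spec.2.2

lemma differentiable_firstIntegral (hb : IsSmallSlope k η b) :
    Differentiable ℝ hb.firstIntegral :=
  hb.contDiff_firstIntegral.differentiable (by have := hb.one_le; simp; omega)

lemma firstIntegral_flowMap (hb : IsSmallSlope k η b) (x : Plane) :
    hb.firstIntegral (hb.flowMap x) = x 0 := by
  rw [firstIntegral, ← flowHomeo_apply, Homeomorph.symm_apply_apply]

lemma flowMap_firstIntegral (hb : IsSmallSlope k η b) (x : Plane) :
    hb.flowMap (pt (hb.firstIntegral x) (x 1)) = x := by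
  have h : hb.flowMap (hb.flowHomeo.symm x) = x := by
    rw [← flowHomeo_apply, Homeomorph.apply_symm_apply]
  have h1 : hb.flowHomeo.symm x = pt (hb.firstIntegral x) (x 1) := by
    refine plane_ext rfl ?_
    have := congrArg (fun v : Plane => v 1) h
    exact this
  rw [← h1, h]

lemma flow_firstIntegral (hb : IsSmallSlope k η b) (x : Plane) :
    hb.flow (pt (hb.firstIntegral x) (x 1)) = x 0 :=
  congrArg (fun v : Plane => v 0) (hb.flowMap_firstIntegral x)

lemma firstIntegral_zero (hb : IsSmallSlope k η b) (s : ℝ) : hb.firstIntegral (pt s 0) = s := by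
  have := hb.firstIntegral_flowMap (pt s 0)
  rwa [flowMap, flow_zero] at this

lemma abs_firstIntegral_sub_le (hb : IsSmallSlope k η b) (x : Plane) :
    |hb.firstIntegral x - x 0| ≤ 2 * η := by
  have := hb.abs_flow_sub_le (pt (hb.firstIntegral x) (x 1))
  rw [flow_firstIntegral, pt_zero, abs_sub_comm] at this
  exact this

lemma pd_zero_firstIntegral (hb : IsSmallSlope k η b) (x : Plane) :
    pd 0 hb.firstIntegral (hb.flowMap x) = (hb.flowDeriv x)⁻¹ := by
  have h1 : HasDerivAt (fun s => hb.firstIntegral (pt (hb.flow (pt s (x 1))) (x 1)))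
      (hb.flowDeriv x • pd 0 hb.firstIntegral (hb.flowMap x) +
        (0 : ℝ) • pd 1 hb.firstIntegral (hb.flowMap x)) (x 0) := by
    have hx : hb.flowMap x = pt (hb.flow (pt (x 0) (x 1))) (x 1) := by rw [pt_eta]; rfl
    rw [hx]
    have := hb.hasDerivAt_flow_fst (x 0) (x 1)
    conv at this => rw [pt_eta]
    exact pd_comp_curve (hb.differentiable_firstIntegral _) this (hasDerivAt_const _ _)
  have h2 : (fun s => hb.firstIntegral (pt (hb.flow (pt s (x 1))) (x 1))) = id := by
    ext s
    exact hb.firstIntegral_flowMap (pt s (x 1))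
  rw [h2] at h1
  have h3 := h1.unique (hasDerivAt_id _)
  simp only [smul_eq_mul, zero_mul, add_zero] at h3
  exact eq_inv_of_mul_eq_one_right h3

lemma pd_one_firstIntegral (hb : IsSmallSlope k η b) (x : Plane) :
    pd 1 hb.firstIntegral x = - (b x * pd 0 hb.firstIntegral x) := by
  obtain ⟨y, rfl⟩ : ∃ y, hb.flowMap y = x := ⟨_, hb.flowMap_firstIntegral x⟩
  have h1 : HasDerivAt (fun t => hb.firstIntegral (pt (hb.flow (pt (y 0) t)) t))
      (b (hb.flowMap y) • pd 0 hb.firstIntegral (hb.flowMap y) +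
        (1 : ℝ) • pd 1 hb.firstIntegral (hb.flowMap y)) (y 1) := by
    have hx : hb.flowMap y = pt (hb.flow (pt (y 0) (y 1))) (y 1) := by rw [pt_eta]; rfl
    rw [hx]
    have := hb.hasDerivAt_flow_snd (y 0) (y 1)
    exact pd_comp_curve (hb.differentiable_firstIntegral _) this (hasDerivAt_id _)
  have h2 : (fun t => hb.firstIntegral (pt (hb.flow (pt (y 0) t)) t)) = fun _ => y 0 := by
    ext t
    exact hb.firstIntegral_flowMap (pt (y 0) t)
  rw [h2] at h1
  have h3 := h1.unique (hasDerivAt_const _ _)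
  simp only [smul_eq_mul, one_mul] at h3
  linarith

lemma abs_pd_zero_firstIntegral_sub_one (hb : IsSmallSlope k η b) (x : Plane) :
    |pd 0 hb.firstIntegral x - 1| ≤ 4 * η := by
  obtain ⟨y, rfl⟩ : ∃ y, hb.flowMap y = x := ⟨_, hb.flowMap_firstIntegral x⟩
  rw [pd_zero_firstIntegral]
  exact hb.abs_inv_flowDeriv_sub_one y

lemma pd_zero_firstIntegral_mem (hb : IsSmallSlope k η b) (x : Plane) :
    1 / 2 ≤ pd 0 hb.firstIntegral x ∧ pd 0 hb.firstIntegral x ≤ 3 / 2 := by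
  have := _root_.abs_le.1 (hb.abs_pd_zero_firstIntegral_sub_one x)
  have := hb.small
  constructor <;> linarith

lemma abs_pd_one_firstIntegral (hb : IsSmallSlope k η b) (x : Plane) :
    |pd 1 hb.firstIntegral x| ≤ 2 * η := by
  rw [pd_one_firstIntegral, abs_neg, abs_mul]
  have h := hb.pd_zero_firstIntegral_mem x
  have h1 : |pd 0 hb.firstIntegral x| ≤ 3 / 2 := _root_.abs_le.2 ⟨by linarith, h.2⟩
  have := hb.abs_le x
  have := hb.nonneg
  nlinarith [abs_nonneg (b x), abs_nonneg (pd 0 hb.firstIntegral x)]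

lemma continuous_flowDeriv (hb : IsSmallSlope k η b) : Continuous hb.flowDeriv :=
  Real.continuous_exp.comp
    (continuous_param_integral (g := fun x => pd 0 b (hb.flowMap x))
      (hb.continuous_pd.comp hb.continuous_flowMap))

lemma flowDeriv_mem (hb : IsSmallSlope k η b) (x : Plane) :
    1 / 2 ≤ hb.flowDeriv x ∧ hb.flowDeriv x ≤ 2 := by
  have h := hb.pd_zero_firstIntegral_mem (hb.flowMap x)
  rw [pd_zero_firstIntegral] at h
  have hp := hb.flowDeriv_pos x
  constructor
  · have := (inv_le_comm₀ hp (by norm_num)).1 h.2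
    linarith
  · have := (le_inv_comm₀ (by norm_num) hp).1 h.1
    linarith

/-- If `G` is of class `C¹` and so is its derivative `T` along `∂₂ + b ∂₁`, then `∂₁G` is
differentiable along integral curves, even though `∂₁∂₂G` need not exist. -/
lemma hasDerivAt_pd_along_flow (hb : IsSmallSlope k η b) {G T : Plane → ℝ} (hG : ContDiff ℝ 1 G)
    (hT : ContDiff ℝ 1 T) (hGT : ∀ x, pd 1 G x + b x * pd 0 G x = T x) (s t : ℝ) :
    HasDerivAt (fun t => pd 0 G (hb.flowMap (pt s t)) * hb.flowDeriv (pt s t))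
      (pd 0 T (hb.flowMap (pt s t)) * hb.flowDeriv (pt s t)) t := by
  have hΦ : ContDiff ℝ 1 hb.flowMap := hb.contDiff_flowMap.of_le (by exact_mod_cast hb.one_le)
  have hcomp : ∀ s t (f : Plane → ℝ), ContDiff ℝ 1 f → HasDerivAt
      (fun s' => f (hb.flowMap (pt s' t))) (pd 0 f (hb.flowMap (pt s t)) * hb.flowDeriv (pt s t)) s := by
    intro s t f hf
    have := pd_comp_curve (f := f) (hf.differentiable (by norm_num) _)
      (hb.hasDerivAt_flow_fst s t) (hasDerivAt_const s t)
    refine this.congr_deriv ?_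
    simp only [smul_eq_mul, zero_mul, add_zero]
    rw [mul_comm]
    rfl
  have hTΦ : ContDiff ℝ 1 fun x => T (hb.flowMap x) := hT.comp hΦ
  have hint : ∀ s t, G (hb.flowMap (pt s t)) =
      G (pt s 0) + ∫ τ in (0 : ℝ)..t, T (hb.flowMap (pt s τ)) := by
    intro s t
    have hder : ∀ τ, HasDerivAt (fun τ => G (hb.flowMap (pt s τ))) (T (hb.flowMap (pt s τ))) τ := by
      intro τ
      have := pd_comp_curve (f := G) (hG.differentiable (by norm_num) _)
        (hb.hasDerivAt_flow_snd s τ) (hasDerivAt_id τ)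
      refine this.congr_deriv ?_
      rw [← hGT]
      simp only [smul_eq_mul, one_mul, id]
      rw [add_comm]
      rfl
    have hc : Continuous fun τ => T (hb.flowMap (pt s τ)) :=
      hT.continuous.comp (hb.continuous_flowMap_line s)
    have := intervalIntegral.integral_eq_sub_of_hasDerivAt (fun τ _ => hder τ)
      (hc.intervalIntegrable 0 t)
    have h0 : hb.flowMap (pt s 0) = pt s 0 := by rw [flowMap, flow_zero, pt_one]
    rw [this, h0]
    ring
  have hpdT : ∀ x, pd 0 (fun x => T (hb.flowMap x)) x = pd 0 T (hb.flowMap x) * hb.flowDeriv x := by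
    intro x
    have h1 := hasDerivAt_fst (hTΦ.differentiable (by norm_num) (pt (x 0) (x 1)))
    have := h1.unique (hcomp (x 0) (x 1) T hT)
    rwa [pt_eta] at this
  have hkey : ∀ t, pd 0 G (hb.flowMap (pt s t)) * hb.flowDeriv (pt s t) = pd 0 G (pt s 0) +
      ∫ τ in (0 : ℝ)..t, pd 0 T (hb.flowMap (pt s τ)) * hb.flowDeriv (pt s τ) := by
    intro t
    have h1 := hcomp s t G hG
    have h2 := (hasDerivAt_fst (hG.differentiable (by norm_num) (pt s 0))).add
      (hasDerivAt_param_integral hTΦ s t)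
    have h3 : (fun s' => G (hb.flowMap (pt s' t))) = fun s' => G (pt s' 0) +
      ∫ τ in (0 : ℝ)..t, T (hb.flowMap (pt s' τ)) := by ext s'; exact hint s' t
    rw [h3] at h1
    rw [h1.unique h2]
    simp only [hpdT]
  have hc : Continuous fun τ => pd 0 T (hb.flowMap (pt s τ)) * hb.flowDeriv (pt s τ) :=
    ((hT.pd (m := 0) (by norm_num) 0).continuous.comp (hb.continuous_flowMap_line s)).mul
      (hb.continuous_flowDeriv.comp (continuous_pt continuous_const continuous_id))
  simp only [hkey]
  exact ((hc.integral_hasStrictDerivAt 0 t).hasDerivAt).const_add _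

end IsSmallSlope

/-! ### Iterated partial derivatives -/

section

variable {F : Type*} [NormedAddCommGroup F] [NormedSpace ℝ F]

lemma contDiff_iterate_pd {m : ℕ} (i : Fin 2) : ∀ {n : ℕ} {f : Plane → F},
    ContDiff ℝ (m + n : ℕ) f → ContDiff ℝ m ((pd i)^[n] f) := by
  intro n
  induction n with
  | zero => intro f hf; simpa using hf
  | succ n ih =>
    intro f hf
    rw [Function.iterate_succ_apply]
    exact ih (hf.pd (by norm_cast) i)

lemma iterate_pd_comm {n : ℕ} {f : Plane → F} (hf : ContDiff ℝ (n + 1 : ℕ) f) :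
    pd 1 ((pd 0)^[n] f) = (pd 0)^[n] (pd 1 f) := by
  induction n generalizing f with
  | zero => rfl
  | succ n ih =>
    rw [Function.iterate_succ_apply, Function.iterate_succ_apply, ih (hf.pd (by norm_cast) 0)]
    congr 1
    ext1 x
    exact pd_comm (hf.contDiffAt.of_le (by norm_cast; omega)) 1 0

lemma norm_iteratedFDeriv_iterate_pd_le {n j : ℕ} (i : Fin 2) {f : Plane → F}
    (hf : ContDiff ℝ (n + j : ℕ) f) (x : Plane) :
    ‖iteratedFDeriv ℝ n ((pd i)^[j] f) x‖ ≤ ‖iteratedFDeriv ℝ (n + j) f x‖ := by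
  induction j generalizing f with
  | zero => exact le_rfl
  | succ j ih =>
    rw [Function.iterate_succ_apply]
    refine (ih (hf.pd (by norm_cast) i)).trans ?_
    exact norm_iteratedFDeriv_pd_le (hf.contDiffAt) i

lemma iterate_pd_eq_iteratedDeriv {n : ℕ} {f : Plane → F} (hf : ContDiff ℝ n f) (s t : ℝ) :
    (pd 0)^[n] f (pt s t) = iteratedDeriv n (fun s' => f (pt s' t)) s := by
  induction n generalizing f with
  | zero => simp
  | succ n ih =>
    rw [Function.iterate_succ_apply, ih (hf.pd (by norm_cast) 0), iteratedDeriv_succ']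
    congr 1
    ext1 s'
    exact (hasDerivAt_fst (hf.differentiable (by simp) _)).deriv.symm

end

lemma iterate_pd_mul {n : ℕ} {f g : Plane → ℝ} (hf : ContDiff ℝ n f) (hg : ContDiff ℝ n g)
    (x : Plane) : (pd 0)^[n] (fun y => f y * g y) x = ∑ j ∈ Finset.range (n + 1),
      (n.choose j : ℝ) * (pd 0)^[j] f x * (pd 0)^[n - j] g x := by
  have hl : ContDiff ℝ n fun s => pt s (x 1) := contDiff_pt contDiff_id contDiff_const
  have hf1 : ContDiff ℝ n fun s => f (pt s (x 1)) := hf.comp hl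
  have hg1 : ContDiff ℝ n fun s => g (pt s (x 1)) := hg.comp hl
  rw [← pt_eta x, iterate_pd_eq_iteratedDeriv (hf.mul hg),
    iteratedDeriv_fun_mul hf1.contDiffAt hg1.contDiffAt]
  refine Finset.sum_congr rfl fun j hj => ?_
  rw [Finset.mem_range] at hj
  rw [iterate_pd_eq_iteratedDeriv (hf.of_le (by norm_cast; omega)),
    iterate_pd_eq_iteratedDeriv (hg.of_le (by norm_cast; omega))]

lemma iteratedFDeriv_const_mul_at {n : ℕ} {f : Plane → ℝ} {x : Plane} (a : ℝ)
    (hf : ContDiffAt ℝ n f x) :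
    iteratedFDeriv ℝ n (fun x => a * f x) x = a • iteratedFDeriv ℝ n f x := by
  have h : (fun x => a * f x) = fun x => a • f x := rfl
  rw [h]
  exact iteratedFDeriv_const_smul_apply' (𝕜 := ℝ) (R := ℝ) (a := a) hf

/-! ### Tame bounds -/

/-- A weight: the sizes `W_j` which the derivatives of order `j` may have. The last property, a
form of the logarithmic convexity of the norms in the scale `C^j`, `j ≤ k`, makes the bounds by
multiples of `W_j` stable under nonlinear operations. -/
structure IsWeight (k : ℕ) (C₀ : ℝ) (W : ℕ → ℝ) : Prop where
  one_le : ∀ j, 1 ≤ W j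
  mono : Monotone W
  le_const : W 1 ≤ C₀
  mul_le' : ∀ i j, 1 ≤ i → 1 ≤ j → i + j ≤ k + 1 → W i * W j ≤ C₀ * W (i + j - 1)

namespace IsWeight

variable {k : ℕ} {C₀ : ℝ} {W : ℕ → ℝ}

lemma pos (h : IsWeight k C₀ W) (j : ℕ) : 0 < W j := zero_lt_one.trans_le (h.one_le j)

lemma const_pos (h : IsWeight k C₀ W) : 0 < C₀ := (h.pos 1).trans_le h.le_const

lemma mul_le (h : IsWeight k C₀ W) {i j : ℕ} (hk : i + j ≤ k) : W i * W j ≤ C₀ * W (i + j) := by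
  have h0 : W 0 ≤ C₀ := (h.mono zero_le_one).trans h.le_const
  rcases Nat.eq_zero_or_pos i with rfl | hi
  · rw [zero_add]
    exact mul_le_mul_of_nonneg_right h0 (h.pos j).le
  rcases Nat.eq_zero_or_pos j with rfl | hj
  · rw [add_zero, mul_comm]
    exact mul_le_mul_of_nonneg_right h0 (h.pos i).le
  exact (h.mul_le' i j hi hj (by omega)).trans
    (mul_le_mul_of_nonneg_left (h.mono (by omega)) h.const_pos.le)

lemma mul_mul_le (h : IsWeight k C₀ W) {a b A B : ℝ} {i j n : ℕ} (ha : |a| ≤ A * W i)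
    (hb : |b| ≤ B * W j) (hA : 0 ≤ A)
    (hn : i + j = n) (hk : n ≤ k) : |a * b| ≤ A * B * C₀ * W n := by
  subst hn
  have hB : 0 ≤ B := nonneg_of_mul_nonneg_left ((abs_nonneg _).trans hb) (h.pos j)
  rw [abs_mul]
  calc |a| * |b| ≤ (A * W i) * (B * W j) :=
        mul_le_mul ha hb (abs_nonneg _) (mul_nonneg hA (h.pos i).le)
    _ = A * B * (W i * W j) := by ring
    _ ≤ A * B * (C₀ * W (i + j)) := mul_le_mul_of_nonneg_left (h.mul_le hk) (mul_nonneg hA hB)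
    _ = _ := by ring

lemma mul_mul_le' (h : IsWeight k C₀ W) {a b A B : ℝ} {i j n : ℕ} (ha : |a| ≤ A * W i)
    (hb : |b| ≤ B * W j) (hA : 0 ≤ A) (hi : 1 ≤ i) (hj : 1 ≤ j) (hn : i + j = n + 1)
    (hk : n ≤ k) :
    |a * b| ≤ A * B * C₀ * W n := by
  have hB : 0 ≤ B := nonneg_of_mul_nonneg_left ((abs_nonneg _).trans hb) (h.pos j)
  rw [abs_mul]
  calc |a| * |b| ≤ (A * W i) * (B * W j) :=
        mul_le_mul ha hb (abs_nonneg _) (mul_nonneg hA (h.pos i).le)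
    _ = A * B * (W i * W j) := by ring
    _ ≤ A * B * (C₀ * W (i + j - 1)) :=
        mul_le_mul_of_nonneg_left (h.mul_le' i j hi hj (by omega)) (mul_nonneg hA hB)
    _ = A * B * C₀ * W n := by rw [hn, Nat.add_sub_cancel]; ring

end IsWeight

/-- The derivatives of `f` on `R` of order at most `k` are bounded by multiples of the weight. -/
structure IsTame (W : ℕ → ℝ) (R : Set Plane) (k : ℕ) (C : ℝ) (f : Plane → ℝ) : Prop where
  contDiffAt : ∀ x ∈ R, ContDiffAt ℝ k f x
  le : ∀ x ∈ R, ∀ j ≤ k, ‖iteratedFDeriv ℝ j f x‖ ≤ C * W j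

namespace IsTame

variable {C₀ C C' : ℝ} {W : ℕ → ℝ} {R : Set Plane} {k : ℕ} {f g : Plane → ℝ}

lemma mono_const (hW : IsWeight k C₀ W) (hf : IsTame W R k C f) (h : C ≤ C') : IsTame W R k C' f :=
  ⟨hf.contDiffAt, fun x hx j hj => (hf.le x hx j hj).trans
    (mul_le_mul_of_nonneg_right h (hW.pos j).le)⟩

lemma mono_set (hf : IsTame W R k C f) {R' : Set Plane} (h : R' ⊆ R) : IsTame W R' k C f :=
  ⟨fun x hx => hf.contDiffAt x (h hx), fun x hx => hf.le x (h hx)⟩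

lemma congr (hf : IsTame W R k C f) (h : ∀ x ∈ R, g =ᶠ[𝓝 x] f) : IsTame W R k C g :=
  ⟨fun x hx => (hf.contDiffAt x hx).congr_of_eventuallyEq (h x hx), fun x hx j hj => by
    rw [(h x hx).iteratedFDeriv ℝ j |>.eq_of_nhds]; exact hf.le x hx j hj⟩

lemma add (hf : IsTame W R k C f) (hg : IsTame W R k C' g) :
    IsTame W R k (C + C') fun x => f x + g x := by
  refine ⟨fun x hx => (hf.contDiffAt x hx).add (hg.contDiffAt x hx), fun x hx j hj => ?_⟩
  have hj' : (j : WithTop ℕ∞) ≤ k := by exact_mod_cast hj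
  rw [fun_iteratedFDeriv_add_apply ((hf.contDiffAt x hx).of_le hj')
    ((hg.contDiffAt x hx).of_le hj'), add_mul]
  exact (norm_add_le _ _).trans (add_le_add (hf.le x hx j hj) (hg.le x hx j hj))

lemma neg (hf : IsTame W R k C f) : IsTame W R k C fun x => - f x := by
  refine ⟨fun x hx => (hf.contDiffAt x hx).neg, fun x hx j hj => ?_⟩
  have : iteratedFDeriv ℝ j (fun x => - f x) x = - iteratedFDeriv ℝ j f x :=
    iteratedFDeriv_neg_apply
  rw [this, norm_neg]
  exact hf.le x hx j hj

lemma sub (hf : IsTame W R k C f) (hg : IsTame W R k C' g) :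
    IsTame W R k (C + C') fun x => f x - g x := by
  simpa only [sub_eq_add_neg] using hf.add hg.neg

lemma const_mul (hf : IsTame W R k C f) (a : ℝ) : IsTame W R k (|a| * C) fun x => a * f x := by
  refine ⟨fun x hx => contDiffAt_const.mul (hf.contDiffAt x hx), fun x hx j hj => ?_⟩
  have hj' : (j : WithTop ℕ∞) ≤ k := by exact_mod_cast hj
  have : iteratedFDeriv ℝ j (fun x => a * f x) x = a • iteratedFDeriv ℝ j f x :=
    iteratedFDeriv_const_mul_at a ((hf.contDiffAt x hx).of_le hj')
  rw [this, norm_smul, Real.norm_eq_abs, mul_assoc]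
  exact mul_le_mul_of_nonneg_left (hf.le x hx j hj) (abs_nonneg a)

lemma const_nonneg (hW : IsWeight k C₀ W) (hf : IsTame W R k C f) {x : Plane} (hx : x ∈ R) : 0 ≤ C :=
  nonneg_of_mul_nonneg_left ((norm_nonneg _).trans (hf.le x hx 0 (Nat.zero_le _))) (hW.pos 0)

lemma mul (hW : IsWeight k C₀ W) (hf : IsTame W R k C f) (hg : IsTame W R k C' g) :
    IsTame W R k (2 ^ k * (C * C' * C₀)) fun x => f x * g x := by
  refine ⟨fun x hx => (hf.contDiffAt x hx).mul (hg.contDiffAt x hx), fun x hx j hj => ?_⟩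
  have hj' : (j : WithTop ℕ∞) ≤ k := by exact_mod_cast hj
  have hC := hf.const_nonneg hW hx
  have hC' := hg.const_nonneg hW hx
  refine (norm_iteratedFDeriv_mul_le_at ((hf.contDiffAt x hx).of_le hj')
    ((hg.contDiffAt x hx).of_le hj')).trans ?_
  have hterm : ∀ i ∈ Finset.range (j + 1), (j.choose i : ℝ) * ‖iteratedFDeriv ℝ i f x‖ *
      ‖iteratedFDeriv ℝ (j - i) g x‖ ≤ (j.choose i : ℝ) * (C * C' * C₀ * W j) := by
    intro i hi
    rw [Finset.mem_range] at hi
    rw [mul_assoc]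
    refine mul_le_mul_of_nonneg_left ?_ (Nat.cast_nonneg _)
    have := hW.mul_mul_le (a := ‖iteratedFDeriv ℝ i f x‖) (b := ‖iteratedFDeriv ℝ (j - i) g x‖)
      (n := j) (by rw [abs_norm]; exact hf.le x hx i (by omega))
      (by rw [abs_norm]; exact hg.le x hx (j - i) (by omega)) hC (by omega) hj
    exact (le_abs_self _).trans this
  refine (Finset.sum_le_sum hterm).trans ?_
  rw [← Finset.sum_mul]
  have hs : ∑ i ∈ Finset.range (j + 1), (j.choose i : ℝ) = 2 ^ j := by
    exact_mod_cast Nat.sum_range_choose j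
  rw [hs]
  have h2 : (2 : ℝ) ^ j ≤ 2 ^ k := pow_le_pow_right₀ (by norm_num) hj
  have h0 : 0 ≤ C * C' * C₀ * W j :=
    mul_nonneg (mul_nonneg (mul_nonneg hC hC') hW.const_pos.le) (hW.pos j).le
  calc _ ≤ 2 ^ k * (C * C' * C₀ * W j) := mul_le_mul_of_nonneg_right h2 h0
    _ = _ := by ring

end IsTame

/-- Quotients of tame functions are tame. The constant does not depend on the functions. -/
lemma exists_tame_div (k : ℕ) {C₀ C c : ℝ} (hc : 0 < c) : ∃ C', ∀ {W : ℕ → ℝ} {R : Set Plane}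
    {f r : Plane → ℝ}, IsWeight k C₀ W → IsTame W R k C f → IsTame W R k C r → (∀ x ∈ R, c ≤ r x) →
    IsTame W R k C' fun x => f x / r x := by
  suffices h : ∀ n, n ≤ k → ∃ C', 0 ≤ C' ∧ ∀ {W : ℕ → ℝ} {R : Set Plane}
      {f r : Plane → ℝ}, IsWeight k C₀ W → IsTame W R k C f → IsTame W R k C r →
      (∀ x ∈ R, c ≤ r x) → ∀ x ∈ R, ∀ j ≤ n,
      ‖iteratedFDeriv ℝ j (fun x => f x / r x) x‖ ≤ C' * W j by
    obtain ⟨C', _, hC'⟩ := h k le_rfl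
    refine ⟨C', fun hW hf hr hrc => ⟨fun x hx => ?_, hC' hW hf hr hrc⟩⟩
    exact (hf.contDiffAt x hx).div (hr.contDiffAt x hx) (hc.trans_le (hrc x hx)).ne'
  intro n
  induction n with
  | zero =>
    intro _
    refine ⟨|C| / c, by positivity, fun {W R f r} hW hf hr hrc x hx j hj => ?_⟩
    obtain rfl : j = 0 := by omega
    have h := hf.le x hx 0 (by omega)
    rw [norm_iteratedFDeriv_zero] at h ⊢
    rw [norm_div, div_mul_eq_mul_div]
    have h2 : c ≤ ‖r x‖ := (hrc x hx).trans (Real.le_norm_self _)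
    have hW0 := hW.pos 0
    gcongr
    exact h.trans (by gcongr; exact le_abs_self C)
  | succ n ih =>
    intro hn
    obtain ⟨C', hC'0, hC'⟩ := ih (by omega)
    set B := (|C| + 2 ^ (n + 1) * (C' * |C| * |C₀|)) / c with hB
    have hB0 : 0 ≤ B := by positivity
    refine ⟨max C' B, le_max_of_le_left hC'0, fun {W R f r} hW hf hr hrc x hx j hj => ?_⟩
    rcases Nat.lt_or_ge j (n + 1) with hlt | hge
    · exact (hC' hW hf hr hrc x hx j (by omega)).trans
        (mul_le_mul_of_nonneg_right (le_max_left _ _) (hW.pos j).le)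
    obtain rfl : j = n + 1 := by omega
    set q := fun x => f x / r x with hq
    have hle : ((n + 1 : ℕ) : WithTop ℕ∞) ≤ k := by exact_mod_cast hn
    have hfx := (hf.contDiffAt x hx).of_le hle
    have hrx := (hr.contDiffAt x hx).of_le hle
    have hr0 : r x ≠ 0 := (hc.trans_le (hrc x hx)).ne'
    have hqx : ContDiffAt ℝ (n + 1 : ℕ) q x := hfx.div hrx hr0
    have hev : (fun y => (r y - r x) * q y) =ᶠ[𝓝 x] fun y => f y - r x * q y := by
      have : ∀ᶠ y in 𝓝 x, r y ≠ 0 := hrx.continuousAt.eventually_ne hr0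
      filter_upwards [this] with y hy
      simp only [hq]; field_simp
    -- freezing the coefficient at `x` removes the derivative of top order from the right hand side
    have hid : r x • iteratedFDeriv ℝ (n + 1) q x = iteratedFDeriv ℝ (n + 1) f x -
        iteratedFDeriv ℝ (n + 1) (fun y => (r y - r x) * q y) x := by
      have h1 : iteratedFDeriv ℝ (n + 1) (fun y => r x * q y) x =
          r x • iteratedFDeriv ℝ (n + 1) q x := iteratedFDeriv_const_mul_at (r x) hqx
      rw [(hev.iteratedFDeriv ℝ (n + 1)).eq_of_nhds,
        fun_iteratedFDeriv_sub_apply hfx (contDiffAt_const.mul hqx), h1]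
      abel
    have hprod : ‖iteratedFDeriv ℝ (n + 1) (fun y => (r y - r x) * q y) x‖ ≤
        2 ^ (n + 1) * (C' * |C| * |C₀| * W (n + 1)) := by
      refine (norm_iteratedFDeriv_mul_le_at (hrx.sub contDiffAt_const) hqx).trans ?_
      have hs : ∑ i ∈ Finset.range (n + 1 + 1), ((n + 1).choose i : ℝ) = 2 ^ (n + 1) := by
        exact_mod_cast Nat.sum_range_choose (n + 1)
      rw [← hs, Finset.sum_mul]
      refine Finset.sum_le_sum fun i hi => ?_
      rw [Finset.mem_range] at hi
      rw [mul_assoc]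
      refine mul_le_mul_of_nonneg_left ?_ (Nat.cast_nonneg _)
      have hWn := (hW.pos (n + 1)).le
      rcases Nat.eq_zero_or_pos i with rfl | hi0
      · rw [norm_iteratedFDeriv_zero, sub_self, norm_zero, zero_mul]
        positivity
      · have h1 : iteratedFDeriv ℝ i (fun y => r y - r x) x = iteratedFDeriv ℝ i r x := by
          rw [fun_iteratedFDeriv_sub_apply (hrx.of_le (by norm_cast; omega)) contDiffAt_const,
            iteratedFDeriv_const_of_ne (by omega)]
          simp
        rw [h1]
        have h2 := hr.le x hx i (by omega)
        have h3 := hC' hW hf hr hrc x hx (n + 1 - i) (by omega)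
        have h4 := hW.mul_mul_le (a := ‖iteratedFDeriv ℝ (n + 1 - i) q x‖)
          (b := ‖iteratedFDeriv ℝ i r x‖) (n := n + 1) (B := |C|) (by rwa [abs_norm])
          (by rw [abs_norm]; exact h2.trans
                (mul_le_mul_of_nonneg_right (le_abs_self C) (hW.pos i).le)) hC'0 (by omega) hn
        rw [mul_comm]
        refine ((le_abs_self _).trans h4).trans ?_
        gcongr
        exact le_abs_self C₀
    have hf1 := hf.le x hx (n + 1) hn
    have hWn := hW.pos (n + 1)
    have hkey : c * ‖iteratedFDeriv ℝ (n + 1) q x‖ ≤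
        (|C| + 2 ^ (n + 1) * (C' * |C| * |C₀|)) * W (n + 1) := by
      calc c * ‖iteratedFDeriv ℝ (n + 1) q x‖
          ≤ ‖r x‖ * ‖iteratedFDeriv ℝ (n + 1) q x‖ := by
            gcongr; exact (hrc x hx).trans (Real.le_norm_self _)
        _ = ‖r x • iteratedFDeriv ℝ (n + 1) q x‖ := (norm_smul _ _).symm
        _ ≤ _ := by
            rw [hid]
            refine (norm_sub_le _ _).trans ?_
            have : C * W (n + 1) ≤ |C| * W (n + 1) := by gcongr; exact le_abs_self C
            linarith
    have : ‖iteratedFDeriv ℝ (n + 1) q x‖ ≤ B * W (n + 1) := by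
      rw [hB, div_mul_eq_mul_div, le_div_iff₀ hc, mul_comm]
      exact hkey
    exact this.trans (mul_le_mul_of_nonneg_right (le_max_right _ _) hWn.le)

/-! ### Derivatives of the first integral -/

/-- Gronwall's inequality on an interval around `0` of length at most `2`. -/
lemma abs_le_of_abs_deriv_le {u u' : ℝ → ℝ} {K δ ε ρ : ℝ} (hu : ∀ t, HasDerivAt u (u' t) t)
    (hK : 1 ≤ K) (hε : 0 ≤ ε) (hρ : ρ ≤ 1) (h0 : |u 0| ≤ δ)
    (hb : ∀ t, |t| < ρ → |u' t| ≤ K * |u t| + ε) {t : ℝ} (ht : |t| < ρ) :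
    |u t| ≤ (δ + ε) * Real.exp K := by
  have key : ∀ {v v' : ℝ → ℝ}, (∀ t, HasDerivAt v (v' t) t) → |v 0| ≤ δ →
      (∀ t, |t| < ρ → |v' t| ≤ K * |v t| + ε) → ∀ t, 0 ≤ t → t < ρ →
      |v t| ≤ (δ + ε) * Real.exp K := by
    intro v v' hv hv0 hvb t ht0 htρ
    have h := norm_le_gronwallBound_of_norm_deriv_right_le (f := v) (f' := v') (δ := δ) (K := K)
      (ε := ε) (a := 0) (b := t) (fun x _ => (hv x).continuousAt.continuousWithinAt)
      (fun x _ => (hv x).hasDerivWithinAt) hv0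
      (fun x hx => hvb x (by rw [abs_of_nonneg hx.1]; linarith [hx.2])) t ⟨ht0, le_rfl⟩
    rw [gronwallBound_of_K_ne_0 (by linarith), sub_zero] at h
    have hδ : 0 ≤ δ := (abs_nonneg _).trans hv0
    have he : Real.exp (K * t) ≤ Real.exp K := Real.exp_le_exp.2 (by nlinarith)
    have h1 : 1 ≤ Real.exp (K * t) := Real.one_le_exp (by positivity)
    have h2 : ε / K ≤ ε := div_le_self hε hK
    have h3 : ε / K * (Real.exp (K * t) - 1) ≤ ε * Real.exp K := by
      have : 0 ≤ Real.exp (K * t) - 1 := by linarith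
      calc _ ≤ ε * (Real.exp (K * t) - 1) := by gcongr
        _ ≤ ε * Real.exp K := by gcongr; linarith
    calc |v t| ≤ _ := h
      _ ≤ δ * Real.exp K + ε * Real.exp K := add_le_add (by gcongr) h3
      _ = _ := by ring
  rcases le_total 0 t with h | h
  · exact key hu h0 hb t h (by rwa [abs_of_nonneg h] at ht)
  · have := key (v := fun τ => u (-τ)) (v' := fun τ => -u' (-τ))
      (fun τ => by simpa [Function.comp_def] using (hu (-τ)).comp τ (hasDerivAt_neg τ)) (by simpa using h0)
      (fun τ hτ => by rw [abs_neg]; exact hb _ (by rwa [abs_neg])) (-t) (by linarith)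
      (by rwa [abs_of_nonpos h] at ht)
    simpa using this

namespace IsSmallSlope

variable {k : ℕ} {η : ℝ} {b : Plane → ℝ}

/-- The part of the strip `|x²| < ρ` covered by the integral curves which start at `|s| < ρ`. -/
def box (hb : IsSmallSlope k η b) (ρ : ℝ) : Set Plane := {x | |hb.firstIntegral x| < ρ ∧ |x 1| < ρ}

lemma flowMap_mem_box (hb : IsSmallSlope k η b) {ρ s t : ℝ} (hs : |s| < ρ) (ht : |t| < ρ) :
    hb.flowMap (pt s t) ∈ hb.box ρ :=
  ⟨by rwa [firstIntegral_flowMap, pt_zero], ht⟩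

lemma norm_iterate_pd_le {f : Plane → ℝ} {j : ℕ} (hf : ContDiff ℝ j f) (x : Plane) :
    |(pd 0)^[j] f x| ≤ ‖iteratedFDeriv ℝ j f x‖ := by
  have := norm_iteratedFDeriv_iterate_pd_le (n := 0) 0 (by rwa [zero_add]) x (j := j) (f := f)
  rwa [norm_iteratedFDeriv_zero, zero_add] at this

/-- Commuting `∂₁ⁿ` with the equation `∂₂F + b ∂₁F = 0`. -/
lemma pd_one_iterate_firstIntegral (hb : IsSmallSlope k η b) {n : ℕ} (hn : n + 1 ≤ k) (x : Plane) :
    pd 1 ((pd 0)^[n] hb.firstIntegral) x = - ∑ j ∈ Finset.range (n + 1),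
      (n.choose j : ℝ) * (pd 0)^[j] b x * (pd 0)^[n - j + 1] hb.firstIntegral x := by
  have hF : ContDiff ℝ (n + 1 : ℕ) hb.firstIntegral :=
    hb.contDiff_firstIntegral.of_le (by exact_mod_cast hn)
  have hb' : ContDiff ℝ n b := hb.contDiff.of_le (by exact_mod_cast (by omega : n ≤ k))
  have hF0 : ContDiff ℝ n (pd 0 hb.firstIntegral) := hF.pd (by norm_cast) 0
  rw [iterate_pd_comm hF]
  have h1 : pd 1 hb.firstIntegral = fun x => (- b x) * pd 0 hb.firstIntegral x := by
    ext y; rw [hb.pd_one_firstIntegral]; ring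
  rw [h1, iterate_pd_mul hb'.neg hF0, ← Finset.sum_neg_distrib]
  refine Finset.sum_congr rfl fun j hj => ?_
  have hneg : ∀ (i : ℕ) (f : Plane → ℝ), (pd 0)^[i] (fun x => - f x) = fun x => - (pd 0)^[i] f x := by
    intro i
    induction i with
    | zero => intro f; rfl
    | succ i ih =>
      intro f
      have : pd 0 (fun x => - f x) = fun x => - pd 0 f x := by ext y; exact pd_neg 0
      rw [Function.iterate_succ_apply, this, ih, Function.iterate_succ_apply]
  rw [hneg, Function.iterate_succ_apply]
  ring

/-- On the line `x² = 0`, where `F(s, 0) = s`, the derivatives `∂₁ⁿF` are `0` or `1`. -/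
lemma iterate_firstIntegral_zero (hb : IsSmallSlope k η b) {n : ℕ} (hn1 : 1 ≤ n) (hn : n ≤ k)
    (s : ℝ) : |(pd 0)^[n] hb.firstIntegral (pt s 0)| ≤ 1 := by
  rw [iterate_pd_eq_iteratedDeriv (hb.contDiff_firstIntegral.of_le (by exact_mod_cast hn))]
  simp only [firstIntegral_zero]
  obtain ⟨m, rfl⟩ : ∃ m, n = m + 1 := ⟨n - 1, by omega⟩
  rw [iteratedDeriv_succ']
  simp only [deriv_id'']
  rw [iteratedDeriv_const]
  split_ifs <;> simp

/-- The pure derivatives `∂₁ᵐF` of the first integral inherit the bounds for `b`: they solve linear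
equations along the integral curves, in which the product of two derivatives of intermediate order
is controlled by the property of the weight. -/
lemma exists_bound_iterate_firstIntegral (k : ℕ) (C₀ C : ℝ) : ∃ C', 0 ≤ C' ∧
    ∀ {W : ℕ → ℝ} {η ρ : ℝ} {b : Plane → ℝ} (hb : IsSmallSlope k η b), IsWeight k C₀ W → ρ ≤ 1 →
    IsTame W (hb.box ρ) k C b → ∀ x ∈ hb.box ρ, ∀ j, 1 ≤ j → j ≤ k →
    |(pd 0)^[j] hb.firstIntegral x| ≤ C' * W j := by
  suffices h : ∀ n, n ≤ k → ∃ C', 0 ≤ C' ∧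
      ∀ {W : ℕ → ℝ} {η ρ : ℝ} {b : Plane → ℝ} (hb : IsSmallSlope k η b), IsWeight k C₀ W → ρ ≤ 1 →
      IsTame W (hb.box ρ) k C b → ∀ x ∈ hb.box ρ, ∀ j, 1 ≤ j → j ≤ n →
      |(pd 0)^[j] hb.firstIntegral x| ≤ C' * W j from h k le_rfl
  intro n
  induction n with
  | zero => exact fun _ => ⟨0, le_rfl, fun _ _ _ _ x _ j h1 h2 => absurd (h1.trans h2) (by norm_num)⟩
  | succ n ih =>
    intro hn
    obtain ⟨C', hC'0, hC'⟩ := ih (by omega)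
    set A := |C| * C' * |C₀| with hA
    have hA0 : 0 ≤ A := by positivity
    set K : ℝ := 2 ^ n with hK
    have hK1 : 1 ≤ K := one_le_pow₀ (by norm_num)
    -- the factor `2` allows for the lower bound `1/2` of `∂φ/∂s` for the flow `φ`
    set B := 2 * ((1 + K * (4 * A)) * Real.exp K) with hB
    have hB0 : 0 ≤ B := by positivity
    refine ⟨max C' B, le_max_of_le_left hC'0, fun {W η ρ b} hb hW hρ hbt x hx j hj1 hj => ?_⟩
    have hWn := hW.pos (n + 1)
    rcases Nat.lt_or_ge j (n + 1) with hlt | hge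
    · exact (hC' hb hW hρ hbt x hx j hj1 (by omega)).trans
        (mul_le_mul_of_nonneg_right (le_max_left _ _) (hW.pos j).le)
    obtain rfl : j = n + 1 := by omega
    refine le_trans ?_ (mul_le_mul_of_nonneg_right (le_max_right _ _) hWn.le)
    have hbj : ∀ y ∈ hb.box ρ, ∀ j ≤ k, |(pd 0)^[j] b y| ≤ |C| * W j := fun y hy j hj =>
      ((norm_iterate_pd_le (hb.contDiff.of_le (by exact_mod_cast hj)) y).trans
        (hbt.le y hy j hj)).trans (mul_le_mul_of_nonneg_right (le_abs_self C) (hW.pos j).le)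
    set F := hb.firstIntegral with hF
    set G := (pd 0)^[n] F with hG
    have hGn : ContDiff ℝ 1 G := by
      have := contDiff_iterate_pd (m := 1) (n := n) (f := F) 0
        (hb.contDiff_firstIntegral.of_le (by norm_cast; omega))
      exact_mod_cast this
    have hDb : ∀ j, j + 1 ≤ k → ContDiff ℝ 1 ((pd 0)^[j] b) := fun j hj => by
      have := contDiff_iterate_pd (m := 1) (n := j) (f := b) 0
        (hb.contDiff.of_le (by norm_cast; omega))
      exact_mod_cast this
    have hDF : ∀ j, j + 1 ≤ k → ContDiff ℝ 1 ((pd 0)^[j] F) := fun j hj => by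
      have := contDiff_iterate_pd (m := 1) (n := j) (f := F) 0
        (hb.contDiff_firstIntegral.of_le (by norm_cast; omega))
      exact_mod_cast this
    -- the derivative of `G = ∂₁ⁿF` along the field `∂₂ + b ∂₁`; it contains at most `n`
    -- derivatives `∂₁` of `F`
    let T : Plane → ℝ := fun y => ∑ j ∈ Finset.range n,
      (-(n.choose (j + 1) : ℝ)) * ((pd 0)^[j + 1] b y * (pd 0)^[n - j] F y)
    have hT : ContDiff ℝ 1 T := by
      refine ContDiff.sum fun j hj => ?_
      rw [Finset.mem_range] at hj
      exact contDiff_const.mul ((hDb _ (by omega)).mul (hDF _ (by omega)))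
    have hGT : ∀ y, pd 1 G y + b y * pd 0 G y = T y := by
      intro y
      rw [hG, hF, hb.pd_one_iterate_firstIntegral hn, Finset.sum_range_succ', ← hF]
      simp only [Nat.choose_zero_right, Nat.cast_one, one_mul, Function.iterate_zero, id, T,
        Nat.sub_zero, neg_mul, Finset.sum_neg_distrib]
      have : ∑ j ∈ Finset.range n, (n.choose (j + 1) : ℝ) * (pd 0)^[j + 1] b y *
          (pd 0)^[n - (j + 1) + 1] F y = ∑ j ∈ Finset.range n, (n.choose (j + 1) : ℝ) *
          ((pd 0)^[j + 1] b y * (pd 0)^[n - j] F y) := by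
        refine Finset.sum_congr rfl fun j hj => ?_
        rw [Finset.mem_range] at hj
        rw [show n - (j + 1) + 1 = n - j by omega, mul_assoc]
      rw [this, Function.iterate_succ_apply' (pd 0) n]
      ring
    have hpdT : ∀ y ∈ hb.box ρ, |pd 0 T y| ≤ K * (2 * A * W (n + 1) + |pd 0 G y|) := by
      intro y hy
      have h1 : pd 0 T y = ∑ j ∈ Finset.range n, (-(n.choose (j + 1) : ℝ)) *
          ((pd 0)^[j + 2] b y * (pd 0)^[n - j] F y +
            (pd 0)^[j + 1] b y * (pd 0)^[n - j + 1] F y) := by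
        rw [pd_sum]
        · refine Finset.sum_congr rfl fun j hj => ?_
          rw [Finset.mem_range] at hj
          have d1 := (hDb (j + 1) (by omega)).differentiable (by norm_num) y
          have d2 := (hDF (n - j) (by omega)).differentiable (by norm_num) y
          have d3 : DifferentiableAt ℝ
              (fun y => (pd 0)^[j + 1] b y * (pd 0)^[n - j] F y) y := d1.mul d2
          rw [pd_const_mul _ d3, pd_mul d1 d2, ← Function.iterate_succ_apply' (pd 0),
            ← Function.iterate_succ_apply' (pd 0)]
        · intro j hj
          rw [Finset.mem_range] at hj
          have d1 := (hDb (j + 1) (by omega)).differentiable (by norm_num) y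
          have d2 := (hDF (n - j) (by omega)).differentiable (by norm_num) y
          exact (d1.mul d2).const_mul _
      rw [h1]
      refine (Finset.abs_sum_le_sum_abs _ _).trans ?_
      have hterm : ∀ j ∈ Finset.range n, |(-(n.choose (j + 1) : ℝ)) *
          ((pd 0)^[j + 2] b y * (pd 0)^[n - j] F y +
            (pd 0)^[j + 1] b y * (pd 0)^[n - j + 1] F y)| ≤
          (n.choose (j + 1) : ℝ) * (2 * A * W (n + 1) + |pd 0 G y|) := by
        intro j hj
        rw [Finset.mem_range] at hj
        rw [abs_mul, abs_neg, Nat.abs_cast]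
        refine mul_le_mul_of_nonneg_left ?_ (Nat.cast_nonneg _)
        refine (abs_add_le _ _).trans ?_
        have hAC : |C| * C' * C₀ * W (n + 1) ≤ A * W (n + 1) := by
          rw [hA]; gcongr; exact le_abs_self C₀
        have ha : |(pd 0)^[j + 2] b y * (pd 0)^[n - j] F y| ≤ A * W (n + 1) :=
          (hW.mul_mul_le' (hbj y hy (j + 2) (by omega))
            (hC' hb hW hρ hbt y hy (n - j) (by omega) (by omega)) (abs_nonneg C) (by omega)
            (by omega) (by omega) hn).trans hAC
        have hb2 : |(pd 0)^[j + 1] b y * (pd 0)^[n - j + 1] F y| ≤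
            A * W (n + 1) + |pd 0 G y| := by
          rcases Nat.eq_zero_or_pos j with rfl | hj0
          -- the derivative of order `n + 1` of `F` occurs only with the bounded factor `∂₁b`, so
          -- that it enters Gronwall's inequality linearly
          · have hG1 : (pd 0)^[n - 0 + 1] F y = pd 0 G y := by
              rw [Nat.sub_zero, Function.iterate_succ_apply']
            rw [hG1, abs_mul]
            have hb1 : |(pd 0)^[0 + 1] b y| ≤ 1 :=
              (hb.abs_pd_le y).trans (hb.small.trans (by norm_num))
            have := mul_le_mul_of_nonneg_right hb1 (abs_nonneg (pd 0 G y))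
            have := mul_nonneg hA0 hWn.le
            linarith
          · have := (hW.mul_mul_le' (n := n + 1) (hbj y hy (j + 1) (by omega))
              (hC' hb hW hρ hbt y hy (n - j + 1) (by omega) (by omega)) (abs_nonneg C) (by omega)
              (by omega) (by omega) hn).trans hAC
            linarith [abs_nonneg (pd 0 G y)]
        linarith
      refine (Finset.sum_le_sum hterm).trans ?_
      rw [← Finset.sum_mul]
      refine mul_le_mul_of_nonneg_right ?_ (by positivity)
      have hs : ∑ j ∈ Finset.range (n + 1), (n.choose j : ℝ) = 2 ^ n := by
        exact_mod_cast Nat.sum_range_choose n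
      rw [Finset.sum_range_succ'] at hs
      rw [hK, ← hs]
      simp
    obtain ⟨s, t, rfl⟩ : ∃ s t, x = hb.flowMap (pt s t) :=
      ⟨_, _, (hb.flowMap_firstIntegral x).symm⟩
    have hst : |s| < ρ ∧ |t| < ρ := by
      have := hx
      simp only [box, mem_ofPred_eq, firstIntegral_flowMap, flowMap_one, pt_zero, pt_one] at this
      exact this
    have hgr := abs_le_of_abs_deriv_le (δ := W (n + 1)) (ε := K * (4 * A * W (n + 1))) (ρ := ρ)
      (hb.hasDerivAt_pd_along_flow hGn hT hGT s) hK1 (by positivity) hρ ?_ ?_ hst.2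
    · have hE := (hb.flowDeriv_mem (pt s t)).1
      rw [abs_mul, abs_of_pos (hb.flowDeriv_pos _)] at hgr
      rw [Function.iterate_succ_apply', ← hG]
      have h0 := abs_nonneg (pd 0 G (hb.flowMap (pt s t)))
      have : |pd 0 G (hb.flowMap (pt s t))| ≤
          2 * (|pd 0 G (hb.flowMap (pt s t))| * hb.flowDeriv (pt s t)) := by nlinarith
      refine this.trans ((mul_le_mul_of_nonneg_left hgr zero_le_two).trans (le_of_eq ?_))
      rw [hB]; ring
    · have h0 : hb.flowDeriv (pt s 0) = 1 := by simp [flowDeriv]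
      have h1 : hb.flowMap (pt s 0) = pt s 0 := by rw [flowMap, flow_zero, pt_one]
      rw [h0, h1, mul_one, hG, ← Function.iterate_succ_apply' (pd 0)]
      exact (hb.iterate_firstIntegral_zero (by omega) hn s).trans (hW.one_le _)
    · intro τ hτ
      have hE := hb.flowDeriv_mem (pt s τ)
      have hE0 := hb.flowDeriv_pos (pt s τ)
      rw [abs_mul, abs_mul, abs_of_pos hE0]
      have h1 := hpdT _ (hb.flowMap_mem_box hst.1 hτ)
      calc _ ≤ K * (2 * A * W (n + 1) + |pd 0 G (hb.flowMap (pt s τ))|) *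
            hb.flowDeriv (pt s τ) := mul_le_mul_of_nonneg_right h1 hE0.le
        _ = K * (|pd 0 G (hb.flowMap (pt s τ))| * hb.flowDeriv (pt s τ)) +
            K * (2 * A * W (n + 1)) * hb.flowDeriv (pt s τ) := by ring
        _ ≤ K * (|pd 0 G (hb.flowMap (pt s τ))| * hb.flowDeriv (pt s τ)) +
            K * (2 * A * W (n + 1)) * 2 := by
            have := mul_le_mul_of_nonneg_left hE.2 (by positivity : 0 ≤ K * (2 * A * W (n + 1)))
            linarith
        _ = _ := by ring

/-- The first integral is tame, with a constant depending only on that of `b`. -/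
lemma exists_tame_firstIntegral (k : ℕ) (C₀ C : ℝ) : ∃ C',
    ∀ {W : ℕ → ℝ} {η ρ : ℝ} {b : Plane → ℝ} (hb : IsSmallSlope k η b), IsWeight k C₀ W → ρ ≤ 1 →
    IsTame W (hb.box ρ) k C b → IsTame W (hb.box ρ) k C' hb.firstIntegral := by
  obtain ⟨C₁, hC₁0, hC₁⟩ := exists_bound_iterate_firstIntegral k C₀ C
  -- bounds for the derivatives of order `n` of the functions `∂₁ᵃF`
  have hn : ∀ n : ℕ, ∃ C', 0 ≤ C' ∧
      ∀ {W : ℕ → ℝ} {η ρ : ℝ} {b : Plane → ℝ} (hb : IsSmallSlope k η b), IsWeight k C₀ W → ρ ≤ 1 →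
      IsTame W (hb.box ρ) k C b → ∀ x ∈ hb.box ρ, ∀ a m, 1 ≤ a → m ≤ n → m + a ≤ k →
      ‖iteratedFDeriv ℝ m ((pd 0)^[a] hb.firstIntegral) x‖ ≤ C' * W (m + a) := by
    intro n
    induction n with
    | zero =>
      refine ⟨C₁, hC₁0, fun {W η ρ b} hb hW hρ hbt x hx a m ha hm hmk => ?_⟩
      obtain rfl : m = 0 := by omega
      rw [norm_iteratedFDeriv_zero, zero_add]
      exact hC₁ hb hW hρ hbt x hx a ha (by omega)
    | succ n ih =>
      obtain ⟨C', hC'0, hC'⟩ := ih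
      set B := C' + 2 ^ k * (2 ^ k * (|C| * C' * |C₀|)) with hB
      have hBC : C' ≤ B := le_add_of_nonneg_right (by positivity)
      refine ⟨B, by positivity, fun {W η ρ b} hb hW hρ hbt x hx a m ha hm hmk => ?_⟩
      have hWm := hW.pos (m + a)
      rcases Nat.lt_or_ge m (n + 1) with hlt | hge
      · exact (hC' hb hW hρ hbt x hx a m ha (by omega) hmk).trans
          (mul_le_mul_of_nonneg_right hBC hWm.le)
      obtain rfl : m = n + 1 := by omega
      set F := hb.firstIntegral with hF
      have hFa : ∀ a m, m + a ≤ k → ContDiff ℝ m ((pd 0)^[a] F) := fun a m h =>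
        contDiff_iterate_pd 0 (hb.contDiff_firstIntegral.of_le (by exact_mod_cast h))
      have hba : ∀ a m, m + a ≤ k → ContDiff ℝ m ((pd 0)^[a] b) := fun a m h =>
        contDiff_iterate_pd 0 (hb.contDiff.of_le (by exact_mod_cast h))
      refine (norm_iteratedFDeriv_succ_le (hFa a (n + 1) hmk).contDiffAt).trans ?_
      rw [hB, add_mul]
      refine add_le_add ?_ ?_
      · rw [← Function.iterate_succ_apply' (pd 0)]
        have := hC' hb hW hρ hbt x hx (a + 1) n (by omega) le_rfl (by omega)
        rwa [show n + (a + 1) = n + 1 + a by omega] at this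
      -- a derivative `∂₂` of `∂₁ᵃF` is expressed by derivatives `∂₁` of `b` and `F`
      · have h1 : pd 1 ((pd 0)^[a] F) = fun x => ∑ j ∈ Finset.range (a + 1),
            (-(a.choose j : ℝ)) * ((pd 0)^[j] b x * (pd 0)^[a - j + 1] F x) := by
          ext y
          rw [hF, hb.pd_one_iterate_firstIntegral (by omega), ← Finset.sum_neg_distrib]
          exact Finset.sum_congr rfl fun j _ => by ring
        have hpr : ∀ j ∈ Finset.range (a + 1), ContDiffAt ℝ n
            (fun x => (pd 0)^[j] b x * (pd 0)^[a - j + 1] F x) x := fun j hj => by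
          rw [Finset.mem_range] at hj
          exact ((hba j n (by omega)).mul (hFa (a - j + 1) n (by omega))).contDiffAt
        rw [h1, iteratedFDeriv_fun_sum_apply fun j hj => contDiffAt_const.mul (hpr j hj)]
        refine (norm_sum_le _ _).trans ?_
        have hterm : ∀ j ∈ Finset.range (a + 1), ‖iteratedFDeriv ℝ n (fun x =>
            (-(a.choose j : ℝ)) * ((pd 0)^[j] b x * (pd 0)^[a - j + 1] F x)) x‖ ≤
            (a.choose j : ℝ) * (2 ^ k * (|C| * C' * |C₀|) * W (n + 1 + a)) := by
          intro j hj
          rw [iteratedFDeriv_const_mul_at _ (hpr j hj), norm_smul, norm_neg, RCLike.norm_natCast]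
          refine mul_le_mul_of_nonneg_left ?_ (Nat.cast_nonneg _)
          rw [Finset.mem_range] at hj
          refine (norm_iteratedFDeriv_mul_le_at (hba j n (by omega)).contDiffAt
            (hFa (a - j + 1) n (by omega)).contDiffAt).trans ?_
          have hs : ∑ i ∈ Finset.range (n + 1), (n.choose i : ℝ) = 2 ^ n := by
            exact_mod_cast Nat.sum_range_choose n
          have ht : ∀ i ∈ Finset.range (n + 1), (n.choose i : ℝ) *
              ‖iteratedFDeriv ℝ i ((pd 0)^[j] b) x‖ *
              ‖iteratedFDeriv ℝ (n - i) ((pd 0)^[a - j + 1] F) x‖ ≤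
              (n.choose i : ℝ) * (|C| * C' * |C₀| * W (n + 1 + a)) := by
            intro i hi
            rw [Finset.mem_range] at hi
            rw [mul_assoc]
            refine mul_le_mul_of_nonneg_left ?_ (Nat.cast_nonneg _)
            have h2 : ‖iteratedFDeriv ℝ i ((pd 0)^[j] b) x‖ ≤ |C| * W (i + j) :=
              ((norm_iteratedFDeriv_iterate_pd_le 0
                (hb.contDiff.of_le (by norm_cast; omega)) x).trans
                (hbt.le x hx (i + j) (by omega))).trans
                (mul_le_mul_of_nonneg_right (le_abs_self C) (hW.pos _).le)
            have h3 := hC' hb hW hρ hbt x hx (a - j + 1) (n - i) (by omega) (by omega) (by omega)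
            have h4 := hW.mul_mul_le (a := ‖iteratedFDeriv ℝ i ((pd 0)^[j] b) x‖)
              (b := ‖iteratedFDeriv ℝ (n - i) ((pd 0)^[a - j + 1] F) x‖) (n := n + 1 + a)
              (by rwa [abs_norm]) (by rwa [abs_norm]) (abs_nonneg C) (by omega) hmk
            refine ((le_abs_self _).trans h4).trans ?_
            gcongr
            exact le_abs_self C₀
          refine (Finset.sum_le_sum ht).trans ?_
          rw [← Finset.sum_mul, hs]
          have h2 : (2 : ℝ) ^ n ≤ 2 ^ k := pow_le_pow_right₀ (by norm_num) (by omega)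
          calc _ ≤ 2 ^ k * (|C| * C' * |C₀| * W (n + 1 + a)) :=
                mul_le_mul_of_nonneg_right h2 (by positivity)
            _ = _ := by ring
        refine (Finset.sum_le_sum hterm).trans ?_
        have hs : ∑ i ∈ Finset.range (a + 1), (a.choose i : ℝ) = 2 ^ a := by
          exact_mod_cast Nat.sum_range_choose a
        rw [← Finset.sum_mul, hs]
        have h2 : (2 : ℝ) ^ a ≤ 2 ^ k := pow_le_pow_right₀ (by norm_num) (by omega)
        calc _ ≤ 2 ^ k * (2 ^ k * (|C| * C' * |C₀|) * W (n + 1 + a)) :=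
              mul_le_mul_of_nonneg_right h2 (by positivity)
          _ = _ := by ring
  obtain ⟨C₂, hC₂0, hC₂⟩ := hn k
  set B := C₂ + 2 ^ k * (|C| * C₂ * |C₀|) with hB
  refine ⟨max 1 B, fun {W η ρ b} hb hW hρ hbt =>
    ⟨fun x _ => hb.contDiff_firstIntegral.contDiffAt, fun x hx j hj => ?_⟩⟩
  have hWj := hW.pos j
  rcases Nat.eq_zero_or_pos j with rfl | hj0
  · rw [norm_iteratedFDeriv_zero, Real.norm_eq_abs]
    have h1 := hW.one_le 0
    have h2 : (1 : ℝ) ≤ max 1 B := le_max_left _ _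
    nlinarith [hx.1]
  refine le_trans ?_ (mul_le_mul_of_nonneg_right (le_max_right _ _) hWj.le)
  obtain ⟨n, rfl⟩ : ∃ n, j = n + 1 := ⟨j - 1, by omega⟩
  have hFn : ContDiff ℝ (n + 1 : ℕ) hb.firstIntegral :=
    hb.contDiff_firstIntegral.of_le (by exact_mod_cast hj)
  have hbn : ContDiff ℝ n b := hb.contDiff.of_le (by norm_cast; omega)
  have hF0 : ContDiff ℝ n (pd 0 hb.firstIntegral) := hFn.pd (by norm_cast) 0
  refine (norm_iteratedFDeriv_succ_le hFn.contDiffAt).trans ?_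
  rw [hB, add_mul]
  refine add_le_add (hC₂ hb hW hρ hbt x hx 1 n le_rfl (by omega) hj) ?_
  have h1 : pd 1 hb.firstIntegral = fun x => (-1) * (b x * pd 0 hb.firstIntegral x) := by
    ext y; rw [hb.pd_one_firstIntegral]; ring
  rw [h1, iteratedFDeriv_const_mul_at _ (hbn.mul hF0).contDiffAt, norm_smul, norm_neg, norm_one,
    one_mul]
  refine (norm_iteratedFDeriv_mul_le_at hbn.contDiffAt hF0.contDiffAt).trans ?_
  have hs : ∑ i ∈ Finset.range (n + 1), (n.choose i : ℝ) = 2 ^ n := by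
    exact_mod_cast Nat.sum_range_choose n
  have ht : ∀ i ∈ Finset.range (n + 1), (n.choose i : ℝ) * ‖iteratedFDeriv ℝ i b x‖ *
      ‖iteratedFDeriv ℝ (n - i) (pd 0 hb.firstIntegral) x‖ ≤
      (n.choose i : ℝ) * (|C| * C₂ * |C₀| * W (n + 1)) := by
    intro i hi
    rw [Finset.mem_range] at hi
    rw [mul_assoc]
    refine mul_le_mul_of_nonneg_left ?_ (Nat.cast_nonneg _)
    have h3 := hC₂ hb hW hρ hbt x hx 1 (n - i) le_rfl (by omega) (by omega)
    have h4 := hW.mul_mul_le (a := ‖iteratedFDeriv ℝ i b x‖) (A := |C|) (i := i)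
      (b := ‖iteratedFDeriv ℝ (n - i) (pd 0 hb.firstIntegral) x‖) (n := n + 1)
      (by rw [abs_norm]; exact (hbt.le x hx i (by omega)).trans
            (mul_le_mul_of_nonneg_right (le_abs_self C) (hW.pos _).le))
      (by rw [abs_norm]; exact h3) (abs_nonneg C) (by omega) hj
    refine ((le_abs_self _).trans h4).trans ?_
    gcongr
    exact le_abs_self C₀
  refine (Finset.sum_le_sum ht).trans ?_
  rw [← Finset.sum_mul, hs]
  have h2 : (2 : ℝ) ^ n ≤ 2 ^ k := pow_le_pow_right₀ (by norm_num) (by omega)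
  calc _ ≤ 2 ^ k * (|C| * C₂ * |C₀| * W (n + 1)) :=
        mul_le_mul_of_nonneg_right h2 (by positivity)
    _ = _ := by ring

end IsSmallSlope

/-! ### Interpolation and embedding on the unit square -/

/-- The closed unit square around the origin, which lies in the unit disc. -/
def square : Set Plane := {x | |x 0| ≤ 1 / 2 ∧ |x 1| ≤ 1 / 2}

lemma square_subset_ball : square ⊆ Metric.ball 0 1 := by
  intro x hx
  rw [mem_ball_zero_iff]
  have h := norm_plane_sq x
  have h0 := abs_le.1 hx.1
  have h1 := abs_le.1 hx.2
  nlinarith [norm_nonneg x]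

lemma isCompact_square : IsCompact square := by
  refine (isCompact_closedBall (0 : Plane) 1).of_isClosed_subset ?_
    (square_subset_ball.trans Metric.ball_subset_closedBall)
  exact (isClosed_le (coord 0).continuous.abs continuous_const).inter
    (isClosed_le (coord 1).continuous.abs continuous_const)

section

variable {F : Type*} [NormedAddCommGroup F] [NormedSpace ℝ F]

/-- Landau's inequality for a partial derivative on the square. -/
lemma norm_pd_le_of_square {f : Plane → F} (hf : ContDiff ℝ 2 f) (i : Fin 2) {a c h : ℝ}
    (ha : ∀ x ∈ square, ‖f x‖ ≤ a) (hc : ∀ x ∈ square, ‖pd i (pd i f) x‖ ≤ c) (hh : 0 < h)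
    (hh2 : h ≤ 1 / 2) {x : Plane} (hx : x ∈ square) : ‖pd i f x‖ ≤ 2 * a / h + c * h := by
  -- a direction in which the segment of length `1/2` from `x` stays in the square
  obtain ⟨σ, hσ, hseg⟩ : ∃ σ : ℝ, |σ| = 1 ∧ ∀ τ ∈ Icc 0 h, x + (σ * τ) • e i ∈ square := by
    have hmem : ∀ σ : ℝ, (∀ τ ∈ Icc 0 h, |x i + σ * τ| ≤ 1 / 2) →
        ∀ τ ∈ Icc 0 h, x + (σ * τ) • e i ∈ square := by
      intro σ hσ τ hτ
      have := hσ τ hτ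
      fin_cases i
      · exact ⟨by simpa using this, by simpa using hx.2⟩
      · exact ⟨by simpa using hx.1, by simpa using this⟩
    have hxi : |x i| ≤ 1 / 2 := by fin_cases i; exacts [hx.1, hx.2]
    rw [abs_le] at hxi
    rcases le_total (x i) 0 with h0 | h0
    · refine ⟨1, by simp, hmem 1 fun τ hτ => abs_le.2 ⟨?_, ?_⟩⟩ <;> linarith [hτ.1, hτ.2]
    · refine ⟨-1, by simp, hmem (-1) fun τ hτ => abs_le.2 ⟨?_, ?_⟩⟩ <;> linarith [hτ.1, hτ.2]
  have hline : ∀ (g : Plane → F), ContDiff ℝ 1 g → ∀ τ, HasDerivAt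
      (fun τ : ℝ => g (x + (σ * τ) • e i)) (σ • pd i g (x + (σ * τ) • e i)) τ := by
    intro g hg τ
    have h1 : HasDerivAt (fun τ : ℝ => x + (σ * τ) • e i) (σ • e i) τ := by
      have := (((hasDerivAt_id τ).const_mul σ).smul_const (e i)).const_add x
      simpa using this
    have h2 := (hg.differentiable (by norm_num) (x + (σ * τ) • e i)).hasFDerivAt.comp_hasDerivAt τ h1
    simpa [pd, Function.comp_def] using h2
  have hpd : ContDiff ℝ 1 (pd i f) := hf.pd (by norm_num) i
  have hc0 : 0 ≤ c := (norm_nonneg _).trans (hc x hx)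
  have h1 : ∀ τ ∈ Icc 0 h, ‖pd i f (x + (σ * τ) • e i) - pd i f x‖ ≤ c * h := by
    intro τ hτ
    have := Convex.norm_image_sub_le_of_norm_hasDerivWithin_le
      (f := fun τ : ℝ => pd i f (x + (σ * τ) • e i)) (s := Icc 0 h) (C := c) (x := 0) (y := τ)
      (fun τ _ => (hline _ hpd τ).hasDerivWithinAt)
      (fun τ hτ => by
        rw [norm_smul, Real.norm_eq_abs, hσ, one_mul]
        exact hc _ (hseg τ hτ)) (convex_Icc 0 h) ⟨le_rfl, hh.le⟩ hτ
    simp only [mul_zero, zero_smul, add_zero, sub_zero] at this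
    refine this.trans ?_
    rw [Real.norm_eq_abs, abs_of_nonneg hτ.1]
    exact mul_le_mul_of_nonneg_left hτ.2 hc0
  have h2 := Convex.norm_image_sub_le_of_norm_hasDerivWithin_le
      (f := fun τ : ℝ => f (x + (σ * τ) • e i) - τ • σ • pd i f x)
      (f' := fun τ => σ • pd i f (x + (σ * τ) • e i) - σ • pd i f x)
      (s := Icc 0 h) (C := c * h) (x := 0) (y := h)
      (fun τ _ => ((hline f (hf.of_le (by norm_num)) τ).sub (by
        simpa using (hasDerivAt_id τ).smul_const (σ • pd i f x))).hasDerivWithinAt)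
      (fun τ hτ => by
        rw [← smul_sub, norm_smul, Real.norm_eq_abs, hσ, one_mul]
        exact h1 τ hτ) (convex_Icc 0 h) ⟨le_rfl, hh.le⟩ ⟨hh.le, le_rfl⟩
  simp only [mul_zero, zero_smul, add_zero, sub_zero] at h2
  rw [Real.norm_eq_abs, abs_of_pos hh] at h2
  have h3 := ha _ (hseg h ⟨hh.le, le_rfl⟩)
  have h4 := ha x hx
  have h5 : ‖h • σ • pd i f x‖ = h * ‖pd i f x‖ := by
    rw [norm_smul, norm_smul, Real.norm_eq_abs, Real.norm_eq_abs, hσ, one_mul, abs_of_pos hh]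
  have h6 : h * ‖pd i f x‖ ≤ 2 * a + c * h * h := by
    rw [← h5]
    have : h • σ • pd i f x = (f (x + (σ * h) • e i) - f x) -
        (f (x + (σ * h) • e i) - h • σ • pd i f x - f x) := by abel
    rw [this]
    refine (norm_sub_le _ _).trans ?_
    have := norm_sub_le (f (x + (σ * h) • e i)) (f x)
    linarith
  rw [div_add' _ _ _ hh.ne', le_div_iff₀ hh]
  linarith

lemma norm_iteratedFDeriv_iteratedFDeriv_two {f : Plane → F} (n : ℕ) (x : Plane) :
    ‖iteratedFDeriv ℝ 2 (iteratedFDeriv ℝ n f) x‖ = ‖iteratedFDeriv ℝ (n + 2) f x‖ := by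
  have h1 : ‖iteratedFDeriv ℝ 1 (fderiv ℝ (iteratedFDeriv ℝ n f)) x‖ =
      ‖iteratedFDeriv ℝ 2 (iteratedFDeriv ℝ n f) x‖ := norm_iteratedFDeriv_fderiv
  have h2 := LinearIsometryEquiv.norm_iteratedFDeriv_comp_left (𝕜 := ℝ)
      (F := Plane →L[ℝ] Plane [×n]→L[ℝ] F)
      (G := ContinuousMultilinearMap ℝ (fun _ : Fin (n + 1) => Plane) F)
      (continuousMultilinearCurryLeftEquiv ℝ (fun _ : Fin (n + 1) => Plane) F).symm
      (fderiv ℝ (iteratedFDeriv ℝ n f)) x 1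
  rw [← iteratedFDeriv_succ_eq_comp_left] at h2
  rw [← h1, ← h2, norm_iteratedFDeriv_one, norm_fderiv_iteratedFDeriv]

/-- The largest norm of a derivative of order `j` on the square. -/
def supNorm (f : Plane → F) (j : ℕ) : ℝ := ⨆ x : square, ‖iteratedFDeriv ℝ j f x‖

/-- `1` plus the norm in `C^k` of the square. -/
def cNorm (f : Plane → F) (k : ℕ) : ℝ := 1 + ∑ j ∈ Finset.range (k + 1), supNorm f j

variable {f : Plane → F} (hf : ContDiff ℝ ∞ f)

lemma contDiff_nat_of_infty (hf : ContDiff ℝ ∞ f) (n : ℕ) : ContDiff ℝ n f :=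
  hf.of_le (by exact_mod_cast le_top)

lemma norm_le_supNorm (hf : ContDiff ℝ ∞ f) (j : ℕ) {x : Plane} (hx : x ∈ square) :
    ‖iteratedFDeriv ℝ j f x‖ ≤ supNorm f j := by
  have hc : Continuous fun x => ‖iteratedFDeriv ℝ j f x‖ :=
    ((contDiff_nat_of_infty hf j).continuous_iteratedFDeriv le_rfl).norm
  have hb := isCompact_square.bddAbove_image hc.continuousOn
  rw [image_eq_range] at hb
  exact le_ciSup hb ⟨x, hx⟩

instance : Nonempty square := ⟨⟨0, by simp [square]⟩⟩

lemma supNorm_nonneg (f : Plane → F) (j : ℕ) : 0 ≤ supNorm f j :=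
  Real.iSup_nonneg fun _ => norm_nonneg _

lemma one_le_cNorm (f : Plane → F) (k : ℕ) : 1 ≤ cNorm f k :=
  le_add_of_nonneg_right (Finset.sum_nonneg fun _ _ => supNorm_nonneg _ _)

lemma cNorm_succ (f : Plane → F) (k : ℕ) : cNorm f (k + 1) = cNorm f k + supNorm f (k + 1) := by
  rw [cNorm, Finset.sum_range_succ, ← add_assoc]; rfl

lemma cNorm_mono (f : Plane → F) : Monotone (cNorm f) :=
  monotone_nat_of_le_succ fun k => by
    rw [cNorm_succ]; exact le_add_of_nonneg_right (supNorm_nonneg _ _)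

lemma supNorm_le_cNorm (f : Plane → F) {j k : ℕ} (h : j ≤ k) : supNorm f j ≤ cNorm f k := by
  refine le_trans ?_ (cNorm_mono f h)
  rw [cNorm]
  have := Finset.single_le_sum (f := supNorm f) (fun i _ => supNorm_nonneg f i)
    (Finset.mem_range.2 (Nat.lt_succ_self j))
  simp only [Nat.succ_eq_add_one] at this
  linarith

lemma norm_le_cNorm (hf : ContDiff ℝ ∞ f) {j k : ℕ} (h : j ≤ k) {x : Plane} (hx : x ∈ square) :
    ‖iteratedFDeriv ℝ j f x‖ ≤ cNorm f k :=
  (norm_le_supNorm hf j hx).trans (supNorm_le_cNorm f h)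

/-- The norms of the spaces `C^k` are logarithmically convex in `k`, up to a constant. -/
lemma cNorm_sq_le (hf : ContDiff ℝ ∞ f) (k : ℕ) :
    cNorm f (k + 1) ^ 2 ≤ 121 * (cNorm f k * cNorm f (k + 2)) := by
  set a := cNorm f k with ha
  set c := cNorm f (k + 2) with hc
  have ha1 : 1 ≤ a := one_le_cNorm f k
  have hac : a ≤ c := cNorm_mono f (by omega)
  have hc0 : 0 < c := by linarith
  -- the step which balances the two terms in Landau's inequality
  set h := √(a / c) / 2 with hh
  have hr0 : 0 < a / c := by positivity
  have hh0 : 0 < h := by positivity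
  have hr1 : √(a / c) ≤ 1 := Real.sqrt_le_one.2 ((div_le_one hc0).2 hac)
  have hsq : √(a / c) ^ 2 = a / c := Real.sq_sqrt hr0.le
  set r := c * √(a / c) with hr
  have hr_sq : r ^ 2 = a * c := by
    rw [hr, mul_pow, hsq]; field_simp
  have hrpos : 0 < r := by positivity
  have hah : a / h = 2 * r := by
    rw [div_eq_iff hh0.ne', hh, hr]
    have : 2 * (c * √(a / c)) * (√(a / c) / 2) = c * √(a / c) ^ 2 := by ring
    rw [this, hsq]; field_simp
  have hch : c * h = r / 2 := by rw [hh, hr]; ring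
  have hg : ContDiff ℝ 2 (iteratedFDeriv ℝ k f) :=
    (contDiff_nat_of_infty hf (k + 2)).iteratedFDeriv_right (by norm_cast; omega)
  have hpd : ∀ i : Fin 2, ∀ x ∈ square, ‖pd i (iteratedFDeriv ℝ k f) x‖ ≤ 5 * r := by
    intro i x hx
    have := norm_pd_le_of_square hg i (a := a) (c := c) (fun x hx => norm_le_cNorm hf le_rfl hx)
      (fun x hx => ?_) hh0 (by linarith) hx
    · rw [mul_div_assoc, hah, hch] at this
      linarith
    · have h1 : ‖pd i (pd i (iteratedFDeriv ℝ k f)) x‖ ≤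
          ‖iteratedFDeriv ℝ 2 (iteratedFDeriv ℝ k f) x‖ := by
        have h2 := norm_iteratedFDeriv_pd_le (n := 0) (f := pd i (iteratedFDeriv ℝ k f)) (x := x)
          ((hg.pd (m := 1) (by norm_num) i).contDiffAt) i
        have h3 := norm_iteratedFDeriv_pd_le (n := 1) (f := iteratedFDeriv ℝ k f) (x := x)
          hg.contDiffAt i
        rw [norm_iteratedFDeriv_zero] at h2
        exact h2.trans h3
      rw [norm_iteratedFDeriv_iteratedFDeriv_two] at h1
      exact h1.trans (norm_le_cNorm hf le_rfl hx)
  have hS : supNorm f (k + 1) ≤ 10 * r := by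
    refine ciSup_le fun x => ?_
    rw [← norm_fderiv_iteratedFDeriv]
    refine (norm_clm_le _).trans ?_
    have h0 := hpd 0 x x.2
    have h1 := hpd 1 x x.2
    simp only [pd] at h0 h1
    linarith
  have har : a ≤ r := by
    refine le_of_sq_le_sq ?_ hrpos.le
    rw [hr_sq, sq]
    exact mul_le_mul_of_nonneg_left hac (by linarith)
  rw [cNorm_succ, ← ha]
  have h1 : a + supNorm f (k + 1) ≤ 11 * r := by linarith
  have h2 : 0 ≤ a + supNorm f (k + 1) := add_nonneg (by linarith) (supNorm_nonneg _ _)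
  calc _ ≤ (11 * r) ^ 2 := pow_le_pow_left₀ h2 h1 2
    _ = _ := by rw [mul_pow, hr_sq]; norm_num

end

/-- For a logarithmically convex sequence, a product of two terms is largest when one of the indices
is `0`. The constant in the convexity is allowed to enter with a power. -/
lemma mul_le_of_log_convex {b : ℕ → ℝ} {c : ℝ} (hb : ∀ n, 0 < b n) (hc : 1 ≤ c)
    (h : ∀ n, b (n + 1) ^ 2 ≤ c * (b n * b (n + 2))) (m n : ℕ) :
    b m * b n ≤ c ^ (m * n) * (b 0 * b (m + n)) := by
  have hr : ∀ m n, b (m + 1) * b (m + n) ≤ c ^ n * (b m * b (m + n + 1)) := by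
    intro m n
    induction n with
    | zero => simp [mul_comm]
    | succ n ih =>
      have h1 := h (m + n)
      have hp := hb (m + n)
      have hcn : 0 < c ^ n := by positivity
      have h2 : b (m + n) * (b (m + 1) * b (m + n + 1)) ≤
          b (m + n) * (c ^ (n + 1) * (b m * b (m + n + 2))) := by
        calc b (m + n) * (b (m + 1) * b (m + n + 1))
            = (b (m + 1) * b (m + n)) * b (m + n + 1) := by ring
          _ ≤ (c ^ n * (b m * b (m + n + 1))) * b (m + n + 1) :=
              mul_le_mul_of_nonneg_right ih (hb _).le
          _ = c ^ n * b m * b (m + n + 1) ^ 2 := by ring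
          _ ≤ c ^ n * b m * (c * (b (m + n) * b (m + n + 2))) :=
              mul_le_mul_of_nonneg_left h1 (mul_nonneg hcn.le (hb m).le)
          _ = _ := by ring
      exact le_of_mul_le_mul_left h2 hp
  induction m with
  | zero => simp
  | succ m ih =>
    have h1 := hr m n
    have hp := hb m
    have h2 : b m * (b (m + 1) * b n) ≤
        b m * (c ^ ((m + 1) * n) * (b 0 * b (m + 1 + n))) := by
      calc b m * (b (m + 1) * b n) = b (m + 1) * (b m * b n) := by ring
        _ ≤ b (m + 1) * (c ^ (m * n) * (b 0 * b (m + n))) :=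
            mul_le_mul_of_nonneg_left ih (hb _).le
        _ = c ^ (m * n) * b 0 * (b (m + 1) * b (m + n)) := by ring
        _ ≤ c ^ (m * n) * b 0 * (c ^ n * (b m * b (m + n + 1))) :=
            mul_le_mul_of_nonneg_left h1 (by have := hb 0; positivity)
        _ = _ := by
            rw [show (m + 1) * n = m * n + n by ring, pow_add, show m + 1 + n = m + n + 1 by ring]
            ring
    exact le_of_mul_le_mul_left h2 hp

lemma norm_le_of_smallC3 {w : Plane → ℝ} (hw : ContDiff ℝ ∞ w) (h3 : SmallC3 w) {x : Plane}
    (hx : x ∈ Metric.closedBall (0 : Plane) 1) {j : ℕ} (hj : j ≤ 3) :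
    ‖iteratedFDeriv ℝ j w x‖ ≤ 8 := by
  obtain ⟨h0, h1, h2, h3⟩ := h3 x hx
  have hp1 : ∀ i, ‖pd i w x‖ ≤ 1 := fun i => (norm_le_pi_norm (grad w x) i).trans h1.le
  have hp2 : ∀ i j, ‖pd i (pd j w) x‖ ≤ 1 := fun i j =>
    ((norm_le_pi_norm (hess w x i) j).trans (norm_le_pi_norm (hess w x) i)).trans h2.le
  have hp3 : ∀ i j l, ‖pd i (pd j (pd l w)) x‖ ≤ 1 := fun i j l =>
    (((norm_le_pi_norm (third w x i j) l).trans (norm_le_pi_norm (third w x i) j)).trans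
      (norm_le_pi_norm (third w x) i)).trans h3.le
  have d1 : ∀ {f : Plane → ℝ}, ContDiff ℝ ∞ f → ∀ i, ContDiff ℝ ∞ (pd i f) := fun hf i =>
    hf.pd (by simp) i
  have s1 : ∀ {f : Plane → ℝ} {n : ℕ}, ContDiff ℝ ∞ f → ‖iteratedFDeriv ℝ (n + 1) f x‖ ≤
      ‖iteratedFDeriv ℝ n (pd 0 f) x‖ + ‖iteratedFDeriv ℝ n (pd 1 f) x‖ := fun hf =>
    norm_iteratedFDeriv_succ_le (contDiff_nat_of_infty hf _).contDiffAt
  have b1 : ∀ {f : Plane → ℝ} {B : ℝ}, ContDiff ℝ ∞ f → (∀ i, ‖pd i f x‖ ≤ B) →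
      ‖iteratedFDeriv ℝ 1 f x‖ ≤ 2 * B := by
    intro f B hf hB
    have := s1 (n := 0) hf
    simp only [norm_iteratedFDeriv_zero] at this
    linarith [hB 0, hB 1]
  have b2 : ∀ {f : Plane → ℝ} {B : ℝ}, ContDiff ℝ ∞ f → (∀ i j, ‖pd i (pd j f) x‖ ≤ B) →
      ‖iteratedFDeriv ℝ 2 f x‖ ≤ 4 * B := by
    intro f B hf hB
    have := s1 (n := 1) hf
    have h0 := b1 (d1 hf 0) fun i => hB i 0
    have h1 := b1 (d1 hf 1) fun i => hB i 1
    simp only [Nat.reduceAdd] at this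
    linarith
  interval_cases j
  · rw [norm_iteratedFDeriv_zero, Real.norm_eq_abs]; linarith
  · linarith [b1 hw hp1]
  · linarith [b2 hw hp2]
  · have := s1 (n := 2) hw
    have h0 := b2 (d1 hw 0) fun i j => hp3 i j 0
    have h1 := b2 (d1 hw 1) fun i j => hp3 i j 1
    simp only [Nat.reduceAdd] at this
    linarith

/-- The norms of a function which is small in `C³` form a weight. -/
lemma isWeight_cNorm {w : Plane → ℝ} (hw : ContDiff ℝ ∞ w) (h3 : SmallC3 w) (k : ℕ) :
    IsWeight k (121 ^ (k * k) * 33) fun j => cNorm w (j + 2) := by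
  have hB3 : cNorm w 3 ≤ 33 := by
    have : ∀ j ∈ Finset.range (3 + 1), supNorm w j ≤ 8 := by
      intro j hj
      rw [Finset.mem_range] at hj
      exact ciSup_le fun x => norm_le_of_smallC3 hw h3
        (Metric.ball_subset_closedBall (square_subset_ball x.2)) (by omega)
    have := Finset.sum_le_sum this
    simp at this
    rw [cNorm]
    linarith
  have hpow : (1 : ℝ) ≤ 121 ^ (k * k) := one_le_pow₀ (by norm_num)
  refine ⟨fun j => one_le_cNorm w _, fun i j h => cNorm_mono w (by omega), ?_, ?_⟩
  · change cNorm w 3 ≤ _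
    nlinarith
  · intro i j hi hj hij
    obtain ⟨m, rfl⟩ : ∃ m, i = m + 1 := ⟨i - 1, by omega⟩
    obtain ⟨n, rfl⟩ : ∃ n, j = n + 1 := ⟨j - 1, by omega⟩
    have h := mul_le_of_log_convex (b := fun n => cNorm w (n + 3)) (c := 121)
      (fun n => zero_lt_one.trans_le (one_le_cNorm w _)) (by norm_num)
      (fun n => cNorm_sq_le hw (n + 3)) m n
    simp only [zero_add] at h
    have hmn : (121 : ℝ) ^ (m * n) ≤ 121 ^ (k * k) :=
      pow_le_pow_right₀ (by norm_num) (Nat.mul_le_mul (by omega) (by omega))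
    have hpos := zero_lt_one.trans_le (one_le_cNorm w (m + n + 3))
    rw [show m + 1 + (n + 1) - 1 + 2 = m + n + 3 by omega]
    calc _ ≤ 121 ^ (m * n) * (cNorm w 3 * cNorm w (m + n + 3)) := h
      _ ≤ 121 ^ (k * k) * (33 * cNorm w (m + n + 3)) := by
          refine mul_le_mul hmn (mul_le_mul_of_nonneg_right hB3 hpos.le) ?_ (by positivity)
          exact mul_nonneg (by linarith [one_le_cNorm w 3]) hpos.le
      _ = _ := by ring

/-! ### Sobolev norms -/

lemma contDiff_infty_pd {F : Type*} [NormedAddCommGroup F] [NormedSpace ℝ F] {f : Plane → F}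
    (hf : ContDiff ℝ ∞ f) (i : Fin 2) : ContDiff ℝ ∞ (pd i f) := hf.pd (by simp) i

lemma contDiff_infty_iterate_pd {F : Type*} [NormedAddCommGroup F] [NormedSpace ℝ F] {f : Plane → F}
    (hf : ContDiff ℝ ∞ f) (i : Fin 2) (n : ℕ) : ContDiff ℝ ∞ ((pd i)^[n] f) := by
  induction n generalizing f with
  | zero => exact hf
  | succ n ih => exact ih (contDiff_infty_pd hf i)

lemma pd_iterate_pd_comm {F : Type*} [NormedAddCommGroup F] [NormedSpace ℝ F] {f : Plane → F}
    (hf : ContDiff ℝ ∞ f) (i j : Fin 2) (n : ℕ) : (pd j)^[n] (pd i f) = pd i ((pd j)^[n] f) := by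
  induction n generalizing f with
  | zero => rfl
  | succ n ih =>
    rw [Function.iterate_succ_apply, Function.iterate_succ_apply, ← ih (contDiff_infty_pd hf j)]
    congr 1
    ext x
    exact pd_comm (contDiff_nat_of_infty hf 2).contDiffAt j i

lemma norm_iteratedFDeriv_le_of_iterate_pd {f : Plane → ℝ} (hf : ContDiff ℝ ∞ f) {T : ℝ} {n : ℕ}
    {x : Plane} (h : ∀ a b, a + b = n → ‖(pd 0)^[a] ((pd 1)^[b] f) x‖ ≤ T) :
    ‖iteratedFDeriv ℝ n f x‖ ≤ 2 ^ n * T := by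
  induction n generalizing f with
  | zero => simpa using h 0 0 rfl
  | succ n ih =>
    have h1 := norm_iteratedFDeriv_succ_le (n := n) (x := x) (contDiff_nat_of_infty hf _).contDiffAt
    have h2 := ih (contDiff_infty_pd hf 0) fun a b hab => by
      rw [pd_iterate_pd_comm hf, ← Function.iterate_succ_apply]
      exact h _ _ (by omega)
    have h3 := ih (contDiff_infty_pd hf 1) fun a b hab => by
      rw [← Function.iterate_succ_apply (pd 1)]
      exact h _ _ (by omega)
    rw [pow_succ]
    linarith

/-- The embedding of `W^{1,1}` in `C⁰` on the interval `[-1/2, 1/2]` of length one. -/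
lemma enorm_le_lintegral_Icc {g g' : ℝ → ℝ} (hg : ∀ t, HasDerivAt g (g' t) t) (hg' : Continuous g')
    {u : ℝ} (hu : u ∈ Icc (-(1 / 2) : ℝ) (1 / 2)) :
    ‖g u‖ₑ ≤ ∫⁻ s in Icc (-(1 / 2) : ℝ) (1 / 2), (‖g s‖ₑ + ‖g' s‖ₑ) := by
  set I := Icc (-(1 / 2) : ℝ) (1 / 2) with hI
  have hvol : volume I = 1 := by rw [hI, Real.volume_Icc]; norm_num
  have h1 : ∀ s ∈ I, ‖g u‖ₑ ≤ ‖g s‖ₑ + ∫⁻ t in I, ‖g' t‖ₑ := by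
    intro s hs
    have h2 : ∫ t in s..u, g' t = g u - g s :=
      intervalIntegral.integral_eq_sub_of_hasDerivAt (fun t _ => hg t)
        (hg'.intervalIntegrable _ _)
    have h3 : ‖g u - g s‖ₑ ≤ ∫⁻ t in I, ‖g' t‖ₑ := by
      rw [← h2, ← ofReal_norm, intervalIntegral.norm_intervalIntegral_eq, ofReal_norm]
      refine (enorm_integral_le_lintegral_enorm _).trans (lintegral_mono_set ?_)
      exact uIoc_subset_uIcc.trans (uIcc_subset_Icc hs hu)
    calc ‖g u‖ₑ = ‖g s + (g u - g s)‖ₑ := by rw [add_sub_cancel]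
      _ ≤ ‖g s‖ₑ + ‖g u - g s‖ₑ := enorm_add_le _ _
      _ ≤ _ := by gcongr
  have hc : Continuous g := continuous_iff_continuousAt.2 fun t => (hg t).continuousAt
  calc ‖g u‖ₑ = ∫⁻ _ in I, ‖g u‖ₑ := by rw [setLIntegral_const, hvol, mul_one]
    _ ≤ ∫⁻ s in I, (‖g s‖ₑ + ∫⁻ t in I, ‖g' t‖ₑ) := setLIntegral_mono' measurableSet_Icc h1
    _ = _ := by
      rw [lintegral_add_left hc.measurable.enorm, lintegral_add_left hc.measurable.enorm,
        setLIntegral_const, hvol, mul_one]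

lemma measurePreserving_pt : MeasurePreserving (fun z : ℝ × ℝ => pt z.1 z.2) :=
  (PiLp.volume_preserving_toLp (Fin 2)).comp (volume_preserving_finTwoArrow ℝ).symm

lemma pt_preimage_square : (fun z : ℝ × ℝ => pt z.1 z.2) ⁻¹' square =
    Icc (-(1 / 2) : ℝ) (1 / 2) ×ˢ Icc (-(1 / 2) : ℝ) (1 / 2) := by
  ext z
  simp only [mem_preimage, square, mem_ofPred_eq, pt_zero, pt_one, abs_le, mem_prod, mem_Icc]

lemma measurableSet_square : MeasurableSet square := isCompact_square.measurableSet

lemma volume_square : volume square = 1 := by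
  rw [← measurePreserving_pt.measure_preimage measurableSet_square.nullMeasurableSet,
    pt_preimage_square, Measure.volume_eq_prod, Measure.prod_prod, Real.volume_Icc]
  norm_num

/-- The embedding of `W^{2,1}` of the unit square in the continuous functions. -/
lemma enorm_le_lintegral_square {f : Plane → ℝ} (hf : ContDiff ℝ ∞ f) {x : Plane}
    (hx : x ∈ square) : ‖f x‖ₑ ≤ ((∫⁻ y in square, ‖f y‖ₑ) + ∫⁻ y in square, ‖pd 1 f y‖ₑ) +
      ((∫⁻ y in square, ‖pd 0 f y‖ₑ) + ∫⁻ y in square, ‖pd 0 (pd 1 f) y‖ₑ) := by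
  set I := Icc (-(1 / 2) : ℝ) (1 / 2) with hI
  have hd : ∀ {h : Plane → ℝ}, ContDiff ℝ ∞ h → Differentiable ℝ h := fun hh =>
    hh.differentiable (by simp)
  have hpd : ∀ {h : Plane → ℝ}, ContDiff ℝ ∞ h → ∀ i, ContDiff ℝ ∞ (pd i h) := contDiff_infty_pd
  have hm : ∀ {h : Plane → ℝ}, ContDiff ℝ ∞ h →
      Measurable fun z : ℝ × ℝ => ‖h (pt z.1 z.2)‖ₑ := fun hh =>
    (hh.continuous.comp (continuous_pt continuous_fst continuous_snd)).measurable.enorm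
  have hsq : ∀ {h : Plane → ℝ}, ContDiff ℝ ∞ h →
      ∫⁻ y in square, ‖h y‖ₑ = ∫⁻ s in I, ∫⁻ t in I, ‖h (pt s t)‖ₑ := by
    intro h hh
    rw [← measurePreserving_pt.setLIntegral_comp_preimage measurableSet_square
      hh.continuous.measurable.enorm, pt_preimage_square, Measure.volume_eq_prod,
      setLIntegral_prod _ (hm hh).aemeasurable]
  have hvert : ∀ {h : Plane → ℝ}, ContDiff ℝ ∞ h → ∀ s, ∀ t ∈ I, ‖h (pt s t)‖ₑ ≤
      ∫⁻ t in I, (‖h (pt s t)‖ₑ + ‖pd 1 h (pt s t)‖ₑ) := by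
    intro h hh s t ht
    exact enorm_le_lintegral_Icc (fun t => hasDerivAt_snd (hd hh _))
      ((hpd hh 1).continuous.comp (continuous_pt continuous_const continuous_id)) ht
  have h1 : ‖f x‖ₑ ≤ ∫⁻ s in I, (‖f (pt s (x 1))‖ₑ + ‖pd 0 f (pt s (x 1))‖ₑ) := by
    have := enorm_le_lintegral_Icc (g := fun s => f (pt s (x 1))) (u := x 0)
      (fun s => hasDerivAt_fst (hd hf _))
      ((hpd hf 0).continuous.comp (continuous_pt continuous_id continuous_const)) (abs_le.1 hx.1)
    simpa only [pt_eta] using this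
  have hx1 : x 1 ∈ I := abs_le.1 hx.2
  have hms : ∀ {h : Plane → ℝ}, ContDiff ℝ ∞ h →
      Measurable fun s => ∫⁻ t in I, ‖h (pt s t)‖ₑ := fun hh => (hm hh).lintegral_prod_right'
  have hmt : ∀ {h : Plane → ℝ}, ContDiff ℝ ∞ h → ∀ s,
      Measurable fun t => ‖h (pt s t)‖ₑ := fun hh s => (hm hh).comp measurable_prodMk_left
  have hcomm : pd 1 (pd 0 f) = pd 0 (pd 1 f) :=
    funext fun y => pd_comm (contDiff_nat_of_infty hf 2).contDiffAt 1 0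
  refine h1.trans ?_
  calc _ ≤ ∫⁻ s in I, ((∫⁻ t in I, (‖f (pt s t)‖ₑ + ‖pd 1 f (pt s t)‖ₑ)) +
        ∫⁻ t in I, (‖pd 0 f (pt s t)‖ₑ + ‖pd 1 (pd 0 f) (pt s t)‖ₑ)) :=
        lintegral_mono fun s => add_le_add (hvert hf s _ hx1) (hvert (hpd hf 0) s _ hx1)
    _ = _ := by
        simp only [lintegral_add_left (hmt hf _), lintegral_add_left (hmt (hpd hf 0) _)]
        have hms2 : Measurable fun s => (∫⁻ t in I, ‖f (pt s t)‖ₑ) + ∫⁻ t in I, ‖pd 1 f (pt s t)‖ₑ :=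
          (hms hf).add (hms (hpd hf 1))
        rw [lintegral_add_left hms2, lintegral_add_left (hms hf),
          lintegral_add_left (hms (hpd hf 0)), hsq hf, hsq (hpd hf 1), hsq (hpd hf 0), hcomm,
          hsq (hpd (hpd hf 1) 0)]

lemma lintegral_square_le {h : Plane → ℝ} (hh : Continuous h) :
    ∫⁻ y in square, ‖h y‖ₑ ≤ (∫⁻ y in Metric.ball 0 1, ‖h y‖ₑ ^ 2) ^ (1 / 2 : ℝ) := by
  have hm := hh.measurable.enorm
  have h1 := ENNReal.lintegral_mul_le_Lp_mul_Lq (volume.restrict square)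
    (Real.HolderConjugate.two_two) hm.aemeasurable
    (aemeasurable_const (b := (1 : ℝ≥0∞)))
  simp only [Pi.mul_apply, mul_one, ENNReal.one_rpow, setLIntegral_const, volume_square] at h1
  refine h1.trans (ENNReal.rpow_le_rpow ?_ (by norm_num))
  refine (lintegral_mono_set square_subset_ball).trans (le_of_eq ?_)
  simp

lemma lintegral_sq_le_sobolevNorm {f : Plane → ℝ} {m a b : ℕ} {D : Set Plane} (h : a + b ≤ m) :
    (∫⁻ y in D, ‖(pd 0)^[a] ((pd 1)^[b] f) y‖ₑ ^ 2) ^ (1 / 2 : ℝ) ≤ sobolevNorm m D f := by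
  refine ENNReal.rpow_le_rpow ?_ (by norm_num)
  have h1 := Finset.single_le_sum (s := Finset.HasAntidiagonal.antidiagonal (a + b))
    (f := fun q : ℕ × ℕ => ∫⁻ y in D, ‖(pd 0)^[q.1] ((pd 1)^[q.2] f) y‖ₑ ^ 2)
    (fun _ _ => zero_le) (Finset.HasAntidiagonal.mem_antidiagonal.2 (rfl : (a, b).1 + (a, b).2 = a + b))
  refine h1.trans ?_
  exact Finset.single_le_sum (s := Finset.range (m + 1))
    (f := fun s => ∑ q ∈ Finset.HasAntidiagonal.antidiagonal s,
      ∫⁻ y in D, ‖(pd 0)^[q.1] ((pd 1)^[q.2] f) y‖ₑ ^ 2) (fun _ _ => zero_le)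
    (Finset.mem_range.2 (by omega))

lemma enorm_iterate_pd_le {w : Plane → ℝ} (hw : ContDiff ℝ ∞ w) {m a b : ℕ} (h : a + b + 2 ≤ m)
    {x : Plane} (hx : x ∈ square) :
    ‖(pd 0)^[a] ((pd 1)^[b] w) x‖ₑ ≤ 4 * sobolevNorm m (Metric.ball 0 1) w := by
  have hs : ∀ a b, ContDiff ℝ ∞ ((pd 0)^[a] ((pd 1)^[b] w)) := fun a b =>
    contDiff_infty_iterate_pd (contDiff_infty_iterate_pd hw 1 b) 0 a
  have hI : ∀ a b, a + b ≤ m → ∫⁻ y in square, ‖(pd 0)^[a] ((pd 1)^[b] w) y‖ₑ ≤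
      sobolevNorm m (Metric.ball 0 1) w := fun a b hab =>
    (lintegral_square_le (hs a b).continuous).trans (lintegral_sq_le_sobolevNorm hab)
  have h1 : pd 1 ((pd 0)^[a] ((pd 1)^[b] w)) = (pd 0)^[a] ((pd 1)^[b + 1] w) := by
    rw [Function.iterate_succ_apply' (pd 1) b, pd_iterate_pd_comm (contDiff_infty_iterate_pd hw 1 b)]
  have h0 : ∀ b, pd 0 ((pd 0)^[a] ((pd 1)^[b] w)) = (pd 0)^[a + 1] ((pd 1)^[b] w) := fun b => by
    rw [Function.iterate_succ_apply' (pd 0)]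
  have := enorm_le_lintegral_square (hs a b) hx
  rw [h1, h0, h0] at this
  refine this.trans ?_
  calc _ ≤ (sobolevNorm m (Metric.ball 0 1) w + sobolevNorm m (Metric.ball 0 1) w) +
        (sobolevNorm m (Metric.ball 0 1) w + sobolevNorm m (Metric.ball 0 1) w) :=
        add_le_add (add_le_add (hI _ _ (by omega)) (hI _ _ (by omega)))
          (add_le_add (hI _ _ (by omega)) (hI _ _ (by omega)))
    _ = _ := by ring

/-- Sobolev's embedding, as a bound of the weight by a Sobolev norm. -/
lemma exists_cNorm_le_sobolevNorm (j : ℕ) : ∃ C : ℝ, 0 < C ∧ ∀ w : Plane → ℝ, ContDiff ℝ ∞ w →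
    ENNReal.ofReal (cNorm w j) ≤
      ENNReal.ofReal C * (1 + sobolevNorm (j + 2) (Metric.ball 0 1) w) := by
  refine ⟨1 + (j + 1) * (2 ^ j * 4), by positivity, fun w hw => ?_⟩
  set N := sobolevNorm (j + 2) (Metric.ball 0 1) w with hN
  have hC : (0 : ℝ) < 1 + (j + 1) * (2 ^ j * 4) := by positivity
  by_cases htop : N = ⊤
  · rw [htop, add_top, ENNReal.mul_top (by simpa using hC)]
    exact le_top
  obtain ⟨T, hT⟩ : ∃ T : NNReal, N = T := ⟨N.toNNReal, (ENNReal.coe_toNNReal htop).symm⟩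
  have h1 : ∀ i ≤ j, supNorm w i ≤ 2 ^ j * (4 * T) := by
    intro i hi
    refine ciSup_le fun x => ?_
    have := norm_iteratedFDeriv_le_of_iterate_pd (T := 4 * T) (n := i) (x := x) hw fun a b hab => by
      have := enorm_iterate_pd_le hw (m := j + 2) (a := a) (b := b) (by omega) x.2
      rw [← hN, hT, enorm_eq_nnnorm] at this
      have h4 : ‖(pd 0)^[a] ((pd 1)^[b] w) x‖₊ ≤ 4 * T := by exact_mod_cast this
      exact_mod_cast h4
    refine this.trans (mul_le_mul_of_nonneg_right ?_ (by positivity))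
    exact pow_le_pow_right₀ (by norm_num) hi
  have h2 : cNorm w j ≤ (1 + (j + 1) * (2 ^ j * 4)) * (1 + T) := by
    have := Finset.sum_le_sum (s := Finset.range (j + 1)) (f := supNorm w)
      (g := fun _ => (2 : ℝ) ^ j * (4 * T)) fun i hi => h1 i (by
        rw [Finset.mem_range] at hi; omega)
    rw [Finset.sum_const, Finset.card_range, nsmul_eq_mul] at this
    push_cast at this
    rw [cNorm]
    have hT0 : (0 : ℝ) ≤ T := T.2
    have : (0 : ℝ) ≤ (j + 1) * (2 ^ j * 4) := by positivity
    nlinarith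
  rw [hT]
  calc _ ≤ ENNReal.ofReal ((1 + (j + 1) * (2 ^ j * 4)) * (1 + T)) := ENNReal.ofReal_le_ofReal h2
    _ = _ := by
      rw [ENNReal.ofReal_mul hC.le, ENNReal.ofReal_add zero_le_one T.coe_nonneg, ENNReal.ofReal_one,
        ENNReal.ofReal_coe_nnreal]

/-- On a part of the unit disc a Sobolev norm is bounded by the supremum of the derivatives. -/
lemma exists_sobolevNorm_le (m : ℕ) : ∃ S : ℝ, 0 < S ∧
    ∀ (D : Set Plane) (f : Plane → Plane) (B : ℝ), 0 ≤ B → D ⊆ Metric.ball 0 1 →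
      ContDiff ℝ m f → MeasurableSet D → (∀ x ∈ D, ∀ j ≤ m, ‖iteratedFDeriv ℝ j f x‖ ≤ B) →
      sobolevNorm m D f ≤ ENNReal.ofReal (S * B) := by
  set T : ℝ≥0∞ := (∑ s ∈ Finset.range (m + 1), ∑ q ∈ Finset.HasAntidiagonal.antidiagonal s,
    volume (Metric.ball (0 : Plane) 1)) ^ (1 / 2 : ℝ) with hT
  have hTtop : T ≠ ⊤ := by
    refine ENNReal.rpow_ne_top_of_nonneg (by norm_num) ?_
    exact ENNReal.sum_ne_top.2 fun s _ => ENNReal.sum_ne_top.2 fun q _ =>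
      (Metric.isBounded_ball.measure_lt_top).ne
  refine ⟨T.toReal + 1, by positivity, fun D f B hB hD hf hDm h => ?_⟩
  have h1 : sobolevNorm m D f ≤ T * ENNReal.ofReal B := by
    have hB2 : ENNReal.ofReal B = ((ENNReal.ofReal B) ^ 2) ^ (1 / 2 : ℝ) := by
      rw [← ENNReal.rpow_natCast, ← ENNReal.rpow_mul]; norm_num
    rw [hB2, hT, ← ENNReal.mul_rpow_of_nonneg _ _ (by norm_num : (0 : ℝ) ≤ 1 / 2), Finset.sum_mul]
    refine ENNReal.rpow_le_rpow (Finset.sum_le_sum fun s hs => ?_) (by norm_num)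
    rw [Finset.sum_mul]
    refine Finset.sum_le_sum fun q hq => ?_
    rw [Finset.HasAntidiagonal.mem_antidiagonal] at hq
    rw [Finset.mem_range] at hs
    calc _ ≤ ∫⁻ _ in D, ENNReal.ofReal B ^ 2 := by
          refine setLIntegral_mono' hDm fun x hx => ?_
          rw [← ofReal_norm]
          refine pow_le_pow_left' (ENNReal.ofReal_le_ofReal ?_) 2
          have hs' : (0 + q.1) + q.2 ≤ m := by omega
          have hfq : ContDiff ℝ ((0 + q.1 + q.2 : ℕ) : WithTop ℕ∞) f := hf.of_le (by exact_mod_cast hs')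
          have h2 := norm_iteratedFDeriv_iterate_pd_le (n := 0) (j := q.1) 0
            (f := (pd 1)^[q.2] f) (contDiff_iterate_pd 1 hfq) x
          have h3 := norm_iteratedFDeriv_iterate_pd_le (n := 0 + q.1) (j := q.2) 1 hfq x
          rw [norm_iteratedFDeriv_zero] at h2
          exact h2.trans (h3.trans (h x hx _ hs'))
      _ = ENNReal.ofReal B ^ 2 * volume D := setLIntegral_const _ _
      _ ≤ _ := by
          rw [mul_comm]
          exact mul_le_mul_left (measure_mono hD) _
  refine h1.trans ?_
  rw [ENNReal.ofReal_mul (by positivity)]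
  refine mul_le_mul_left ?_ _
  rw [← ENNReal.ofReal_toReal hTtop]
  exact ENNReal.ofReal_le_ofReal (by simp)

/-! ### Christoffel symbols and the equations of Codazzi -/

/-- A Riemannian metric with coefficients of class `C^{n+1}` on the open set `O`, in the form in which
it is used below. -/
structure IsSmoothMetric (n : ℕ) (G : Plane → Matrix (Fin 2) (Fin 2) ℝ) (O : Set Plane) : Prop where
  isOpen : IsOpen O
  contDiffAt : ∀ y ∈ O, ∀ i j, ContDiffAt ℝ (n + 1 : ℕ) (fun q => G q i j) y
  symm : ∀ y ∈ O, ∀ i j, G y i j = G y j i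
  det_pos : ∀ y ∈ O, 0 < (G y).det

/-- Christoffel symbols with the upper index lowered. -/
def lowered (G : Plane → Matrix (Fin 2) (Fin 2) ℝ) (s i j : Fin 2) (y : Plane) : ℝ :=
  (1 / 2) * (pd i (fun q => G q s j) y + pd j (fun q => G q s i) y - pd s (fun q => G q i j) y)

lemma inv_fin_two (A : Matrix (Fin 2) (Fin 2) ℝ) :
    A⁻¹ 0 0 = A 1 1 / A.det ∧ A⁻¹ 0 1 = - A 0 1 / A.det ∧ A⁻¹ 1 0 = - A 1 0 / A.det ∧
      A⁻¹ 1 1 = A 0 0 / A.det := by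
  rw [Matrix.inv_def, Matrix.adjugate_fin_two]
  simp [Ring.inverse_eq_inv', div_eq_inv_mul]

namespace IsSmoothMetric

variable {n : ℕ} {G : Plane → Matrix (Fin 2) (Fin 2) ℝ} {O : Set Plane} {y : Plane}

lemma mem_nhds (hG : IsSmoothMetric n G O) (hy : y ∈ O) : O ∈ 𝓝 y := hG.isOpen.mem_nhds hy

lemma symm_eventually (hG : IsSmoothMetric n G O) (hy : y ∈ O) (i j : Fin 2) :
    (fun q => G q i j) =ᶠ[𝓝 y] fun q => G q j i := by
  filter_upwards [hG.mem_nhds hy] with q hq using hG.symm q hq i j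

lemma pd_symm (hG : IsSmoothMetric n G O) (hy : y ∈ O) (a i j : Fin 2) :
    pd a (fun q => G q i j) y = pd a (fun q => G q j i) y := pd_congr (hG.symm_eventually hy i j) a

lemma contDiffAt_det (hG : IsSmoothMetric n G O) (hy : y ∈ O) :
    ContDiffAt ℝ (n + 1 : ℕ) (fun q => (G q).det) y := by
  simp only [Matrix.det_fin_two]
  have h := hG.contDiffAt y hy
  exact ((h 0 0).mul (h 1 1)).sub ((h 0 1).mul (h 1 0))

lemma contDiffAt_inv (hG : IsSmoothMetric n G O) (hy : y ∈ O) (i j : Fin 2) :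
    ContDiffAt ℝ (n + 1 : ℕ) (fun q => (G q)⁻¹ i j) y := by
  have h := hG.contDiffAt y hy
  have hd := hG.contDiffAt_det hy
  have hd0 := (hG.det_pos y hy).ne'
  have hi := fun q => inv_fin_two (G q)
  fin_cases i <;> fin_cases j
  · exact ((h 1 1).div hd hd0).congr_of_eventuallyEq (.of_forall fun q => (hi q).1)
  · exact ((h 0 1).neg.div hd hd0).congr_of_eventuallyEq (.of_forall fun q => (hi q).2.1)
  · exact ((h 1 0).neg.div hd hd0).congr_of_eventuallyEq (.of_forall fun q => (hi q).2.2.1)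
  · exact ((h 0 0).div hd hd0).congr_of_eventuallyEq (.of_forall fun q => (hi q).2.2.2)

lemma contDiffAt_christoffel (hG : IsSmoothMetric n G O) (hy : y ∈ O) (l i j : Fin 2) :
    ContDiffAt ℝ n (christoffel G l i j) y := by
  have h : ∀ a i j, ContDiffAt ℝ n (pd a fun q => G q i j) y := fun a i j =>
    (hG.contDiffAt y hy i j).pd (by norm_cast) a
  refine contDiffAt_const.mul (ContDiffAt.sum fun s _ => ?_)
  exact ((hG.contDiffAt_inv hy l s).of_le (by norm_cast; omega)).mul
    (((h i s j).add (h j s i)).sub (h s i j))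

lemma christoffel_symm (hG : IsSmoothMetric n G O) (hy : y ∈ O) (l i j : Fin 2) :
    christoffel G l i j y = christoffel G l j i y := by
  simp only [christoffel]
  congr 1
  refine Finset.sum_congr rfl fun s _ => ?_
  rw [hG.pd_symm hy s i j]
  ring

lemma sum_mul_christoffel (hG : IsSmoothMetric n G O) (hy : y ∈ O) (s i j : Fin 2) :
    G y s 0 * christoffel G 0 i j y + G y s 1 * christoffel G 1 i j y = lowered G s i j y := by
  have hd := (hG.det_pos y hy).ne'
  have hdet := Matrix.det_fin_two (G y)
  obtain ⟨h00, h01, h10, h11⟩ := inv_fin_two (G y)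
  simp only [christoffel, Fin.sum_univ_two, h00, h01, h10, h11]
  have e0 : pd i (fun q => G q 0 j) y + pd j (fun q => G q 0 i) y - pd 0 (fun q => G q i j) y =
      2 * lowered G 0 i j y := by rw [lowered]; ring
  have e1 : pd i (fun q => G q 1 j) y + pd j (fun q => G q 1 i) y - pd 1 (fun q => G q i j) y =
      2 * lowered G 1 i j y := by rw [lowered]; ring
  rw [e0, e1]
  field_simp
  rw [hdet]
  fin_cases s <;> simp <;> ring

lemma pd_metric (hG : IsSmoothMetric n G O) (hy : y ∈ O) (a s l : Fin 2) :
    pd a (fun q => G q s l) y = lowered G l a s y + lowered G s a l y := by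
  rw [lowered, lowered, hG.pd_symm hy a l s, hG.pd_symm hy s a l, hG.pd_symm hy l a s]
  ring

lemma pd_det (hG : IsSmoothMetric n G O) (hy : y ∈ O) : pd 0 (fun q => (G q).det) y =
    2 * (G y).det * (christoffel G 0 0 0 y + christoffel G 1 0 1 y) := by
  have h : ∀ i j, DifferentiableAt ℝ (fun q => G q i j) y := fun i j =>
    (hG.contDiffAt y hy i j).differentiableAt (by norm_cast)
  have h1 := hG.sum_mul_christoffel hy
  simp only [Matrix.det_fin_two]
  rw [pd_sub ((h 0 0).fun_mul (h 1 1)) ((h 0 1).fun_mul (h 1 0)), pd_mul (h 0 0) (h 1 1),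
    pd_mul (h 0 1) (h 1 0)]
  simp only [hG.pd_metric hy, ← h1, hG.symm y hy 1 0]
  ring

/-- The components `R_{s101}` of the curvature tensor and those with exchanged indices. -/
lemma lowered_curvature (hG : IsSmoothMetric n G O) (hn : 1 ≤ n) (hy : y ∈ O) (i j s : Fin 2) :
    ∑ l, G y s l * (pd i (christoffel G l j j) y - pd j (christoffel G l i j) y +
      ∑ m, (christoffel G m j j y * christoffel G l i m y -
        christoffel G m i j y * christoffel G l j m y)) =
    pd i (lowered G s j j) y - pd j (lowered G s i j) y +
      ((∑ m, christoffel G m s j y * lowered G m i j y) -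
        ∑ m, christoffel G m s i y * lowered G m j j y) := by
  have hdG : ∀ i j, DifferentiableAt ℝ (fun q => G q i j) y := fun i j =>
    (hG.contDiffAt y hy i j).differentiableAt (by norm_cast)
  have hdC : ∀ l i j, DifferentiableAt ℝ (christoffel G l i j) y := fun l i j =>
    (hG.contDiffAt_christoffel hy l i j).differentiableAt (by norm_cast; omega)
  have key : ∀ a b c, pd a (lowered G s b c) y =
      (pd a (fun q => G q s 0) y * christoffel G 0 b c y + G y s 0 * pd a (christoffel G 0 b c) y) +
      (pd a (fun q => G q s 1) y * christoffel G 1 b c y +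
        G y s 1 * pd a (christoffel G 1 b c) y) := by
    intro a b c
    have h1 : lowered G s b c =ᶠ[𝓝 y] fun q =>
        G q s 0 * christoffel G 0 b c q + G q s 1 * christoffel G 1 b c q := by
      filter_upwards [hG.mem_nhds hy] with q hq using (hG.sum_mul_christoffel hq s b c).symm
    rw [pd_congr h1 a, pd_add ((hdG s 0).fun_mul (hdC 0 b c)) ((hdG s 1).fun_mul (hdC 1 b c)),
      pd_mul (hdG s 0) (hdC 0 b c), pd_mul (hdG s 1) (hdC 1 b c)]
  rw [key, key]
  simp only [hG.pd_metric hy, Fin.sum_univ_two, ← hG.sum_mul_christoffel hy]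
  rw [hG.christoffel_symm hy _ s j, hG.christoffel_symm hy _ s i,
    hG.christoffel_symm hy _ s j, hG.christoffel_symm hy _ s i, hG.symm y hy 1 0]
  ring

/-- The components `R^l_{jij}` of the curvature tensor. -/
def _root_.DarbouxForm.curvature (G : Plane → Matrix (Fin 2) (Fin 2) ℝ) (i j l : Fin 2)
    (y : Plane) : ℝ :=
  pd i (christoffel G l j j) y - pd j (christoffel G l i j) y +
    ∑ m, (christoffel G m j j y * christoffel G l i m y -
      christoffel G m i j y * christoffel G l j m y)

lemma pd_lowered (hG : IsSmoothMetric n G O) (hn : 1 ≤ n) (hy : y ∈ O) (a s i j : Fin 2) :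
    pd a (lowered G s i j) y = (1 / 2) * (pd a (pd i fun q => G q s j) y +
      pd a (pd j fun q => G q s i) y - pd a (pd s fun q => G q i j) y) := by
  have h : ∀ a i j, DifferentiableAt ℝ (pd a fun q => G q i j) y := fun a i j =>
    ((hG.contDiffAt y hy i j).pd (m := n) (by norm_cast) a).differentiableAt
      (by norm_cast; omega)
  change pd a (fun q => (1 / 2) * (pd i (fun q => G q s j) q + pd j (fun q => G q s i) q -
    pd s (fun q => G q i j) q)) y = _
  rw [pd_const_mul _ (((h i s j).fun_add (h j s i)).fun_sub (h s i j)),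
    pd_sub ((h i s j).fun_add (h j s i)) (h s i j), pd_add (h i s j) (h j s i)]

/-- In dimension two, the curvature tensor with all indices lowered is determined by `K|g|`. -/
lemma sum_curvature (hG : IsSmoothMetric n G O) (hn : 1 ≤ n) (hy : y ∈ O) :
    (∑ l, G y 0 l * curvature G 0 1 l y = gaussCurv G y * (G y).det ∧
      ∑ l, G y 1 l * curvature G 0 1 l y = 0) ∧
    ∑ l, G y 0 l * curvature G 1 0 l y = 0 ∧
      ∑ l, G y 1 l * curvature G 1 0 l y = gaussCurv G y * (G y).det := by
  have hd := (hG.det_pos y hy).ne'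
  have hK : ∑ l, G y 0 l * curvature G 0 1 l y = gaussCurv G y * (G y).det := by
    rw [gaussCurv, div_mul_cancel₀ _ hd]; rfl
  have h2 : ∀ i j, ContDiffAt ℝ 2 (fun q => G q i j) y := fun i j =>
    (hG.contDiffAt y hy i j).of_le (by norm_cast; omega)
  have hcomm : ∀ i j, pd 1 (pd 0 fun q => G q i j) y = pd 0 (pd 1 fun q => G q i j) y :=
    fun i j => pd_comm (h2 i j) 1 0
  have hsymm : ∀ a b, pd a (pd b fun q => G q 1 0) y = pd a (pd b fun q => G q 0 1) y :=
    fun a b => pd_congr (pd_eventuallyEq (hG.symm_eventually hy 1 0) b) a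
  have key := fun i j s => hG.lowered_curvature hn hy i j s
  have hc := fun l => hG.christoffel_symm hy l 1 0
  simp only [hG.pd_lowered hn hy] at key
  refine ⟨⟨hK, ?_⟩, ?_, ?_⟩
  · refine (key 0 1 1).trans ?_
    simp only [← hG.sum_mul_christoffel hy, Fin.sum_univ_two, hcomm, hsymm, hc, hG.symm y hy 1 0]
    ring
  · refine (key 1 0 0).trans ?_
    simp only [← hG.sum_mul_christoffel hy, Fin.sum_univ_two, hcomm, hsymm, hc, hG.symm y hy 1 0]
    ring
  · rw [← hK]
    refine (key 1 0 1).trans (Eq.trans ?_ (key 0 1 0).symm)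
    simp only [← hG.sum_mul_christoffel hy, Fin.sum_univ_two, hcomm, hsymm, hc, hG.symm y hy 1 0]
    ring

lemma contDiffAt_covHess (hG : IsSmoothMetric n G O) (hy : y ∈ O) {z : Plane → ℝ}
    (hz : ContDiffAt ℝ (n + 2 : ℕ) z y) (i j : Fin 2) : ContDiffAt ℝ n (covHess G z i j) y := by
  refine ((hz.pd (m := (n + 1 : ℕ)) (by norm_cast) j).pd (by norm_cast) i).sub
    (ContDiffAt.sum fun l _ => ?_)
  exact (hG.contDiffAt_christoffel hy l i j).mul (hz.pd (by norm_cast; omega) l)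

/-- The equations of Codazzi, up to the curvature term. -/
lemma pd_covHess_sub (hG : IsSmoothMetric n G O) (hn : 1 ≤ n) (hy : y ∈ O) {z : Plane → ℝ}
    (hz : ContDiffAt ℝ 3 z y) (i j : Fin 2) :
    pd i (covHess G z j j) y - pd j (covHess G z i j) y = -(∑ l, curvature G i j l y * pd l z y) -
      ∑ l, christoffel G l j j y * covHess G z i l y +
      ∑ l, christoffel G l i j y * covHess G z j l y := by
  have hdC : ∀ l i j, DifferentiableAt ℝ (christoffel G l i j) y := fun l i j =>
    (hG.contDiffAt_christoffel hy l i j).differentiableAt (by norm_cast; omega)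
  have hz2 : ∀ i, ContDiffAt ℝ 2 (pd i z) y := fun i => hz.pd (by norm_num) i
  have hz1 : ∀ i, DifferentiableAt ℝ (pd i z) y := fun i => (hz2 i).differentiableAt (by norm_num)
  have hzz : ∀ i j, DifferentiableAt ℝ (pd i (pd j z)) y := fun i j =>
    ((hz2 j).pd (m := 1) (by norm_num) i).differentiableAt (by norm_num)
  have key : ∀ a b c, pd a (covHess G z b c) y = pd a (pd b (pd c z)) y -
      ((pd a (christoffel G 0 b c) y * pd 0 z y + christoffel G 0 b c y * pd a (pd 0 z) y) +
        (pd a (christoffel G 1 b c) y * pd 1 z y + christoffel G 1 b c y * pd a (pd 1 z) y)) := by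
    intro a b c
    change pd a (fun q => pd b (pd c z) q - ∑ l, christoffel G l b c q * pd l z q) y = _
    simp only [Fin.sum_univ_two]
    have h0 := (hdC 0 b c).fun_mul (hz1 0)
    have h1 := (hdC 1 b c).fun_mul (hz1 1)
    rw [pd_sub (hzz b c) (h0.fun_add h1), pd_add h0 h1, pd_mul (hdC 0 b c) (hz1 0),
      pd_mul (hdC 1 b c) (hz1 1)]
  have hsw : pd i (pd j (pd j z)) y = pd j (pd i (pd j z)) y := pd_comm (hz2 j) i j
  rw [key, key, hsw]
  simp only [curvature, Fin.sum_univ_two, covHess]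
  ring

/-- The first equation of Codazzi for `∇²z`. The commutator of the derivatives brings in the Gaussian
curvature, as a factor of the gradient of `z`. -/
lemma codazzi_zero (hG : IsSmoothMetric n G O) (hn : 1 ≤ n) (hy : y ∈ O) {z : Plane → ℝ}
    (hz : ContDiffAt ℝ 3 z y) :
    pd 0 (covHess G z 1 1) y - pd 1 (covHess G z 0 1) y =
      -(gaussCurv G y * (G y).det * ((G y)⁻¹ 0 0 * pd 0 z y + (G y)⁻¹ 0 1 * pd 1 z y)) -
      (christoffel G 0 1 1 y * covHess G z 0 0 y + christoffel G 1 1 1 y * covHess G z 0 1 y) +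
      (christoffel G 0 0 1 y * covHess G z 0 1 y + christoffel G 1 0 1 y * covHess G z 1 1 y) := by
  rw [hG.pd_covHess_sub hn hy hz]
  obtain ⟨⟨h1, h2⟩, -⟩ := hG.sum_curvature hn hy
  obtain ⟨i00, i01, -⟩ := inv_fin_two (G y)
  have hd := (hG.det_pos y hy).ne'
  have hdet := Matrix.det_fin_two (G y)
  have hs := hG.symm y hy 1 0
  have hcs : covHess G z 1 0 y = covHess G z 0 1 y := by
    simp only [covHess, hG.christoffel_symm hy _ 1 0]
    rw [pd_comm (hz.of_le (by norm_num)) 1 0]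
  simp only [Fin.sum_univ_two] at h1 h2 ⊢
  rw [i00, i01, hcs]
  have e0 : curvature G 0 1 0 y = gaussCurv G y * G y 1 1 := by
    apply mul_left_cancel₀ hd
    rw [hdet] at h1 ⊢
    linear_combination (G y 1 1) * h1 - (G y 0 1) * h2
  have e1 : curvature G 0 1 1 y = -(gaussCurv G y * G y 0 1) := by
    apply mul_left_cancel₀ hd
    rw [hdet] at h1 ⊢
    rw [hs] at h1 h2 ⊢
    linear_combination (G y 0 0) * h2 - (G y 0 1) * h1
  rw [e0, e1]
  field_simp

lemma covHess_symm (hG : IsSmoothMetric n G O) (hy : y ∈ O) {z : Plane → ℝ}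
    (hz : ContDiffAt ℝ 2 z y) : covHess G z 1 0 y = covHess G z 0 1 y := by
  simp only [covHess, hG.christoffel_symm hy _ 1 0]
  rw [pd_comm hz 1 0]

/-- The second equation of Codazzi for `∇²z`. -/
lemma codazzi_one (hG : IsSmoothMetric n G O) (hn : 1 ≤ n) (hy : y ∈ O) {z : Plane → ℝ}
    (hz : ContDiffAt ℝ 3 z y) :
    pd 1 (covHess G z 0 0) y - pd 0 (covHess G z 0 1) y =
      -(gaussCurv G y * (G y).det * ((G y)⁻¹ 1 0 * pd 0 z y + (G y)⁻¹ 1 1 * pd 1 z y)) -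
      (christoffel G 0 0 0 y * covHess G z 0 1 y + christoffel G 1 0 0 y * covHess G z 1 1 y) +
      (christoffel G 0 0 1 y * covHess G z 0 0 y + christoffel G 1 0 1 y * covHess G z 0 1 y) := by
  have hz2 : ∀ᶠ q in 𝓝 y, ContDiffAt ℝ 2 z q :=
    (hz.of_le (by norm_num : (2 : WithTop ℕ∞) ≤ 3)).eventually (by simp)
  have hev : covHess G z 0 1 =ᶠ[𝓝 y] covHess G z 1 0 := by
    filter_upwards [hG.mem_nhds hy, hz2] with q hq hzq using (hG.covHess_symm hq hzq).symm
  rw [pd_congr hev, hG.pd_covHess_sub hn hy hz]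
  obtain ⟨-, h1, h2⟩ := hG.sum_curvature hn hy
  obtain ⟨-, -, i10, i11⟩ := inv_fin_two (G y)
  have hd := (hG.det_pos y hy).ne'
  have hdet := Matrix.det_fin_two (G y)
  have hs := hG.symm y hy 1 0
  have hcs := hG.covHess_symm hy (hz.of_le (by norm_num : (2 : WithTop ℕ∞) ≤ 3))
  simp only [Fin.sum_univ_two, hG.christoffel_symm hy _ 1 0] at h1 h2 ⊢
  rw [i10, i11, hcs]
  have e0 : curvature G 1 0 0 y = -(gaussCurv G y * G y 0 1) := by
    apply mul_left_cancel₀ hd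
    rw [hdet] at h2 ⊢
    linear_combination (G y 1 1) * h1 - (G y 0 1) * h2
  have e1 : curvature G 1 0 1 y = gaussCurv G y * G y 0 0 := by
    apply mul_left_cancel₀ hd
    rw [hdet] at h2 ⊢
    rw [hs] at h2 ⊢
    linear_combination (G y 0 0) * h2 - (G y 0 1) * h1
  rw [e0, e1, hs]
  field_simp

end IsSmoothMetric

/-! ### The linearization of the Darboux operator -/

lemma contDiff_ofReal_smul {n : WithTop ℕ∞} {F : Type*} [NormedAddCommGroup F] [NormedSpace ℝ F]
    {f : Plane → F} {c : ℝ} {x : Plane} (hf : ContDiffAt ℝ n f (c • x)) :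
    ContDiffAt ℝ n (fun y => f (c • y)) x :=
  ContDiffAt.comp x hf (contDiff_const_smul c).contDiffAt

lemma pd_scaled (u : Plane → ℝ) (c a : ℝ) (i : Fin 2) :
    pd i (fun y => c * u (a • y)) = fun y => c * a * pd i u (a • y) := by
  ext y
  have h1 : pd i (fun y => c * u (a • y)) y = c * pd i (fun y => u (a • y)) y := by
    simp only [pd]
    change fderiv ℝ (c • fun y => u (a • y)) y (e i) = _
    rw [fderiv_const_smul_field]; rfl
  rw [h1, pd_comp_smul, smul_eq_mul, mul_assoc]

lemma pd_fun_add {f g : Plane → ℝ} {x : Plane} (hf : ContDiffAt ℝ 1 f x) (hg : ContDiffAt ℝ 1 g x)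
    (i : Fin 2) : pd i (fun y => f y + g y) =ᶠ[𝓝 x] fun y => pd i f y + pd i g y := by
  filter_upwards [hf.eventually (by simp), hg.eventually (by simp)] with y h1 h2 using
    pd_add (h1.differentiableAt (by simp)) (h2.differentiableAt (by simp)) i

lemma pd_pd_add {f g : Plane → ℝ} {x : Plane} (hf : ContDiffAt ℝ 2 f x) (hg : ContDiffAt ℝ 2 g x)
    (i j : Fin 2) : pd i (pd j fun y => f y + g y) x = pd i (pd j f) x + pd i (pd j g) x := by
  rw [pd_congr (pd_fun_add (hf.of_le (by norm_num)) (hg.of_le (by norm_num)) j) i,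
    pd_add ((hf.pd (m := 1) (by norm_num) j).differentiableAt (by simp))
      ((hg.pd (m := 1) (by norm_num) j).differentiableAt (by simp))]

section

variable {G : Plane → Matrix (Fin 2) (Fin 2) ℝ} {ζ : Plane → ℝ} {ε : ℝ} {w : Plane → ℝ} {x : Plane}

lemma scale_inv_smul (hε : ε ≠ 0) (x : Plane) : (ε ^ 2)⁻¹ • ε ^ 2 • x = x :=
  inv_smul_smul₀ (pow_ne_zero 2 hε) x

lemma contDiffAt_scaled {n : WithTop ℕ∞} {u : Plane → ℝ} (hε : ε ≠ 0) (hu : ContDiffAt ℝ n u x)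
    (c : ℝ) : ContDiffAt ℝ n (fun y => c * u ((ε ^ 2)⁻¹ • y)) (ε ^ 2 • x) :=
  contDiffAt_const.mul (contDiff_ofReal_smul (by rwa [scale_inv_smul hε]))

lemma contDiffAt_height {n : WithTop ℕ∞} (hε : ε ≠ 0) (hζ : ContDiffAt ℝ n ζ (ε ^ 2 • x))
    (hw : ContDiffAt ℝ n w x) : ContDiffAt ℝ n (height ζ ε w) (ε ^ 2 • x) :=
  hζ.add (contDiffAt_scaled hε hw _)

lemma pd_height (hε : ε ≠ 0) (hζ : DifferentiableAt ℝ ζ (ε ^ 2 • x)) (hw : DifferentiableAt ℝ w x)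
    (i : Fin 2) : pd i (height ζ ε w) (ε ^ 2 • x) = pd i ζ (ε ^ 2 • x) + ε ^ 3 * pd i w x := by
  have h1 : DifferentiableAt ℝ (fun y : Plane => ε ^ 5 * w ((ε ^ 2)⁻¹ • y)) (ε ^ 2 • x) := by
    refine (DifferentiableAt.comp _ (g := w) (f := fun y : Plane => (ε ^ 2)⁻¹ • y) ?_
      (differentiableAt_id.const_smul ((ε ^ 2)⁻¹ : ℝ))).const_mul _
    rwa [scale_inv_smul hε]
  change pd i (fun y => ζ y + ε ^ 5 * w ((ε ^ 2)⁻¹ • y)) _ = _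
  rw [pd_add hζ h1, pd_scaled]
  simp only [scale_inv_smul hε]
  congr 2
  field_simp

lemma pd_pd_height (hε : ε ≠ 0) (hζ : ContDiffAt ℝ 2 ζ (ε ^ 2 • x)) (hw : ContDiffAt ℝ 2 w x)
    (i j : Fin 2) : pd i (pd j (height ζ ε w)) (ε ^ 2 • x) =
      pd i (pd j ζ) (ε ^ 2 • x) + ε * pd i (pd j w) x := by
  change pd i (pd j (fun y => ζ y + ε ^ 5 * w ((ε ^ 2)⁻¹ • y))) _ = _
  rw [pd_pd_add hζ (contDiffAt_scaled hε hw _), pd_scaled, pd_scaled]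
  simp only [scale_inv_smul hε]
  congr 2
  field_simp

/-- The first-order coefficients of the linearization of `Φ` at `w` enter through the covariant
derivatives of the variation. -/
lemma hasDerivAt_Phi (hε : ε ≠ 0) (hs : ∀ i j, (G (ε ^ 2 • x))⁻¹ i j = (G (ε ^ 2 • x))⁻¹ j i)
    (hζ : ContDiffAt ℝ 2 ζ (ε ^ 2 • x)) (hw : ContDiffAt ℝ 2 w x)
    (hc : covHess G (height ζ ε w) 1 0 (ε ^ 2 • x) = covHess G (height ζ ε w) 0 1 (ε ^ 2 • x))
    (hΓ : ∀ l, christoffel G l 1 0 (ε ^ 2 • x) = christoffel G l 0 1 (ε ^ 2 • x))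
    {u : Plane → ℝ} (hu : ContDiffAt ℝ 2 u x) :
    HasDerivAt (fun t : ℝ => Phi G ζ ε (fun p => w p + t * u p) x)
      (ε * (covHess G (height ζ ε w) 1 1 (ε ^ 2 • x) * (pd 0 (pd 0 u) x -
            ε ^ 2 * ∑ l, christoffel G l 0 0 (ε ^ 2 • x) * pd l u x) -
        2 * covHess G (height ζ ε w) 0 1 (ε ^ 2 • x) * (pd 0 (pd 1 u) x -
            ε ^ 2 * ∑ l, christoffel G l 0 1 (ε ^ 2 • x) * pd l u x) +
        covHess G (height ζ ε w) 0 0 (ε ^ 2 • x) * (pd 1 (pd 1 u) x -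
            ε ^ 2 * ∑ l, christoffel G l 1 1 (ε ^ 2 • x) * pd l u x) +
        2 * ε ^ 2 * gaussCurv G (ε ^ 2 • x) * (G (ε ^ 2 • x)).det *
          ∑ i, ∑ j, (G (ε ^ 2 • x))⁻¹ i j * pd i (height ζ ε w) (ε ^ 2 • x) * pd j u x)) 0 := by
  have hd : ∀ t : ℝ, ContDiffAt ℝ 2 (fun p => w p + t * u p) x := fun t =>
    hw.add (contDiffAt_const.mul hu)
  have hd1 : ∀ {f : Plane → ℝ} {y : Plane}, ContDiffAt ℝ 2 f y → DifferentiableAt ℝ f y := fun h =>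
    h.differentiableAt (by norm_num)
  have h1 : ∀ t i, pd i (height ζ ε (fun p => w p + t * u p)) (ε ^ 2 • x) =
      pd i (height ζ ε w) (ε ^ 2 • x) + t * (ε ^ 3 * pd i u x) := by
    intro t i
    rw [pd_height hε (hd1 hζ) (hd1 (hd t)), pd_height hε (hd1 hζ) (hd1 hw),
      pd_add (hd1 hw) ((hd1 hu).const_mul t), pd_const_mul t (hd1 hu)]
    ring
  have h2 : ∀ t i j, covHess G (height ζ ε (fun p => w p + t * u p)) i j (ε ^ 2 • x) =
      covHess G (height ζ ε w) i j (ε ^ 2 • x) + t * (ε * (pd i (pd j u) x -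
            ε ^ 2 * ∑ l, christoffel G l i j (ε ^ 2 • x) * pd l u x)) := by
    intro t i j
    have h3 : pd i (pd j fun y => t * u y) x = t * pd i (pd j u) x := by
      have := pd_scaled u t 1
      simp only [one_smul, mul_one] at this
      rw [this, pd_const_mul t ((hu.pd (m := 1) (by norm_num) j).differentiableAt (by simp))]
    simp only [covHess, h1, Fin.sum_univ_two]
    rw [pd_pd_height hε hζ (hd t), pd_pd_height hε hζ hw, pd_pd_add hw (contDiffAt_const.mul hu), h3]
    ring
  have h4 : pd 1 (pd 0 u) x = pd 0 (pd 1 u) x := pd_comm hu 1 0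
  have key : (fun t : ℝ => Phi G ζ ε (fun p => w p + t * u p) x) = fun t =>
      Phi G ζ ε w x + t * (ε * (covHess G (height ζ ε w) 1 1 (ε ^ 2 • x) * (pd 0 (pd 0 u) x -
            ε ^ 2 * ∑ l, christoffel G l 0 0 (ε ^ 2 • x) * pd l u x) -
        2 * covHess G (height ζ ε w) 0 1 (ε ^ 2 • x) * (pd 0 (pd 1 u) x -
            ε ^ 2 * ∑ l, christoffel G l 0 1 (ε ^ 2 • x) * pd l u x) +
        covHess G (height ζ ε w) 0 0 (ε ^ 2 • x) * (pd 1 (pd 1 u) x -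
            ε ^ 2 * ∑ l, christoffel G l 1 1 (ε ^ 2 • x) * pd l u x) +
        2 * ε ^ 2 * gaussCurv G (ε ^ 2 • x) * (G (ε ^ 2 • x)).det *
          ∑ i, ∑ j, (G (ε ^ 2 • x))⁻¹ i j * pd i (height ζ ε w) (ε ^ 2 • x) * pd j u x)) +
      t ^ 2 * (ε ^ 2 * ((pd 0 (pd 0 u) x -
            ε ^ 2 * ∑ l, christoffel G l 0 0 (ε ^ 2 • x) * pd l u x) * (pd 1 (pd 1 u) x -
            ε ^ 2 * ∑ l, christoffel G l 1 1 (ε ^ 2 • x) * pd l u x) - (pd 0 (pd 1 u) x -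
            ε ^ 2 * ∑ l, christoffel G l 0 1 (ε ^ 2 • x) * pd l u x) ^ 2) +
        ε ^ 6 * gaussCurv G (ε ^ 2 • x) * (G (ε ^ 2 • x)).det *
          ∑ i, ∑ j, (G (ε ^ 2 • x))⁻¹ i j * pd i u x * pd j u x) := by
    ext t
    simp only [Phi, darboux, gradSq, Matrix.det_fin_two (Matrix.of _),
      Matrix.of_apply, h2, h1, Fin.sum_univ_two, hΓ, h4, hc, hs 1 0]
    ring
  rw [key]
  set c₁ : ℝ := ε * _
  set c₂ : ℝ := ε ^ 2 * _ + _
  have h5 := (((hasDerivAt_id' (0 : ℝ)).mul_const c₁).const_add (Phi G ζ ε w x)).fun_add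
    ((hasDerivAt_pow 2 (0 : ℝ)).mul_const c₂)
  simpa using h5

end

/-! ### The canonical form of the linearization -/

section Chart

variable {ξ : OpenPartialHomeomorph Plane Plane} {F : Plane → ℝ} {lam : ℝ} {x : Plane}

/-- The chain rule in the coordinates `ξ = (λ F, x²)`. -/
lemma pdChart_eq (hsymm : ∀ η ∈ ξ.target, DifferentiableAt ℝ ξ.symm η)
    (hξ : ∀ x, ξ x = pt (lam * F x) (x 1)) (hx : x ∈ ξ.source) (hF : DifferentiableAt ℝ F x)
    (hF0 : pd 0 F x ≠ 0) (hlam : lam ≠ 0) {f : Plane → ℝ} (hf : DifferentiableAt ℝ f x) :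
    pdChart ξ 0 f x = pd 0 f x / (lam * pd 0 F x) ∧
      pdChart ξ 1 f x = pd 1 f x - pd 1 F x / pd 0 F x * pd 0 f x := by
  have hξe : (ξ : Plane → Plane) = fun x => (lam * F x) • e 0 + x 1 • e 1 := by
    ext1 y; rw [hξ, pt_eq]
  have hl : DifferentiableAt ℝ (fun y => lam * F y) x := hF.const_mul lam
  have hξd : DifferentiableAt ℝ ξ x := by
    rw [hξe]
    exact (hl.smul_const (e 0)).add ((coord 1).differentiableAt.smul_const (e 1))
  have hc : ∀ i, pd i ξ x 0 = lam * pd i F x ∧ pd i ξ x 1 = if i = 1 then 1 else 0 := by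
    intro i
    rw [← pd_apply hξd, ← pd_apply hξd]
    constructor
    · have : (fun y => ξ y 0) = fun y => lam * F y := by ext y; rw [hξ, pt_zero]
      rw [this, pd_const_mul _ hF]
    · have : (fun y => ξ y 1) = fun y => y 1 := by ext y; rw [hξ, pt_one]
      rw [this, pd_coord]
  have hleft : ξ.symm (ξ x) = x := ξ.left_inv hx
  have hg : DifferentiableAt ℝ (fun η => f (ξ.symm η)) (ξ x) :=
    DifferentiableAt.comp (ξ x) (by rwa [hleft]) (hsymm _ (ξ.map_source hx))
  have hev : f =ᶠ[𝓝 x] fun y => (fun η => f (ξ.symm η)) (ξ y) := by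
    filter_upwards [ξ.open_source.mem_nhds hx] with y hy
    simp only [ξ.left_inv hy]
  have key : ∀ i, pd i f x = pd i ξ x 0 * pdChart ξ 0 f x + pd i ξ x 1 * pdChart ξ 1 f x := by
    intro i
    rw [pd_congr hev i, pd_comp_plane i hg hξd]
    rfl
  have k0 := key 0
  have k1 := key 1
  simp only [(hc 0).1, (hc 0).2, (hc 1).1, (hc 1).2] at k0 k1
  simp only [zero_ne_one, if_false, zero_mul, add_zero, if_true, one_mul] at k0 k1
  have e0 : pdChart ξ 0 f x = pd 0 f x / (lam * pd 0 F x) := by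
    rw [k0]; field_simp
  refine ⟨e0, ?_⟩
  rw [k1, e0]
  field_simp
  ring

/-- The operator `L` in the variable `x`, for `k = H (λ F₁ / p)²` and `F` constant on the
integral curves of `∂₂ - (q / p) ∂₁`. -/
lemma opL_eq (hsymm : ∀ η ∈ ξ.target, DifferentiableAt ℝ ξ.symm η)
    (hξ : ∀ x, ξ x = pt (lam * F x) (x 1)) (hx : x ∈ ξ.source)
    (hF : ∀ y ∈ ξ.source, ContDiffAt ℝ 2 F y) (hF0 : ∀ y ∈ ξ.source, pd 0 F y ≠ 0) (hlam : lam ≠ 0)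
    {p q H k c d u : Plane → ℝ} (hp : ∀ y ∈ ξ.source, DifferentiableAt ℝ p y)
    (hp0 : ∀ y ∈ ξ.source, p y ≠ 0) (hq : ∀ y ∈ ξ.source, DifferentiableAt ℝ q y)
    (hpq : ∀ y ∈ ξ.source, p y * pd 1 F y = q y * pd 0 F y) (hH : DifferentiableAt ℝ H x)
    (hk : ∀ y ∈ ξ.source, k y = H y * (lam * pd 0 F y) ^ 2 / p y ^ 2)
    (hu : ∀ y ∈ ξ.source, ContDiffAt ℝ 2 u y) :
    opL ξ k c d u x = H x / p x ^ 2 * pd 0 (pd 0 u) x +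
      (pd 0 H x / p x ^ 2 + H x * pd 0 (pd 0 F) x / (pd 0 F x * p x ^ 2) -
        2 * H x * pd 0 p x / p x ^ 3) * pd 0 u x +
      (pd 1 (pd 1 u) x - 2 * (q x / p x) * pd 0 (pd 1 u) x + (q x / p x) ^ 2 * pd 0 (pd 0 u) x +
        (-pd 1 q x / p x + q x * pd 1 p x / p x ^ 2 +
          q x / p x * (pd 0 q x / p x - q x * pd 0 p x / p x ^ 2)) * pd 0 u x) +
      c x * (pd 0 u x / (lam * pd 0 F x)) + d x * (pd 1 u x - q x / p x * pd 0 u x) := by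
  have hmem := ξ.open_source.mem_nhds hx
  have d1 : ∀ {f : Plane → ℝ} {y : Plane}, ContDiffAt ℝ 2 f y → DifferentiableAt ℝ f y := fun h =>
    h.differentiableAt (by norm_num)
  have d2 : ∀ {f : Plane → ℝ} {y : Plane}, ContDiffAt ℝ 2 f y → ∀ i, DifferentiableAt ℝ (pd i f) y :=
    fun h i => (h.pd (m := 1) (by norm_num) i).differentiableAt (by norm_num)
  have hC : ∀ {f : Plane → ℝ} {y : Plane}, y ∈ ξ.source → DifferentiableAt ℝ f y →
      pdChart ξ 0 f y = pd 0 f y / (lam * pd 0 F y) ∧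
      pdChart ξ 1 f y = pd 1 f y - q y / p y * pd 0 f y := by
    intro f y hy hf
    have h := pdChart_eq hsymm hξ hy (d1 (hF y hy)) (hF0 y hy) hlam hf
    have e1 : pd 1 F y / pd 0 F y = q y / p y := by
      rw [div_eq_div_iff (hF0 y hy) (hp0 y hy)]
      linear_combination hpq y hy
    rwa [e1] at h
  have hinv : ∀ {f : Plane → ℝ}, DifferentiableAt ℝ f x → f x ≠ 0 → ∀ i,
      pd i (fun y => (f y)⁻¹) x = -(f x ^ 2)⁻¹ * pd i f x ∧
        DifferentiableAt ℝ (fun y => (f y)⁻¹) x := fun hf h0 i =>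
    ⟨pd_comp_real hf (hasDerivAt_inv h0) i, hf.inv h0⟩
  have hpx := hp x hx
  have hqx := hq x hx
  have hp0x := hp0 x hx
  have hF1x := d2 (hF x hx) 0
  have hF0x := hF0 x hx
  have hux := hu x hx
  obtain ⟨hpi, hpid⟩ := hinv hpx hp0x 0
  obtain ⟨hpi1, -⟩ := hinv hpx hp0x 1
  -- the term with `k`
  have t1 : pdChart ξ 0 (fun y => k y * pdChart ξ 0 u y) x = H x / p x ^ 2 * pd 0 (pd 0 u) x +
      (pd 0 H x / p x ^ 2 + H x * pd 0 (pd 0 F) x / (pd 0 F x * p x ^ 2) -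
        2 * H x * pd 0 p x / p x ^ 3) * pd 0 u x := by
    have hev : (fun y => k y * pdChart ξ 0 u y) =ᶠ[𝓝 x] fun y =>
        lam * ((H y * pd 0 F y) * (((p y)⁻¹ * (p y)⁻¹) * pd 0 u y)) := by
      filter_upwards [hmem] with y hy
      rw [hk y hy, (hC hy (d1 (hu y hy))).1]
      have := hF0 y hy
      have := hp0 y hy
      field_simp
    have m1 := hH.fun_mul hF1x
    have m2 := hpid.fun_mul hpid
    have m3 := m2.fun_mul (d2 hux 0)
    have hd : DifferentiableAt ℝ (fun y => k y * pdChart ξ 0 u y) x :=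
      ((m1.fun_mul m3).const_mul lam).congr_of_eventuallyEq hev
    rw [(hC hx hd).1, pd_congr hev 0, pd_const_mul _ (m1.fun_mul m3), pd_mul m1 m3, pd_mul hH hF1x,
      pd_mul m2 (d2 hux 0), pd_mul hpid hpid, hpi]
    field_simp
    ring
  -- the second derivative along the integral curves
  have t2 : pdChart ξ 1 (pdChart ξ 1 u) x = pd 1 (pd 1 u) x - 2 * (q x / p x) * pd 0 (pd 1 u) x +
      (q x / p x) ^ 2 * pd 0 (pd 0 u) x + (-pd 1 q x / p x + q x * pd 1 p x / p x ^ 2 +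
          q x / p x * (pd 0 q x / p x - q x * pd 0 p x / p x ^ 2)) * pd 0 u x := by
    have hev : pdChart ξ 1 u =ᶠ[𝓝 x] fun y => pd 1 u y - (q y * (p y)⁻¹) * pd 0 u y := by
      filter_upwards [hmem] with y hy
      rw [(hC hy (d1 (hu y hy))).2, div_eq_mul_inv]
    have m1 := hqx.fun_mul hpid
    have m2 := m1.fun_mul (d2 hux 0)
    have hd : DifferentiableAt ℝ (pdChart ξ 1 u) x :=
      ((d2 hux 1).fun_sub m2).congr_of_eventuallyEq hev
    rw [(hC hx hd).2, pd_congr hev 0, pd_congr hev 1, pd_sub (d2 hux 1) m2, pd_sub (d2 hux 1) m2,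
      pd_mul m1 (d2 hux 0), pd_mul m1 (d2 hux 0), pd_mul hqx hpid, pd_mul hqx hpid, hpi, hpi1,
      pd_comm hux 1 0]
    field_simp
    ring
  rw [opL, t1, t2, (hC hx (d1 hux)).1, (hC hx (d1 hux)).2]

end Chart

section Coefficients

variable (G : Plane → Matrix (Fin 2) (Fin 2) ℝ) (ζ : Plane → ℝ)

/-- `∂_l z` as a function of the jet of `w`. -/
def gradArg (l : Fin 2) (a : ArgD) : ℝ := pd l ζ (a.1 ^ 2 • a.2.1) + a.1 ^ 3 * a.2.2.2.1 l

/-- `∇_{ij} z` as a function of the jet of `w`. -/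
def hessArg (i j : Fin 2) (a : ArgD) : ℝ :=
  pd i (pd j ζ) (a.1 ^ 2 • a.2.1) + a.1 * a.2.2.2.2 i j -
    ∑ l, christoffel G l i j (a.1 ^ 2 • a.2.1) * gradArg ζ l a

/-- `|g| (1 - |∇z|²)` as a function of the jet of `w`. -/
def areaArg (a : ArgD) : ℝ :=
  (G (a.1 ^ 2 • a.2.1)).det *
    (1 - ∑ i, ∑ j, (G (a.1 ^ 2 • a.2.1))⁻¹ i j * gradArg ζ i a * gradArg ζ j a)

/-- `∂_{x¹} ∇_{11} z` as a function of the jet of `w`. -/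
def thirdArg (a : ArgD) (w₃ : Fin 2 → Fin 2 → Fin 2 → ℝ) : ℝ :=
  a.1 ^ 2 * pd 0 (pd 0 (pd 0 ζ)) (a.1 ^ 2 • a.2.1) + a.1 * w₃ 0 0 0 -
    ∑ l, (a.1 ^ 2 * pd 0 (christoffel G l 0 0) (a.1 ^ 2 • a.2.1) * gradArg ζ l a +
      christoffel G l 0 0 (a.1 ^ 2 • a.2.1) *
        (a.1 ^ 2 * pd 0 (pd l ζ) (a.1 ^ 2 • a.2.1) + a.1 ^ 3 * a.2.2.2.2 0 l))

/-- The coefficient `k̄ = |g| (1 - |∇z|²) (∂_{x¹}ξ¹)² / (∇₁₁z)²`. -/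
def kbarFun (a : ArgK) : ℝ := areaArg G ζ a.1 * (a.2 0 0) ^ 2 / (hessArg G ζ 0 0 a.1) ^ 2

/-- The coefficient `d̄`: the factor of `∂_{x²}u` in `ε⁻¹ 𝓛(w)u` is `ε² (∇₁₁z) d̄`. It does not
depend on `ξ`, because `ξ² = x²`. -/
def dbarFun (a : ArgD) : ℝ :=
  (-(hessArg G ζ 1 1 a * christoffel G 1 0 0 (a.1 ^ 2 • a.2.1) -
        2 * hessArg G ζ 0 1 a * christoffel G 1 0 1 (a.1 ^ 2 • a.2.1) +
        hessArg G ζ 0 0 a * christoffel G 1 1 1 (a.1 ^ 2 • a.2.1)) +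
    2 * gaussCurv G (a.1 ^ 2 • a.2.1) * (G (a.1 ^ 2 • a.2.1)).det *
      ∑ i, (G (a.1 ^ 2 • a.2.1))⁻¹ i 1 * gradArg ζ i a) / hessArg G ζ 0 0 a

/-- The coefficient `c̄`. It involves no derivative of `K`: these are absorbed in the derivative of
`Φ(w)` by the equations of Codazzi. -/
def cbarFun (a : ArgC) : ℝ :=
  a.2.2.1 0 0 *
      (3 * a.1.1 ^ 2 * (G (a.1.1 ^ 2 • a.1.2.1)).det *
          ((∑ i, (G (a.1.1 ^ 2 • a.1.2.1))⁻¹ 0 i * gradArg ζ i a.1) / hessArg G ζ 0 0 a.1 +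
            hessArg G ζ 0 1 a.1 * (∑ i, (G (a.1.1 ^ 2 • a.1.2.1))⁻¹ 1 i * gradArg ζ i a.1) /
              hessArg G ζ 0 0 a.1 ^ 2) +
        areaArg G ζ a.1 * (thirdArg G ζ a.1 a.2.1 / hessArg G ζ 0 0 a.1 ^ 3 -
          a.1.1 ^ 2 * (christoffel G 0 0 0 (a.1.1 ^ 2 • a.1.2.1) +
            christoffel G 1 0 1 (a.1.1 ^ 2 • a.1.2.1)) / hessArg G ζ 0 0 a.1 ^ 2)) -
    areaArg G ζ a.1 * a.2.2.2 0 0 0 / hessArg G ζ 0 0 a.1 ^ 2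

variable {G ζ}

namespace IsSmoothMetric

variable {n : ℕ} {O : Set Plane} {y : Plane}

lemma contDiffAt_gaussCurv (hG : IsSmoothMetric (n + 1) G O) (hy : y ∈ O) :
    ContDiffAt ℝ n (gaussCurv G) y := by
  have hC : ∀ l i j, ContDiffAt ℝ n (christoffel G l i j) y := fun l i j =>
    (hG.contDiffAt_christoffel hy l i j).of_le (by norm_cast; omega)
  have hdC : ∀ a l i j, ContDiffAt ℝ n (pd a (christoffel G l i j)) y := fun a l i j =>
    (hG.contDiffAt_christoffel hy l i j).pd (by norm_cast) a
  refine ContDiffAt.div (ContDiffAt.sum fun l _ => ?_)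
    ((hG.contDiffAt_det hy).of_le (by norm_cast; omega)) (hG.det_pos y hy).ne'
  refine ((hG.contDiffAt y hy 0 l).of_le (by norm_cast; omega)).mul
    (((hdC 0 l 1 1).sub (hdC 1 l 0 1)).add (ContDiffAt.sum fun s _ => ?_))
  exact ((hC s 1 1).mul (hC l 0 s)).sub ((hC s 0 1).mul (hC l 1 s))

end IsSmoothMetric

section Smoothness

variable {m : ℕ} {O : Set Plane}

lemma contDiff_point : ContDiff ℝ ∞ fun a : ArgD => a.1 ^ 2 • a.2.1 :=
  (contDiff_fst.pow 2).smul contDiff_snd.fst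

lemma contDiffAt_comp_point {n : ℕ} {f : Plane → ℝ} {a : ArgD}
    (hf : ContDiffAt ℝ n f (a.1 ^ 2 • a.2.1)) :
    ContDiffAt ℝ n (fun a : ArgD => f (a.1 ^ 2 • a.2.1)) a :=
  ContDiffAt.comp a hf ((contDiff_point.of_le (by exact_mod_cast le_top)).contDiffAt)

lemma contDiff_eps {n : ℕ} (k : ℕ) : ContDiff ℝ n fun a : ArgD => a.1 ^ k := contDiff_fst.pow k

lemma contDiff_jet_one {n : ℕ} (l : Fin 2) : ContDiff ℝ n fun a : ArgD => a.2.2.2.1 l :=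
  contDiff_pi.1 (contDiff_snd.snd.snd.fst) l

lemma contDiff_jet_two {n : ℕ} (i j : Fin 2) : ContDiff ℝ n fun a : ArgD => a.2.2.2.2 i j :=
  contDiff_pi.1 (contDiff_pi.1 (contDiff_snd.snd.snd.snd) i) j

lemma contDiffAt_gradArg (hζ : ContDiff ℝ ∞ ζ) {n : ℕ} (l : Fin 2) (a : ArgD) :
    ContDiffAt ℝ n (gradArg ζ l) a :=
  (contDiffAt_comp_point (contDiff_nat_of_infty (contDiff_infty_pd hζ l) n).contDiffAt).add
    ((contDiff_eps 3).mul (contDiff_jet_one l)).contDiffAt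

variable {a : ArgD}

lemma contDiffAt_hessArg (hG : IsSmoothMetric (m + 2) G O) (hζ : ContDiff ℝ ∞ ζ)
    (ha : a.1 ^ 2 • a.2.1 ∈ O) (i j : Fin 2) : ContDiffAt ℝ m (hessArg G ζ i j) a := by
  refine ((contDiffAt_comp_point (contDiff_nat_of_infty
    (contDiff_infty_pd (contDiff_infty_pd hζ j) i) m).contDiffAt).add
    (contDiff_fst.mul (contDiff_jet_two i j)).contDiffAt).sub (ContDiffAt.sum fun l _ => ?_)
  exact (contDiffAt_comp_point ((hG.contDiffAt_christoffel ha l i j).of_le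
    (by norm_cast; omega))).mul (contDiffAt_gradArg hζ l a)

lemma contDiffAt_det_point (hG : IsSmoothMetric (m + 2) G O) (ha : a.1 ^ 2 • a.2.1 ∈ O) :
    ContDiffAt ℝ m (fun a : ArgD => (G (a.1 ^ 2 • a.2.1)).det) a :=
  contDiffAt_comp_point (f := fun q => (G q).det)
    ((hG.contDiffAt_det ha).of_le (by norm_cast; omega))

lemma contDiffAt_inv_point (hG : IsSmoothMetric (m + 2) G O) (ha : a.1 ^ 2 • a.2.1 ∈ O)
    (i j : Fin 2) : ContDiffAt ℝ m (fun a : ArgD => (G (a.1 ^ 2 • a.2.1))⁻¹ i j) a :=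
  contDiffAt_comp_point (f := fun q => (G q)⁻¹ i j)
    ((hG.contDiffAt_inv ha i j).of_le (by norm_cast; omega))

lemma contDiffAt_christoffel_point (hG : IsSmoothMetric (m + 2) G O) (ha : a.1 ^ 2 • a.2.1 ∈ O)
    (l i j : Fin 2) : ContDiffAt ℝ m (fun a : ArgD => christoffel G l i j (a.1 ^ 2 • a.2.1)) a :=
  contDiffAt_comp_point ((hG.contDiffAt_christoffel ha l i j).of_le (by norm_cast; omega))

lemma contDiffAt_areaArg (hG : IsSmoothMetric (m + 2) G O) (hζ : ContDiff ℝ ∞ ζ)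
    (ha : a.1 ^ 2 • a.2.1 ∈ O) : ContDiffAt ℝ m (areaArg G ζ) a := by
  refine (contDiffAt_det_point hG ha).mul (contDiffAt_const.sub
    (ContDiffAt.sum fun i _ => ContDiffAt.sum fun j _ => ?_))
  exact ((contDiffAt_inv_point hG ha i j).mul (contDiffAt_gradArg hζ i a)).mul
    (contDiffAt_gradArg hζ j a)

lemma contDiffAt_dbarFun (hG : IsSmoothMetric (m + 2) G O) (hζ : ContDiff ℝ ∞ ζ)
    (ha : a.1 ^ 2 • a.2.1 ∈ O) (hp : hessArg G ζ 0 0 a ≠ 0) : ContDiffAt ℝ m (dbarFun G ζ) a := by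
  have hh := contDiffAt_hessArg hG hζ ha
  have hC := contDiffAt_christoffel_point hG ha
  have hK : ContDiffAt ℝ m (fun a : ArgD => gaussCurv G (a.1 ^ 2 • a.2.1)) a :=
    contDiffAt_comp_point ((IsSmoothMetric.contDiffAt_gaussCurv hG ha).of_le (by norm_cast; omega))
  refine ContDiffAt.div ?_ (hh 0 0) hp
  refine ((((hh 1 1).mul (hC 1 0 0)).sub ((contDiffAt_const.mul (hh 0 1)).mul (hC 1 0 1))).add
    ((hh 0 0).mul (hC 1 1 1))).neg.add (((contDiffAt_const.mul hK).mul
      (contDiffAt_det_point hG ha)).mul (ContDiffAt.sum fun i _ => ?_))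
  exact (contDiffAt_inv_point hG ha i 1).mul (contDiffAt_gradArg hζ i a)

lemma contDiff_coord_of_pi {E : Type*} [NormedAddCommGroup E] [NormedSpace ℝ E] {n : WithTop ℕ∞}
    {f : E → Plane} (hf : ContDiff ℝ n f) (i : Fin 2) : ContDiff ℝ n fun x => f x i :=
  (contDiff_coord i).comp hf

lemma contDiffAt_kbarFun (hG : IsSmoothMetric (m + 2) G O) (hζ : ContDiff ℝ ∞ ζ) {b : ArgK}
    (ha : b.1.1 ^ 2 • b.1.2.1 ∈ O) (hp : hessArg G ζ 0 0 b.1 ≠ 0) :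
    ContDiffAt ℝ m (kbarFun G ζ) b := by
  have hh := (contDiffAt_hessArg hG hζ ha 0 0).comp b contDiffAt_fst
  have hA := (contDiffAt_areaArg hG hζ ha).comp b contDiffAt_fst
  have h2 : ContDiff ℝ m fun b : ArgK => b.2 0 0 :=
    contDiff_coord_of_pi (contDiff_pi.1 contDiff_snd 0) 0
  exact (hA.mul (h2.contDiffAt.pow 2)).div (hh.pow 2) (pow_ne_zero 2 hp)

lemma contDiffAt_cbarFun (hG : IsSmoothMetric (m + 2) G O) (hζ : ContDiff ℝ ∞ ζ) {b : ArgC}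
    (ha : b.1.1 ^ 2 • b.1.2.1 ∈ O) (hp : hessArg G ζ 0 0 b.1 ≠ 0) :
    ContDiffAt ℝ m (cbarFun G ζ) b := by
  have hb : ContDiffAt ℝ m (fun b : ArgC => b.1) b := contDiffAt_fst
  have hp' := (contDiffAt_hessArg hG hζ ha 0 0).comp b hb
  have hq' := (contDiffAt_hessArg hG hζ ha 0 1).comp b hb
  have hA := (contDiffAt_areaArg hG hζ ha).comp b hb
  have hC := fun l i j => (contDiffAt_christoffel_point hG ha l i j).comp b hb
  have hD := (contDiffAt_det_point hG ha).comp b hb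
  have hg := fun l => (contDiffAt_gradArg (n := m) hζ l b.1).comp b hb
  have hI := fun i j => (contDiffAt_inv_point hG ha i j).comp b hb
  have hs : ∀ k, ContDiffAt ℝ m (fun b : ArgC => ∑ i, (G (b.1.1 ^ 2 • b.1.2.1))⁻¹ k i *
      gradArg ζ i b.1) b := fun k => ContDiffAt.sum fun i _ => (hI k i).mul (hg i)
  have he : ∀ k, ContDiffAt ℝ m (fun b : ArgC => b.1.1 ^ k) b := fun k =>
    (contDiff_fst.fst.pow k).contDiffAt
  have hx1 : ContDiff ℝ m fun b : ArgC => b.2.2.1 0 0 :=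
    contDiff_coord_of_pi (contDiff_pi.1 contDiff_snd.snd.fst 0) 0
  have hx2 : ContDiff ℝ m fun b : ArgC => b.2.2.2 0 0 0 :=
    contDiff_coord_of_pi (contDiff_pi.1 (contDiff_pi.1 contDiff_snd.snd.snd 0) 0) 0
  have hw3 : ContDiff ℝ m fun b : ArgC => b.2.1 0 0 0 :=
    contDiff_pi.1 (contDiff_pi.1 (contDiff_pi.1 contDiff_snd.fst 0) 0) 0
  have hw2 : ∀ l, ContDiffAt ℝ m (fun b : ArgC => b.1.2.2.2.2 0 l) b := fun l =>
    ((contDiff_jet_two 0 l).contDiffAt).comp b hb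
  have hζ3 : ContDiffAt ℝ m (fun b : ArgC => pd 0 (pd 0 (pd 0 ζ)) (b.1.1 ^ 2 • b.1.2.1)) b :=
    (contDiffAt_comp_point (contDiff_nat_of_infty (contDiff_infty_pd (contDiff_infty_pd
      (contDiff_infty_pd hζ 0) 0) 0) m).contDiffAt).comp b hb
  have hζ2 : ∀ l, ContDiffAt ℝ m (fun b : ArgC => pd 0 (pd l ζ) (b.1.1 ^ 2 • b.1.2.1)) b := fun l =>
    (contDiffAt_comp_point (contDiff_nat_of_infty (contDiff_infty_pd
      (contDiff_infty_pd hζ l) 0) m).contDiffAt).comp b hb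
  have hdC : ∀ l, ContDiffAt ℝ m (fun b : ArgC => pd 0 (christoffel G l 0 0)
      (b.1.1 ^ 2 • b.1.2.1)) b := fun l =>
    (contDiffAt_comp_point ((hG.contDiffAt_christoffel ha l 0 0).pd
      (by norm_cast; omega) 0)).comp b hb
  have hT : ContDiffAt ℝ m (fun b : ArgC => thirdArg G ζ b.1 b.2.1) b := by
    refine (((he 2).mul hζ3).add (contDiff_fst.fst.contDiffAt.mul hw3.contDiffAt)).sub
      (ContDiffAt.sum fun l _ => ?_)
    exact (((he 2).mul (hdC l)).mul (hg l)).add ((hC l 0 0).mul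
      (((he 2).mul (hζ2 l)).add ((he 3).mul (hw2 l))))
  exact (hx1.contDiffAt.mul ((((contDiffAt_const.mul (he 2)).mul hD).mul
    (((hs 0).div hp' hp).add ((hq'.mul (hs 1)).div (hp'.pow 2) (pow_ne_zero 2 hp)))).add
    (hA.mul ((hT.div (hp'.pow 3) (pow_ne_zero 3 hp)).sub
      (((he 2).mul ((hC 0 0 0).add (hC 1 0 1))).div (hp'.pow 2) (pow_ne_zero 2 hp)))))).sub
    ((hA.mul hx2.contDiffAt).div (hp'.pow 2) (pow_ne_zero 2 hp))

end Smoothness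

section Jets

variable {ε : ℝ} {w : Plane → ℝ} {x : Plane}

lemma gradArg_argD (hζ : ContDiff ℝ ∞ ζ) (hε : ε ≠ 0) (hw : ContDiff ℝ ∞ w) (l : Fin 2)
    (x : Plane) : gradArg ζ l (argD ε w x) = pd l (height ζ ε w) (ε ^ 2 • x) :=
  (pd_height hε (hζ.differentiable (by simp) _) (hw.differentiable (by simp) _) l).symm

lemma hessArg_argD (hζ : ContDiff ℝ ∞ ζ) (hε : ε ≠ 0) (hw : ContDiff ℝ ∞ w) (i j : Fin 2)
    (x : Plane) : hessArg G ζ i j (argD ε w x) = covHess G (height ζ ε w) i j (ε ^ 2 • x) := by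
  simp only [hessArg, covHess, gradArg_argD hζ hε hw, pd_pd_height hε
    (contDiff_nat_of_infty hζ 2).contDiffAt (contDiff_nat_of_infty hw 2).contDiffAt]
  rfl

lemma areaArg_argD (hζ : ContDiff ℝ ∞ ζ) (hε : ε ≠ 0) (hw : ContDiff ℝ ∞ w) (x : Plane) :
    areaArg G ζ (argD ε w x) =
      (G (ε ^ 2 • x)).det * (1 - gradSq G (height ζ ε w) (ε ^ 2 • x)) := by
  simp only [areaArg, gradSq, gradArg_argD hζ hε hw]
  rfl

lemma thirdArg_argD {n : ℕ} {O : Set Plane} (hG : IsSmoothMetric (n + 1) G O)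
    (hζ : ContDiff ℝ ∞ ζ) (hε : ε ≠ 0) (hw : ContDiff ℝ ∞ w) (hx : ε ^ 2 • x ∈ O) :
    thirdArg G ζ (argD ε w x) (third w x) = pd 0 (a22 G ζ ε w) x := by
  have h1 : a22 G ζ ε w = fun x => pd 0 (pd 0 ζ) (ε ^ 2 • x) + ε * pd 0 (pd 0 w) x -
      (christoffel G 0 0 0 (ε ^ 2 • x) * (pd 0 ζ (ε ^ 2 • x) + ε ^ 3 * pd 0 w x) +
        christoffel G 1 0 0 (ε ^ 2 • x) * (pd 1 ζ (ε ^ 2 • x) + ε ^ 3 * pd 1 w x)) := by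
    ext x
    have := hessArg_argD (G := G) hζ hε hw 0 0 x
    rw [a22, ← this, hessArg, Fin.sum_univ_two]
    rfl
  have ds : ∀ {f : Plane → ℝ}, DifferentiableAt ℝ f (ε ^ 2 • x) →
      DifferentiableAt ℝ (fun y => f (ε ^ 2 • y)) x := fun hf =>
    DifferentiableAt.comp x hf (differentiableAt_id.const_smul (ε ^ 2))
  have dζ : ∀ l, DifferentiableAt ℝ (pd l ζ) (ε ^ 2 • x) := fun l =>
    (contDiff_infty_pd hζ l).differentiable (by simp) _
  have dζ2 : DifferentiableAt ℝ (pd 0 (pd 0 ζ)) (ε ^ 2 • x) :=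
    (contDiff_infty_pd (contDiff_infty_pd hζ 0) 0).differentiable (by simp) _
  have dw : ∀ l, DifferentiableAt ℝ (pd l w) x := fun l =>
    (contDiff_infty_pd hw l).differentiable (by simp) _
  have dw2 : DifferentiableAt ℝ (pd 0 (pd 0 w)) x :=
    (contDiff_infty_pd (contDiff_infty_pd hw 0) 0).differentiable (by simp) _
  have dC : ∀ l, DifferentiableAt ℝ (christoffel G l 0 0) (ε ^ 2 • x) := fun l =>
    (hG.contDiffAt_christoffel hx l 0 0).differentiableAt (by norm_cast)
  have a1 := fun l => (ds (dζ l)).fun_add ((dw l).const_mul (ε ^ 3))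
  have a2 := fun l => (ds (dC l)).fun_mul (a1 l)
  rw [h1, pd_sub ((ds dζ2).fun_add (dw2.const_mul ε)) ((a2 0).fun_add (a2 1)),
    pd_add (ds dζ2) (dw2.const_mul ε), pd_add (a2 0) (a2 1), pd_mul (ds (dC 0)) (a1 0),
    pd_mul (ds (dC 1)) (a1 1), pd_add (ds (dζ 0)) ((dw 0).const_mul _),
    pd_add (ds (dζ 1)) ((dw 1).const_mul _), pd_const_mul _ dw2, pd_const_mul _ (dw 0),
    pd_const_mul _ (dw 1), pd_comp_smul, pd_comp_smul, pd_comp_smul, pd_comp_smul, pd_comp_smul,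
    thirdArg, Fin.sum_univ_two]
  simp only [argD, third, gradArg, grad, hess, smul_eq_mul]

end Jets

/-- The identity between the coefficients which yields the canonical form. -/
lemma canonical_identity {ε K D ar p q r p0 p1 q0 q1 r0 H0 F1 F11 lam a0 a1 b0 b1 c0 c1 g00 g01 g11
    z0 z1 u0 u1 u00 u01 u11 : ℝ} (hp : p ≠ 0) (hF : F1 ≠ 0) (hl : lam ≠ 0)
    (hr0 : r0 - q1 = -(K * D * (g00 * z0 + g01 * z1)) * ε ^ 2 - (c0 * p + c1 * q) * ε ^ 2 +
      (b0 * q + b1 * r) * ε ^ 2)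
    (hp1 : p1 - q0 = -(K * D * (g01 * z0 + g11 * z1)) * ε ^ 2 - (a0 * q + a1 * r) * ε ^ 2 +
      (b0 * p + b1 * q) * ε ^ 2) :
    r * (u00 - ε ^ 2 * (a0 * u0 + a1 * u1)) - 2 * q * (u01 - ε ^ 2 * (b0 * u0 + b1 * u1)) +
        p * (u11 - ε ^ 2 * (c0 * u0 + c1 * u1)) + 2 * ε ^ 2 * K * D *
          (g00 * z0 * u0 + g01 * z0 * u1 + (g01 * z1 * u0 + g11 * z1 * u1)) =
      p * (K * ar / p ^ 2 * u00 + (H0 / p ^ 2 + K * ar * F11 / (F1 * p ^ 2) -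
          2 * (K * ar) * p0 / p ^ 3) * u0 +
        (u11 - 2 * (q / p) * u01 + (q / p) ^ 2 * u00 + (-q1 / p + q * p1 / p ^ 2 +
          q / p * (q0 / p - q * p0 / p ^ 2)) * u0) +
        (K * (lam * F1 * (3 * ε ^ 2 * D * ((g00 * z0 + g01 * z1) / p +
            q * (g01 * z0 + g11 * z1) / p ^ 2) + ar * (p0 / p ^ 3 - ε ^ 2 * (a0 + b1) / p ^ 2)) -
            ar * (lam * F11) / p ^ 2) +
          p⁻¹ ^ 2 * (p0 * r + p * r0 - 2 * q * q0 - H0) * (lam * F1)) * (u0 / (lam * F1)) +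
        ε ^ 2 * ((-(r * a1 - 2 * q * b1 + p * c1) + 2 * K * D * (g01 * z0 + g11 * z1)) / p) *
          (u1 - q / p * u0)) +
      p⁻¹ * (p * r - q ^ 2 - K * ar) * (u00 - (p0 / p + ε ^ 2 * (a0 + b1)) * u0) := by
  have e1 : r0 = q1 + (-(K * D * (g00 * z0 + g01 * z1)) * ε ^ 2 - (c0 * p + c1 * q) * ε ^ 2 +
      (b0 * q + b1 * r) * ε ^ 2) := by linarith
  have e2 : p1 = q0 + (-(K * D * (g01 * z0 + g11 * z1)) * ε ^ 2 - (a0 * q + a1 * r) * ε ^ 2 +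
      (b0 * p + b1 * q) * ε ^ 2) := by linarith
  rw [e1, e2]
  field_simp
  ring

end Coefficients

/-- Coordinates `(λ F, x²)` in which `F` is constant on the characteristics `a²² ∂₂ F = -a¹² ∂₁ F`
put the linearization in canonical form. -/
lemma hasCanonicalForm {G : Plane → Matrix (Fin 2) (Fin 2) ℝ} {ζ : Plane → ℝ} {m : ℕ} {O : Set Plane}
    (hG : IsSmoothMetric (m + 2) G O) (hζ : ContDiff ℝ ∞ ζ) {ε : ℝ} (hε : ε ≠ 0) {w : Plane → ℝ}
    (hw : ContDiff ℝ ∞ w) {ξ : OpenPartialHomeomorph Plane Plane}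
    (hO : ∀ x ∈ ξ.source, ε ^ 2 • x ∈ O) (hpos : ∀ x ∈ ξ.source, 0 < a22 G ζ ε w x)
    (hk : ∀ x ∈ ξ.source, 1 / 2 < kbarFun G ζ (argK ε w ξ x))
    (hsymm : ∀ η ∈ ξ.target, DifferentiableAt ℝ ξ.symm η) {F : Plane → ℝ} {lam : ℝ}
    (hlam : lam ≠ 0) (hξ : ∀ x, ξ x = pt (lam * F x) (x 1)) (hF : ContDiff ℝ 2 F)
    (hF0 : ∀ y ∈ ξ.source, pd 0 F y ≠ 0)
    (hpq : ∀ y ∈ ξ.source, covHess G (height ζ ε w) 0 0 (ε ^ 2 • y) * pd 1 F y =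
      covHess G (height ζ ε w) 0 1 (ε ^ 2 • y) * pd 0 F y) :
    HasCanonicalForm G ζ ε w (kbarFun G ζ) (cbarFun G ζ) (dbarFun G ζ) ξ := by
  refine ⟨hpos, hk, fun u hu x hx => ?_⟩
  set z := height ζ ε w with hz
  have hxO := hO x hx
  have hzs : ∀ {n : ℕ} y, ContDiffAt ℝ n z (ε ^ 2 • y) := fun {n} y =>
    contDiffAt_height hε (contDiff_nat_of_infty hζ n).contDiffAt
      (contDiff_nat_of_infty hw n).contDiffAt
  have hmem := ξ.open_source.mem_nhds hx
  have hu2 : ∀ y ∈ ξ.source, ContDiffAt ℝ 2 u y := fun y hy =>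
    hu.contDiffAt (ξ.open_source.mem_nhds hy)
  have hGs := hG.symm _ hxO
  have hinv : (G (ε ^ 2 • x))⁻¹ 1 0 = (G (ε ^ 2 • x))⁻¹ 0 1 := by
    obtain ⟨-, h1, h2, -⟩ := inv_fin_two (G (ε ^ 2 • x))
    rw [h1, h2, hGs 1 0]
  have hΓ := fun l => hG.christoffel_symm hxO l 1 0
  have hlin := hasDerivAt_Phi (G := G) hε (x := x)
    (fun i j => by fin_cases i <;> fin_cases j <;> simp [hinv])
    (contDiff_nat_of_infty hζ 2).contDiffAt (contDiff_nat_of_infty hw 2).contDiffAt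
    (hG.covHess_symm hxO (hzs x)) hΓ (hu2 x hx)
  refine hlin.congr_deriv ?_
  congr 1
  -- the functions `p = ∇₁₁z`, `q = ∇₁₂z`, `r = ∇₂₂z` and `H = K |g| (1 - |∇z|²)` of `x`
  have hc1 : ∀ i j, ∀ y ∈ ξ.source, DifferentiableAt ℝ (fun y => covHess G z i j (ε ^ 2 • y)) y :=
    fun i j y hy => (contDiff_ofReal_smul
      (hG.contDiffAt_covHess (hO y hy) (hzs y) i j)).differentiableAt (by norm_cast)
  have hpdc : ∀ a i j, pd a (fun y => covHess G z i j (ε ^ 2 • y)) x =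
      ε ^ 2 * pd a (covHess G z i j) (ε ^ 2 • x) := fun a i j => pd_comp_smul _ _ _ _
  set H : Plane → ℝ := fun y => gaussCurv G (ε ^ 2 • y) * areaArg G ζ (argD ε w y) with hH
  have hHd : DifferentiableAt ℝ H x := by
    have h1 : DifferentiableAt ℝ (fun y => gaussCurv G (ε ^ 2 • y)) x :=
      (contDiff_ofReal_smul ((IsSmoothMetric.contDiffAt_gaussCurv (n := m + 1) hG hxO).of_le
        (m := 1) (by norm_cast; omega))).differentiableAt (by norm_num)
    have h2 : DifferentiableAt ℝ (fun y => areaArg G ζ (argD ε w y)) x := by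
      simp only [areaArg_argD hζ hε hw, gradSq]
      have h3 : DifferentiableAt ℝ (fun q => (G q).det *
          (1 - ∑ i, ∑ j, (G q)⁻¹ i j * pd i z q * pd j z q)) (ε ^ 2 • x) := by
        have h4 : ContDiffAt ℝ 1 (fun q => (G q).det *
          (1 - ∑ i, ∑ j, (G q)⁻¹ i j * pd i z q * pd j z q)) (ε ^ 2 • x) := by
          refine ((hG.contDiffAt_det hxO).of_le (by norm_cast; omega)).mul
            (contDiffAt_const.sub (ContDiffAt.sum fun i _ => ContDiffAt.sum fun j _ => ?_))
          have h5 : ∀ i, ContDiffAt ℝ 1 (pd i z) (ε ^ 2 • x) := fun i =>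
            (hzs (n := 2) x).pd (by norm_num) i
          exact (((hG.contDiffAt_inv hxO i j).of_le (by norm_cast; omega)).mul (h5 i)).mul (h5 j)
        exact h4.differentiableAt (by norm_num)
      exact DifferentiableAt.comp x h3 (differentiableAt_id.const_smul (ε ^ 2))
    exact h1.fun_mul h2
  have hFd : Differentiable ℝ F := hF.differentiable (by norm_num)
  have hξ0 : ∀ y, pd 0 ξ y 0 = lam * pd 0 F y := by
    intro y
    have hξe : (ξ : Plane → Plane) = fun x => (lam * F x) • e 0 + x 1 • e 1 := by
      ext1 y; rw [hξ, pt_eq]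
    have hξd : DifferentiableAt ℝ ξ y := by
      rw [hξe]
      exact (((hFd y).const_mul lam).smul_const (e 0)).add
        ((coord 1).differentiableAt.smul_const (e 1))
    rw [← pd_apply hξd]
    have : (fun y => ξ y 0) = fun y => lam * F y := by ext y; rw [hξ, pt_zero]
    rw [this, pd_const_mul _ (hFd y)]
  have hξ00 : pd 0 (pd 0 ξ) x 0 = lam * pd 0 (pd 0 F) x := by
    have h1 : ContDiff ℝ 2 ξ := by
      have hξe : (ξ : Plane → Plane) = fun x => pt (lam * F x) (x 1) := funext hξ
      rw [hξe]
      exact contDiff_pt (contDiff_const.mul hF) (contDiff_coord 1)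
    rw [← pd_apply (((h1.pd (m := 1) (by norm_num) 0).differentiable (by norm_num)) x)]
    have : (fun y => pd 0 ξ y 0) = fun y => lam * pd 0 F y := funext hξ0
    rw [this, pd_const_mul _ ((hF.pd (m := 1) (by norm_num) 0).differentiable (by norm_num) x)]
  have hopL := opL_eq (k := coeffK G ε w (kbarFun G ζ) ξ)
    (c := coeffC G ζ ε w (cbarFun G ζ) ξ) (d := coeffD ε w (dbarFun G ζ))
    (p := fun y => covHess G z 0 0 (ε ^ 2 • y)) (q := fun y => covHess G z 0 1 (ε ^ 2 • y)) (H := H)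
    hsymm hξ hx (fun y _ => hF.contDiffAt) hF0 hlam (hc1 0 0) (fun y hy => (hpos y hy).ne') (hc1 0 1)
    hpq hHd (fun y hy => by
      rw [coeffK, kbarFun, hH]
      simp only [argK, grad, hξ0, hessArg_argD hζ hε hw]
      rw [mul_div_assoc, mul_div_assoc, mul_assoc]) hu2
  -- the derivative of `Φ = p r - q² - H`
  have hPhi : ∀ y ∈ ξ.source, Phi G ζ ε w y = covHess G z 0 0 (ε ^ 2 • y) *
      covHess G z 1 1 (ε ^ 2 • y) - covHess G z 0 1 (ε ^ 2 • y) * covHess G z 0 1 (ε ^ 2 • y) -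
        H y := by
    intro y hy
    simp only [Phi, darboux, Matrix.det_fin_two (Matrix.of _), Matrix.of_apply, hH,
      areaArg_argD hζ hε hw]
    rw [← hz, hG.covHess_symm (hO y hy) (hzs y)]
    ring
  have hPhi0 : pd 0 (Phi G ζ ε w) x = ε ^ 2 * pd 0 (covHess G z 0 0) (ε ^ 2 • x) *
      covHess G z 1 1 (ε ^ 2 • x) + covHess G z 0 0 (ε ^ 2 • x) *
        (ε ^ 2 * pd 0 (covHess G z 1 1) (ε ^ 2 • x)) - 2 * covHess G z 0 1 (ε ^ 2 • x) *
        (ε ^ 2 * pd 0 (covHess G z 0 1) (ε ^ 2 • x)) - pd 0 H x := by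
    have hev : Phi G ζ ε w =ᶠ[𝓝 x] fun y => covHess G z 0 0 (ε ^ 2 • y) *
      covHess G z 1 1 (ε ^ 2 • y) - covHess G z 0 1 (ε ^ 2 • y) * covHess G z 0 1 (ε ^ 2 • y) -
        H y := by
      filter_upwards [hmem] with y hy using hPhi y hy
    have m1 := (hc1 0 0 x hx).fun_mul (hc1 1 1 x hx)
    have m2 := (hc1 0 1 x hx).fun_mul (hc1 0 1 x hx)
    rw [pd_congr hev 0, pd_sub (m1.fun_sub m2) hHd, pd_sub m1 m2, pd_mul (hc1 0 0 x hx) (hc1 1 1 x hx),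
      pd_mul (hc1 0 1 x hx) (hc1 0 1 x hx), hpdc, hpdc, hpdc]
    ring
  have hdet0 := hG.det_pos _ hxO
  have hlog : pd 0 (fun p => Real.log (a22 G ζ ε w p * √(G (ε ^ 2 • p)).det)) x =
      ε ^ 2 * pd 0 (covHess G z 0 0) (ε ^ 2 • x) / covHess G z 0 0 (ε ^ 2 • x) +
        ε ^ 2 * (christoffel G 0 0 0 (ε ^ 2 • x) + christoffel G 1 0 1 (ε ^ 2 • x)) := by
    have hdd : DifferentiableAt ℝ (fun y => (G (ε ^ 2 • y)).det) x :=
      DifferentiableAt.comp x (g := fun q => (G q).det)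
        ((hG.contDiffAt_det hxO).differentiableAt (by norm_cast))
        (differentiableAt_id.const_smul (ε ^ 2))
    have hev : (fun p => Real.log (a22 G ζ ε w p * √(G (ε ^ 2 • p)).det)) =ᶠ[𝓝 x] fun y =>
        Real.log (covHess G z 0 0 (ε ^ 2 • y)) + 1 / 2 * Real.log ((G (ε ^ 2 • y)).det) := by
      filter_upwards [hmem] with y hy
      have hd := hG.det_pos _ (hO y hy)
      rw [Real.log_mul (hpos y hy).ne' (Real.sqrt_pos.2 hd).ne', Real.log_sqrt hd.le]
      rw [a22, ← hz]
      ring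
    have l1 : DifferentiableAt ℝ (fun y => Real.log (covHess G z 0 0 (ε ^ 2 • y))) x :=
      (hc1 0 0 x hx).log (hpos x hx).ne'
    have l2 : DifferentiableAt ℝ (fun y => Real.log ((G (ε ^ 2 • y)).det)) x := hdd.log hdet0.ne'
    rw [pd_congr hev 0, pd_add l1 (l2.const_mul _), pd_const_mul _ l2,
      pd_comp_real (hc1 0 0 x hx) (Real.hasDerivAt_log (hpos x hx).ne'),
      pd_comp_real hdd (Real.hasDerivAt_log hdet0.ne'), hpdc,
      pd_comp_smul (fun q => (G q).det), hG.pd_det hxO, smul_eq_mul]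
    have hp0 : covHess G z 0 0 (ε ^ 2 • x) ≠ 0 := (hpos x hx).ne'
    field_simp
  have hcod0 := hG.codazzi_zero (by omega) hxO (hzs x)
  have hcod1 := hG.codazzi_one (by omega) hxO (hzs x)
  rw [hinv] at hcod1
  rw [hopL, hlog, hPhi x hx]
  simp only [coeffC, coeffD, cbarFun, dbarFun, argC, grad, hess, hξ0, hξ00, hPhi0,
    thirdArg_argD (n := m + 1) hG hζ hε hw hxO, hessArg_argD hζ hε hw, gradArg_argD hζ hε hw,
    Fin.sum_univ_two, hinv, hpdc]
  have ha22 : pd 0 (a22 G ζ ε w) x = ε ^ 2 * pd 0 (covHess G z 0 0) (ε ^ 2 • x) := hpdc 0 0 0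
  have hid := canonical_identity (ε := ε) (K := gaussCurv G (ε ^ 2 • x)) (D := (G (ε ^ 2 • x)).det)
    (ar := areaArg G ζ (argD ε w x)) (p := covHess G z 0 0 (ε ^ 2 • x))
    (q := covHess G z 0 1 (ε ^ 2 • x)) (r := covHess G z 1 1 (ε ^ 2 • x))
    (p0 := ε ^ 2 * pd 0 (covHess G z 0 0) (ε ^ 2 • x))
    (p1 := ε ^ 2 * pd 1 (covHess G z 0 0) (ε ^ 2 • x))
    (q0 := ε ^ 2 * pd 0 (covHess G z 0 1) (ε ^ 2 • x))
    (q1 := ε ^ 2 * pd 1 (covHess G z 0 1) (ε ^ 2 • x))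
    (r0 := ε ^ 2 * pd 0 (covHess G z 1 1) (ε ^ 2 • x)) (H0 := pd 0 H x) (F1 := pd 0 F x)
    (F11 := pd 0 (pd 0 F) x) (lam := lam)
    (a0 := christoffel G 0 0 0 (ε ^ 2 • x)) (a1 := christoffel G 1 0 0 (ε ^ 2 • x))
    (b0 := christoffel G 0 0 1 (ε ^ 2 • x)) (b1 := christoffel G 1 0 1 (ε ^ 2 • x))
    (c0 := christoffel G 0 1 1 (ε ^ 2 • x)) (c1 := christoffel G 1 1 1 (ε ^ 2 • x))
    (g00 := (G (ε ^ 2 • x))⁻¹ 0 0) (g01 := (G (ε ^ 2 • x))⁻¹ 0 1) (g11 := (G (ε ^ 2 • x))⁻¹ 1 1)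
    (z0 := pd 0 z (ε ^ 2 • x)) (z1 := pd 1 z (ε ^ 2 • x)) (u0 := pd 0 u x) (u1 := pd 1 u x)
    (u00 := pd 0 (pd 0 u) x) (u01 := pd 0 (pd 1 u) x) (u11 := pd 1 (pd 1 u) x)
    (hpos x hx).ne' (hF0 x hx) hlam (by linear_combination ε ^ 2 * hcod0)
    (by linear_combination ε ^ 2 * hcod1)
  rw [ha22]
  have hHx : H x = gaussCurv G (ε ^ 2 • x) * areaArg G ζ (argD ε w x) := rfl
  simp only [a22, ← hz, hHx]
  have e1 : (argD ε w x).1 = ε := rfl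
  have e2 : (argD ε w x).2.1 = x := rfl
  simp only [e1, e2, hinv]
  linear_combination hid

/-! ### Estimates for the coefficients -/

lemma norm_iteratedFDeriv_comp_equiv_le {F : Type*} [NormedAddCommGroup F] [NormedSpace ℝ F]
    (A : Plane ≃L[ℝ] Plane) (f : Plane → F) (x : Plane) (j : ℕ) :
    ‖iteratedFDeriv ℝ j (fun y => f (A y)) x‖ ≤
      ‖iteratedFDeriv ℝ j f (A x)‖ * ‖(A : Plane →L[ℝ] Plane)‖ ^ j := by
  have h := A.iteratedFDerivWithin_comp_right f (s := univ) uniqueDiffOn_univ (x := x) (mem_univ _) j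
  simp only [preimage_univ, iteratedFDerivWithin_univ] at h
  change ‖iteratedFDeriv ℝ j (f ∘ A) x‖ ≤ _
  rw [h]
  refine (ContinuousMultilinearMap.norm_compContinuousLinearMap_le _ _).trans (le_of_eq ?_)
  simp

lemma norm_iteratedFDeriv_comp_smul_le {F : Type*} [NormedAddCommGroup F] [NormedSpace ℝ F]
    {c : ℝ} (hc : c ≠ 0) (f : Plane → F) (x : Plane) (j : ℕ) :
    ‖iteratedFDeriv ℝ j (fun y => f (c • y)) x‖ ≤ ‖iteratedFDeriv ℝ j f (c • x)‖ * |c| ^ j := by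
  set A : Plane ≃L[ℝ] Plane := ContinuousLinearEquiv.smulLeft (Units.mk0 c hc) with hA
  have hAx : ∀ y, A y = c • y := fun y => rfl
  have hn : ‖(A : Plane →L[ℝ] Plane)‖ ≤ |c| :=
    ContinuousLinearMap.opNorm_le_bound _ (abs_nonneg c) fun y => by
      change ‖A y‖ ≤ _
      rw [hAx, norm_smul, Real.norm_eq_abs]
  have := norm_iteratedFDeriv_comp_equiv_le A f x j
  simp only [hAx] at this
  exact this.trans (mul_le_mul_of_nonneg_left (pow_le_pow_left₀ (norm_nonneg _) hn j)
    (norm_nonneg _))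

lemma IsTame.comp_equiv {W : ℕ → ℝ} {R : Set Plane} {k : ℕ} {C a : ℝ} {f : Plane → ℝ}
    (hf : IsTame W R k C f) (A : Plane ≃L[ℝ] Plane) (hA : ‖(A : Plane →L[ℝ] Plane)‖ ≤ a)
    (ha : 1 ≤ a) : IsTame W (A ⁻¹' R) k (a ^ k * C) fun x => f (A x) := by
  refine ⟨fun x hx => (hf.contDiffAt (A x) hx).comp x A.contDiff.contDiffAt, fun x hx j hj => ?_⟩
  have h1 := hf.le (A x) hx j hj
  calc _ ≤ ‖iteratedFDeriv ℝ j f (A x)‖ * ‖(A : Plane →L[ℝ] Plane)‖ ^ j :=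
        norm_iteratedFDeriv_comp_equiv_le A f x j
    _ ≤ (C * W j) * a ^ k := mul_le_mul h1 ((pow_le_pow_left₀ (norm_nonneg _) hA j).trans
        (pow_le_pow_right₀ ha hj)) (by positivity) ((norm_nonneg _).trans h1)
    _ = _ := by ring

lemma isTame_const {W : ℕ → ℝ} (hW : ∀ j, 1 ≤ W j) (R : Set Plane) (k : ℕ) (a : ℝ) :
    IsTame W R k |a| fun _ => a := by
  refine ⟨fun x _ => contDiffAt_const, fun x _ j _ => ?_⟩
  have h0 := hW j
  have ha := abs_nonneg a
  rcases Nat.eq_zero_or_pos j with rfl | hj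
  · rw [norm_iteratedFDeriv_zero, Real.norm_eq_abs]; nlinarith
  · rw [iteratedFDeriv_const_of_ne (by omega)]
    simp only [Pi.zero_apply, norm_zero]; positivity

/-- The derivatives of a function near the origin are bounded. -/
lemma exists_bound_near_zero {O : Set Plane} (hO : IsOpen O) (h0 : (0 : Plane) ∈ O) {k : ℕ}
    {f : Plane → ℝ} (hf : ∀ y ∈ O, ContDiffAt ℝ k f y) : ∃ ρ B : ℝ, 0 < ρ ∧ 0 ≤ B ∧
      Metric.closedBall 0 ρ ⊆ O ∧
      ∀ y ∈ Metric.closedBall (0 : Plane) ρ, ∀ j ≤ k, ‖iteratedFDeriv ℝ j f y‖ ≤ B := by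
  obtain ⟨ρ, hρ, hρO⟩ := Metric.nhds_basis_closedBall.mem_iff.1 (hO.mem_nhds h0)
  have hcd : ContDiffOn ℝ k f O := fun y hy => (hf y hy).contDiffWithinAt
  have hb : ∀ j ≤ k, ∃ B, ∀ y ∈ Metric.closedBall (0 : Plane) ρ, ‖iteratedFDeriv ℝ j f y‖ ≤ B := by
    intro j hj
    have hc : ContinuousOn (iteratedFDeriv ℝ j f) O := by
      have := hcd.continuousOn_iteratedFDerivWithin (m := j) (by exact_mod_cast hj) hO.uniqueDiffOn
      exact this.congr fun y hy => (iteratedFDerivWithin_of_isOpen j hO hy).symm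
    exact (isCompact_closedBall 0 ρ).exists_bound_of_continuousOn (hc.mono hρO)
  choose! B hB using hb
  refine ⟨ρ, ∑ j ∈ Finset.range (k + 1), |B j|, hρ, Finset.sum_nonneg fun _ _ => abs_nonneg _, hρO,
    fun y hy j hj => ?_⟩
  refine (hB j hj y hy).trans ((le_abs_self _).trans ?_)
  exact Finset.single_le_sum (f := fun j => |B j|) (fun _ _ => abs_nonneg _)
    (Finset.mem_range.2 (by omega))

/-- Rescaled functions are tame, and those which vanish at the origin are so after division
by `ε`. -/
lemma exists_tame_rescaled {O : Set Plane} (hO : IsOpen O) (h0 : (0 : Plane) ∈ O) {k : ℕ}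
    (hk : 1 ≤ k) {f : Plane → ℝ} (hf : ∀ y ∈ O, ContDiffAt ℝ k f y) :
    ∃ C ε₁ : ℝ, 0 < ε₁ ∧ ε₁ ≤ 1 ∧ ∀ ε ∈ Ioo 0 ε₁, ∀ W : ℕ → ℝ, (∀ j, 1 ≤ W j) →
      IsTame W square k C (fun x => f (ε ^ 2 • x)) ∧
      (f 0 = 0 → IsTame W square k C (fun x => ε⁻¹ * f (ε ^ 2 • x))) := by
  obtain ⟨ρ, B, hρ, hB0, hρO, hB⟩ := exists_bound_near_zero hO h0 hf
  refine ⟨B, min ρ 1, lt_min hρ one_pos, min_le_right _ _, fun ε hε W hW => ?_⟩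
  have hε0 := hε.1
  have hε1 : ε ≤ 1 := hε.2.le.trans (min_le_right _ _)
  have hερ : ε ≤ ρ := hε.2.le.trans (min_le_left _ _)
  have hsq : ε ^ 2 ≤ ε := by nlinarith
  have hsq1 : |ε ^ 2| ≤ 1 := by rw [abs_of_pos (by positivity)]; linarith
  have hmem : ∀ x ∈ square, ε ^ 2 • x ∈ Metric.closedBall (0 : Plane) ρ ∧ ‖ε ^ 2 • x‖ ≤ ε ^ 2 := by
    intro x hx
    have h1 : ‖x‖ ≤ 1 := by have := square_subset_ball hx; rw [mem_ball_zero_iff] at this; exact this.le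
    have h2 : ‖ε ^ 2 • x‖ ≤ ε ^ 2 := by
      rw [norm_smul, Real.norm_eq_abs, abs_of_pos (by positivity)]
      exact mul_le_of_le_one_right (by positivity) h1
    exact ⟨by rw [mem_closedBall_zero_iff]; linarith, h2⟩
  have hcd : ∀ x ∈ square, ContDiffAt ℝ k (fun x => f (ε ^ 2 • x)) x := fun x hx =>
    contDiff_ofReal_smul (hf _ (hρO (hmem x hx).1))
  have hBW : ∀ j, B ≤ B * W j := fun j => le_mul_of_one_le_right hB0 (hW j)
  have hle : ∀ x ∈ square, ∀ j ≤ k,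
      ‖iteratedFDeriv ℝ j (fun x => f (ε ^ 2 • x)) x‖ ≤ B * |ε ^ 2| ^ j := fun x hx j hj =>
    (norm_iteratedFDeriv_comp_smul_le (by positivity) f x j).trans
      (mul_le_mul_of_nonneg_right (hB _ (hmem x hx).1 j hj) (by positivity))
  refine ⟨⟨hcd, fun x hx j hj => (hle x hx j hj).trans ((mul_le_of_le_one_right hB0
    (pow_le_one₀ (abs_nonneg _) hsq1)).trans (hBW j))⟩, fun hf0 =>
    ⟨fun x hx => contDiffAt_const.mul (hcd x hx), fun x hx j hj => ?_⟩⟩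
  have key : ‖iteratedFDeriv ℝ j (fun x => f (ε ^ 2 • x)) x‖ ≤ B * ε := by
    rcases Nat.eq_zero_or_pos j with rfl | hj0
    · rw [norm_iteratedFDeriv_zero]
      have h1 := Convex.norm_image_sub_le_of_norm_fderiv_le (f := f) (C := B)
        (s := Metric.closedBall (0 : Plane) ρ) (x := 0) (y := ε ^ 2 • x) (𝕜 := ℝ)
        (fun y hy => (hf y (hρO hy)).differentiableAt (by norm_cast; omega))
        (fun y hy => by
          have := hB y hy 1 hk
          rwa [norm_iteratedFDeriv_one] at this)
        (convex_closedBall 0 ρ) (Metric.mem_closedBall_self hρ.le) (hmem x hx).1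
      rw [hf0, sub_zero, sub_zero] at h1
      exact h1.trans (mul_le_mul_of_nonneg_left ((hmem x hx).2.trans hsq) hB0)
    · refine (hle x hx j hj).trans (mul_le_mul_of_nonneg_left ?_ hB0)
      calc |ε ^ 2| ^ j ≤ |ε ^ 2| ^ 1 := pow_le_pow_of_le_one (abs_nonneg _) hsq1 hj0
        _ ≤ ε := by rw [pow_one, abs_of_pos (by positivity)]; exact hsq
  rw [iteratedFDeriv_const_mul_at _ ((hcd x hx).of_le (by exact_mod_cast hj)), norm_smul,
    Real.norm_eq_abs, abs_of_pos (inv_pos.2 hε0)]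
  refine le_trans ?_ (hBW j)
  calc _ ≤ ε⁻¹ * (B * ε) := mul_le_mul_of_nonneg_left key (inv_nonneg.2 hε0.le)
    _ = B := by field_simp

lemma isTame_pd_pd {w : Plane → ℝ} (hw : ContDiff ℝ ∞ w) (k : ℕ) (i j : Fin 2) :
    IsTame (fun j => cNorm w (j + 2)) square k 1 (pd i (pd j w)) := by
  refine ⟨fun x _ => (contDiff_nat_of_infty (contDiff_infty_pd (contDiff_infty_pd hw j) i)
    k).contDiffAt, fun x hx n _ => ?_⟩
  rw [one_mul]
  have h1 := norm_iteratedFDeriv_pd_le (n := n) (f := pd j w) (x := x)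
    (contDiff_nat_of_infty (contDiff_infty_pd hw j) _).contDiffAt i
  have h2 := norm_iteratedFDeriv_pd_le (n := n + 1) (f := w) (x := x)
    (contDiff_nat_of_infty hw _).contDiffAt j
  exact h1.trans (h2.trans (norm_le_cNorm hw le_rfl hx))

lemma isTame_pd {w : Plane → ℝ} (hw : ContDiff ℝ ∞ w) (k : ℕ) (i : Fin 2) :
    IsTame (fun j => cNorm w (j + 2)) square k 1 (pd i w) := by
  refine ⟨fun x _ => (contDiff_nat_of_infty (contDiff_infty_pd hw i) k).contDiffAt,
    fun x hx n _ => ?_⟩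
  rw [one_mul]
  have h2 := norm_iteratedFDeriv_pd_le (n := n) (f := w) (x := x)
    (contDiff_nat_of_infty hw _).contDiffAt i
  exact h2.trans (norm_le_cNorm hw (by omega) hx)

/-- The second covariant derivatives of `z₀ + ε⁵ w` are tame perturbations of order `ε` of their
values at the origin. -/
lemma exists_tame_covHess {G : Plane → Matrix (Fin 2) (Fin 2) ℝ} {ζ : Plane → ℝ} {k : ℕ}
    {O : Set Plane} (hG : IsSmoothMetric k G O) (h0 : (0 : Plane) ∈ O) (hk : 1 ≤ k)
    (hζ : ContDiff ℝ ∞ ζ) (hζ1 : ∀ l, pd l ζ 0 = 0) (i j : Fin 2) :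
    ∃ C ε₁ : ℝ, 0 < ε₁ ∧ ε₁ ≤ 1 ∧ ∀ ε ∈ Ioo 0 ε₁, ∀ w : Plane → ℝ, ContDiff ℝ ∞ w → SmallC3 w →
      ∃ P : Plane → ℝ, (∀ x, covHess G (height ζ ε w) i j (ε ^ 2 • x) =
        pd i (pd j ζ) 0 + ε * P x) ∧ IsTame (fun j => cNorm w (j + 2)) square k C P := by
  have hs : ∀ l, ContDiff ℝ ∞ (pd l ζ) := contDiff_infty_pd hζ
  obtain ⟨C₁, ε₁, h1, h1', H1⟩ := exists_tame_rescaled hG.isOpen h0 hk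
    (f := fun y => pd i (pd j ζ) y - pd i (pd j ζ) 0)
    (fun y _ => (contDiff_nat_of_infty (contDiff_infty_pd (hs j) i) k).contDiffAt.sub
      contDiffAt_const)
  have hl : ∀ l, ∃ C ε₁ : ℝ, 0 < ε₁ ∧ ε₁ ≤ 1 ∧ ∀ ε ∈ Ioo 0 ε₁, ∀ W : ℕ → ℝ, (∀ j, 1 ≤ W j) →
      IsTame W square k C (fun x => ε⁻¹ * pd l ζ (ε ^ 2 • x)) := fun l => by
    obtain ⟨C, ε, h, h', H⟩ := exists_tame_rescaled hG.isOpen h0 hk (f := pd l ζ)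
      (fun y _ => (contDiff_nat_of_infty (hs l) k).contDiffAt)
    exact ⟨C, ε, h, h', fun ε hε W hW => (H ε hε W hW).2 (hζ1 l)⟩
  have hc : ∀ l, ∃ C ε₁ : ℝ, 0 < ε₁ ∧ ε₁ ≤ 1 ∧ ∀ ε ∈ Ioo 0 ε₁, ∀ W : ℕ → ℝ, (∀ j, 1 ≤ W j) →
      IsTame W square k C (fun x => christoffel G l i j (ε ^ 2 • x)) := fun l => by
    obtain ⟨C, ε, h, h', H⟩ := exists_tame_rescaled hG.isOpen h0 hk (f := christoffel G l i j)
      (fun y hy => hG.contDiffAt_christoffel hy l i j)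
    exact ⟨C, ε, h, h', fun ε hε W hW => (H ε hε W hW).1⟩
  choose A α hα hα' HA using hl
  choose B β hβ hβ' HB using hc
  set C₀ : ℝ := 121 ^ (k * k) * 33 with hC₀
  refine ⟨C₁ + 1 + (2 ^ k * (B 0 * (A 0 + 1) * C₀) + 2 ^ k * (B 1 * (A 1 + 1) * C₀)),
    min ε₁ (min (min (α 0) (α 1)) (min (β 0) (β 1))), ?_, (min_le_left _ _).trans h1',
    fun ε hε w hw h3 => ?_⟩
  · exact lt_min h1 (lt_min (lt_min (hα 0) (hα 1)) (lt_min (hβ 0) (hβ 1)))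
  have hW := isWeight_cNorm hw h3 k
  have hε0 := hε.1
  have hlt := hε.2
  simp only [lt_min_iff] at hlt
  obtain ⟨hlt1, ⟨hα0, hα1⟩, hβ0, hβ1⟩ := hlt
  have hεsq : |ε ^ 2| ≤ 1 := by
    rw [abs_of_pos (by positivity)]
    exact pow_le_one₀ hε0.le (hlt1.le.trans h1')
  have t1 := (H1 ε ⟨hε0, hlt1⟩ _ hW.one_le).2 (sub_self _)
  have t2 : ∀ l, ε < α l → IsTame (fun j => cNorm w (j + 2)) square k (A l + 1)
      fun x => ε⁻¹ * pd l ζ (ε ^ 2 • x) + ε ^ 2 * pd l w x := fun l hl =>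
    (HA l ε ⟨hε0, hl⟩ _ hW.one_le).add (((isTame_pd hw k l).const_mul (ε ^ 2)).mono_const hW
      (by rwa [mul_one]))
  have t3 : ∀ l, ε < α l → ε < β l → IsTame (fun j => cNorm w (j + 2)) square k
      (2 ^ k * (B l * (A l + 1) * C₀)) fun x => christoffel G l i j (ε ^ 2 • x) *
        (ε⁻¹ * pd l ζ (ε ^ 2 • x) + ε ^ 2 * pd l w x) := fun l hl hl' =>
    (HB l ε ⟨hε0, hl'⟩ _ hW.one_le).mul hW (t2 l hl)
  refine ⟨_, fun x => ?_, (t1.add (isTame_pd_pd hw k i j)).sub ((t3 0 hα0 hβ0).add (t3 1 hα1 hβ1))⟩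
  rw [← hessArg_argD hζ hε0.ne' hw, hessArg]
  simp only [argD, gradArg, grad, hess, Fin.sum_univ_two]
  field_simp
  ring

lemma IsTame.abs_le {C₀ C : ℝ} {W : ℕ → ℝ} {R : Set Plane} {k : ℕ} {f : Plane → ℝ}
    (hW : IsWeight k C₀ W) (hf : IsTame W R k C f) {x : Plane} (hx : x ∈ R) : |f x| ≤ C * C₀ := by
  have h := hf.le x hx 0 (Nat.zero_le k)
  rw [norm_iteratedFDeriv_zero, Real.norm_eq_abs] at h
  exact h.trans (mul_le_mul_of_nonneg_left ((hW.mono zero_le_one).trans hW.le_const)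
    (hf.const_nonneg hW hx))

/-- The slope of the characteristics, as seen from the line `x² = c x¹`, is tame. -/
lemma exists_tame_slope {G : Plane → Matrix (Fin 2) (Fin 2) ℝ} {ζ : Plane → ℝ} {k : ℕ}
    {O : Set Plane} (hG : IsSmoothMetric k G O) (h0 : (0 : Plane) ∈ O) (hk : 1 ≤ k)
    (hζ : ContDiff ℝ ∞ ζ) (hζ1 : ∀ l, pd l ζ 0 = 0) (hζ00 : pd 0 (pd 0 ζ) 0 = 1)
    (hζ01 : pd 0 (pd 1 ζ) 0 = 0) {c : ℝ} (hc0 : 0 ≤ c) (hc1 : c ≤ 1) :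
    ∃ C ε₁ : ℝ, 0 ≤ C ∧ 0 < ε₁ ∧ ε₁ ≤ 1 ∧
      ∀ ε ∈ Ioo 0 ε₁, ∀ w : Plane → ℝ, ContDiff ℝ ∞ w → SmallC3 w →
      ∃ T : Plane → ℝ, IsTame (fun j => cNorm w (j + 2)) square k C T ∧ ∀ x ∈ square,
        |covHess G (height ζ ε w) 0 0 (ε ^ 2 • x) - 1| ≤ C * ε ∧
        covHess G (height ζ ε w) 0 1 (ε ^ 2 • x) = ε * T x *
          (covHess G (height ζ ε w) 0 0 (ε ^ 2 • x) +
            c * covHess G (height ζ ε w) 0 1 (ε ^ 2 • x)) := by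
  obtain ⟨A, α, hα, hα', HA⟩ := exists_tame_covHess hG h0 hk hζ hζ1 0 0
  obtain ⟨B, β, hβ, hβ', HB⟩ := exists_tame_covHess hG h0 hk hζ hζ1 0 1
  set C₀ : ℝ := 121 ^ (k * k) * 33 with hC₀
  have hC₀pos : 0 < C₀ := by positivity
  set E : ℝ := 1 + (max A 0 + max B 0) with hE
  have hE1 : 1 ≤ E := by
    have := le_max_right A 0; have := le_max_right B 0; linarith
  obtain ⟨C, HC⟩ := exists_tame_div k (C₀ := C₀) (C := E) (c := 1 / 2) (by norm_num)
  refine ⟨max C (E * C₀), min (min α β) (1 / (2 * (E * C₀))), le_max_of_le_right (by positivity),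
    lt_min (lt_min hα hβ) (by positivity), (min_le_left _ _).trans ((min_le_left _ _).trans hα'),
    fun ε hε w hw h3 => ?_⟩
  have hW := isWeight_cNorm hw h3 k
  have hε0 := hε.1
  have hlt := hε.2
  simp only [lt_min_iff] at hlt
  obtain ⟨⟨hεα, hεβ⟩, hεE⟩ := hlt
  have hε1 : ε ≤ 1 := hεα.le.trans hα'
  have hEC : ε * (E * C₀) ≤ 1 / 2 := by
    rw [lt_div_iff₀ (by positivity)] at hεE
    linarith
  obtain ⟨P, hP, tP⟩ := HA ε ⟨hε0, hεα⟩ w hw h3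
  obtain ⟨Q, hQ, tQ⟩ := HB ε ⟨hε0, hεβ⟩ w hw h3
  rw [hζ00] at hP
  rw [hζ01] at hQ
  have h0s : (0 : Plane) ∈ square := by simp [square]
  have hA0 := tP.const_nonneg hW h0s
  have hB0 := tQ.const_nonneg hW h0s
  rw [max_eq_left hA0, max_eq_left hB0] at hE
  have tr : IsTame (fun j => cNorm w (j + 2)) square k E fun x => 1 + ε * (P x + c * Q x) := by
    have h1 := (isTame_const hW.one_le square k 1).add ((tP.add (tQ.const_mul c)).const_mul ε)
    refine h1.mono_const hW ?_
    rw [abs_one, abs_of_pos hε0, abs_of_nonneg hc0, hE]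
    have : c * B ≤ B := mul_le_of_le_one_left hB0 hc1
    nlinarith [mul_nonneg hc0 hB0]
  have hr : ∀ x ∈ square, 1 / 2 ≤ 1 + ε * (P x + c * Q x) := by
    intro x hx
    have h1 := tP.abs_le hW hx
    have h2 := tQ.abs_le hW hx
    have h3 : |P x + c * Q x| ≤ E * C₀ := by
      calc _ ≤ |P x| + |c * Q x| := abs_add_le _ _
        _ ≤ A * C₀ + 1 * (B * C₀) := by
          rw [abs_mul, abs_of_nonneg hc0]
          exact add_le_add h1 (mul_le_mul hc1 h2 (abs_nonneg _) zero_le_one)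
        _ ≤ _ := by rw [hE]; nlinarith
    have h4 := abs_le.1 h3
    nlinarith
  -- with `p = 1 + ε P` and `q = ε Q` the slope is `q / (p + c q) = ε T`, `T = Q / (1 + ε (P + c Q))`
  refine ⟨_, (HC hW (tQ.mono_const hW (by linarith)) tr hr).mono_const hW (le_max_left _ _),
    fun x hx => ⟨?_, ?_⟩⟩
  · rw [hP, add_sub_cancel_left, abs_mul, abs_of_pos hε0, mul_comm]
    refine mul_le_mul_of_nonneg_right ((tP.abs_le hW hx).trans ?_) hε0.le
    refine le_trans ?_ (le_max_right _ _)
    exact mul_le_mul_of_nonneg_right (by linarith) hC₀pos.le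
  · have := hr x hx
    rw [hP, hQ]
    have h5 : 1 + ε * P x + c * (0 + ε * Q x) = 1 + ε * (P x + c * Q x) := by ring
    rw [h5]
    have h6 : 1 + ε * (P x + c * Q x) ≠ 0 := by linarith
    rw [zero_add, mul_assoc, div_mul_cancel₀ _ h6]

/-- The shear `x ↦ (x¹, x² + c x¹)`. -/
def lowerShear (c : ℝ) : Plane ≃L[ℝ] Plane :=
  LinearEquiv.toContinuousLinearEquiv
    { toFun := fun v => pt (v 0) (v 1 + c * v 0)
      invFun := fun v => pt (v 0) (v 1 - c * v 0)
      map_add' := fun u v => by apply plane_ext <;> simp; ring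
      map_smul' := fun c v => by apply plane_ext <;> simp; ring
      left_inv := fun v => by apply plane_ext <;> simp
      right_inv := fun v => by apply plane_ext <;> simp }

lemma lowerShear_apply (c : ℝ) (v : Plane) : lowerShear c v = pt (v 0) (v 1 + c * v 0) := rfl

lemma lowerShear_symm_apply (c : ℝ) (v : Plane) :
    (lowerShear c).symm v = pt (v 0) (v 1 - c * v 0) := rfl

lemma norm_pt_le (a b : ℝ) : ‖pt a b‖ ≤ |a| + |b| := by
  simpa using norm_plane_le (pt a b)

lemma norm_lowerShear_le {c : ℝ} (hc : |c| ≤ 1) :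
    ‖(lowerShear c : Plane →L[ℝ] Plane)‖ ≤ 3 ∧
      ‖((lowerShear c).symm : Plane →L[ℝ] Plane)‖ ≤ 3 := by
  have h0 := fun a b : ℝ => norm_pt_le a b
  constructor
  · refine (norm_clm_le _).trans ?_
    simp only [ContinuousLinearEquiv.coe_coe, lowerShear_apply, e_zero_zero, e_zero_one, e_one_zero,
      e_one_one]
    have h1 := h0 1 (0 + c * 1)
    have h2 := h0 0 (1 + c * 0)
    simp at h1 h2 ⊢
    linarith
  · refine (norm_clm_le _).trans ?_
    simp only [ContinuousLinearEquiv.coe_coe, lowerShear_symm_apply, e_zero_zero, e_zero_one,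
      e_one_zero, e_one_one]
    have h1 := h0 1 (0 - c * 1)
    have h2 := h0 0 (1 - c * 0)
    simp at h1 h2 ⊢
    linarith

/-- A cutoff function, equal to `1` on the disc of radius `1/5` and supported in that of
radius `1/4`. -/
def cutoff : ContDiffBump (0 : Plane) := ⟨1 / 5, 1 / 4, by norm_num, by norm_num⟩

/-- A global slope which agrees with `-ε T` in the sheared coordinates near the origin. -/
lemma exists_isSmallSlope {k : ℕ} (hk : 1 ≤ k) {c : ℝ} (hc0 : 0 ≤ c) (hc1 : c ≤ 1) (C₀ : ℝ) {C : ℝ}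
    (hC : 0 ≤ C) : ∃ C' : ℝ, 0 < C' ∧ ∀ {W : ℕ → ℝ} {T : Plane → ℝ} {ε : ℝ}, IsWeight k C₀ W →
      IsTame W square k C T → 0 < ε → ε ≤ 1 → ε * C' ≤ 1 / 64 →
      ∃ b : Plane → ℝ, IsSmallSlope k (ε * C') b ∧ IsTame W (Metric.ball 0 (1 / 5)) k C' b ∧
        ∀ x ∈ Metric.ball (0 : Plane) (1 / 5), b x = -(ε * T (lowerShear c x)) := by
  obtain ⟨B, hB⟩ := (cutoff.hasCompactSupport.fderiv ℝ).exists_bound_of_continuous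
    ((cutoff.contDiff (n := 1)).continuous_fderiv (by norm_num))
  have hB0 : 0 ≤ B := (norm_nonneg _).trans (hB 0)
  set C₁ : ℝ := 3 ^ k * C with hC₁
  have hC₁0 : 0 ≤ C₁ := by positivity
  have hCC₁ : C ≤ C₁ := le_mul_of_one_le_left hC (one_le_pow₀ (by norm_num))
  refine ⟨(B + 1) * (C₁ * |C₀|) + C₁ + 1, by positivity, fun {W T ε} hW hT hε hε1 hη => ?_⟩
  have hC₀pos : 0 < C₀ := hW.const_pos
  rw [abs_of_pos hC₀pos] at hη ⊢
  set C' := (B + 1) * (C₁ * C₀) + C₁ + 1 with hC'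
  set S := lowerShear c with hS
  have hSsq : ∀ x ∈ Metric.closedBall (0 : Plane) (1 / 4), S x ∈ square := by
    intro x hx
    rw [mem_closedBall_zero_iff] at hx
    have h0 := abs_le.1 ((abs_coord_le x 0).trans hx)
    have h1 := abs_le.1 ((abs_coord_le x 1).trans hx)
    rw [hS, lowerShear_apply]
    refine ⟨?_, ?_⟩
    · rw [pt_zero]; exact abs_le.2 ⟨by linarith, by linarith⟩
    · rw [pt_one]; exact abs_le.2 ⟨by nlinarith, by nlinarith⟩
  have hTS : IsTame W (S ⁻¹' square) k C₁ fun x => T (S x) :=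
    hT.comp_equiv S (norm_lowerShear_le (by rwa [abs_of_nonneg hc0])).1 (by norm_num)
  set b : Plane → ℝ := fun x => -(ε * (cutoff x * T (S x))) with hb
  have hzero : ∀ x, x ∉ Metric.closedBall (0 : Plane) (1 / 4) → b =ᶠ[𝓝 x] fun _ => 0 := by
    intro x hx
    have : (Metric.closedBall (0 : Plane) (1 / 4))ᶜ ∈ 𝓝 x :=
      Metric.isClosed_closedBall.isOpen_compl.mem_nhds hx
    filter_upwards [this] with y hy
    have h1 : cutoff y = 0 := by
      refine cutoff.zero_of_le_dist ?_
      rw [mem_compl_iff, Metric.mem_closedBall, not_le] at hy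
      exact hy.le
    rw [hb]; simp [h1]
  have hcd : ∀ x ∈ Metric.closedBall (0 : Plane) (1 / 4), ContDiffAt ℝ k (fun x => T (S x)) x :=
    fun x hx => hTS.contDiffAt x (hSsq x hx)
  have hC'nn : 0 ≤ ε * C' := by positivity
  have hT0 : ∀ x ∈ Metric.closedBall (0 : Plane) (1 / 4), |T (S x)| ≤ C₁ * C₀ := fun x hx =>
    hTS.abs_le hW (hSsq x hx)
  have hT1 : ∀ x ∈ Metric.closedBall (0 : Plane) (1 / 4), |pd 0 (fun x => T (S x)) x| ≤ C₁ * C₀ := by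
    intro x hx
    have h1 := hTS.le x (hSsq x hx) 1 hk
    rw [norm_iteratedFDeriv_one] at h1
    exact (norm_pd_le 0 _ x).trans (h1.trans (mul_le_mul_of_nonneg_left hW.le_const hC₁0))
  have hχ : ∀ x, |cutoff x| ≤ 1 := fun x => abs_le.2 ⟨by linarith [cutoff.nonneg (x := x)],
    cutoff.le_one⟩
  have hCC₀ : 0 ≤ C₁ * C₀ := by positivity
  refine ⟨b, ⟨hk, ?_, hC'nn, by linarith, fun x => ?_, fun x => ?_, fun x hx => ?_⟩, ?_, ?_⟩
  · refine contDiff_iff_contDiffAt.2 fun x => ?_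
    by_cases hx : x ∈ Metric.closedBall (0 : Plane) (1 / 4)
    · exact (contDiffAt_const.mul (cutoff.contDiff.contDiffAt.mul (hcd x hx))).neg
    · exact contDiffAt_const.congr_of_eventuallyEq (hzero x hx)
  · by_cases hx : x ∈ Metric.closedBall (0 : Plane) (1 / 4)
    · rw [hb]
      simp only [abs_neg, abs_mul, abs_of_pos hε]
      refine mul_le_mul_of_nonneg_left ?_ hε.le
      calc _ ≤ 1 * (C₁ * C₀) := mul_le_mul (hχ x) (hT0 x hx) (abs_nonneg _) zero_le_one
        _ ≤ C' := by rw [hC']; nlinarith [mul_nonneg hB0 hCC₀]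
    · rw [(hzero x hx).eq_of_nhds, abs_zero]; exact hC'nn
  · by_cases hx : x ∈ Metric.closedBall (0 : Plane) (1 / 4)
    · have hd : DifferentiableAt ℝ (fun x => T (S x)) x :=
        (hcd x hx).differentiableAt (by norm_cast; omega)
      have hdχ : DifferentiableAt ℝ cutoff x :=
        (cutoff.contDiff (n := 1)).differentiable (by norm_num) x
      rw [hb, pd_neg, pd_const_mul ε (hdχ.fun_mul hd), pd_mul hdχ hd, abs_neg, abs_mul, abs_of_pos hε]
      refine mul_le_mul_of_nonneg_left ?_ hε.le
      have hBx : |pd 0 cutoff x| ≤ B := (norm_pd_le 0 cutoff x).trans (hB x)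
      calc _ ≤ |pd 0 cutoff x * T (S x)| + |cutoff x * pd 0 (fun x => T (S x)) x| := abs_add_le _ _
        _ ≤ B * (C₁ * C₀) + 1 * (C₁ * C₀) := by
          rw [abs_mul, abs_mul]
          exact add_le_add (mul_le_mul hBx (hT0 x hx) (abs_nonneg _) hB0)
            (mul_le_mul (hχ x) (hT1 x hx) (abs_nonneg _) zero_le_one)
        _ ≤ C' := by rw [hC']; linarith
    · rw [pd_congr (hzero x hx), pd_const, abs_zero]; exact hC'nn
  · refine (hzero x fun h => ?_).eq_of_nhds
    rw [mem_closedBall_zero_iff] at h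
    have := abs_coord_le x 1
    linarith
  · have hone : ∀ x ∈ Metric.ball (0 : Plane) (1 / 5), b =ᶠ[𝓝 x] fun x => -ε * T (S x) := by
      intro x hx
      filter_upwards [Metric.isOpen_ball.mem_nhds hx] with y hy
      have h1 : cutoff y = 1 := cutoff.one_of_mem_closedBall (Metric.ball_subset_closedBall hy)
      rw [hb]; simp [h1]
    have hsub : Metric.ball (0 : Plane) (1 / 5) ⊆ S ⁻¹' square := fun x hx =>
      hSsq x (Metric.closedBall_subset_closedBall (by norm_num) (Metric.ball_subset_closedBall hx))
    refine (((hTS.mono_set hsub).const_mul (-ε)).congr hone).mono_const hW ?_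
    rw [abs_neg, abs_of_pos hε, hC']
    nlinarith [mul_nonneg hB0 hCC₀]
  · intro x hx
    have h1 : cutoff x = 1 := cutoff.one_of_mem_closedBall (Metric.ball_subset_closedBall hx)
    rw [hb]; simp [h1]

/-! ### The coordinates `ξ` -/

namespace IsSmallSlope

variable {k : ℕ} {η : ℝ} {b : Plane → ℝ} {c : ℝ}

/-- The first integral in the coordinates before the shear: it equals `s` at the points
`(s, c s)`. -/
def shearedIntegral (hb : IsSmallSlope k η b) (c : ℝ) (x : Plane) : ℝ :=
  hb.firstIntegral ((lowerShear c).symm x)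

/-- The domain of the coordinates `ξ`. -/
def shearedBox (hb : IsSmallSlope k η b) (c : ℝ) : Set Plane :=
  {x | |hb.shearedIntegral c x| < 1 / 16 ∧ |x 1 - c * x 0| < 1 / 16}

lemma shearedBox_eq (hb : IsSmallSlope k η b) (c : ℝ) :
    hb.shearedBox c = (lowerShear c).symm ⁻¹' hb.box (1 / 16) := by
  ext x
  simp [shearedBox, box, shearedIntegral, lowerShear_symm_apply]

lemma contDiff_shearedIntegral (hb : IsSmallSlope k η b) (c : ℝ) :
    ContDiff ℝ k (hb.shearedIntegral c) :=
  hb.contDiff_firstIntegral.comp (lowerShear c).symm.contDiff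

lemma isOpen_shearedBox (hb : IsSmallSlope k η b) (c : ℝ) : IsOpen (hb.shearedBox c) :=
  (isOpen_lt (hb.contDiff_shearedIntegral c).continuous.abs continuous_const).inter
    (isOpen_lt ((coord 1).continuous.sub (continuous_const.mul (coord 0).continuous)).abs
      continuous_const)

lemma pd_shearedIntegral (hb : IsSmallSlope k η b) (c : ℝ) (x : Plane) :
    pd 0 (hb.shearedIntegral c) x = pd 0 hb.firstIntegral ((lowerShear c).symm x) *
        (1 + c * b ((lowerShear c).symm x)) ∧
      pd 1 (hb.shearedIntegral c) x = -(b ((lowerShear c).symm x) *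
        pd 0 hb.firstIntegral ((lowerShear c).symm x)) := by
  have hS : ∀ i, pd i (fun y => (lowerShear c).symm y) x = (lowerShear c).symm (e i) := by
    intro i
    have h : fderiv ℝ (fun y => (lowerShear c).symm y) x = _ := (lowerShear c).symm.fderiv
    rw [pd, h]; rfl
  have h := fun i => pd_comp_plane (f := hb.firstIntegral) (h := (lowerShear c).symm) (x := x) i
    (hb.differentiable_firstIntegral _) ((lowerShear c).symm.differentiable x)
  have h0 := h 0
  have h1 := h 1
  rw [hS, lowerShear_symm_apply c (e 0), pd_one_firstIntegral] at h0
  rw [hS, lowerShear_symm_apply c (e 1), pd_one_firstIntegral] at h1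
  constructor
  · refine h0.trans ?_
    simp; ring
  · refine h1.trans ?_
    simp

lemma abs_pd_zero_shearedIntegral_sub_one (hb : IsSmallSlope k η b) (hc0 : 0 ≤ c) (hc1 : c ≤ 1)
    (x : Plane) : |pd 0 (hb.shearedIntegral c) x - 1| ≤ 6 * η := by
  rw [(hb.pd_shearedIntegral c x).1]
  set y := (lowerShear c).symm x
  have h1 := hb.abs_pd_zero_firstIntegral_sub_one y
  have h2 := hb.pd_zero_firstIntegral_mem y
  have h3 := hb.abs_le y
  have h4 : |pd 0 hb.firstIntegral y * (c * b y)| ≤ 3 / 2 * (1 * η) := by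
    rw [abs_mul, abs_mul, abs_of_nonneg hc0]
    refine mul_le_mul ?_ (mul_le_mul hc1 h3 (abs_nonneg _) zero_le_one) ?_ (by norm_num)
    · exact _root_.abs_le.2 ⟨by linarith, h2.2⟩
    · positivity
  have h5 : pd 0 hb.firstIntegral y * (1 + c * b y) - 1 =
      (pd 0 hb.firstIntegral y - 1) + pd 0 hb.firstIntegral y * (c * b y) := by ring
  rw [h5]
  have := abs_add_le (pd 0 hb.firstIntegral y - 1) (pd 0 hb.firstIntegral y * (c * b y))
  have := hb.nonneg
  linarith

lemma pd_zero_shearedIntegral_pos (hb : IsSmallSlope k η b) (hc0 : 0 ≤ c) (hc1 : c ≤ 1)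
    (x : Plane) : 0 < pd 0 (hb.shearedIntegral c) x := by
  have := _root_.abs_le.1 (hb.abs_pd_zero_shearedIntegral_sub_one hc0 hc1 x)
  have := hb.small
  linarith

lemma abs_shearedIntegral_sub_le (hb : IsSmallSlope k η b) (c : ℝ) (x : Plane) :
    |hb.shearedIntegral c x - x 0| ≤ 2 * η := by
  have h := hb.abs_firstIntegral_sub_le ((lowerShear c).symm x)
  rwa [show (lowerShear c).symm x 0 = x 0 by rw [lowerShear_symm_apply, pt_zero]] at h

lemma shearedIntegral_line (hb : IsSmallSlope k η b) (c s : ℝ) :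
    hb.shearedIntegral c (pt s (c * s)) = s := by
  rw [shearedIntegral, lowerShear_symm_apply]
  simpa using hb.firstIntegral_zero s

lemma box_subset_ball (hb : IsSmallSlope k η b) (hη : η ≤ 1 / 64) :
    hb.box (1 / 16) ⊆ Metric.ball 0 (1 / 5) := by
  intro x hx
  have h1 := _root_.abs_le.1 (hb.abs_firstIntegral_sub_le x)
  have h2 := abs_lt.1 hx.1
  have h3 : |x 0| ≤ 3 / 32 := _root_.abs_le.2 ⟨by linarith, by linarith⟩
  rw [mem_ball_zero_iff]
  linarith [norm_plane_le x, hx.2]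

lemma shearedBox_subset_square (hb : IsSmallSlope k η b) (hη : η ≤ 1 / 64) (hc0 : 0 ≤ c)
    (hc1 : c ≤ 1) : hb.shearedBox c ⊆ square := by
  intro x hx
  have h1 := _root_.abs_le.1 (hb.abs_shearedIntegral_sub_le c x)
  have h2 := abs_lt.1 hx.1
  have h3 := abs_lt.1 hx.2
  exact ⟨_root_.abs_le.2 ⟨by linarith, by linarith⟩, _root_.abs_le.2 ⟨by nlinarith, by nlinarith⟩⟩

/-- The coordinates `ξ = (λ F, x²)`. -/
lemma exists_coordinates (hb : IsSmallSlope k η b) (hη : η ≤ 1 / 64) (hc0 : 0 ≤ c) (hc1 : c ≤ 1)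
    {lam : ℝ} (hlam : 1 ≤ lam) : ∃ ξ : OpenPartialHomeomorph Plane Plane,
      ξ.source = hb.shearedBox c ∧ (∀ x, ξ x = pt (lam * hb.shearedIntegral c x) (x 1)) ∧
      ContDiff ℝ k ξ ∧ ContDiff ℝ k ξ.symm ∧ (∀ η, ξ (ξ.symm η) = η) ∧
      ∀ σ ≤ 1 / 64, Metric.ball 0 σ ⊆ ξ.source ∧ Metric.ball 0 σ ⊆ ξ.target := by
  have hlam0 : 0 < lam := by linarith
  have hFd := (hb.contDiff_shearedIntegral c).differentiable
    (by have := hb.one_le; simp; omega)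
  obtain ⟨Ψ, hΨ, hΨ1, hΨ2⟩ := exists_graph_diffeo hb.one_le
    (contDiff_const.mul (hb.contDiff_shearedIntegral c) :
      ContDiff ℝ k fun x => lam * hb.shearedIntegral c x)
    (fun x => by
      rw [pd_const_mul _ (hFd x)]
      exact mul_pos hlam0 (hb.pd_zero_shearedIntegral_pos hc0 hc1 x)) hlam0
    (B := lam * (2 * η)) (fun x => by
      rw [← mul_sub, abs_mul, abs_of_pos hlam0]
      exact mul_le_mul_of_nonneg_left (hb.abs_shearedIntegral_sub_le c x) hlam0.le)
  have hopen := hb.isOpen_shearedBox c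
  set ξ := (Ψ.toOpenPartialHomeomorph).restrOpen (hb.shearedBox c) hopen with hξ
  have hsrc : ξ.source = hb.shearedBox c := by
    rw [hξ, OpenPartialHomeomorph.restrOpen_source]; simp
  have htgt : ∀ η, η ∈ ξ.target ↔ Ψ.symm η ∈ hb.shearedBox c := by
    intro η
    have h1 : ξ.target = Ψ.symm ⁻¹' hb.shearedBox c := by
      have : ξ.target = Ψ.toOpenPartialHomeomorph.target ∩
          Ψ.toOpenPartialHomeomorph.symm ⁻¹' hb.shearedBox c := rfl
      rw [this]
      simp
    rw [h1]; rfl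
  refine ⟨ξ, hsrc, hΨ, hΨ1, hΨ2, fun η => Ψ.apply_symm_apply η, fun σ hσ => ⟨?_, ?_⟩⟩
  · intro x hx
    rw [mem_ball_zero_iff] at hx
    have h0 := abs_lt.1 ((abs_coord_le x 0).trans_lt hx)
    have h1 := abs_lt.1 ((abs_coord_le x 1).trans_lt hx)
    have h2 := _root_.abs_le.1 (hb.abs_shearedIntegral_sub_le c x)
    rw [hsrc]
    exact ⟨abs_lt.2 ⟨by linarith, by linarith⟩, abs_lt.2 ⟨by nlinarith, by nlinarith⟩⟩
  · intro y hy
    rw [mem_ball_zero_iff] at hy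
    rw [htgt]
    have h0 := (abs_coord_le y 0).trans_lt hy
    have h1 := abs_lt.1 ((abs_coord_le y 1).trans_lt hy)
    have h2 := _root_.abs_le.1 (hb.abs_shearedIntegral_sub_le c (Ψ.symm y))
    have h3 := hΨ (Ψ.symm y)
    rw [Ψ.apply_symm_apply] at h3
    have e0 : y 0 = lam * hb.shearedIntegral c (Ψ.symm y) := by rw [h3, pt_zero, ← h3]
    have e1 : y 1 = Ψ.symm y 1 := by rw [h3, pt_one, ← h3]
    rw [e0, abs_mul, abs_of_pos hlam0] at h0
    have h4 : |hb.shearedIntegral c (Ψ.symm y)| < σ :=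
      (le_mul_of_one_le_left (abs_nonneg _) hlam).trans_lt h0
    have h5 := abs_lt.1 h4
    rw [e1] at h1
    exact ⟨by linarith, abs_lt.2 ⟨by nlinarith, by nlinarith⟩⟩

/-- The integral in the sheared coordinates is tame. -/
lemma exists_tame_shearedIntegral (k : ℕ) (C₀ C : ℝ) : ∃ C', ∀ {W : ℕ → ℝ} {η c : ℝ}
    {b : Plane → ℝ} (hb : IsSmallSlope k η b), IsWeight k C₀ W → η ≤ 1 / 64 → 0 ≤ c → c ≤ 1 →
    IsTame W (Metric.ball 0 (1 / 5)) k C b →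
    IsTame W (hb.shearedBox c) k C' (hb.shearedIntegral c) := by
  obtain ⟨C', hC'⟩ := exists_tame_firstIntegral k C₀ C
  refine ⟨3 ^ k * C', fun {W η c b} hb hW hη hc0 hc1 ht => ?_⟩
  have h1 := hC' hb hW (by norm_num : (1 : ℝ) / 16 ≤ 1) (ht.mono_set (hb.box_subset_ball hη))
  have h2 := h1.comp_equiv (lowerShear c).symm
    (norm_lowerShear_le (by rwa [abs_of_nonneg hc0])).2 (by norm_num)
  rwa [← shearedBox_eq] at h2

end IsSmallSlope

/-! ### The regions in the coordinates `ξ` -/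

/-- The sectors into which a region is brought by the linear change of coordinates. -/
def sector : Kind → Set Plane
  | .elliptic => {x | 0 < x 1 ∧ x 1 < x 0}
  | .vertical => {x | |x 0| < x 1}
  | .lateral => {x | |x 1| < x 0}

lemma abs_sub_sub_le_of_deriv {g g' : ℝ → ℝ} {a κ : ℝ} (hg : ∀ t, HasDerivAt g (g' t) t)
    (h : ∀ t, |g' t - a| ≤ κ) (s t : ℝ) : |g s - g t - a * (s - t)| ≤ κ * |s - t| := by
  have := Convex.norm_image_sub_le_of_norm_hasDerivWithin_le (f := fun t => g t - a * t)
    (f' := fun t => g' t - a) (s := univ) (C := κ) (x := t) (y := s)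
    (fun t _ => ((hg t).fun_sub (by simpa using (hasDerivAt_id' t).const_mul a)).hasDerivWithinAt)
    (fun t _ => h t) convex_univ (mem_univ _) (mem_univ _)
  rw [Real.norm_eq_abs, Real.norm_eq_abs] at this
  rwa [show g s - g t - a * (s - t) = g s - a * s - (g t - a * t) by ring]

/-- A function composed of two branches with slopes close to `1` and `-1` is close to the absolute
value. -/
lemma isNearAbs_of_branches {u v u' v' : ℝ → ℝ} {κ σ : ℝ} (hu : ContDiff ℝ 1 u)
    (hv : ContDiff ℝ 1 v) (hu' : ∀ t, HasDerivAt u (u' t) t) (hv' : ∀ t, HasDerivAt v (v' t) t)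
    (u0 : u 0 = 0) (v0 : v 0 = 0) (hκu : ∀ t, |u' t - 1| ≤ κ) (hκv : ∀ t, |v' t - (-1)| ≤ κ)
    (hκσ : κ ≤ σ) (hσ : σ ≤ 1) : IsNearAbs σ 1 fun t => if 0 ≤ t then u t else v t := by
  set h : ℝ → ℝ := fun t => if 0 ≤ t then u t else v t with hh
  have hκ0 : 0 ≤ κ := (abs_nonneg _).trans (hκu 0)
  have hu2 := abs_sub_sub_le_of_deriv hu' hκu
  have hv2 := abs_sub_sub_le_of_deriv hv' hκv
  have hpos : ∀ t, 0 ≤ t → h t = u t := fun t ht => by rw [hh]; simp [ht]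
  have hneg : ∀ t, t ≤ 0 → h t = v t := fun t ht => by
    rcases ht.lt_or_eq with h' | rfl
    · rw [hh]; simp [h']
    · rw [hpos 0 le_rfl, u0, v0]
  have hlu : ∀ s t, |u s - u t| ≤ 2 * |s - t| := fun s t => by
    have h1 := hu2 s t
    have h2 := abs_add_le (u s - u t - 1 * (s - t)) (1 * (s - t))
    rw [sub_add_cancel, one_mul] at h2
    rw [one_mul] at h1
    have := mul_le_mul_of_nonneg_right (hκσ.trans hσ) (abs_nonneg (s - t))
    linarith
  have hlv : ∀ s t, |v s - v t| ≤ 2 * |s - t| := fun s t => by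
    have h1 := hv2 s t
    have h2 := abs_add_le (v s - v t - -1 * (s - t)) (-1 * (s - t))
    rw [sub_add_cancel, abs_mul, abs_neg, abs_one, one_mul] at h2
    have := mul_le_mul_of_nonneg_right (hκσ.trans hσ) (abs_nonneg (s - t))
    linarith
  have hmix : ∀ s t, s ≤ 0 → 0 ≤ t → |h s - h t| ≤ 2 * |s - t| := by
    intro s t hs ht
    rw [hneg s hs, hpos t ht]
    have h1 := hlv s 0
    have h2 := hlu t 0
    rw [v0, sub_zero, sub_zero, abs_of_nonpos hs] at h1
    rw [u0, sub_zero, sub_zero, abs_of_nonneg ht] at h2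
    rw [abs_of_nonpos (sub_nonpos.2 (hs.trans ht))]
    have := abs_sub (v s) (u t)
    linarith
  refine ⟨⟨2, ?_⟩, ?_, ?_, ?_, fun t ht => ⟨?_, fun ht0 => ?_⟩⟩
  · refine LipschitzOnWith.of_dist_le_mul fun s _ t _ => ?_
    rw [Real.dist_eq, Real.dist_eq]
    change |h s - h t| ≤ 2 * |s - t|
    rcases le_total s 0 with hs | hs <;> rcases le_total t 0 with ht | ht
    · rw [hneg s hs, hneg t ht]; exact hlv s t
    · exact hmix s t hs ht
    · rw [abs_sub_comm, abs_sub_comm s]; exact hmix t s ht hs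
    · rw [hpos s hs, hpos t ht]; exact hlu s t
  · rw [hpos 0 le_rfl, u0]
  · exact hv.contDiffOn.congr fun t ht => hneg t ht.2.le
  · exact hu.contDiffOn.congr fun t ht => hpos t ht.1.le
  · have ht' : |t| ≤ 1 := (abs_lt.2 ht).le.trans hσ
    rw [one_mul]
    refine le_trans ?_ hκσ
    rcases le_total t 0 with h0 | h0
    · have h1 := hv2 t 0
      simp only [v0, sub_zero] at h1
      rw [hneg t h0, abs_of_nonpos h0]
      rw [show v t - -t = v t - -1 * t by ring]
      exact h1.trans (mul_le_of_le_one_right hκ0 ht')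
    · have h1 := hu2 t 0
      simp only [u0, sub_zero, one_mul] at h1
      rw [hpos t h0, abs_of_nonneg h0]
      exact h1.trans (mul_le_of_le_one_right hκ0 ht')
  · rw [one_mul]
    refine le_trans ?_ hκσ
    rcases lt_or_gt_of_ne ht0 with h0 | h0
    · have hev : (fun s => h s - |s|) =ᶠ[𝓝 t] fun s => v s - -s := by
        filter_upwards [Iio_mem_nhds h0] with s hs
        rw [hneg s (le_of_lt hs), abs_of_neg hs]
      rw [hev.deriv_eq, ((hv' t).fun_sub (hasDerivAt_id' t).fun_neg).deriv]
      exact hκv t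
    · have hev : (fun s => h s - |s|) =ᶠ[𝓝 t] fun s => u s - s := by
        filter_upwards [Ioi_mem_nhds h0] with s hs
        rw [hpos s (le_of_lt hs), abs_of_pos hs]
      rw [hev.deriv_eq, ((hu' t).fun_sub (hasDerivAt_id' t)).deriv]
      exact hκu t

/-- The inverse of a function of one variable which is close to the identity. -/
lemma exists_inverse_of_near_id {f f' : ℝ → ℝ} {κ B : ℝ} (hf : ContDiff ℝ 1 f)
    (hf' : ∀ t, HasDerivAt f (f' t) t) (h0 : f 0 = 0) (hκ : ∀ t, |f' t - 1| ≤ κ) (hκ2 : κ ≤ 1 / 2)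
    (hB : ∀ t, |f t - t| ≤ B) : ∃ g g' : ℝ → ℝ, ContDiff ℝ 1 g ∧ (∀ s, HasDerivAt g (g' s) s) ∧
      g 0 = 0 ∧ (∀ s, |g' s - 1| ≤ 2 * κ) ∧ ∀ s, f (g s) = s := by
  have hpos : ∀ t, 1 / 2 ≤ f' t := fun t => by
    have := abs_le.1 (hκ t); linarith
  have hd : ∀ x : Plane, pd 0 (fun x : Plane => f (x 0)) x = f' (x 0) := fun x => by
    have := pd_comp_real (f := fun x : Plane => x 0) (coord 0).differentiableAt (hf' (x 0)) 0
    rw [this, pd_coord]; simp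
  obtain ⟨Ψ, hΨ, -, hΨ2⟩ := exists_graph_diffeo (k := 1) le_rfl (f := fun x : Plane => f (x 0))
    (hf.comp (contDiff_coord 0)) (fun x => by rw [hd]; linarith [hpos (x 0)]) one_pos
    (B := B) (fun x => by rw [one_mul]; exact hB _)
  set g : ℝ → ℝ := fun s => Ψ.symm (pt s 0) 0 with hg
  have hgc : ContDiff ℝ 1 g :=
    (contDiff_coord 0).comp (hΨ2.comp (contDiff_pt contDiff_id contDiff_const))
  have hfg : ∀ s, f (g s) = s := fun s => by
    have h1 := hΨ (Ψ.symm (pt s 0))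
    rw [Ψ.apply_symm_apply] at h1
    have := congrArg (fun v : Plane => v 0) h1
    simpa using this.symm
  have hinj : Function.Injective f := by
    have : StrictMono f := strictMono_of_deriv_pos fun t => by
      rw [(hf' t).deriv]; linarith [hpos t]
    exact this.injective
  have hgd : ∀ s, HasDerivAt g (deriv g s) s := fun s =>
    (hgc.differentiable (by norm_num) s).hasDerivAt
  refine ⟨g, deriv g, hgc, hgd, hinj (by rw [hfg, h0]), fun s => ?_, hfg⟩
  have h1 : HasDerivAt (fun s => f (g s)) (f' (g s) * deriv g s) s := (hf' (g s)).comp s (hgd s)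
  have h2 : HasDerivAt (fun s => f (g s)) 1 s := by
    have : (fun s => f (g s)) = fun s => s := funext hfg
    rw [this]; exact hasDerivAt_id' s
  have h3 := h1.unique h2
  have h4 := hpos (g s)
  have h5 := abs_le.1 (hκ (g s))
  have hκ0 : 0 ≤ κ := (abs_nonneg _).trans (hκ 0)
  have h6 : deriv g s = (f' (g s))⁻¹ := eq_inv_of_mul_eq_one_right h3
  have h7 : deriv g s - 1 = (1 - f' (g s)) * (f' (g s))⁻¹ := by
    rw [h6]; field_simp
  rw [h7, abs_mul]
  have h8 : |(f' (g s))⁻¹| ≤ 2 := by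
    rw [abs_of_pos (inv_pos.2 (show 0 < f' (g s) by linarith))]
    exact (inv_le_comm₀ (show 0 < f' (g s) by linarith) (by norm_num)).2 (by linarith)
  rw [abs_sub_comm, mul_comm]
  exact mul_le_mul h8 (hκ (g s)) (abs_nonneg _) (by norm_num)

namespace IsSmallSlope

variable {k : ℕ} {η : ℝ} {b : Plane → ℝ}

lemma strictMono_shearedIntegral (hb : IsSmallSlope k η b) {c : ℝ} (hc0 : 0 ≤ c) (hc1 : c ≤ 1)
    (t : ℝ) : StrictMono fun s => hb.shearedIntegral c (pt s t) := by
  have hFd := (hb.contDiff_shearedIntegral c).differentiable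
    (by have := hb.one_le; simp; omega)
  refine strictMono_of_deriv_pos fun s => ?_
  rw [(hasDerivAt_fst (hFd (pt s t))).deriv]
  exact hb.pd_zero_shearedIntegral_pos hc0 hc1 _

lemma shearedIntegral_zero (hb : IsSmallSlope k η b) :
    hb.shearedIntegral 0 = hb.firstIntegral := by
  ext x
  rw [shearedIntegral, lowerShear_symm_apply, zero_mul, sub_zero, pt_eta]

/-- The first integral along a line of slope `±1`. -/
lemma exists_branch (hb : IsSmallSlope k η b) (a d : ℝ) (ha : |a| = 1) (hd : |d| = 1) :
    ∃ f' : ℝ → ℝ, ContDiff ℝ 1 (fun t => hb.firstIntegral (pt (a * t) (d * t))) ∧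
      (∀ t, HasDerivAt (fun t => hb.firstIntegral (pt (a * t) (d * t))) (f' t) t) ∧
      ∀ t, |f' t - a| ≤ 6 * η := by
  refine ⟨fun t => a • pd 0 hb.firstIntegral (pt (a * t) (d * t)) +
    d • pd 1 hb.firstIntegral (pt (a * t) (d * t)), ?_, fun t => ?_, fun t => ?_⟩
  · exact (hb.contDiff_firstIntegral.of_le (by exact_mod_cast hb.one_le)).comp
      (contDiff_pt (contDiff_const.mul contDiff_id) (contDiff_const.mul contDiff_id))
  · exact pd_comp_curve (hb.differentiable_firstIntegral _)
      (by simpa using (hasDerivAt_id' t).const_mul a) (by simpa using (hasDerivAt_id' t).const_mul d)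
  · set x := pt (a * t) (d * t)
    have h1 := hb.abs_pd_zero_firstIntegral_sub_one x
    have h2 := hb.abs_pd_one_firstIntegral x
    have h3 : a • pd 0 hb.firstIntegral x + d • pd 1 hb.firstIntegral x - a =
        a * (pd 0 hb.firstIntegral x - 1) + d * pd 1 hb.firstIntegral x := by
      simp only [smul_eq_mul]; ring
    rw [h3]
    refine (abs_add_le _ _).trans ?_
    rw [abs_mul, abs_mul, ha, hd]
    linarith

lemma abs_lt_iff_of_flow (hb : IsSmallSlope k η b) {s h : ℝ} (hh : |hb.flow (pt s h)| = h) (t : ℝ) :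
    |hb.flow (pt s t)| < t ↔ h < t := by
  have h1 := abs_sub_sub_le_of_deriv (g := fun t => hb.flow (pt s t)) (a := 0) (κ := η)
    (fun t => hb.hasDerivAt_flow_snd s t) (fun t => by rw [sub_zero]; exact hb.abs_le _) t h
  rw [zero_mul, sub_zero] at h1
  have hη := hb.small
  have h2 := abs_sub_abs_le_abs_sub (hb.flow (pt s t)) (hb.flow (pt s h))
  have h3 := abs_sub_abs_le_abs_sub (hb.flow (pt s h)) (hb.flow (pt s t))
  rw [abs_sub_comm] at h3
  have hn := hb.nonneg
  constructor
  · intro h4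
    by_contra h5
    rw [not_lt] at h5
    rw [abs_of_nonpos (by linarith : t - h ≤ 0)] at h1
    nlinarith
  · intro h4
    rw [abs_of_pos (by linarith : 0 < t - h)] at h1
    nlinarith

/-- In the coordinates `ξ` the sectors have the standard form. -/
lemma isStandardRegion_of_sector (hb : IsSmallSlope k η b) {σ δ : ℝ} (hησ : 12 * η ≤ σ)
    (hσ : σ ≤ 1 / 2) (hδ : 0 < Real.tan δ) (κ : Kind) {c lam : ℝ}
    (hcl : match κ with
      | .elliptic => c = 1 ∧ lam = (Real.tan δ)⁻¹
      | _ => c = 0 ∧ lam = 1)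
    {ξ ξinv : Plane → Plane} (hξ : ∀ x, ξ x = pt (lam * hb.shearedIntegral c x) (x 1))
    (hinv : ∀ y, ξ (ξinv y) = y) :
    IsStandardRegion σ δ 1 {y | ‖y‖ < σ ∧ ξinv y ∈ sector κ} κ := by
  have hy0 : ∀ y, y 0 = lam * hb.shearedIntegral c (ξinv y) := fun y => by
    have := congrArg (fun v : Plane => v 0) (hinv y)
    simp only [hξ, pt_zero] at this
    exact this.symm
  have hy1 : ∀ y, y 1 = ξinv y 1 := fun y => by
    have := congrArg (fun v : Plane => v 1) (hinv y)
    simp only [hξ, pt_one] at this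
    exact this.symm
  cases κ with
  | elliptic =>
    obtain ⟨rfl, rfl⟩ := hcl
    change {y | ‖y‖ < σ ∧ ξinv y ∈ sector .elliptic} =
      {y | 0 < y 1 ∧ y 1 < Real.tan δ * y 0 ∧ ‖y‖ < σ}
    ext y
    have h1 : Real.tan δ * y 0 = hb.shearedIntegral 1 (ξinv y) := by
      rw [hy0 y]; field_simp
    have h2 : ξinv y 1 < ξinv y 0 ↔ ξinv y 1 < hb.shearedIntegral 1 (ξinv y) := by
      have h3 := (hb.strictMono_shearedIntegral zero_le_one le_rfl (ξinv y 1)).lt_iff_lt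
        (a := ξinv y 1) (b := ξinv y 0)
      simp only [pt_eta] at h3
      have h4 := hb.shearedIntegral_line 1 (ξinv y 1)
      rw [one_mul] at h4
      rw [h4] at h3
      exact h3.symm
    simp only [mem_ofPred_eq, sector, h1, hy1 y, h2]
    tauto
  | lateral =>
    obtain ⟨rfl, rfl⟩ := hcl
    obtain ⟨u', hu, hu', hκu⟩ := hb.exists_branch 1 1 (by simp) (by simp)
    obtain ⟨v', hv, hv', hκv⟩ := hb.exists_branch (-1) 1 (by simp) (by simp)
    have h00 : hb.firstIntegral (pt 0 0) = 0 := hb.firstIntegral_zero 0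
    have hna := isNearAbs_of_branches (σ := σ) hu hv hu' hv' (by simpa using h00)
      (by simpa using h00) hκu hκv (by linarith [hb.nonneg]) (by linarith)
    refine ⟨_, hna, ?_⟩
    ext y
    have h2 : |ξinv y 1| < ξinv y 0 ↔
        (if 0 ≤ y 1 then hb.firstIntegral (pt (1 * y 1) (1 * y 1)) else
          hb.firstIntegral (pt (-1 * y 1) (1 * y 1))) < y 0 := by
      have h3 := (hb.strictMono_shearedIntegral le_rfl zero_le_one (ξinv y 1)).lt_iff_lt
        (a := |ξinv y 1|) (b := ξinv y 0)
      simp only [pt_eta, shearedIntegral_zero] at h3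
      have h4 : (if 0 ≤ y 1 then hb.firstIntegral (pt (1 * y 1) (1 * y 1)) else
          hb.firstIntegral (pt (-1 * y 1) (1 * y 1))) = hb.firstIntegral (pt |ξinv y 1| (ξinv y 1)) := by
        rw [← hy1 y]
        split_ifs with h5
        · rw [abs_of_nonneg h5, one_mul]
        · rw [abs_of_neg (not_le.1 h5), one_mul, neg_one_mul]
      rw [h4, hy0 y, one_mul, shearedIntegral_zero]
      exact h3.symm
    simp only [mem_ofPred_eq, sector, h2]
    tauto
  | vertical =>
    obtain ⟨rfl, rfl⟩ := hcl
    obtain ⟨u', hu, hu', hκu⟩ := hb.exists_branch 1 1 (by simp) (by simp)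
    obtain ⟨v', hv, hv', hκv⟩ := hb.exists_branch 1 (-1) (by simp) (by simp)
    have h00 : hb.firstIntegral (pt 0 0) = 0 := hb.firstIntegral_zero 0
    have hη := hb.nonneg
    have hB : ∀ d t : ℝ, |hb.firstIntegral (pt (1 * t) (d * t)) - t| ≤ 2 * η := fun d t => by
      simpa using hb.abs_firstIntegral_sub_le (pt (1 * t) (d * t))
    obtain ⟨g, g', hg, hg', hg0, hκg, hfg⟩ := exists_inverse_of_near_id hu hu' (by simpa using h00)
      hκu (by linarith) (hB 1)
    obtain ⟨l, l', hl, hl', hl0, hκl, hfl⟩ := exists_inverse_of_near_id hv hv' (by simpa using h00)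
      hκv (by linarith) (hB (-1))
    have hna := isNearAbs_of_branches (σ := σ) (κ := 12 * η) hg hl.neg hg' (fun t => (hl' t).neg)
      hg0 (by simp [hl0]) (fun t => by linarith [hκg t]) (fun t => by
        rw [← abs_neg, neg_sub, sub_neg_eq_add, add_comm, ← sub_eq_add_neg]
        linarith [hκl t]) (by linarith) (by linarith)
    refine ⟨_, hna, ?_⟩
    ext y
    have h2 : |ξinv y 0| < ξinv y 1 ↔ (if 0 ≤ y 0 then g (y 0) else (-l) (y 0)) < y 1 := by
      have hF := hb.flow_firstIntegral (ξinv y)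
      have hy0' := hy0 y
      rw [one_mul, shearedIntegral_zero] at hy0'
      rw [← hy0', ← hy1 y] at hF
      rw [← hF, ← hy1 y]
      split_ifs with h5
      · refine hb.abs_lt_iff_of_flow ?_ _
        have h6 := hb.flow_firstIntegral (pt (1 * g (y 0)) (1 * g (y 0)))
        rw [hfg] at h6
        simp only [pt_zero, pt_one, one_mul] at h6
        rw [h6, abs_of_nonneg]
        have h7 := abs_sub_sub_le_of_deriv hg' hκg (y 0) 0
        rw [hg0, sub_zero, sub_zero, abs_of_nonneg h5] at h7
        have := (_root_.abs_le.1 h7).1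
        nlinarith
      · refine hb.abs_lt_iff_of_flow ?_ _
        rw [not_le] at h5
        have h6 := hb.flow_firstIntegral (pt (1 * l (y 0)) (-1 * l (y 0)))
        rw [hfl] at h6
        simp only [pt_zero, pt_one, one_mul, neg_one_mul] at h6
        rw [Pi.neg_apply, h6, abs_of_nonpos]
        have h7 := abs_sub_sub_le_of_deriv hl' hκl (y 0) 0
        rw [hl0, sub_zero, sub_zero, abs_of_neg h5] at h7
        have := (_root_.abs_le.1 h7).2
        nlinarith
    simp only [mem_ofPred_eq, sector, h2]
    tauto

end IsSmallSlope

/-! ### The change of coordinates for a straightened metric -/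

lemma norm_iteratedFDeriv_pt_le {f g : Plane → ℝ} {n : ℕ} (hf : ContDiff ℝ n f)
    (hg : ContDiff ℝ n g) (x : Plane) : ‖iteratedFDeriv ℝ n (fun x => pt (f x) (g x)) x‖ ≤
      ‖iteratedFDeriv ℝ n f x‖ + ‖iteratedFDeriv ℝ n g x‖ := by
  have h : ∀ (i : Fin 2) {f : Plane → ℝ}, ContDiff ℝ n f →
      ‖iteratedFDeriv ℝ n (fun x => f x • e i) x‖ ≤ ‖iteratedFDeriv ℝ n f x‖ := by
    intro i f hf
    have := (ContinuousLinearMap.toSpanSingleton ℝ (e i)).norm_iteratedFDeriv_comp_left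
      (hf.contDiffAt (x := x)) le_rfl
    rw [ContinuousLinearMap.norm_toSpanSingleton, show ‖e i‖ = 1 by simp [e],
      one_mul] at this
    exact this
  simp only [pt_eq]
  have h0 : ∀ (i : Fin 2) {f : Plane → ℝ}, ContDiff ℝ n f →
      ContDiffAt ℝ n (fun x => f x • e i) x := fun i f hf => (hf.smul contDiff_const).contDiffAt
  rw [fun_iteratedFDeriv_add_apply (h0 0 hf) (h0 1 hg)]
  exact (norm_add_le _ _).trans (add_le_add (h 0 hf) (h 1 hg))

lemma norm_iteratedFDeriv_coord_le (i : Fin 2) (n : ℕ) {x : Plane} (hx : ‖x‖ ≤ 1) :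
    ‖iteratedFDeriv ℝ n (fun x : Plane => x i) x‖ ≤ 1 := by
  cases n with
  | zero => rw [norm_iteratedFDeriv_zero]; exact (abs_coord_le x i).trans hx
  | succ n =>
    refine (norm_iteratedFDeriv_succ_le (contDiff_coord i).contDiffAt).trans ?_
    have h : ∀ j, (pd j fun x : Plane => x i) = fun _ => if j = i then (1 : ℝ) else 0 :=
      fun j => funext fun x => pd_coord j i x
    rw [h, h]
    cases n with
    | zero => rw [norm_iteratedFDeriv_zero, norm_iteratedFDeriv_zero]; fin_cases i <;> simp
    | succ n => rw [iteratedFDeriv_succ_const, iteratedFDeriv_succ_const]; simp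

section Straightened

variable {G : Plane → Matrix (Fin 2) (Fin 2) ℝ} {ζ : Plane → ℝ} {m : ℕ} {O : Set Plane}

/-- For small `ε` the hessian is close to `∂₁₁z₀ = 1` and `|g| (1 - |∇z|²)` is bounded below. -/
lemma exists_domD (hG : IsSmoothMetric (m + 2) G O) (h0 : (0 : Plane) ∈ O) (hdet : 1 ≤ (G 0).det)
    (hζ : ContDiff ℝ ∞ ζ) (hζ1 : ∀ l, pd l ζ 0 = 0) (hζ00 : pd 0 (pd 0 ζ) 0 = 1) :
    ∃ ε₁ : ℝ, 0 < ε₁ ∧ ε₁ ≤ 1 ∧ ∀ a ∈ domD ε₁, a.1 ^ 2 • a.2.1 ∈ O ∧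
      |hessArg G ζ 0 0 a - 1| < 1 / 10 ∧ 9 / 10 < areaArg G ζ a := by
  -- the coefficients depend only on `ε² x`, `ε³ ∇w` and `ε ∇²w`
  set a₀ : ArgD := (1, 0, 0, 0, 0) with ha₀
  have hO : a₀.1 ^ 2 • a₀.2.1 ∈ O := by simpa [ha₀] using h0
  have hg0 : ∀ l, gradArg ζ l a₀ = 0 := fun l => by simp [gradArg, ha₀, hζ1]
  have hh0 : hessArg G ζ 0 0 a₀ = 1 := by
    simp only [hessArg, hg0]; simp [ha₀, hζ00]
  have har0 : areaArg G ζ a₀ = (G 0).det := by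
    simp only [areaArg, hg0]; simp [ha₀]
  have h1 := (contDiffAt_hessArg hG hζ hO 0 0).continuousAt
  have h2 := (contDiffAt_areaArg hG hζ hO).continuousAt
  have h3 : ContinuousAt (fun a : ArgD => a.1 ^ 2 • a.2.1) a₀ := contDiff_point.continuous.continuousAt
  have hev : ∀ᶠ a in 𝓝 a₀, a.1 ^ 2 • a.2.1 ∈ O ∧
      |hessArg G ζ 0 0 a - 1| < 1 / 10 ∧ 9 / 10 < areaArg G ζ a := by
    refine (h3.eventually (hG.mem_nhds hO)).and (Eventually.and ?_ ?_)
    · refine (h1.sub continuousAt_const).abs.eventually_lt continuousAt_const ?_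
      change |hessArg G ζ 0 0 a₀ - 1| < 1 / 10
      rw [hh0]; norm_num
    · refine continuousAt_const.eventually_lt h2 ?_
      rw [har0]; linarith
  obtain ⟨r, hr, H⟩ := Metric.eventually_nhds_iff.1 hev
  refine ⟨min 1 (r / 2), by positivity, min_le_left _ _, fun a ha => ?_⟩
  obtain ⟨ε, x, u, v, W⟩ := a
  obtain ⟨hε, hx, hu, hv, hW⟩ := ha
  simp only [mem_ball_zero_iff] at hx hu hv hW
  have hε' : |ε| < min 1 (r / 2) := abs_lt.2 hε
  have hε1 : |ε| < 1 := hε'.trans_le (min_le_left _ _)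
  have hε2 : |ε| < r / 2 := hε'.trans_le (min_le_right _ _)
  have hpow : ∀ n, 1 ≤ n → |ε ^ n| * 2 < r := fun n hn => by
    rw [abs_pow]
    have := pow_le_of_le_one (abs_nonneg ε) hε1.le (by omega : n ≠ 0)
    linarith
  have hbound : ∀ {E : Type} [SeminormedAddCommGroup E] [NormedSpace ℝ E] (n : ℕ) (v : E), 1 ≤ n →
      ‖v‖ < 2 → ‖ε ^ n • v‖ < r := by
    intro E _ _ n v hn hv
    rw [norm_smul, Real.norm_eq_abs]
    exact (mul_le_mul_of_nonneg_left hv.le (abs_nonneg _)).trans_lt (hpow n hn)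
  have hd : dist ((1, ε ^ 2 • x, 0, ε ^ 3 • v, ε ^ 1 • W) : ArgD) a₀ < r := by
    simp only [ha₀, Prod.dist_eq, dist_self, dist_zero_right, max_lt_iff]
    exact ⟨hr, hbound 2 x (by norm_num) hx, hr, hbound 3 v (by norm_num) hv,
      hbound 1 W le_rfl hW⟩
  have := H hd
  have hgr : ∀ l, gradArg ζ l (1, ε ^ 2 • x, 0, ε ^ 3 • v, ε ^ 1 • W) =
      gradArg ζ l (ε, x, u, v, W) := fun l => by simp [gradArg]
  have hhe : hessArg G ζ 0 0 (1, ε ^ 2 • x, 0, ε ^ 3 • v, ε ^ 1 • W) =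
      hessArg G ζ 0 0 (ε, x, u, v, W) := by
    simp only [hessArg, hgr]; simp
  have har : areaArg G ζ (1, ε ^ 2 • x, 0, ε ^ 3 • v, ε ^ 1 • W) =
      areaArg G ζ (ε, x, u, v, W) := by
    simp only [areaArg, hgr]; simp
  rw [hhe, har] at this
  simpa using this

lemma argD_mem_domD {ε ε₁ : ℝ} (hε : ε ∈ Ioo (-ε₁) ε₁) {w : Plane → ℝ} (h3 : SmallC3 w) {x : Plane}
    (hx : x ∈ Metric.ball (0 : Plane) 1) : argD ε w x ∈ domD ε₁ := by
  obtain ⟨a, b, c, -⟩ := h3 x (Metric.ball_subset_closedBall hx)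
  rw [mem_ball_zero_iff] at hx
  refine ⟨hε, ?_, ?_, ?_, ?_⟩ <;> rw [mem_ball_zero_iff] <;> simp only [argD] <;>
    first | linarith | (rw [Real.norm_eq_abs]; linarith)

/-- The Sobolev norm of the coordinates `ξ`. -/
lemma exists_sobolevNorm_coordinates_le (k : ℕ) (C : ℝ) (n : ℕ) (hn : n ≤ k) : ∃ S : ℝ,
    ∀ {w F : Plane → ℝ} {D : Set Plane} {lam δ : ℝ} {ξ : Plane → Plane}, ContDiff ℝ ∞ w → D ⊆ square →
      MeasurableSet D → ContDiff ℝ k F → IsTame (fun j => cNorm w (j + 2)) D k C F → 1 ≤ lam →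
      lam ≤ δ⁻¹ → (∀ x, ξ x = pt (lam * F x) (x 1)) →
      sobolevNorm n D ξ ≤ ENNReal.ofReal (δ⁻¹ * S) *
        (1 + sobolevNorm (n + 4) (Metric.ball 0 1) w) := by
  obtain ⟨S, hS, HS⟩ := exists_sobolevNorm_le n
  obtain ⟨T, hT, HT⟩ := exists_cNorm_le_sobolevNorm (n + 2)
  refine ⟨S * (|C| + 1) * T, fun {w F D lam δ ξ} hw hD hDm hF hFt hlam hlamδ hξ => ?_⟩
  have hn' : (n : WithTop ℕ∞) ≤ k := by exact_mod_cast hn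
  have hδ : 0 ≤ δ⁻¹ := by linarith
  have hlF : ContDiff ℝ n fun x => lam * F x := contDiff_const.mul (hF.of_le hn')
  have hw1 := one_le_cNorm w (n + 2)
  have hξ' : ξ = fun x => pt (lam * F x) (x 1) := funext hξ
  have h1 := HS D ξ (δ⁻¹ * (|C| + 1) * cNorm w (n + 2)) (by positivity)
    (hD.trans square_subset_ball) (by rw [hξ']; exact contDiff_pt hlF (contDiff_coord 1)) hDm ?_
  · refine h1.trans ?_
    have h2 : S * (δ⁻¹ * (|C| + 1) * cNorm w (n + 2)) =
        (δ⁻¹ * (S * (|C| + 1))) * cNorm w (n + 2) := by ring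
    rw [h2, ENNReal.ofReal_mul (by positivity)]
    have h3 : δ⁻¹ * (S * (|C| + 1) * T) = (δ⁻¹ * (S * (|C| + 1))) * T := by ring
    rw [h3, ENNReal.ofReal_mul (q := T) (by positivity), mul_assoc (ENNReal.ofReal _)]
    exact mul_le_mul_right (HT w hw) _
  · intro x hx j hj
    have hjn : (j : WithTop ℕ∞) ≤ n := by exact_mod_cast hj
    have hx1 : ‖x‖ ≤ 1 := (mem_ball_zero_iff.1 (square_subset_ball (hD hx))).le
    rw [hξ']
    refine (norm_iteratedFDeriv_pt_le (hlF.of_le hjn) (contDiff_coord 1) x).trans ?_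
    have h2 : ‖iteratedFDeriv ℝ j (fun x => lam * F x) x‖ ≤ lam * (|C| * cNorm w (n + 2)) := by
      have h3 := iteratedFDeriv_const_smul_apply' (a := lam) ((hF.of_le (hjn.trans hn')).contDiffAt (x := x))
      simp only [smul_eq_mul] at h3
      rw [h3, norm_smul, Real.norm_eq_abs, abs_of_pos (by linarith)]
      refine mul_le_mul_of_nonneg_left ((hFt.le x hx j (hj.trans hn)).trans ?_) (by linarith)
      exact mul_le_mul (le_abs_self C) (cNorm_mono w (by omega))
        (zero_le_one.trans (one_le_cNorm w _)) (abs_nonneg C)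
    have h3 := norm_iteratedFDeriv_coord_le 1 j hx1
    have h4 : 0 ≤ |C| * cNorm w (n + 2) := by positivity
    have h5 := mul_le_mul_of_nonneg_right hlamδ h4
    have h6 : 1 ≤ δ⁻¹ * cNorm w (n + 2) := one_le_mul_of_one_le_of_one_le (hlam.trans hlamδ) hw1
    calc _ ≤ lam * (|C| * cNorm w (n + 2)) + 1 := add_le_add h2 h3
      _ ≤ δ⁻¹ * (|C| * cNorm w (n + 2)) + δ⁻¹ * cNorm w (n + 2) := add_le_add h5 h6
      _ = _ := by ring

/-- The shear `c` and the range of the factor `λ` for the three kinds of regions. -/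
lemma exists_shear (κ : Kind) : ∃ c : ℝ, 0 ≤ c ∧ c ≤ 1 ∧ ∀ δ ∈ Ioo 0 (Real.pi / 4),
    0 < Real.tan δ ∧ ∃ lam : ℝ, 1 ≤ lam ∧ lam ≤ δ⁻¹ ∧ match κ with
      | .elliptic => c = 1 ∧ lam = (Real.tan δ)⁻¹
      | _ => c = 0 ∧ lam = 1 := by
  have h : ∀ δ ∈ Ioo 0 (Real.pi / 4), 0 < Real.tan δ ∧ 1 ≤ δ⁻¹ ∧ 1 ≤ (Real.tan δ)⁻¹ ∧
      (Real.tan δ)⁻¹ ≤ δ⁻¹ := by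
    intro δ hδ
    have hpi := Real.pi_lt_four
    have h1 := Real.lt_tan hδ.1 (by linarith [hδ.2, Real.pi_pos])
    have h2 : Real.tan δ ≤ 1 := by
      rw [← Real.tan_pi_div_four]
      exact (Real.tan_lt_tan_of_nonneg_of_lt_pi_div_two hδ.1.le (by linarith [Real.pi_pos]) hδ.2).le
    have h3 := hδ.1.trans h1
    exact ⟨h3, (one_le_inv₀ hδ.1).2 (by linarith [hδ.2]), (one_le_inv₀ h3).2 h2,
      inv_anti₀ hδ.1 h1.le⟩
  cases κ with
  | elliptic => exact ⟨1, zero_le_one, le_rfl, fun δ hδ =>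
      ⟨(h δ hδ).1, _, (h δ hδ).2.2.1, (h δ hδ).2.2.2, rfl, rfl⟩⟩
  | vertical => exact ⟨0, le_rfl, zero_le_one, fun δ hδ =>
      ⟨(h δ hδ).1, 1, le_rfl, (h δ hδ).2.1, rfl, rfl⟩⟩
  | lateral => exact ⟨0, le_rfl, zero_le_one, fun δ hδ =>
      ⟨(h δ hδ).1, 1, le_rfl, (h δ hδ).2.1, rfl, rfl⟩⟩

/-- The assertion for a metric in whose coordinates the region is one of the model sectors. The new
coordinates are `ξ = (λF, x²)`, where `F` is constant on the integral curves of `∂₂ - b ∂₁`,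
`b = ∇₁₂z / ∇₁₁z`. -/
theorem exists_canonical_coordinates (hG : IsSmoothMetric (m + 2) G O) (h0 : (0 : Plane) ∈ O)
    (hdet : 1 ≤ (G 0).det) (hζ : ContDiff ℝ ∞ ζ) (hζ1 : ∀ l, pd l ζ 0 = 0)
    (hζ00 : pd 0 (pd 0 ζ) 0 = 1) (hζ01 : pd 0 (pd 1 ζ) 0 = 0) (κ : Kind) :
    ∃ ε₁ : ℝ, 0 < ε₁ ∧ (∀ ε ∈ Ioo (-ε₁) ε₁, ∀ x ∈ Metric.ball (0 : Plane) 2, ε ^ 2 • x ∈ O) ∧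
    ContDiffOn ℝ m (kbarFun G ζ) (domK ε₁) ∧ ContDiffOn ℝ m (cbarFun G ζ) (domC ε₁) ∧
    ContDiffOn ℝ m (dbarFun G ζ) (domD ε₁) ∧
    ∃ (C : ℕ → ℝ) (C' σ₀ δ₀ : ℝ), 0 < σ₀ ∧ 0 < δ₀ ∧ δ₀ < Real.pi / 2 ∧
    ∀ σ ∈ Ioo 0 σ₀, ∃ ε₀ ∈ Ioc 0 ε₁, ∀ δ ∈ Ioo 0 δ₀, ∀ ε ∈ Ioo 0 ε₀,
    ∀ w : Plane → ℝ, ContDiff ℝ ∞ w → SmallC3 w →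
    ∃ ξ : OpenPartialHomeomorph Plane Plane, IsCoordChange (m + 4) σ ξ ∧
      IsStandardRegion σ δ C' {η | ‖η‖ < σ ∧ ξ.symm η ∈ sector κ} κ ∧
      HasCanonicalForm G ζ ε w (kbarFun G ζ) (cbarFun G ζ) (dbarFun G ζ) ξ ∧
      ∀ n : ℕ, n ≤ m + 2 → sobolevNorm n ξ.source ξ ≤
        ENNReal.ofReal (δ⁻¹ * C n) * (1 + sobolevNorm (n + 4) (Metric.ball 0 1) w) := by
  obtain ⟨c, hc0, hc1, hcκ⟩ := exists_shear κ
  obtain ⟨εa, hεa, -, Hdom⟩ := exists_domD hG h0 hdet hζ hζ1 hζ00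
  obtain ⟨CT, εb, hCT, hεb, hεb1, HT⟩ := exists_tame_slope hG h0 (by omega) hζ hζ1 hζ00 hζ01 hc0 hc1
  obtain ⟨Cb, hCb, Hb⟩ := exists_isSmallSlope (k := m + 2) (by omega) hc0 hc1
    (121 ^ ((m + 2) * (m + 2)) * 33) hCT
  obtain ⟨CF, HF⟩ := IsSmallSlope.exists_tame_shearedIntegral (m + 2)
    (121 ^ ((m + 2) * (m + 2)) * 33) Cb
  choose! C HC using exists_sobolevNorm_coordinates_le (m + 2) CF
  have hp0 : ∀ a ∈ domD εa, hessArg G ζ 0 0 a ≠ 0 := fun a ha => by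
    have := abs_lt.1 (Hdom a ha).2.1
    exact ne_of_gt (by linarith)
  refine ⟨εa, hεa, fun ε hε x hx => ?_, fun b hb => ?_, fun b hb => ?_, fun a ha => ?_,
    C, 1, 1 / 64, Real.pi / 4, by norm_num, by positivity, by linarith [Real.pi_pos],
    fun σ hσ => ?_⟩
  · exact (Hdom (ε, x, 0, 0, 0) ⟨hε, hx, by simp, by simp, by simp⟩).1
  · exact (contDiffAt_kbarFun hG hζ (Hdom b.1 hb.1).1 (hp0 _ hb.1)).contDiffWithinAt
  · exact (contDiffAt_cbarFun hG hζ (Hdom b.1 hb.1).1 (hp0 _ hb.1)).contDiffWithinAt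
  · exact (contDiffAt_dbarFun hG hζ (Hdom a ha).1 (hp0 _ ha)).contDiffWithinAt
  have hσ0 := hσ.1
  -- the slope `ε Cb` has to be small compared with `σ`, the bound for the distortion of the region
  refine ⟨min (min εa εb) (σ / (12 * Cb)), ⟨by positivity, (min_le_left _ _).trans (min_le_left _ _)⟩,
    fun δ hδ ε hε w hw h3 => ?_⟩
  obtain ⟨htan, lam, hlam, hlamδ, hcl⟩ := hcκ δ hδ
  have hε0 := hε.1
  have hεa' : ε < εa := hε.2.trans_le ((min_le_left _ _).trans (min_le_left _ _))
  have hεb' : ε < εb := hε.2.trans_le ((min_le_left _ _).trans (min_le_right _ _))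
  have hεσ : 12 * (ε * Cb) ≤ σ := by
    have := (lt_div_iff₀ (by positivity)).1 (hε.2.trans_le (min_le_right _ _))
    linarith
  have hη : ε * Cb ≤ 1 / 64 := by linarith [hσ.2]
  obtain ⟨T, hT, hTeq⟩ := HT ε ⟨hε0, hεb'⟩ w hw h3
  have hW := isWeight_cNorm hw h3 (m + 2)
  obtain ⟨b, hb, hbt, hbT⟩ := Hb hW hT hε0 (by linarith) hη
  obtain ⟨ξ, hsrc, hξ, hξ1, hξ2, hinv, hball⟩ := hb.exists_coordinates hη hc0 hc1 hlam
  have hsq : ξ.source ⊆ square := by rw [hsrc]; exact hb.shearedBox_subset_square hη hc0 hc1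
  have hb1 : ξ.source ⊆ Metric.ball 0 1 := hsq.trans square_subset_ball
  have hdom : ∀ x ∈ ξ.source, argD ε w x ∈ domD εa := fun x hx =>
    argD_mem_domD ⟨by linarith, hεa'⟩ h3 (hb1 hx)
  have hpH : ∀ x, hessArg G ζ 0 0 (argD ε w x) = covHess G (height ζ ε w) 0 0 (ε ^ 2 • x) :=
    fun x => hessArg_argD hζ hε0.ne' hw 0 0 x
  have hF := hb.contDiff_shearedIntegral c
  refine ⟨ξ, ⟨hb1, (hball σ hσ.2.le).1, (hball σ hσ.2.le).2, ?_, ?_, ?_⟩,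
    hb.isStandardRegion_of_sector hεσ (by linarith [hσ.2]) htan κ hcl hξ hinv,
    hasCanonicalForm (F := hb.shearedIntegral c) (lam := lam) hG hζ hε0.ne' hw
      (fun x hx => (Hdom _ (hdom x hx)).1) (fun x hx => ?_)
      (fun x hx => ?_) (fun η _ => ?_) (by linarith) hξ ?_ (fun x _ => ?_) (fun x hx => ?_),
    fun n hn => HC n hn hw hsq ξ.open_source.measurableSet hF ?_ hlam hlamδ hξ⟩
  · rw [hξ]
    have := hb.shearedIntegral_line c 0
    rw [mul_zero] at this
    have h00 : (0 : Plane) = pt 0 0 := plane_ext (by simp) (by simp)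
    rw [h00, this]
    simp
  · exact hξ1.contDiffOn
  · exact hξ2.contDiffOn
  · have := abs_lt.1 (Hdom _ (hdom x hx)).2.1
    rw [hpH] at this
    rw [a22]; linarith
  · have h1 := (Hdom _ (hdom x hx)).2
    have h2 := abs_lt.1 h1.1
    have h4 := _root_.abs_le.1 (hb.abs_pd_zero_shearedIntegral_sub_one hc0 hc1 x)
    have h5 : grad ξ x 0 0 = lam * pd 0 (hb.shearedIntegral c) x := by
      have h6 := pd_apply (hξ1.differentiable (by norm_cast) x) 0 0
      rw [grad, ← h6]
      have h7 : (fun y => ξ y 0) = fun y => lam * hb.shearedIntegral c y := by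
        ext y; rw [hξ, pt_zero]
      rw [h7, pd_const_mul _ (hF.differentiable (by norm_cast) x)]
    have h8 : 29 / 32 ≤ grad ξ x 0 0 := by
      rw [h5]
      have : 29 / 32 ≤ pd 0 (hb.shearedIntegral c) x := by linarith
      nlinarith
    change 1 / 2 < areaArg G ζ (argD ε w x) * (grad ξ x 0 0) ^ 2 / hessArg G ζ 0 0 (argD ε w x) ^ 2
    set p := hessArg G ζ 0 0 (argD ε w x)
    have hp : p ^ 2 < 121 / 100 := by nlinarith
    have hp' : 0 < p ^ 2 := by nlinarith
    have hq : 8 / 10 ≤ (grad ξ x 0 0) ^ 2 := by nlinarith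
    rw [lt_div_iff₀ hp']
    have h9 := h1.2
    nlinarith
  · exact hξ2.differentiable (by norm_cast) η
  · exact hF.of_le (by exact_mod_cast (by omega : 2 ≤ m + 2))
  · exact (hb.pd_zero_shearedIntegral_pos hc0 hc1 x).ne'
  -- the relation `(∇₁₁z) ∂₂F = (∇₁₂z) ∂₁F`, which removes the mixed second derivative
  · have hx' : x ∈ hb.shearedBox c := hsrc ▸ hx
    obtain ⟨e1, e2⟩ := hb.pd_shearedIntegral c x
    have hy : (lowerShear c).symm x ∈ hb.box (1 / 16) := by
      rw [hb.shearedBox_eq] at hx'; exact hx'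
    have e3 := hbT _ (hb.box_subset_ball hη hy)
    rw [ContinuousLinearEquiv.apply_symm_apply] at e3
    have e4 := (hTeq x (hsq hx)).2
    rw [e1, e2, e3]
    linear_combination (-pd 0 hb.firstIntegral ((lowerShear c).symm x)) * e4
  · rw [hsrc]
    exact HF hb hW hη hc0 hc1 hbt

end Straightened

/-! ### Straightening the zero set of the curvature -/

/-- Near the origin, a point of a simple arc has a small parameter. -/
lemma IsArc.eventually_abs_lt {m : ℕ} {γ : ℝ → Plane} (hγ : IsArc m γ) {r : ℝ} (hr : 0 < r) :
    ∀ᶠ p in 𝓝 (0 : Plane), ∀ s ∈ Icc (-1 : ℝ) 1, γ s = p → |s| < r := by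
  obtain ⟨h0, hc, hinj⟩ := hγ
  have hcpt : IsCompact (γ '' (Icc (-1) 1 ∩ {s | r ≤ |s|})) :=
    (isCompact_Icc.inter_right (isClosed_le continuous_const continuous_abs)).image_of_continuousOn
      (hc.continuousOn.mono inter_subset_left)
  have h0' : (0 : Plane) ∉ γ '' (Icc (-1) 1 ∩ {s | r ≤ |s|}) := by
    rintro ⟨s, ⟨hs, hsr⟩, hs0⟩
    have := hinj hs (by simp) (hs0.trans h0.symm)
    rw [mem_ofPred_eq, this, abs_zero] at hsr
    linarith
  filter_upwards [hcpt.isClosed.isOpen_compl.mem_nhds h0'] with p hp s hs hsp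
  by_contra h
  exact hp ⟨s, ⟨hs, not_lt.1 h⟩, hsp⟩

lemma IsArc.contDiffAt {m : ℕ} {γ : ℝ → Plane} (hγ : IsArc m γ) {s : ℝ} (hs : |s| < 1) :
    ContDiffAt ℝ m γ s :=
  hγ.2.1.contDiffAt (Icc_mem_nhds (abs_lt.1 hs).1 (abs_lt.1 hs).2)

/-- Coordinates in which the two curves are the coordinate axes: the sum of the two
parametrizations. -/
lemma exists_straightening {m : ℕ} (hm : 1 ≤ m) {f : Plane → ℝ} (hf : ZeroSetTwoCurves m f)
    {U : Set Plane} (hU : U ∈ 𝓝 (0 : Plane)) : ∃ (χ : OpenPartialHomeomorph Plane Plane) (ρ : ℝ),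
      0 < ρ ∧ χ.source = Metric.ball 0 ρ ∧ χ 0 = 0 ∧ χ.target ⊆ U ∧
      (∀ x ∈ χ.source, ContDiffAt ℝ m χ x) ∧ (∀ p ∈ χ.target, ContDiffAt ℝ m χ.symm p) ∧
      ∀ x ∈ χ.source, f (χ x) = 0 ↔ x 0 = 0 ∨ x 1 = 0 := by
  obtain ⟨γ₁, γ₂, h1, h2, hli, hz⟩ := hf
  have hm0 : (m : WithTop ℕ∞) ≠ 0 := by norm_cast; omega
  set F : Plane → Plane := fun x => γ₁ (x 0) + γ₂ (x 1) with hF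
  have hFc : ∀ x : Plane, |x 0| < 1 → |x 1| < 1 → ContDiffAt ℝ m F x := fun x h0' h1' =>
    ((h1.contDiffAt h0').comp x (contDiff_coord 0).contDiffAt).add
      ((h2.contDiffAt h1').comp x (contDiff_coord 1).contDiffAt)
  have hF0 : F 0 = 0 := by simp [hF, h1.1, h2.1]
  have hFc0 : ContDiffAt ℝ m F 0 := hFc 0 (by simp) (by simp)
  have hd : ∀ v, fderiv ℝ F 0 v = v 0 • deriv γ₁ 0 + v 1 • deriv γ₂ 0 := by
    intro v
    have hγ : ∀ {γ : ℝ → Plane} (i : Fin 2), IsArc m γ → HasFDerivAt (fun x : Plane => γ (x i))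
        ((coord i).smulRight (deriv γ 0)) 0 := by
      intro γ i hγ
      have h3 : HasDerivAt γ (deriv γ 0) ((coord i) (0 : Plane)) := by
        rw [map_zero]
        exact ((hγ.contDiffAt (by simp)).differentiableAt hm0).hasDerivAt
      exact (h3.hasFDerivAt.comp (0 : Plane) (coord i).hasFDerivAt).congr_fderiv (by ext; simp)
    rw [((hγ 0 h1).fun_add (hγ 1 h2)).fderiv]
    rfl
  have hinj : Function.Injective (fderiv ℝ F 0) := by
    refine (injective_iff_map_eq_zero _).2 fun v hv => ?_
    rw [hd] at hv
    have := LinearIndependent.pair_iff.1 hli _ _ hv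
    exact plane_ext (by simpa using this.1) (by simpa using this.2)
  set D : Plane ≃L[ℝ] Plane :=
    (LinearEquiv.ofInjectiveEndo (fderiv ℝ F 0 : Plane →ₗ[ℝ] Plane) hinj).toContinuousLinearEquiv
  have hD : HasFDerivAt F (D : Plane →L[ℝ] Plane) 0 :=
    (hFc0.differentiableAt hm0).hasFDerivAt.congr_fderiv (by ext v; rfl)
  set E := hFc0.toOpenPartialHomeomorph F hD hm0 with hE
  have hE0 : (0 : Plane) ∈ E.source := hFc0.mem_toOpenPartialHomeomorph_source hD hm0
  have hEF : ∀ x, E x = F x := fun x => rfl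
  have hEs0 : E.symm 0 = 0 := by
    have := E.left_inv hE0
    rwa [hEF, hF0] at this
  have hEt0 : (0 : Plane) ∈ E.target := by
    have := E.map_source hE0
    rwa [hEF, hF0] at this
  have hsymm : ContDiffAt ℝ m E.symm 0 :=
    E.contDiffAt_symm hEt0 (by rw [hEs0]; exact hD) (by rw [hEs0]; exact hFc0)
  obtain ⟨r, hr, hrE⟩ := Metric.isOpen_iff.1 E.open_source 0 hE0
  have hev : ∀ᶠ x in 𝓝 (0 : Plane), F x ∈ U ∧ ContDiffAt ℝ m E.symm (F x) ∧
      (f (F x) = 0 ↔ F x ∈ γ₁ '' Icc (-1) 1 ∪ γ₂ '' Icc (-1) 1) ∧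
      (∀ s ∈ Icc (-1 : ℝ) 1, γ₁ s = F x → |s| < r) ∧
      (∀ s ∈ Icc (-1 : ℝ) 1, γ₂ s = F x → |s| < r) := by
    have hc : Tendsto F (𝓝 0) (𝓝 0) := by
      have := hFc0.continuousAt.tendsto
      rwa [hF0] at this
    exact hc.eventually ((eventually_mem_set.2 hU).and
      ((hsymm.eventually (by exact_mod_cast ENat.natCast_ne_top m)).and
      (hz.and ((h1.eventually_abs_lt hr).and (h2.eventually_abs_lt hr)))))
  obtain ⟨ρ', hρ', H⟩ := Metric.eventually_nhds_iff.1 hev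
  set ρ := min (min ρ' r) 1 with hρ
  have hρ0 : 0 < ρ := by positivity
  have hball : ∀ x ∈ Metric.ball (0 : Plane) ρ, x ∈ E.source := fun x hx =>
    hrE (Metric.ball_subset_ball ((min_le_left _ _).trans (min_le_right _ _)) hx)
  have hball' : ∀ x ∈ Metric.ball (0 : Plane) ρ, dist x 0 < ρ' := fun x hx =>
    (Metric.mem_ball.1 hx).trans_le ((min_le_left _ _).trans (min_le_left _ _))
  have hcoord : ∀ x ∈ Metric.ball (0 : Plane) ρ, ∀ i, |x i| < 1 := fun x hx i =>
    ((abs_coord_le x i).trans_lt (mem_ball_zero_iff.1 hx)).trans_le (min_le_right _ _)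
  refine ⟨E.restrOpen (Metric.ball 0 ρ) Metric.isOpen_ball, ρ, hρ0, ?_, hF0, ?_, ?_, ?_, ?_⟩
  · rw [OpenPartialHomeomorph.restrOpen_source]
    exact inter_eq_right.2 hball
  · intro p hp
    obtain ⟨x, hx, rfl⟩ : ∃ x ∈ Metric.ball (0 : Plane) ρ, F x = p :=
      ⟨E.symm p, hp.2, E.right_inv hp.1⟩
    exact (H (hball' x hx)).1
  · intro x hx
    exact hFc x (hcoord x hx.2 0) (hcoord x hx.2 1)
  · intro p hp
    obtain ⟨x, hx, rfl⟩ : ∃ x ∈ Metric.ball (0 : Plane) ρ, F x = p :=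
      ⟨E.symm p, hp.2, E.right_inv hp.1⟩
    exact (H (hball' x hx)).2.1
  · rintro x ⟨hxs, hx⟩
    obtain ⟨-, -, h3, h4, h5⟩ := H (hball' x hx)
    change f (F x) = 0 ↔ _
    rw [h3]
    constructor
    · rintro (⟨s, hs, hsx⟩ | ⟨s, hs, hsx⟩)
      · have h6 : pt s 0 ∈ E.source := hrE <| by
          rw [mem_ball_zero_iff]
          exact (norm_plane_le _).trans_lt (by simpa using h4 s hs hsx)
        have h7 : E (pt s 0) = E x := by rw [hEF, hEF, ← hsx]; simp [hF, h2.1]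
        right
        rw [← E.injOn h6 hxs h7, pt_one]
      · have h6 : pt 0 s ∈ E.source := hrE <| by
          rw [mem_ball_zero_iff]
          exact (norm_plane_le _).trans_lt (by simpa using h5 s hs hsx)
        have h7 : E (pt 0 s) = E x := by rw [hEF, hEF, ← hsx]; simp [hF, h1.1]
        left
        rw [← E.injOn h6 hxs h7, pt_zero]
    · have h8 : ∀ i, x i ∈ Icc (-1 : ℝ) 1 := fun i =>
        ⟨(abs_lt.1 (hcoord x hx i)).1.le, (abs_lt.1 (hcoord x hx i)).2.le⟩
      rintro (h | h)
      · exact Or.inr ⟨x 1, h8 1, by simp [hF, h, h1.1]⟩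
      · exact Or.inl ⟨x 0, h8 0, by simp [hF, h, h2.1]⟩

/-- The regions are the images of the four quadrants. -/
lemma exists_quadrant_of_isRegion {g : Plane → Matrix (Fin 2) (Fin 2) ℝ}
    {χ : OpenPartialHomeomorph Plane Plane} {ρ : ℝ} (hsrc : χ.source = Metric.ball 0 ρ)
    (hz : ∀ x ∈ χ.source, gaussCurv g (χ x) = 0 ↔ x 0 = 0 ∨ x 1 = 0) {Ω : Set Plane}
    (hΩ : IsRegion g χ.target Ω) : ∃ s t : ℝ, (s = 1 ∨ s = -1) ∧ (t = 1 ∨ t = -1) ∧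
      ∀ x ∈ χ.source, χ x ∈ Ω ↔ 0 < s * x 0 ∧ 0 < t * x 1 := by
  obtain ⟨p, hpV, hpK, rfl⟩ := hΩ
  set W := {q ∈ χ.target | gaussCurv g q ≠ 0} with hW
  have hW0 : ∀ q ∈ W, χ.symm q 0 ≠ 0 ∧ χ.symm q 1 ≠ 0 := by
    rintro q ⟨hq, hqK⟩
    have := hz _ (χ.map_target hq)
    rw [χ.right_inv hq] at this
    exact not_or.1 (mt this.2 hqK)
  have hpW : p ∈ W := ⟨hpV, hpK⟩
  have hsign : ∀ a : ℝ, a ≠ 0 → ∃ s : ℝ, (s = 1 ∨ s = -1) ∧ 0 < s * a := by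
    intro a ha
    rcases lt_or_gt_of_ne ha with h | h
    · exact ⟨-1, Or.inr rfl, by linarith⟩
    · exact ⟨1, Or.inl rfl, by linarith⟩
  obtain ⟨s, hs, hsp⟩ := hsign _ (hW0 p hpW).1
  obtain ⟨t, ht, htp⟩ := hsign _ (hW0 p hpW).2
  refine ⟨s, t, hs, ht, fun x hx => ⟨fun hxC => ?_, fun hxQ => ?_⟩⟩
  · -- the coordinates have constant signs on a connected set on which they do not vanish
    have hconst : ∀ (i : Fin 2) (a : ℝ), a ≠ 0 → (∀ q ∈ W, χ.symm q i ≠ 0) →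
        0 < a * χ.symm p i → 0 < a * x i := by
      intro i a ha hi hp
      have hcont : ContinuousOn (fun q => a * χ.symm q i) (connectedComponentIn W p) :=
        continuousOn_const.mul ((coord i).continuous.comp_continuousOn
          (χ.continuousOn_symm.mono fun q hq => (connectedComponentIn_subset W p hq).1))
      have hconn := (isPreconnected_connectedComponentIn (F := W) (x := p)).image _ hcont
      by_contra hneg
      have h1 : a * χ.symm (χ x) i ≤ 0 := by rw [χ.left_inv hx]; exact not_lt.1 hneg
      obtain ⟨q, hq, hq0⟩ := hconn.Icc_subset ⟨_, hxC, rfl⟩ ⟨_, mem_connectedComponentIn hpW, rfl⟩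
        ⟨h1, hp.le⟩
      exact mul_ne_zero ha (hi q (connectedComponentIn_subset W p hq)) hq0
    have hne : ∀ {a : ℝ}, a = 1 ∨ a = -1 → a ≠ 0 := by rintro a (rfl | rfl) <;> norm_num
    exact ⟨hconst 0 s (hne hs) (fun q hq => (hW0 q hq).1) hsp,
      hconst 1 t (hne ht) (fun q hq => (hW0 q hq).2) htp⟩
  · set Q := Metric.ball (0 : Plane) ρ ∩ {x | 0 < s * x 0 ∧ 0 < t * x 1}
    have hQ : Convex ℝ Q := by
      refine (convex_ball _ _).inter (Convex.inter ?_ ?_)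
      · exact convex_halfSpace_gt (f := fun x : Plane => s * x 0)
          ⟨fun x y => by simp [mul_add], fun c x => by simp; ring⟩ 0
      · exact convex_halfSpace_gt (f := fun x : Plane => t * x 1)
          ⟨fun x y => by simp [mul_add], fun c x => by simp; ring⟩ 0
    have hQs : Q ⊆ χ.source := by rw [hsrc]; exact inter_subset_left
    have hconn := hQ.isPreconnected.image χ (χ.continuousOn.mono hQs)
    have hsub : χ '' Q ⊆ W := by
      rintro _ ⟨y, hy, rfl⟩
      refine ⟨χ.map_source (hQs hy), fun h => ?_⟩
      rcases (hz y (hQs hy)).1 h with h' | h'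
      · have := hy.2.1; rw [h', mul_zero] at this; exact lt_irrefl _ this
      · have := hy.2.2; rw [h', mul_zero] at this; exact lt_irrefl _ this
    have hpQ : p ∈ χ '' Q := by
      refine ⟨χ.symm p, ⟨?_, hsp, htp⟩, χ.right_inv hpV⟩
      rw [← hsrc]; exact χ.map_target hpV
    refine hconn.subset_connectedComponentIn hpQ hsub ⟨x, ⟨?_, hxQ⟩, rfl⟩
    rwa [← hsrc]

/-! ### Metrics in new coordinates -/

/-- The Jacobian determinant. -/
def jac (f : Plane → Plane) (y : Plane) : ℝ := pd 0 f y 0 * pd 1 f y 1 - pd 1 f y 0 * pd 0 f y 1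

lemma jac_comp {f h : Plane → Plane} {y : Plane} (hf : DifferentiableAt ℝ f (h y))
    (hh : DifferentiableAt ℝ h y) : jac (fun y => f (h y)) y = jac f (h y) * jac h y := by
  simp only [jac, pd_comp_plane _ hf hh]
  simp only [PiLp.add_apply, PiLp.smul_apply, smul_eq_mul]
  ring

lemma jac_congr {f h : Plane → Plane} {y : Plane} (H : f =ᶠ[𝓝 y] h) : jac f y = jac h y := by
  simp only [jac, pd_congr H]

lemma jac_clm (L : Plane →L[ℝ] Plane) (y : Plane) :
    jac L y = L (e 0) 0 * L (e 1) 1 - L (e 1) 0 * L (e 0) 1 := by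
  simp only [jac, pd, L.fderiv]

lemma jac_ne_zero {χ : OpenPartialHomeomorph Plane Plane} {x : Plane} (hx : x ∈ χ.source)
    (h : DifferentiableAt ℝ χ x) (h' : DifferentiableAt ℝ χ.symm (χ x)) : jac χ x ≠ 0 := by
  have h1 := jac_comp h' h
  have h2 : (fun y => χ.symm (χ y)) =ᶠ[𝓝 x] (ContinuousLinearMap.id ℝ Plane) :=
    χ.eventually_left_inverse hx
  rw [jac_congr h2, jac_clm] at h1
  intro h3
  rw [h3, mul_zero] at h1
  simp at h1

lemma det_pullback (χ : Plane → Plane) (g : Plane → Matrix (Fin 2) (Fin 2) ℝ) (y : Plane) :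
    (pullback χ g y).det = (g (χ y)).det * jac χ y ^ 2 := by
  simp only [pullback, jac, Matrix.det_fin_two, Matrix.of_apply, Fin.sum_univ_two]
  ring

/-- The expression of a metric in coordinates `B⁻¹ ∘ χ⁻¹` with a linear map `B`. -/
lemma isSmoothMetric_pullback {m : ℕ} {g : Plane → Matrix (Fin 2) (Fin 2) ℝ} {U : Set Plane}
    (hU : IsOpen U) (hg : IsMetricOn (m + 2) g U) {χ : OpenPartialHomeomorph Plane Plane}
    (hχU : χ.target ⊆ U) (hχ : ∀ x ∈ χ.source, ContDiffAt ℝ (m + 2 : ℕ) χ x)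
    (hχ' : ∀ p ∈ χ.target, ContDiffAt ℝ (m + 2 : ℕ) χ.symm p) (B : Plane ≃L[ℝ] Plane) :
    IsSmoothMetric m (pullback (fun y => χ (B y)) g) (B ⁻¹' χ.source) ∧
      ∀ y ∈ B ⁻¹' χ.source, (pullback (fun y => χ (B y)) g y).det =
        (g (χ (B y))).det * jac χ (B y) ^ 2 * jac B y ^ 2 := by
  have h2 : ((m + 2 : ℕ) : WithTop ℕ∞) ≠ 0 := by norm_cast
  have hΨ : ∀ y ∈ B ⁻¹' χ.source, ContDiffAt ℝ (m + 2 : ℕ) (fun y => χ (B y)) y := fun y hy =>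
    (hχ _ hy).comp y B.contDiff.contDiffAt
  have hd : ∀ y ∈ B ⁻¹' χ.source, (pullback (fun y => χ (B y)) g y).det =
      (g (χ (B y))).det * jac χ (B y) ^ 2 * jac B y ^ 2 := fun y hy => by
    rw [det_pullback, jac_comp ((hχ _ hy).differentiableAt h2) (B.differentiable y)]; ring
  have hmem : ∀ y ∈ B ⁻¹' χ.source, χ (B y) ∈ U := fun y hy => hχU (χ.map_source hy)
  refine ⟨⟨χ.open_source.preimage B.continuous, fun y hy i j => ?_, fun y hy i j => ?_,
    fun y hy => ?_⟩, hd⟩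
  · have hp : ∀ i a, ContDiffAt ℝ (m + 1 : ℕ) (fun q => pd i (fun y => χ (B y)) q a) y :=
      fun i a => (contDiff_coord a).contDiffAt.comp y ((hΨ y hy).pd (by norm_cast) i)
    have hgc : ∀ a b, ContDiffAt ℝ (m + 1 : ℕ) (fun q => g (χ (B q)) a b) y := fun a b =>
      (((hg.2 a b).contDiffAt (hU.mem_nhds (hmem y hy))).comp y (hΨ y hy)).of_le
        (by norm_cast; omega)
    simp only [pullback, Matrix.of_apply]
    exact ContDiffAt.sum fun a _ => ContDiffAt.sum fun b _ => ((hgc a b).mul (hp i a)).mul (hp j b)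
  · have hs : g (χ (B y)) 1 0 = g (χ (B y)) 0 1 := by
      have := (hg.1 _ (hmem y hy)).isHermitian.apply 0 1
      simpa using this
    simp only [pullback, Matrix.of_apply, Fin.sum_univ_two, hs]
    ring
  · rw [hd y hy]
    have h3 := (hg.1 _ (hmem y hy)).det_pos
    have h4 := jac_ne_zero hy ((hχ _ hy).differentiableAt h2)
      ((hχ' _ (χ.map_source hy)).differentiableAt h2)
    have h5 : jac B y ≠ 0 := by
      have := jac_ne_zero (χ := B.toHomeomorph.toOpenPartialHomeomorph) (x := y) (mem_univ _)
        (B.differentiable y) (B.symm.differentiable _)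
      exact this
    positivity

/-! ### The approximate solution -/

lemma contDiff_eval (p : MvPolynomial (Fin 2) ℝ) :
    ContDiff ℝ ∞ fun y : Plane => MvPolynomial.eval (fun i => y i) p := by
  simp only [MvPolynomial.eval_eq']
  exact ContDiff.sum fun d _ => contDiff_const.mul
    (contDiff_prod fun i _ => (contDiff_coord i).pow _)

lemma eval_smul_of_isHomogeneous {p : MvPolynomial (Fin 2) ℝ} {n : ℕ} (hp : p.IsHomogeneous n)
    (t : ℝ) (y : Plane) : MvPolynomial.eval (fun i => (t • y) i) p =
      t ^ n * MvPolynomial.eval (fun i => y i) p := by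
  simp only [MvPolynomial.eval_eq', Finset.mul_sum]
  refine Finset.sum_congr rfl fun d hd => ?_
  have h1 : d 0 + d 1 = n := by
    have := hp (MvPolynomial.mem_support_iff.1 hd)
    rw [Finsupp.weight_apply, Finsupp.sum_fintype _ _ (by simp)] at this
    simpa using this
  simp only [PiLp.smul_apply, smul_eq_mul, Fin.prod_univ_two, mul_pow, ← h1, pow_add]
  ring

/-- The derivatives of a homogeneous function are homogeneous. -/
lemma pd_homogeneous {f : Plane → ℝ} {d : ℕ} (hf : ∀ t : ℝ, t ≠ 0 → ∀ y, f (t • y) = t ^ (d + 1) * f y)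
    (hfd : Differentiable ℝ f) (i : Fin 2) (t : ℝ) (ht : t ≠ 0) (y : Plane) :
    pd i f (t • y) = t ^ d * pd i f y := by
  have h1 := pd_comp_smul f t i y
  have h2 : (fun y => f (t • y)) = fun y => t ^ (d + 1) * f y := funext (hf t ht)
  rw [h2, pd_const_mul _ (hfd y), smul_eq_mul] at h1
  refine mul_left_cancel₀ ht ?_
  rw [← h1]; ring

lemma homogeneous_zero {f : Plane → ℝ} {d : ℕ}
    (hf : ∀ t : ℝ, t ≠ 0 → ∀ y, f (t • y) = t ^ (d + 1) * f y) : f 0 = 0 := by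
  have h := hf 2 two_ne_zero 0
  rw [smul_zero] at h
  have h2 : (1 : ℝ) < 2 ^ (d + 1) := one_lt_pow₀ one_lt_two (by omega)
  nlinarith

/-- The `2`-jet of the approximate solution at the origin in linear coordinates. -/
lemma jet_approxSolution {M : ℕ} {z₀ : Plane → ℝ} {p : ℕ → MvPolynomial (Fin 2) ℝ}
    (hp : ∀ n, (p n).IsHomogeneous n) (hz : ∀ y : Plane, z₀ y = (1 / 2) * y 0 ^ 2 +
      ∑ n ∈ Finset.Icc 3 M, MvPolynomial.eval (fun i => y i) (p n)) (A : Plane ≃L[ℝ] Plane) {α : ℝ}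
    (hα : α ^ 2 = 1) (hA : ∀ y, A y 0 = α * y 0) :
    ContDiff ℝ ∞ (fun y => z₀ (A y)) ∧ (∀ l, pd l (fun y => z₀ (A y)) 0 = 0) ∧
      pd 0 (pd 0 fun y => z₀ (A y)) 0 = 1 ∧ pd 0 (pd 1 fun y => z₀ (A y)) 0 = 0 := by
  set R : Plane → ℝ := fun y => ∑ n ∈ Finset.Icc 3 M, MvPolynomial.eval (fun i => A y i) (p n) with hR
  have hS : ∀ n, ContDiff ℝ ∞ fun y => MvPolynomial.eval (fun i => A y i) (p n) := fun n =>
    (contDiff_eval (p n)).comp A.contDiff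
  have hRc : ContDiff ℝ ∞ R := ContDiff.sum fun n _ => hS n
  have hSd : ∀ n, Differentiable ℝ fun y => MvPolynomial.eval (fun i => A y i) (p n) := fun n =>
    (hS n).differentiable (by simp)
  have hSd' : ∀ n i, ContDiff ℝ ∞ (pd i fun y => MvPolynomial.eval (fun i => A y i) (p n)) :=
    fun n i => contDiff_infty_pd (hS n) i
  have hSh : ∀ n, ∀ t : ℝ, t ≠ 0 → ∀ y, MvPolynomial.eval (fun i => A (t • y) i) (p (n + 3)) =
      t ^ (n + 3) * MvPolynomial.eval (fun i => A y i) (p (n + 3)) := fun n t _ y => by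
    rw [map_smul]; exact eval_smul_of_isHomogeneous (hp _) t _
  have h3 : ∀ n ∈ Finset.Icc 3 M, ∃ k, n = k + 3 := fun n hn =>
    ⟨n - 3, by have := (Finset.mem_Icc.1 hn).1; omega⟩
  have hpdR : ∀ i, pd i R = fun y => ∑ n ∈ Finset.Icc 3 M,
      pd i (fun y => MvPolynomial.eval (fun i => A y i) (p n)) y := fun i => by
    ext y; exact pd_sum (fun n _ => hSd n y) i
  have hR1 : ∀ i, pd i R 0 = 0 := fun i => by
    rw [hpdR]
    refine Finset.sum_eq_zero fun n hn => ?_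
    obtain ⟨k, rfl⟩ := h3 n hn
    exact homogeneous_zero (d := k + 1) (pd_homogeneous (d := k + 2) (hSh k) (hSd _) i)
  have hR2 : ∀ i j, pd j (pd i R) 0 = 0 := fun i j => by
    rw [hpdR, pd_sum (fun n _ => (hSd' n i).differentiable (by simp) 0)]
    refine Finset.sum_eq_zero fun n hn => ?_
    obtain ⟨k, rfl⟩ := h3 n hn
    exact homogeneous_zero (d := k) (pd_homogeneous (d := k + 1)
      (pd_homogeneous (d := k + 2) (hSh k) (hSd _) i) ((hSd' _ i).differentiable (by simp)) j)
  have hζ : (fun y => z₀ (A y)) = fun y : Plane => (1 / 2) * (y 0 * y 0) + R y := by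
    ext y
    rw [hz, hA, hR]
    have : (α * y 0) ^ 2 = y 0 * y 0 := by rw [mul_pow, hα]; ring
    rw [this]
  have hc0 : ContDiff ℝ ∞ fun y : Plane => y 0 := contDiff_coord 0
  have hc0d : Differentiable ℝ fun y : Plane => y 0 := (coord 0).differentiable
  have hsq : ContDiff ℝ ∞ fun y : Plane => (1 / 2) * (y 0 * y 0) :=
    contDiff_const.mul (hc0.mul hc0)
  have hpd : ∀ i, pd i (fun y => z₀ (A y)) = fun y => (if i = 0 then 1 else 0) * y 0 + pd i R y := by
    intro i
    ext y
    rw [hζ, pd_add (hsq.differentiable (by simp) y) (hRc.differentiable (by simp) y),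
      pd_const_mul _ ((hc0d y).fun_mul (hc0d y)), pd_mul (hc0d y) (hc0d y), pd_coord]
    ring
  have hpd2 : ∀ i, pd 0 (pd i fun y => z₀ (A y)) 0 = if i = 0 then 1 else 0 := by
    intro i
    rw [hpd, pd_add ((hc0d 0).const_mul _) ((contDiff_infty_pd hRc i).differentiable (by simp) 0),
      pd_const_mul _ (hc0d 0), pd_coord, hR2]
    simp
  refine ⟨by rw [hζ]; exact hsq.add hRc, fun l => ?_, by simpa using hpd2 0, by simpa using hpd2 1⟩
  rw [hpd]
  simp [hR1]

/-! ### Linear coordinates adapted to a region -/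

/-- The linear coordinate change with the matrix `(a, b; c, d)`. -/
def linearEquiv (a b c d : ℝ) (h : a * d - b * c ≠ 0) : Plane ≃L[ℝ] Plane :=
  LinearEquiv.toContinuousLinearEquiv
    { toFun := fun y => pt (a * y 0 + b * y 1) (c * y 0 + d * y 1)
      map_add' := fun x y => plane_ext (by simp; ring) (by simp; ring)
      map_smul' := fun r x => plane_ext (by simp; ring) (by simp; ring)
      invFun := fun y => pt ((d * y 0 - b * y 1) / (a * d - b * c))
        ((a * y 1 - c * y 0) / (a * d - b * c))
      left_inv := fun y => plane_ext
        (by simp only [pt_zero, pt_one]; rw [div_eq_iff h]; ring)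
        (by simp only [pt_zero, pt_one]; rw [div_eq_iff h]; ring)
      right_inv := fun y => plane_ext
        (by simp only [pt_zero, pt_one]
            rw [mul_div_assoc', mul_div_assoc', ← add_div, div_eq_iff h]; ring)
        (by simp only [pt_zero, pt_one]
            rw [mul_div_assoc', mul_div_assoc', ← add_div, div_eq_iff h]; ring) }

section

variable {a b c d : ℝ} (h : a * d - b * c ≠ 0)

lemma linearEquiv_apply (y : Plane) :
    linearEquiv a b c d h y = pt (a * y 0 + b * y 1) (c * y 0 + d * y 1) := rfl

lemma jac_linearEquiv (y : Plane) : jac (linearEquiv a b c d h) y = a * d - b * c := by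
  have := jac_clm (linearEquiv a b c d h : Plane →L[ℝ] Plane) y
  refine this.trans ?_
  simp only [ContinuousLinearEquiv.coe_coe, linearEquiv_apply]
  simp

end

/-- A region bounded by the lines `y² = ± Λ y¹` becomes the model sector in suitable linear
coordinates. -/
lemma exists_adapted_coordinates {Λ : ℝ} (hΛ : 0 < Λ) (κ : Kind) {a b : ℝ} (ha : a = 1 ∨ a = -1)
    (hb : b = 1 ∨ b = -1) (hab : match κ with | .vertical => a = b | _ => a ≠ b) :
    ∃ α ν μ : ℝ, α ^ 2 = 1 ∧ Λ ^ 2 ≤ μ ^ 2 ∧ ∀ y : Plane,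
      (0 < a * (ν * y 0 + μ * y 1 - Λ * (α * y 0)) ∧ 0 < b * (ν * y 0 + μ * y 1 + Λ * (α * y 0))) ↔
        y ∈ sector κ := by
  have key : ∀ {p q u v : ℝ} {P : Prop}, p = Λ * u → q = Λ * v → (0 < u ∧ 0 < v ↔ P) →
      (0 < p ∧ 0 < q ↔ P) := by
    rintro p q u v P rfl rfl h
    rw [mul_pos_iff_of_pos_left hΛ, mul_pos_iff_of_pos_left hΛ, h]
  have hm2 : Λ ^ 2 ≤ (2 * Λ) ^ 2 := by nlinarith [sq_nonneg Λ]
  cases κ with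
  | elliptic =>
    rcases ha with rfl | rfl <;> rcases hb with rfl | rfl
    · exact absurd rfl hab
    · refine ⟨-1, -Λ, 2 * Λ, by norm_num, hm2, fun y => key (u := 2 * y 1) (v := 2 * (y 0 - y 1))
        (by ring) (by ring) ?_⟩
      simp only [sector, mem_ofPred_eq]
      constructor <;> rintro ⟨h1, h2⟩ <;> constructor <;> linarith
    · refine ⟨1, -Λ, 2 * Λ, by norm_num, hm2, fun y => key (u := 2 * (y 0 - y 1)) (v := 2 * y 1)
        (by ring) (by ring) ?_⟩
      simp only [sector, mem_ofPred_eq]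
      constructor <;> rintro ⟨h1, h2⟩ <;> constructor <;> linarith
    · exact absurd rfl hab
  | vertical =>
    change a = b at hab
    subst hab
    rcases ha with rfl | rfl
    · refine ⟨1, 0, Λ, by norm_num, le_rfl, fun y => key (u := y 1 - y 0) (v := y 1 + y 0)
        (by ring) (by ring) ?_⟩
      simp only [sector, mem_ofPred_eq, abs_lt]
      constructor <;> rintro ⟨h1, h2⟩ <;> constructor <;> linarith
    · refine ⟨1, 0, -Λ, by norm_num, by rw [neg_sq], fun y => key (u := y 1 + y 0)
        (v := y 1 - y 0) (by ring) (by ring) ?_⟩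
      simp only [sector, mem_ofPred_eq, abs_lt]
      constructor <;> rintro ⟨h1, h2⟩ <;> constructor <;> linarith
  | lateral =>
    rcases ha with rfl | rfl <;> rcases hb with rfl | rfl
    · exact absurd rfl hab
    · refine ⟨-1, 0, Λ, by norm_num, le_rfl, fun y => key (u := y 0 + y 1) (v := y 0 - y 1)
        (by ring) (by ring) ?_⟩
      simp only [sector, mem_ofPred_eq, abs_lt]
      constructor <;> rintro ⟨h1, h2⟩ <;> constructor <;> linarith
    · refine ⟨1, 0, Λ, by norm_num, le_rfl, fun y => key (u := y 0 - y 1) (v := y 0 + y 1)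
        (by ring) (by ring) ?_⟩
      simp only [sector, mem_ofPred_eq, abs_lt]
      constructor <;> rintro ⟨h1, h2⟩ <;> constructor <;> linarith
    · exact absurd rfl hab

lemma one_le_det_of_slope {D Λ μ : ℝ} (hΛ : 1 ≤ Λ) (hD : 0 ≤ D) (hDΛ : 1 ≤ D * Λ)
    (hμ : Λ ^ 2 ≤ μ ^ 2) : 1 ≤ D * (4 * 1 * 1 * Λ ^ 2 * 1 * μ ^ 2) := by
  have h1 : Λ ≤ Λ ^ 2 := by nlinarith
  have h2 : Λ ^ 2 ≤ Λ ^ 2 * μ ^ 2 :=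
    le_mul_of_one_le_right (by positivity) ((hΛ.trans h1).trans hμ)
  refine hDΛ.trans (mul_le_mul_of_nonneg_left ?_ hD)
  nlinarith

lemma eventually_smul_mem_source {ψ : OpenPartialHomeomorph Plane Plane} (h0 : (0 : Plane) ∈ ψ.source) :
    ∀ᶠ t : ℝ in 𝓝 0, t • e 1 ∈ ψ.source := by
  have hc : Continuous fun t : ℝ => t • e 1 := continuous_id.smul continuous_const
  exact hc.continuousAt.eventually_mem (ψ.open_source.mem_nhds (by simpa using h0))

/-- A region contains half of the `y²`-axis exactly if the two factors which describe it have the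
same sign. -/
lemma containsHalfAxis_iff {ψ : OpenPartialHomeomorph Plane Plane} (h0 : (0 : Plane) ∈ ψ.source)
    {Ω : Set Plane} {a b : ℝ} (ha : a = 1 ∨ a = -1) (hb : b = 1 ∨ b = -1)
    (hΩ : ∀ t : ℝ, t • e 1 ∈ ψ.source → (ψ (t • e 1) ∈ Ω ↔ 0 < a * t ∧ 0 < b * t)) :
    ContainsHalfAxis ψ Ω ↔ a = b := by
  have hs := eventually_smul_mem_source h0
  constructor
  · intro h
    have hex : ∃ t : ℝ, 0 < a * t ∧ 0 < b * t := by
      rcases h with h | h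
      · obtain ⟨t, h1, h2⟩ := (h.and (hs.filter_mono nhdsWithin_le_nhds)).exists
        exact ⟨t, (hΩ t h2).1 h1⟩
      · obtain ⟨t, h1, h2⟩ := (h.and (hs.filter_mono nhdsWithin_le_nhds)).exists
        exact ⟨t, (hΩ t h2).1 h1⟩
    obtain ⟨t, h1, h2⟩ := hex
    rcases ha with rfl | rfl <;> rcases hb with rfl | rfl <;> first | rfl | (exfalso; linarith)
  · rintro rfl
    rcases ha with rfl | rfl
    · left
      filter_upwards [self_mem_nhdsWithin, hs.filter_mono nhdsWithin_le_nhds] with t ht h2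
      exact (hΩ t h2).2 ⟨by rw [one_mul]; exact ht, by rw [one_mul]; exact ht⟩
    · right
      filter_upwards [self_mem_nhdsWithin, hs.filter_mono nhdsWithin_le_nhds] with t ht h2
      have ht' : t < 0 := ht
      exact (hΩ t h2).2 ⟨by linarith, by linarith⟩

lemma smul_mem_sector {κ : Kind} {r : ℝ} (hr : 0 < r) (x : Plane) :
    r • x ∈ sector κ ↔ x ∈ sector κ := by
  cases κ <;> simp only [sector, mem_ofPred_eq, PiLp.smul_apply, smul_eq_mul, abs_mul,
    abs_of_pos hr, mul_lt_mul_iff_right₀ hr, mul_pos_iff_of_pos_left hr]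

end DarbouxForm

end

open DarbouxForm

theorem lemma2p1 (M N : ℕ) (hM : 36 * (N + 10) ≤ M)
    (U : Set DarbouxForm.Plane) (hU : IsOpen U) (hU0 : (0 : DarbouxForm.Plane) ∈ U)
    (g : DarbouxForm.Plane → Matrix (Fin 2) (Fin 2) ℝ) (hg : DarbouxForm.IsMetricOn M g U)
    (hN : DarbouxForm.VanishesToOrder N (DarbouxForm.gaussCurv g))
    (hK : DarbouxForm.ZeroSetTwoCurves M (DarbouxForm.gaussCurv g)) :
    -- a small neighbourhood `V` of the origin, divided into regions by the zero set of `K`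
    ∃ V : Set DarbouxForm.Plane, IsOpen V ∧ (0 : DarbouxForm.Plane) ∈ V ∧ V ⊆ U ∧
    ∀ Ω₀, DarbouxForm.IsRegion g V Ω₀ →
    -- initial coordinates, and any approximate solution `z₀` with respect to them
    ∃ ψ : OpenPartialHomeomorph DarbouxForm.Plane DarbouxForm.Plane,
      DarbouxForm.IsInitialChart M g V Ω₀ ψ ∧
    ∀ z₀ : DarbouxForm.Plane → ℝ,
      DarbouxForm.IsApproxSolution M (DarbouxForm.pullback ψ g) z₀ →
    ∀ (Ω : Set DarbouxForm.Plane) (κ : DarbouxForm.Kind),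
      DarbouxForm.IsRegion g V Ω → DarbouxForm.HasKind g ψ Ω κ →
    -- a linear change of coordinates adapted to the region `Ω`
    ∃ A : DarbouxForm.Plane ≃L[ℝ] DarbouxForm.Plane,
      (∃ α : ℝ, α ≠ 0 ∧ ∀ y, A y 0 = α * y 0) ∧
    -- the coefficient functions
    ∃ ε₁ : ℝ, 0 < ε₁ ∧
      (∀ ε ∈ Ioo (-ε₁) ε₁, ∀ x ∈ Metric.ball (0 : DarbouxForm.Plane) 2,
        A (ε ^ 2 • x) ∈ ψ.source) ∧
    ∃ (kbar : DarbouxForm.ArgK → ℝ) (cbar : DarbouxForm.ArgC → ℝ) (dbar : DarbouxForm.ArgD → ℝ),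
      ContDiffOn ℝ (M - 4 : ℕ) kbar (DarbouxForm.domK ε₁) ∧
      ContDiffOn ℝ (M - 4 : ℕ) cbar (DarbouxForm.domC ε₁) ∧
      ContDiffOn ℝ (M - 4 : ℕ) dbar (DarbouxForm.domD ε₁) ∧
    -- the constants
    ∃ (C : ℕ → ℝ) (C' σ₀ δ₀ : ℝ), 0 < σ₀ ∧ 0 < δ₀ ∧ δ₀ < Real.pi / 2 ∧
    ∀ σ ∈ Ioo 0 σ₀, ∃ ε₀ ∈ Ioc 0 ε₁, ∀ δ ∈ Ioo 0 δ₀, ∀ ε ∈ Ioo 0 ε₀,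
    ∀ w : DarbouxForm.Plane → ℝ, ContDiff ℝ ∞ w → DarbouxForm.SmallC3 w →
    ∃ ξ : OpenPartialHomeomorph DarbouxForm.Plane DarbouxForm.Plane,
      DarbouxForm.IsCoordChange M σ ξ ∧
      DarbouxForm.IsStandardRegion σ δ C'
        {η | ‖η‖ < σ ∧ ψ (A (ε ^ 2 • ξ.symm η)) ∈ Ω} κ ∧
      DarbouxForm.HasCanonicalForm (DarbouxForm.pullback (fun y => ψ (A y)) g)
        (fun y => z₀ (A y)) ε w kbar cbar dbar ξ ∧
      ∀ m : ℕ, m ≤ M - 2 →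
        DarbouxForm.sobolevNorm m ξ.source ξ ≤
          ENNReal.ofReal (δ⁻¹ * C m) *
            (1 + DarbouxForm.sobolevNorm (m + 4) (Metric.ball 0 1) w) := by
  obtain ⟨m, rfl⟩ : ∃ m, M = m + 4 := ⟨M - 4, by omega⟩
  obtain ⟨χ, ρ, hρ, hsrc, hχ0, hχU, hχ, hχ', hχz⟩ :=
    exists_straightening (by omega) hK (hU.mem_nhds hU0)
  have hχs0 : (0 : Plane) ∈ χ.source := by rw [hsrc]; exact Metric.mem_ball_self hρ
  have hm0 : ((m + 4 : ℕ) : WithTop ℕ∞) ≠ 0 := by norm_cast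
  refine ⟨χ.target, χ.open_target, by simpa [hχ0] using χ.map_source hχs0, hχU, fun Ω₀ hΩ₀ => ?_⟩
  obtain ⟨s, t, hs, ht, hΩ₀⟩ := exists_quadrant_of_isRegion hsrc hχz hΩ₀
  have hs2 : s * s = 1 := by rcases hs with rfl | rfl <;> norm_num
  have ht2 : t * t = 1 := by rcases ht with rfl | rfl <;> norm_num
  -- the slope `Λ` is so large that the determinant of the metric is at least `1` in the end
  set D : ℝ := (g (χ 0)).det * jac χ 0 ^ 2 with hD
  have hD0 : 0 < D := by
    have h1 := (hg.1 _ (hχU (χ.map_source hχs0))).det_pos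
    have h2 := jac_ne_zero hχs0 ((hχ _ hχs0).differentiableAt hm0)
      ((hχ' _ (χ.map_source hχs0)).differentiableAt hm0)
    positivity
  set Λ : ℝ := 1 + D⁻¹ with hΛ
  have hΛ1 : 1 ≤ Λ := by rw [hΛ]; linarith [inv_pos.2 hD0]
  have hΛD : 1 ≤ D * Λ := by rw [hΛ, mul_add, mul_inv_cancel₀ hD0.ne']; linarith
  have hΛ0 : 0 < Λ := by linarith
  have hdet : -s * Λ * t - s * (t * Λ) ≠ 0 := by
    rcases hs with rfl | rfl <;> rcases ht with rfl | rfl <;> intro h <;> linarith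
  -- coordinates in which the two lines are `y² = ± Λ y¹`
  set L := linearEquiv (-s * Λ) s (t * Λ) t hdet with hL
  have hL0 : ∀ y, L y 0 = s * (y 1 - Λ * y 0) := fun y => by
    rw [hL, linearEquiv_apply, pt_zero]; ring
  have hL1 : ∀ y, L y 1 = t * (y 1 + Λ * y 0) := fun y => by
    rw [hL, linearEquiv_apply, pt_one]; ring
  set ψ : OpenPartialHomeomorph Plane Plane := L.toHomeomorph.transOpenPartialHomeomorph χ with hψ
  have hψs : ∀ y, y ∈ ψ.source ↔ L y ∈ χ.source := fun y => Iff.rfl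
  have hψ0 : (0 : Plane) ∈ ψ.source := by rw [hψs, map_zero]; exact hχs0
  have hregion : ∀ {Ω : Set Plane} {s' t' : ℝ},
      (∀ x ∈ χ.source, χ x ∈ Ω ↔ 0 < s' * x 0 ∧ 0 < t' * x 1) → ∀ y ∈ ψ.source,
        (ψ y ∈ Ω ↔ 0 < s' * s * (y 1 - Λ * y 0) ∧ 0 < t' * t * (y 1 + Λ * y 0)) := by
    intro Ω s' t' h y hy
    have := h (L y) hy
    rw [hL0, hL1, ← mul_assoc, ← mul_assoc] at this
    exact this
  refine ⟨ψ, ⟨rfl, hψ0, ?_, ?_, ?_, ⟨Λ, -Λ, by intro h; linarith, fun y hy => ?_⟩, ?_⟩,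
    fun z₀ hz₀ Ω κ hΩ hκ => ?_⟩
  · change χ (L 0) = 0
    rw [map_zero, hχ0]
  · exact fun y hy => ((hχ _ hy).comp y L.contDiff.contDiffAt).contDiffWithinAt
  · exact fun p hp => (L.symm.contDiff.contDiffAt.comp p (hχ' p hp)).contDiffWithinAt
  · have := hχz (L y) hy
    rw [hL0, hL1] at this
    refine this.trans (or_congr ?_ ?_)
    · have hs0 : s ≠ 0 := by rintro rfl; simp at hs2
      rw [mul_eq_zero, or_iff_right hs0, sub_eq_zero]
    · have ht0 : t ≠ 0 := by rintro rfl; simp at ht2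
      rw [mul_eq_zero, or_iff_right ht0, neg_mul, add_eq_zero_iff_eq_neg]
  · filter_upwards [self_mem_nhdsWithin,
      (eventually_smul_mem_source hψ0).filter_mono nhdsWithin_le_nhds] with τ hτ hτs
    refine (hregion hΩ₀ _ hτs).2 ?_
    rw [hs2, ht2]
    simpa using hτ
  obtain ⟨s', t', hs', ht', hΩ'⟩ := exists_quadrant_of_isRegion hsrc hχz hΩ
  have hΩψ := hregion hΩ'
  have hsign : ∀ {a b : ℝ}, a = 1 ∨ a = -1 → b = 1 ∨ b = -1 → a * b = 1 ∨ a * b = -1 := by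
    rintro a b (rfl | rfl) (rfl | rfl) <;> norm_num
  have ha := hsign hs' hs
  have hb := hsign ht' ht
  have hhalf : ContainsHalfAxis ψ Ω ↔ s' * s = t' * t :=
    containsHalfAxis_iff hψ0 ha hb fun τ hτ => by simpa using hΩψ _ hτ
  obtain ⟨α, ν, μ, hα, hμ, hA⟩ := exists_adapted_coordinates hΛ0 κ ha hb (by
    cases κ with
    | elliptic => exact fun h => hκ.2 (hhalf.2 h)
    | vertical => exact hhalf.1 hκ.2
    | lateral => exact fun h => hκ.2 (hhalf.2 h))
  have hα0 : α ≠ 0 := by rintro rfl; norm_num at hα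
  have hμ0 : μ ≠ 0 := by
    rintro rfl
    rw [zero_pow two_ne_zero] at hμ
    exact absurd hμ (not_le.2 (pow_pos hΛ0 2))
  have hdetA : α * μ - 0 * ν ≠ 0 := by rw [zero_mul, sub_zero]; exact mul_ne_zero hα0 hμ0
  set A := linearEquiv α 0 ν μ hdetA with hAdef
  have hA0 : ∀ y, A y 0 = α * y 0 := fun y => by rw [hAdef, linearEquiv_apply, pt_zero]; ring
  have hA1 : ∀ y, A y 1 = ν * y 0 + μ * y 1 := fun y => by rw [hAdef, linearEquiv_apply, pt_one]
  have hsector : ∀ y, A y ∈ ψ.source → (ψ (A y) ∈ Ω ↔ y ∈ sector κ) := fun y hy => by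
    rw [hΩψ _ hy, hA0, hA1]; exact hA y
  obtain ⟨hG, hGdet⟩ := isSmoothMetric_pullback (m := m + 2) hU hg hχU hχ hχ' (A.trans L)
  have hO0 : (0 : Plane) ∈ (A.trans L) ⁻¹' χ.source := by
    rw [mem_preimage, map_zero]; exact hχs0
  have hG1 : 1 ≤ (pullback (fun y => χ ((A.trans L) y)) g 0).det := by
    have hj : jac (A.trans L) 0 = (-s * Λ * t - s * (t * Λ)) * (α * μ - 0 * ν) := by
      have := jac_comp (L.differentiable (A 0)) (A.differentiable 0)
      rw [jac_linearEquiv, jac_linearEquiv] at this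
      exact this
    rw [hGdet 0 hO0, hj, map_zero, ← hD]
    have h1 : ((-s * Λ * t - s * (t * Λ)) * (α * μ - 0 * ν)) ^ 2 =
        4 * (s * s) * (t * t) * Λ ^ 2 * α ^ 2 * μ ^ 2 := by ring
    rw [h1, hs2, ht2, hα]
    exact one_le_det_of_slope hΛ1 hD0.le hΛD hμ
  obtain ⟨⟨p, hp, hpz⟩, -⟩ := hz₀
  obtain ⟨hζ, hζ1, hζ00, hζ01⟩ := jet_approxSolution hp hpz A hα hA0
  obtain ⟨ε₁, hε₁, hdom, hkb, hcb, hdb, C, C', σ₀, δ₀, hσ₀, hδ₀, hδ₀', H⟩ :=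
    exists_canonical_coordinates hG hO0 hG1 hζ hζ1 hζ00 hζ01 κ
  refine ⟨A, ⟨α, hα0, hA0⟩, ε₁, hε₁, hdom, _, _, _, hkb, hcb, hdb, C, C', σ₀, δ₀, hσ₀, hδ₀, hδ₀',
    fun σ hσ => ?_⟩
  obtain ⟨ε₀, hε₀, H⟩ := H σ hσ
  refine ⟨ε₀, hε₀, fun δ hδ ε hε w hw h3 => ?_⟩
  obtain ⟨ξ, hξ, hstd, hcan, hsob⟩ := H δ hδ ε hε w hw h3
  refine ⟨ξ, hξ, ?_, hcan, hsob⟩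
  -- the model sectors are cones, so that the factor `ε²` does not matter
  have hset : {η | ‖η‖ < σ ∧ ψ (A (ε ^ 2 • ξ.symm η)) ∈ Ω} =
      {η | ‖η‖ < σ ∧ ξ.symm η ∈ sector κ} := by
    ext η
    refine and_congr_right fun hη => ?_
    have h1 := hξ.source_subset (ξ.map_target (hξ.ball_subset_target (mem_ball_zero_iff.2 hη)))
    have h2 := hdom ε ⟨by linarith [hε.1], hε.2.trans_le hε₀.2⟩ (ξ.symm η)
      (Metric.ball_subset_ball (by norm_num) h1)
    rw [hsector _ h2, smul_mem_sector (pow_pos hε.1 2)]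
  rw [hset]
  exact hstd
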